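/- **Setting.** Let $K$ be a linearly ordered set of keys, $V$ a set of values, $a\ge 2$ and $b\ge 2a-1$ (minimum and maximum node size). Arbitrarily many threads execute the OCC-ABtree in an asynchronous, sequentially consistent shared memory: every read or write of a field, every acquisition or release of a (mutual exclusion) lock and every creation of a new, still private node is one atomic step, and steps of different threads interleave arbitrarily. Memory is not reclaimed. Besides its lock, a node has a size, a marked bit and an immutable (arbitrary) search key. A leaf has $b$ slots, each with a key (or $\bot$) and a value, and a version number; an internal node has $c$ child pointers and $c-1$ sorted, immutable routing keys; a tagged node is a special internal node. A sentinel *entry* has one child, the root. A node is *reachable* (in the tree) if it can be reached from the entry by child pointers. Initially no operation is in progress and the root is an empty leaf. * $\mathrm{search}(k,t)$ starts at the entry and follows, from each visited node, the child pointer after the last routing key $\le k$, until it visits a leaf or $t$; it takes no locks. $\mathrm{searchLeaf}(l,k)$ reads the version of $l$, retries if it is odd, scans the slots for $k$ (reading the value if found), reads the version again, and retries if it has changed. * $\mathrm{find}(k)$ searches $k$, runs searchLeaf on the leaf reached, and returns the result ($\bot$ if $k$ is not found). * $\mathrm{insert}(k,v)$ does the same and returns the value if $k$ is found. Otherwise it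 locks the leaf, restarts if the leaf is marked, scans it again for $k$ and, if $k$ is found, returns its value after unlocking. Otherwise, if the leaf is not full, it increments the version, writes $k$ and $v$ into an empty slot, increments the size and then the version, unlocks and returns $\bot$ (*simple insert*). If the leaf is full, it locks the parent (restarting if the parent is marked), creates two leaves that evenly share the old pairs and $\langle k,v\rangle$ and a tagged node above them (an ordinary internal node if it becomes the root), overwrites the parent's pointer to the leaf by a pointer to that node, marks the leaf, unlocks, calls fixTagged on the new node if it is tagged, and returns $\bot$ (*splitting insert*). * $\mathrm{delete}(k)$ searches likewise and returns $\bot$ if $k$ is not found. Otherwise it locks the leaf, restarts if it is marked, and scans it again; if $k$ is absent it unlocks and returns $\bot$. Otherwise it increments the version, sets the key to $\bot$, decrements the size, increments the version, unlocks, calls fixUnderfull if the leaf has fewer than $a$ keys, and returns the deleted value (*successful delete*). * $\mathrm{fixTagged}$ and $\mathrm{fixUnderfull}$ search for their node, lock it, its parent and grandparent (and, for fixUnderfull, a neighbouring sibling), check that these are unmarked and that the parent (for fixUnderfull also the node and the sibling) is not tagged, and retry otherwise. fixTagged replaces the node and its parent by one internal node or, if that would have more than $b$ children, by a tagged node (an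 internal node at the root) above two halves. fixUnderfull does nothing if the node is the entry or the root, or has size at least $a$, and retries if the parent's size is less than $a$; otherwise it distributes the contents of node and sibling evenly over two new nodes if their total size is at least $2a$, and merges them into one new node if not, with a new copy of the parent (when a root with two children would be left with one, the merged node becomes the root), and after a merge that is not at the root it calls fixUnderfull on the merged node and on the new parent. Each does so by overwriting one child pointer of the grandparent, and marks the replaced nodes. In a configuration, $k$ is *in the tree with value $v$* if some reachable leaf held $k$ and $v$ in the same slot when its version was last even. **Theorem.** In every execution the following holds. 1. The operations are linearizable with respect to the dictionary semantics ($\mathrm{find}(k)$ returns the value of $k$, or $\bot$ if $k$ is absent; $\mathrm{insert}(k,v)$ returns the value of $k$ if present, and otherwise adds $\langle k,v\rangle$ and returns $\bot$; $\mathrm{delete}(k)$ removes $k$ and returns its value if present, and otherwise returns $\bot$), starting from the empty dictionary: for every finite prefix there is a legal sequential ordering of all complete operations, with their return values, and some of the pending ones, that respects the real-time order. 2. In each configuration the pairs in the tree form a dictionary $D$ (each key has at most one value), initially empty, with the following linearization points. * Call the following steps *update points*: the second increment of a leaf version by an insert or delete, and the step in which an insert overwrites a parent's pointer to a leaf. An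 operation has at most one update point. $D$ changes in no other step, and at an update point it really changes, and does so as the operation prescribes. If the operation returns, its update point precedes its response and it returns the value prescribed for $D$ just before that point. Thus simple inserts and successful deletes linearize at the second increment of the leaf version, and splitting inserts at the write of the parent pointer. * Consider any complete operation without an update point. If its last searchLeaf, on a leaf $l$, decided its result (always for find), its admissible points are the configurations between the two last reads of the version of $l$ (which return the same even number) in which $l$ is reachable; or, if there is none, the configuration during the operation just before $l$ was unlinked. If it locked a leaf in its last attempt (an insert that then found the key, or a delete that then did not), its admissible points are the configurations in which it then holds the lock. There is at least one admissible point, all of them lie between the invocation and the response, and at each of them the operation leaves $D$ unchanged and returns what the dictionary semantics prescribes. 3. Every node that a search visits was reachable in some configuration between the start of that search and the visit. -/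

import Mathlib

/-!
A model of the OCC-ABtree: a shared memory of nodes with locks, the code of the operations as a
tree of atomic memory accesses, its interleaving semantics, and linearizability.
-/

namespace OCC

/-! ### Sequential dictionaries -/

/-- The dictionary operations. -/
inductive Op (K V : Type) : Type
  | find (key : K)
  | insert (key : K) (val : V)
  | delete (key : K)

/-- A dictionary; `none` plays the role of `⊥`. -/
abbrev Dict (K V : Type) : Type := K → Option V

def Op.key {K V : Type} : Op K V → K
  | .find k => k
  | .insert k _ => k
  | .delete k => k

/-- The sequential semantics of the operations: the new dictionary and the return value. -/
def Op.apply {K V : Type} [DecidableEq K] : Op K V → Dict K V → Dict K V × Option V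
  | .find k, D => (D, D k)
  | .insert k v, D =>
    match D k with
    | some w => (D, some w)
    | none => (Function.update D k (some v), none)
  | .delete k, D => (Function.update D k none, D k)

/-! ### Nodes -/

/-- Addresses of nodes. The null pointer is `none : Option Addr`. -/
abbrev Addr : Type := ℕ

/-- The address of the sentinel node. -/
abbrev entry : Addr := 0

inductive Kind : Type
  | leaf
  | internal
  | tagged
  deriving DecidableEq

/-- The fields of a node, except for its lock. The size of a leaf is its number of keys, the size
of an internal node is its number of children. -/
inductive Field : Type
  | kind
  | searchKey
  | size
  | marked
  | ver
  | key (i : ℕ)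
  | val (i : ℕ)
  | ptr (i : ℕ)
  deriving DecidableEq

abbrev Field.Ty (K V : Type) : Field → Type
  | .kind => Kind
  | .searchKey => K
  | .size => ℕ
  | .marked => Bool
  | .ver => ℕ
  | .key _ => Option K
  | .val _ => Option V
  | .ptr _ => Option Addr

abbrev Node (K V : Type) : Type := (f : Field) → f.Ty K V

/-- A new leaf that contains the pairs of a list. -/
def mkLeaf {K V : Type} (sk : K) (L : List (K × V)) : Node K V
  | .kind => .leaf
  | .searchKey => sk
  | .size => L.length
  | .marked => false
  | .ver => (0 : ℕ)
  | .key i => L[i]?.map Prod.fst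
  | .val i => L[i]?.map Prod.snd
  | .ptr _ => none

/-- A new internal (or tagged) node with given routing keys and children. -/
def mkInternal {K V : Type} (kd : Kind) (sk : K) (ks : List K) (cs : List Addr) : Node K V
  | .kind => kd
  | .searchKey => sk
  | .size => cs.length
  | .marked => false
  | .ver => (0 : ℕ)
  | .key i => ks[i]?
  | .val _ => none
  | .ptr i => cs[i]?

/-! ### Programs -/

/-- The result of a search. -/
structure PathInfo : Type where
  gp : Option Addr
  p : Option Addr
  pIdx : ℕ
  n : Addr
  nIdx : ℕ

/-- The values of the variables of a search when it starts. -/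
def PathInfo.start : PathInfo := ⟨none, none, 0, entry, 0⟩

/-- A call of a rebalancing step. -/
inductive Task : Type
  | fixTagged (node : Addr)
  | fixUnderfull (node : Addr)

/-- Where a search returns to. A rebalancing step remembers the rebalancing steps that the
operation still has to run after it, and the value that the operation finally returns. -/
inductive Caller (K V : Type) : Type
  | op (o : Op K V)
  | fixTagged (node : Addr) (todo : List Task) (res : Option V)
  | fixUnderfull (node : Addr) (todo : List Task) (res : Option V)

/-- The targets of jumps. `search` is the head of the outer loop of `search(key, target)` with the
current values of its variables (so `path.n` is the node that is being visited), `searchLeaf` is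
the label `RETRY` of `searchLeaf`, and `rebalance` runs the pending rebalancing steps and then
returns from the operation. -/
inductive Label (K V : Type) : Type
  | search (c : Caller K V) (key : K) (target : Option Addr) (path : PathInfo)
  | searchLeaf (o : Op K V) (path : PathInfo)
  | rebalance (todo : List Task) (res : Option V)

/-- Code of a thread. Each constructor other than `ret` and `crash` is one atomic step; `alloc`
creates a new node (which is private until a pointer to it is written), `anyKey` is an arbitrary
choice of a key, `ret` is the response of the operation and `crash` is a dereferenced null pointer
or another undefined behaviour. -/
inductive Prog (K V : Type) : Type
  | read (a : Addr) (f : Field) (next : f.Ty K V → Prog K V)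
  | write (a : Addr) (f : Field) (x : f.Ty K V) (next : Prog K V)
  | lock (a : Addr) (next : Prog K V)
  | unlock (a : Addr) (next : Prog K V)
  | alloc (node : Node K V) (next : Addr → Prog K V)
  | anyKey (next : K → Prog K V)
  | goto (l : Label K V)
  | ret (res : Option V)
  | crash

section Code

variable {K V : Type}

def lockAll (as : List Addr) (next : Prog K V) : Prog K V := as.foldr Prog.lock next

def unlockAll (as : List Addr) (next : Prog K V) : Prog K V := as.foldr Prog.unlock next

def markAll (as : List Addr) (next : Prog K V) : Prog K V :=
  as.foldr (fun a q => Prog.write a .marked true q) next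

/-- Continue with `yes` if one of the nodes is marked, and with `no` otherwise. -/
def ifMarked (as : List Addr) (yes no : Prog K V) : Prog K V :=
  as.foldr (fun a q => Prog.read a .marked fun m => if m = true then yes else q) no

/-- Continue with `yes` if one of the nodes is tagged, and with `no` otherwise. -/
def ifTagged (as : List Addr) (yes no : Prog K V) : Prog K V :=
  as.foldr (fun a q => Prog.read a .kind fun kd => if kd = .tagged then yes else q) no

/-- The first slot `i, ..., i + fuel - 1` of the node whose key is `x`. -/
def findSlot [DecidableEq K] (n : Addr) (x : Option K) (found : ℕ → Prog K V)
    (notFound : Prog K V) : ℕ → ℕ → Prog K V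
  | _, 0 => notFound
  | i, fuel + 1 => .read n (.key i) fun y =>
      if y = x then found i else findSlot n x found notFound (i + 1) fuel

/-- The inner loop of `search`: advance the index `i` past the routing keys that are at most `key`,
of which `fuel` are left. -/
def route [LinearOrder K] (key : K) (n : Addr) (next : ℕ → Prog K V) : ℕ → ℕ → Prog K V
  | i, 0 => next i
  | i, fuel + 1 => .read n (.key i) fun
      | some rk => if rk ≤ key then route key n next (i + 1) fuel else next i
      | none => .crash

/-- Read the key-value pairs of a leaf, slot by slot. -/
def readPairs (n : Addr) (next : List (K × V) → Prog K V) : ℕ → ℕ → Prog K V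
  | _, 0 => next []
  | i, fuel + 1 => .read n (.key i) fun
      | none => readPairs n next (i + 1) fuel
      | some k => .read n (.val i) fun
        | none => .crash
        | some v => readPairs n (fun L => next ((k, v) :: L)) (i + 1) fuel

def readKeys (n : Addr) (next : List K → Prog K V) : ℕ → ℕ → Prog K V
  | _, 0 => next []
  | i, fuel + 1 => .read n (.key i) fun
      | none => .crash
      | some k => readKeys n (fun L => next (k :: L)) (i + 1) fuel

def readPtrs (n : Addr) (next : List Addr → Prog K V) : ℕ → ℕ → Prog K V
  | _, 0 => next []
  | i, fuel + 1 => .read n (.ptr i) fun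
      | none => .crash
      | some c => readPtrs n (fun L => next (c :: L)) (i + 1) fuel

/-- Read the routing keys and the children of an internal node. -/
def readInternal (n : Addr) (next : List K → List Addr → Prog K V) : Prog K V :=
  .read n .size fun s =>
    readKeys n (fun ks => readPtrs n (fun cs => next ks cs) 0 s) 0 (s - 1)

def allocLeaf (N : List (K × V)) (next : Addr → Prog K V) : Prog K V :=
  .anyKey fun sk => .alloc (mkLeaf sk N) next

def allocInternal (kd : Kind) (ks : List K) (cs : List Addr) (next : Addr → Prog K V) : Prog K V :=
  .anyKey fun sk => .alloc (mkInternal kd sk ks cs) next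

/-- Two new leaves that evenly share the contents of a sorted list, and the routing key between
them. -/
def allocLeaves (N : List (K × V)) (next : Addr → K → Addr → Prog K V) : Prog K V :=
  match N.drop (N.length / 2) with
  | [] => .crash
  | x :: R =>
    allocLeaf (N.take (N.length / 2)) fun l =>
    allocLeaf (x :: R) fun r =>
    next l x.1 r

/-- Two new internal nodes that evenly share routing keys and children, and the routing key between
them. -/
def allocInternals (ks : List K) (cs : List Addr) (next : Addr → K → Addr → Prog K V) :
    Prog K V :=
  match ks.drop (cs.length / 2 - 1) with
  | [] => .crash
  | x :: R =>
    allocInternal .internal (ks.take (cs.length / 2 - 1)) (cs.take (cs.length / 2)) fun l =>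
    allocInternal .internal R (cs.drop (cs.length / 2)) fun r =>
    next l x r

/-- The kind of the new node above two halves: tagged, unless it becomes the root. -/
def topKind (parent : Addr) : Kind := if parent = entry then .internal else .tagged

def sortPairs [LinearOrder K] (L : List (K × V)) : List (K × V) :=
  L.insertionSort fun x y => x.1 ≤ y.1

/-- An operation (and each of its retries) starts with a search for its key. -/
def startOp (o : Op K V) : Prog K V := .goto (.search (.op o) o.key none PathInfo.start)

/-- `n.ver++` -/
def incVer (n : Addr) (next : Prog K V) : Prog K V :=
  .read n .ver fun x => .write n .ver (x + 1 : ℕ) next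

/-- `insert` after a search that has not found the key. -/
def insertLocked [LinearOrder K] (b : ℕ) (key : K) (val : V) (path : PathInfo) : Prog K V :=
  let leaf := path.n
  match path.p with
  | none => .crash
  | some parent =>
    .lock leaf <|
    .read leaf .marked fun m =>
    if m = true then .unlock leaf (startOp (.insert key val)) else
    findSlot leaf (some key)
      (fun i => .read leaf (.val i) fun w => .unlock leaf (.ret w))
      (.read leaf .size fun s =>
        if s < b then
          findSlot leaf none
            (fun i =>
              incVer leaf <|
              .write leaf (.key i) (some key) <|
              .write leaf (.val i) (some val) <|
              .read leaf .size fun s' =>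
              .write leaf .size (s' + 1 : ℕ) <|
              incVer leaf <|
              .unlock leaf <|
              .ret none)
            .crash 0 b
        else
          .lock parent <|
          .read parent .marked fun m' =>
          if m' = true then unlockAll [leaf, parent] (startOp (.insert key val)) else
          readPairs leaf (fun L =>
            allocLeaves (sortPairs ((key, val) :: L)) fun l x r =>
            allocInternal (topKind parent) [x] [l, r] fun new =>
            .write parent (.ptr path.nIdx) (some new) <|
            .write leaf .marked true <|
            unlockAll [leaf, parent] <|
            .goto (.rebalance [.fixTagged new] none)) 0 b)
      0 b

/-- `delete` after a search that has found the key. -/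
def deleteLocked [LinearOrder K] (a b : ℕ) (key : K) (path : PathInfo) : Prog K V :=
  let leaf := path.n
  .lock leaf <|
  .read leaf .marked fun m =>
  if m = true then .unlock leaf (startOp (.delete key)) else
  findSlot leaf (some key)
    (fun i =>
      .read leaf (.val i) fun deletedVal =>
      incVer leaf <|
      .write leaf (.key i) none <|
      .read leaf .size fun s =>
      .write leaf .size (s - 1 : ℕ) <|
      incVer leaf <|
      .read leaf .size fun s' =>
      .unlock leaf <|
      .goto (.rebalance (if s' < a then [.fixUnderfull leaf] else []) deletedVal))
    (.unlock leaf (.ret none))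
    0 b

/-- What an operation does with the result of `searchLeaf`. -/
def afterSearchLeaf [LinearOrder K] (a b : ℕ) (path : PathInfo) (res : Option V) :
    Op K V → Prog K V
  | .find _ => .ret res
  | .insert key val => if res.isSome then .ret res else insertLocked b key val path
  | .delete key => if res.isSome then deleteLocked a b key path else .ret none

/-- `searchLeaf` -/
def searchLeaf [LinearOrder K] (a b : ℕ) (o : Op K V) (path : PathInfo) : Prog K V :=
  let leaf := path.n
  let finish (ver1 : ℕ) (res : Option V) : Prog K V :=
    .read leaf .ver fun ver2 =>
    if ver1 = ver2 then afterSearchLeaf a b path res o else .goto (.searchLeaf o path)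
  .read leaf .ver fun ver1 =>
  if Odd ver1 then .goto (.searchLeaf o path) else
  findSlot leaf (some o.key) (fun i => .read leaf (.val i) fun w => finish ver1 w)
    (finish ver1 none) 0 b

/-- `fixTagged` after a search that has found the node. -/
def fixTaggedFound (b : ℕ) (node : Addr) (path : PathInfo) (todo : List Task) (res : Option V) :
    Prog K V :=
  match path.p, path.gp with
  | some p, some gp =>
    let retry : Prog K V := unlockAll [node, p, gp] (.goto (.rebalance (.fixTagged node :: todo) res))
    lockAll [node, p, gp] <|
    ifMarked [node, p, gp] retry <|
    ifTagged [p] retry <|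
    .write node .marked true <|
    .write p .marked true <|
    readInternal p fun ks cs =>
    readInternal node fun ks' cs' =>
    let newKs := ks.take path.nIdx ++ ks' ++ ks.drop path.nIdx
    let newCs := cs.take path.nIdx ++ cs' ++ cs.drop (path.nIdx + 1)
    if cs.length + 1 ≤ b then
      allocInternal .internal newKs newCs fun new =>
      .write gp (.ptr path.pIdx) (some new) <|
      unlockAll [node, p, gp] <|
      .goto (.rebalance todo res)
    else
      allocInternals newKs newCs fun l x r =>
      allocInternal (topKind gp) [x] [l, r] fun new =>
      .write gp (.ptr path.pIdx) (some new) <|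
      unlockAll [node, p, gp] <|
      .goto (.rebalance (.fixTagged new :: todo) res)
  | _, _ => .crash

/-- `fixUnderfull` from its label `RETRY` on. -/
def fixUnderfullRetry (node : Addr) (todo : List Task) (res : Option V) : Prog K V :=
  .read node .searchKey fun k =>
  .goto (.search (.fixUnderfull node todo res) k (some node) PathInfo.start)

/-- `fixUnderfull` after a search that has found the node. Here `li` and `li + 1` are the indices
of the node and its sibling (in left-to-right order) in their parent. -/
def fixUnderfullFound [LinearOrder K] (a b : ℕ) (node : Addr) (path : PathInfo)
    (todo : List Task) (res : Option V) : Prog K V :=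
  match path.p, path.gp with
  | some p, some gp =>
    let sIdx : ℕ := if path.nIdx = 0 then 1 else path.nIdx - 1
    .read p (.ptr sIdx) fun sib? =>
    match sib? with
    | none => fixUnderfullRetry node todo res
    | some sib =>
      let li : ℕ := if path.nIdx = 0 then 0 else path.nIdx - 1
      let left : Addr := if path.nIdx = 0 then node else sib
      let right : Addr := if path.nIdx = 0 then sib else node
      let release : Prog K V → Prog K V := unlockAll [left, right, p, gp]
      let retry : Prog K V := release (fixUnderfullRetry node todo res)
      let linkDistributed (ks : List K) (cs : List Addr) (l : Addr) (x : K) (r : Addr) : Prog K V :=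
        allocInternal .internal (ks.set li x) ((cs.set li l).set (li + 1) r) fun newParent =>
        .write gp (.ptr path.pIdx) (some newParent) <|
        markAll [node, p, sib] <|
        release <|
        .goto (.rebalance todo res)
      let linkMerged (ks : List K) (cs : List Addr) (new : Addr) : Prog K V :=
        if gp = entry ∧ cs.length = 2 then
          .write entry (.ptr 0) (some new) <|
          markAll [node, p, sib] <|
          release <|
          .goto (.rebalance todo res)
        else
          allocInternal .internal (ks.eraseIdx li) ((cs.set li new).eraseIdx (li + 1))
            fun newParent =>
          .write gp (.ptr path.pIdx) (some newParent) <|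
          markAll [node, p, sib] <|
          release <|
          .goto (.rebalance (.fixUnderfull new :: .fixUnderfull newParent :: todo) res)
      lockAll [left, right, p, gp] <|
      .read node .size fun s =>
      if a ≤ s then release (.goto (.rebalance todo res)) else
      .read p .size fun sp =>
      if sp < a then retry else
      ifMarked [node, sib, p, gp] retry <|
      ifTagged [node, sib, p] retry <|
      .read sib .size fun s' =>
      readInternal p fun ks cs =>
      .read node .kind fun kd =>
      if kd = .leaf then
        readPairs left (fun L => readPairs right (fun R =>
          let N := sortPairs (L ++ R)
          if 2 * a ≤ s + s' then allocLeaves N (linkDistributed ks cs)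
          else allocLeaf N (linkMerged ks cs)) 0 b) 0 b
      else
        match ks[li]? with
        | none => .crash
        | some x =>
          readInternal left fun ksL csL =>
          readInternal right fun ksR csR =>
          let N := ksL ++ x :: ksR
          if 2 * a ≤ s + s' then allocInternals N (csL ++ csR) (linkDistributed ks cs)
          else allocInternal .internal N (csL ++ csR) (linkMerged ks cs)
  | _, _ => .crash

/-- The code after the end of a search. -/
def searchDone [LinearOrder K] (a b : ℕ) (path : PathInfo) : Caller K V → Prog K V
  | .op o => .goto (.searchLeaf o path)
  | .fixTagged node todo res =>
    if path.n = node then fixTaggedFound b node path todo res else .goto (.rebalance todo res)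
  | .fixUnderfull node todo res =>
    if path.n = node then fixUnderfullFound a b node path todo res
    else .goto (.rebalance todo res)

/-- One iteration of the outer loop of `search`. -/
def searchIter [LinearOrder K] (a b : ℕ) (c : Caller K V) (key : K) (target : Option Addr)
    (path : PathInfo) : Prog K V :=
  .read path.n .kind fun kd =>
  if kd = .leaf ∨ target = some path.n then searchDone a b path c else
  .read path.n .size fun s =>
  route key path.n (fun i =>
    .read path.n (.ptr i) fun
      | none => .crash
      | some child => .goto (.search c key target ⟨path.p, some path.n, path.nIdx, child, i⟩))
    0 (s - 1)

/-- Run the pending rebalancing steps, and then return. -/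
def rebalance (todo : List Task) (res : Option V) : Prog K V :=
  match todo with
  | [] => .ret res
  | .fixTagged node :: todo =>
    .read node .marked fun m =>
    .read node .kind fun kd =>
    if m = true ∨ kd ≠ .tagged then .goto (.rebalance todo res) else
    .read node .searchKey fun k =>
    .goto (.search (.fixTagged node todo res) k (some node) PathInfo.start)
  | .fixUnderfull node :: todo =>
    .read entry (.ptr 0) fun root =>
    if node = entry ∨ root = some node then .goto (.rebalance todo res)
    else fixUnderfullRetry node todo res

/-- The code at a label of the OCC-ABtree with `MIN_SIZE = a` and `MAX_SIZE = b`. -/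
def body [LinearOrder K] (a b : ℕ) : Label K V → Prog K V
  | .search c key target path => searchIter a b c key target path
  | .searchLeaf o path => searchLeaf a b o path
  | .rebalance todo res => rebalance todo res

end Code

/-! ### Executions -/

/-- The shared memory: nodes, locks (with their holders), and the next address to allocate. -/
structure Mem (K V T : Type) : Type where
  node : Addr → Node K V
  lock : Addr → Option T
  next : Addr

/-- A configuration: the shared memory and the code that remains for each thread to execute
(`none` if the thread has no operation in progress). -/
structure Config (K V T : Type) : Type where
  mem : Mem K V T
  thread : T → Option (Prog K V)

/-- Initially, no operation is in progress and the root is an empty leaf. -/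
structure IsInit {K V T : Type} (c : Config K V T) : Prop where
  idle : ∀ t, c.thread t = none
  unlocked : ∀ n, c.mem.lock n = none
  next_eq : c.mem.next = 2
  entry_eq : ∃ sk, c.mem.node entry = mkInternal .internal sk [] [1]
  root_eq : ∃ sk, c.mem.node 1 = mkLeaf sk []

/-- One atomic step of the code of thread `t`. -/
inductive ProgStep {K V T : Type} [LinearOrder K] [DecidableEq T] (a b : ℕ) (t : T) :
    Mem K V T → Prog K V → Mem K V T → Prog K V → Prop
  | read (m : Mem K V T) (n : Addr) (f : Field) (next : f.Ty K V → Prog K V) :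
    ProgStep a b t m (.read n f next) m (next (m.node n f))
  | write (m : Mem K V T) (n : Addr) (f : Field) (x : f.Ty K V) (next : Prog K V) :
    ProgStep a b t m (.write n f x next)
      { m with node := Function.update m.node n (Function.update (m.node n) f x) } next
  | lock (m : Mem K V T) (n : Addr) (next : Prog K V) (free : m.lock n = none) :
    ProgStep a b t m (.lock n next) { m with lock := Function.update m.lock n (some t) } next
  | unlock (m : Mem K V T) (n : Addr) (next : Prog K V) :
    ProgStep a b t m (.unlock n next) { m with lock := Function.update m.lock n none } next
  | alloc (m : Mem K V T) (node : Node K V) (next : Addr → Prog K V) :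
    ProgStep a b t m (.alloc node next)
      { m with node := Function.update m.node m.next node, next := m.next + 1 } (next m.next)
  | anyKey (m : Mem K V T) (next : K → Prog K V) (k : K) :
    ProgStep a b t m (.anyKey next) m (next k)
  | goto (m : Mem K V T) (l : Label K V) :
    ProgStep a b t m (.goto l) m (body a b l)

inductive Action (K V T : Type) : Type
  | invoke (t : T) (o : Op K V)
  | respond (t : T) (res : Option V)
  | internal (t : T)
  | stutter

/-- The steps of the system. Stuttering makes every finite execution a prefix of an infinite one. -/
inductive Step {K V T : Type} [LinearOrder K] [DecidableEq T] (a b : ℕ) :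
    Config K V T → Action K V T → Config K V T → Prop
  | invoke (c : Config K V T) (t : T) (o : Op K V) (idle : c.thread t = none) :
    Step a b c (.invoke t o) { c with thread := Function.update c.thread t (some (startOp o)) }
  | respond (c : Config K V T) (t : T) (res : Option V) (h : c.thread t = some (.ret res)) :
    Step a b c (.respond t res) { c with thread := Function.update c.thread t none }
  | internal (c : Config K V T) (t : T) (q q' : Prog K V) (m' : Mem K V T)
    (h : c.thread t = some q) (hq : ProgStep a b t c.mem q m' q') :
    Step a b c (.internal t) ⟨m', Function.update c.thread t (some q')⟩
  | stutter (c : Config K V T) : Step a b c .stutter c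

/-- An execution; step `j` leads from configuration `j` to configuration `j + 1`. -/
structure Execution (K V T : Type) [LinearOrder K] [DecidableEq T] (a b : ℕ) : Type where
  cfg : ℕ → Config K V T
  act : ℕ → Action K V T
  init : IsInit (cfg 0)
  step : ∀ j, Step a b (cfg j) (act j) (cfg (j + 1))

/-! ### The abstract dictionary -/

def IsChild {K V T : Type} (m : Mem K V T) (n c : Addr) : Prop :=
  m.node n .kind ≠ .leaf ∧ ∃ i < m.node n .size, m.node n (.ptr i) = some c

/-- The node can be reached by following child pointers from the entry node. -/
def Reachable {K V T : Type} (m : Mem K V T) (n : Addr) : Prop :=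
  Relation.ReflTransGen (IsChild m) entry n

namespace Execution

variable {K V T : Type} [LinearOrder K] [DecidableEq T] {a b : ℕ} (E : Execution K V T a b)

/-- In configuration `j`, the key `k` is in the tree with associated value `v`: for some leaf `l`
that is reachable, they were the key and the value of a slot of `l` when the version of `l` was last
even. -/
def InTree (j : ℕ) (k : K) (v : V) : Prop :=
  ∃ l, Reachable (E.cfg j).mem l ∧ (E.cfg j).mem.node l .kind = .leaf ∧
    ∃ j' ≤ j, Even ((E.cfg j').mem.node l .ver) ∧
      (∀ m, j' < m → m ≤ j → ¬ Even ((E.cfg m).mem.node l .ver)) ∧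
      ∃ i < b, (E.cfg j').mem.node l (.key i) = some k ∧ (E.cfg j').mem.node l (.val i) = some v

/-! ### Histories and linearizability

An operation instance is a pair `(t, i)`, where step `i` is its invocation by thread `t`. -/

def Invokes (o : T × ℕ) (op : Op K V) : Prop := E.act o.2 = .invoke o.1 op

/-- Step `r` is the response of the operation instance, with return value `v`. -/
def Responds (o : T × ℕ) (r : ℕ) (v : Option V) : Prop :=
  o.2 < r ∧ E.act r = .respond o.1 v ∧ ∀ m, o.2 < m → m < r → ∀ w, E.act m ≠ .respond o.1 w

/-- A sequence of operations and return values is a sequential execution from a dictionary. -/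
def Legal : Dict K V → List (Op K V × Option V) → Prop
  | _, [] => True
  | D, (op, v) :: L => v = (op.apply D).2 ∧ Legal (op.apply D).1 L

/-- The history of the first `n` steps is linearizable: there is a sequence of operation instances
of the history that contains all the complete ones, with their return values, and possibly some
pending ones, respects the real-time order, and is a sequential execution from the empty
dictionary. -/
def LinearizableUpTo (n : ℕ) : Prop :=
  ∃ L : List ((T × ℕ) × Op K V × Option V),
    (L.map Prod.fst).Nodup ∧
    (∀ x ∈ L, x.1.2 < n ∧ E.Invokes x.1 x.2.1) ∧
    (∀ o op r v, r < n → E.Invokes o op → E.Responds o r v → (o, op, v) ∈ L) ∧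
    L.Pairwise (fun x y => ¬ ∃ r v, E.Responds y.1 r v ∧ r < x.1.2) ∧
    Legal (fun _ => none) (L.map Prod.snd)

def Linearizable : Prop := ∀ n, E.LinearizableUpTo n

/-! ### Linearization points -/

/-- Step `j` is a write of thread `t` to the field `f` of the node `n`. -/
def Writes (t : T) (j : ℕ) (n : Addr) (f : Field) : Prop :=
  E.act j = .internal t ∧ ∃ x next, (E.cfg j).thread t = some (.write n f x next)

/-- Step `j` is a read by thread `t` of the field `f` of the node `n`. -/
def Reads (t : T) (j : ℕ) (n : Addr) (f : Field) : Prop :=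
  E.act j = .internal t ∧ ∃ next, (E.cfg j).thread t = some (.read n f next)

/-- In step `j`, thread `t` acquires the lock of the node `n`. -/
def Locks (t : T) (j : ℕ) (n : Addr) : Prop :=
  E.act j = .internal t ∧ ∃ next, (E.cfg j).thread t = some (.lock n next)

/-- The operation instance is in progress in configuration `j`. -/
def InProgress (o : T × ℕ) (j : ℕ) : Prop :=
  o.2 < j ∧ ∀ m, o.2 < m → m < j → ∀ w, E.act m ≠ .respond o.1 w

/-- Step `j` is the second increment of the version of a leaf by the operation instance. -/
def SecondIncrement (o : T × ℕ) (j : ℕ) : Prop :=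
  E.InProgress o j ∧ ∃ l, E.Writes o.1 j l .ver ∧
    ∃! j', o.2 < j' ∧ j' < j ∧ E.Writes o.1 j' l .ver

/-- In step `j`, the operation instance replaces the pointer to a leaf in the parent of the leaf. -/
def ReplacesLeaf (o : T × ℕ) (j : ℕ) : Prop :=
  E.InProgress o j ∧ ∃ p i l, E.Writes o.1 j p (.ptr i) ∧
    (E.cfg j).mem.node p (.ptr i) = some l ∧ (E.cfg j).mem.node l .kind = .leaf

/-- The linearization points of the operations that modify the dictionary: simple inserts and
successful deletes, and splitting inserts. -/
def UpdatePoint (o : T × ℕ) (j : ℕ) : Op K V → Prop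
  | .find _ => False
  | .insert _ _ => E.SecondIncrement o j ∨ E.ReplacesLeaf o j
  | .delete _ => E.SecondIncrement o j

/-- The operation instance, which responds in step `r`, is decided by a `searchLeaf` on the leaf `l`
(its last one, after which it acquires no lock), whose two last reads of the version of `l` are the
steps `s₁` and `s₂` and have the same even result. -/
def ConsistentInterval (o : T × ℕ) (r : ℕ) (l : Addr) (s₁ s₂ : ℕ) : Prop :=
  o.2 < s₁ ∧ s₁ < s₂ ∧ s₂ < r ∧ E.Reads o.1 s₁ l .ver ∧ E.Reads o.1 s₂ l .ver ∧
    (E.cfg s₁).mem.node l .ver = (E.cfg s₂).mem.node l .ver ∧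
    Even ((E.cfg s₁).mem.node l .ver) ∧
    (∀ m n, s₁ < m → m < r → E.Reads o.1 m n .ver → m = s₂) ∧
    (∀ m n, s₁ < m → m < r → ¬ E.Locks o.1 m n)

/-- The points at which an operation that is decided by a `searchLeaf` on `l` may linearize: any
configuration of the version-consistent interval in which `l` is in the tree or, if there is none,
the configuration just before `l` is unlinked. -/
def SearchPoint (o : T × ℕ) (r j : ℕ) : Prop :=
  ∃ l s₁ s₂, E.ConsistentInterval o r l s₁ s₂ ∧
    ((s₁ ≤ j ∧ j ≤ s₂ ∧ Reachable (E.cfg j).mem l) ∨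
      ((∀ m, s₁ ≤ m → m ≤ s₂ → ¬ Reachable (E.cfg m).mem l) ∧ o.2 < j ∧ j < s₁ ∧
        Reachable (E.cfg j).mem l ∧ ¬ Reachable (E.cfg (j + 1)).mem l))

/-- The points at which an operation that locks a leaf in its last attempt without modifying it may
linearize: any configuration in which it then holds the lock. -/
def LockPoint (o : T × ℕ) (r j : ℕ) : Prop :=
  o.2 < j ∧ j ≤ r ∧
    (∃ l, (E.cfg j).mem.node l .kind = .leaf ∧ (E.cfg j).mem.lock l = some o.1) ∧
    ∀ m n, j ≤ m → m < r → ¬ E.Locks o.1 m n ∧ ¬ E.Reads o.1 m n .ver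

/-- The linearization points of the operations that do not modify the dictionary. -/
def ReadPoint (o : T × ℕ) (r j : ℕ) : Op K V → Prop
  | .find _ => E.SearchPoint o r j
  | .insert _ _ => E.SearchPoint o r j ∨ E.LockPoint o r j
  | .delete _ => E.SearchPoint o r j ∨ E.LockPoint o r j

/-- In configuration `j`, thread `t` is at the start of a search. -/
def StartsSearch (t : T) (j : ℕ) : Prop :=
  ∃ c key target, (E.cfg j).thread t = some (.goto (.search c key target PathInfo.start))

/-- In configuration `j`, thread `t` visits the node `n` in a search that has started in
configuration `s`. -/
def VisitsFrom (t : T) (s j : ℕ) (n : Addr) : Prop :=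
  s ≤ j ∧ E.StartsSearch t s ∧ (∀ m, s < m → m ≤ j → ¬ E.StartsSearch t m) ∧
    ∃ c key target path, path.n = n ∧
      (E.cfg j).thread t = some (.goto (.search c key target path))

end Execution

end OCC

/-!
The proof is an assertional verification of the code against invariants of the shared memory, from
which linearizability follows by choosing a point in time for each operation.

*The tree.* In a frozen memory, `OnPath m k n` says that a search for `k` visits `n`; the keys with
this property form the range of `n`. By `WF`, the reachable nodes form a search tree: each has one
parent, routing keys are sorted and lie in the range of their node, and, apart from tagged nodes, all
leaves are at the same depth, so that siblings are of the same kind. Splitting inserts and rebalancing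
steps overwrite one child pointer, and thereby exchange two fragments of the tree, an old one and a
newly created one. If they are seen as large nodes, where leaves count as anonymous children and
adjacent ones are merged (`Frag`), the fragments have the same routing keys and children. Hence the
exchange (`Surgery`) yields a search tree again (`Surgery.wf'`), the reachable nodes change exactly by
the two fragments (`Surgery.reach_iff`), and no other node changes its range (`Surgery.onPath_iff`).

*The invariants.* `Inv` describes a configuration and `Trans` a step: nodes are written and unlinked
only by the thread that holds their lock, an unlinked node is never linked again and only its marked
bit can change, leaves change only while their version is odd, and as long as a node is in the tree its
range does not change. So a leaf that a search has visited, even without locks, contains the key of the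
search if any leaf does, whenever it is in the tree later on (`Inv.dict_leaf`, `Good.on_iff`). The same
argument shows that the child to which a stale pointer leads was in the tree after the search had
started, with the key in its range, and this is how searches are traced from node to node.

*The code.* `Safe` says that code keeps the invariants, whatever the other threads do between its
steps, and ends with a correct response or at a label whose assertion `LInv` holds. It is proved by
symbolic execution (`SafeFrom`): facts about locked nodes and about new, still private ones are stable.
Pointer writes are instances of `Surgery`; simple inserts and successful deletes change the dictionary at
one key, when the version of the leaf becomes even again (`stepOK_ver_even`). An operation without an
update point has seen a leaf that was constant between two reads of its version, or under its lock;
if the leaf was unlinked, this happened after the search visited it, when it already had its final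
contents (`resOK_of_searchLeaf`, `resOK_of_lock`). Induction on the configurations (`good`) combines all
this.

*Linearizability.* The update points and, for the other complete operations, one admissible point each
lie between invocation and response. Ordering the operations by these points, where reads at a
configuration precede the update in the following step, gives a legal sequential execution
(`linearizableUpTo`).
-/

set_option linter.unusedSectionVars false

namespace OCC

section Tree

variable {K V T : Type} [LinearOrder K]

/-! ### Routing -/

/-- The index of the child that a search for `k` follows from a node with routing keys `ks`. -/
def idx (ks : List K) (k : K) : ℕ := ks.countP fun z => decide (z ≤ k)

lemma idx_nil (k : K) : idx [] k = 0 := rfl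

lemma idx_append (A B : List K) (k : K) : idx (A ++ B) k = idx A k + idx B k :=
  List.countP_append

lemma idx_le_length (ks : List K) (k : K) : idx ks k ≤ ks.length := List.countP_le_length

lemma idx_eq_length {ks : List K} {k : K} : idx ks k = ks.length ↔ ∀ z ∈ ks, z ≤ k := by
  simp [idx, List.countP_eq_length]

lemma idx_eq_zero {ks : List K} {k : K} : idx ks k = 0 ↔ ∀ z ∈ ks, k < z := by
  simp [idx, List.countP_eq_zero]

/-- In a sorted list whose length fits, the middle block `KM`, `M` is entered exactly by the keys
between `KA` and `KB`. -/
lemma splice_lookup {α : Type} {KA KM KB : List K} {A M B : List α}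
    (hs : (KA ++ KM ++ KB).Pairwise (· < ·)) (hA : KA.length = A.length)
    (hM : M.length = KM.length + 1) (k : K) :
    (A ++ M ++ B)[idx (KA ++ KM ++ KB) k]? =
      if idx KA k < KA.length then A[idx KA k]?
      else if 0 < idx KB k then B[idx KB k - 1]? else M[idx KM k]? := by
  have hs' := hs
  rw [List.pairwise_append, List.pairwise_append] at hs
  obtain ⟨⟨-, -, h1⟩, -, h2⟩ := hs
  rw [idx_append, idx_append]
  have l1 := idx_le_length KA k
  have l2 := idx_le_length KM k
  split_ifs with hA' hB'
  · have : ∃ z ∈ KA, k < z := by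
      by_contra hc
      push Not at hc
      exact absurd (idx_eq_length.2 hc) hA'.ne
    obtain ⟨z, hz, hkz⟩ := this
    have e1 : idx KM k = 0 := idx_eq_zero.2 fun y hy => hkz.trans (h1 z hz y hy)
    have e2 : idx KB k = 0 := idx_eq_zero.2 fun y hy => hkz.trans (h2 z (by simp [hz]) y hy)
    rw [e1, e2, List.append_assoc, List.getElem?_append_left (by omega)]
    simp
  · have : ∃ z ∈ KB, z ≤ k := by
      by_contra hc
      push Not at hc
      exact absurd (idx_eq_zero.2 hc) hB'.ne'
    obtain ⟨z, hz, hkz⟩ := this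
    have e1 : idx KM k = KM.length := idx_eq_length.2 fun y hy =>
      (h2 y (by simp [hy]) z hz).le.trans hkz
    rw [List.getElem?_append_right (by simp; omega)]
    congr 1
    simp; omega
  · rw [List.getElem?_append_left (by simp; omega), List.getElem?_append_right (by omega)]
    congr 1
    omega

lemma collapse_lookup {α : Type} {KA KB : List K} {x : K} {A B : List (Option α)}
    (hs : (KA ++ x :: KB).Pairwise (· < ·)) (hA : KA.length = A.length) (k : K) (c : α) :
    (A ++ none :: B)[idx (KA ++ KB) k]? = some (some c) ↔
      (A ++ none :: none :: B)[idx (KA ++ x :: KB) k]? = some (some c) := by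
  have h1 := splice_lookup (KA := KA) (KM := [x]) (KB := KB) (A := A) (M := [none, none]) (B := B)
    (by simpa using hs) hA rfl k
  have h2 := splice_lookup (KA := KA) (KM := []) (KB := KB) (A := A) (M := [none]) (B := B)
    (by
      simp only [List.append_nil]
      exact hs.sublist (by simp)) hA rfl k
  simp only [List.append_assoc, List.cons_append, List.nil_append] at h1 h2
  rw [h1, h2]
  split_ifs
  · rfl
  · rfl
  · have : idx [x] k = 0 ∨ idx [x] k = 1 := by
      have := idx_le_length [x] k
      simp at this
      omega
    rcases this with h | h <;> simp [h, idx_nil]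

/-! ### Nodes and paths -/

/-- The node is an internal (or tagged) node with routing keys `ks` and children `cs`. -/
structure IsInternal (nd : Node K V) (ks : List K) (cs : List Addr) : Prop where
  kind_ne : nd .kind ≠ .leaf
  size_eq : nd .size = cs.length
  key_eq : ∀ i, nd (.key i) = ks[i]?
  ptr_eq : ∀ i, nd (.ptr i) = cs[i]?

lemma IsInternal.children_unique {nd : Node K V} {ks ks' : List K} {cs cs' : List Addr}
    (h : IsInternal nd ks cs) (h' : IsInternal nd ks' cs') : cs = cs' :=
  List.ext_getElem? fun i => (h.ptr_eq i).symm.trans (h'.ptr_eq i)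

lemma IsInternal.keys_unique {nd : Node K V} {ks ks' : List K} {cs cs' : List Addr}
    (h : IsInternal nd ks cs) (h' : IsInternal nd ks' cs') : ks = ks' :=
  List.ext_getElem? fun i => (h.key_eq i).symm.trans (h'.key_eq i)

lemma isInternal_mkInternal {kd : Kind} (hk : kd ≠ .leaf) (sk : K) (ks : List K) (cs : List Addr) :
    IsInternal (mkInternal (V := V) kd sk ks cs) ks cs :=
  ⟨hk, rfl, fun _ => rfl, fun _ => rfl⟩

/-- A search for `k` goes from the node `n` to its child `c`. -/
def Next (m : Mem K V T) (k : K) (n c : Addr) : Prop :=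
  ∃ ks cs, IsInternal (m.node n) ks cs ∧ cs[idx ks k]? = some c

/-- A search for `k` in the frozen memory `m` visits the node. The keys with this property form the
key range of the node. -/
def OnPath (m : Mem K V T) (k : K) (n : Addr) : Prop := Relation.ReflTransGen (Next m k) entry n

lemma onPath_entry (m : Mem K V T) (k : K) : OnPath m k entry := .refl

lemma OnPath.next {m : Mem K V T} {k : K} {n c : Addr} (h : OnPath m k n) (h' : Next m k n c) :
    OnPath m k c := Relation.ReflTransGen.tail h h'

lemma next_det {m : Mem K V T} {k : K} {n c c' : Addr} (h : Next m k n c) (h' : Next m k n c') :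
    c = c' := by
  obtain ⟨ks, cs, hi, hc⟩ := h
  obtain ⟨ks', cs', hi', hc'⟩ := h'
  obtain rfl := hi.keys_unique hi'
  obtain rfl := hi.children_unique hi'
  simpa [hc] using hc'

lemma isChild_iff {m : Mem K V T} {n c : Addr} {ks : List K} {cs : List Addr}
    (h : IsInternal (m.node n) ks cs) : IsChild m n c ↔ c ∈ cs := by
  constructor
  · rintro ⟨-, i, -, hi⟩
    rw [h.ptr_eq] at hi
    exact List.mem_of_getElem? hi
  · intro hc
    obtain ⟨i, hi⟩ := List.mem_iff_getElem?.1 hc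
    refine ⟨h.kind_ne, i, ?_, (h.ptr_eq i).trans hi⟩
    have := h.size_eq
    rw [this]
    exact (List.getElem?_eq_some_iff.1 hi).1

lemma IsChild.of_ptr {m : Mem K V T} {n c : Addr} {ks : List K} {cs : List Addr} {i : ℕ}
    (h : IsInternal (m.node n) ks cs) (hi : m.node n (.ptr i) = some c) : IsChild m n c := by
  rw [isChild_iff h]
  rw [h.ptr_eq] at hi
  exact List.mem_of_getElem? hi

lemma Next.isChild {m : Mem K V T} {k : K} {n c : Addr} (h : Next m k n c) : IsChild m n c := by
  obtain ⟨ks, cs, hi, hc⟩ := h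
  rw [isChild_iff hi]
  exact List.mem_of_getElem? hc

lemma Reachable.child {m : Mem K V T} {n c : Addr} (h : Reachable m n) (h' : IsChild m n c) :
    Reachable m c := Relation.ReflTransGen.tail h h'

lemma reachable_entry (m : Mem K V T) : Reachable m entry := .refl

lemma OnPath.reachable {m : Mem K V T} {k : K} {n : Addr} (h : OnPath m k n) : Reachable m n := by
  induction h with
  | refl => exact reachable_entry m
  | tail _ hc ih => exact ih.child hc.isChild

lemma not_next_of_leaf {m : Mem K V T} {k : K} {n c : Addr} (h : m.node n .kind = .leaf) :
    ¬ Next m k n c := fun ⟨_, _, hi, _⟩ => hi.kind_ne h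

/-- The search path of a key leads to at most one leaf. -/
lemma OnPath.leaf_unique {m : Mem K V T} {k : K} {l l' : Addr} (h : OnPath m k l)
    (h' : OnPath m k l') (hl : m.node l .kind = .leaf) (hl' : m.node l' .kind = .leaf) :
    l = l' := by
  have hu : Relator.RightUnique (Next m k) := fun _ _ _ h h' => next_det h h'
  rcases Relation.ReflTransGen.total_of_right_unique hu h h' with h | h
  · rcases Relation.ReflTransGen.cases_head h with h | ⟨c, hc, -⟩
    · exact h
    · exact absurd hc (not_next_of_leaf hl)
  · rcases Relation.ReflTransGen.cases_head h with h | ⟨c, hc, -⟩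
    · exact h.symm
    · exact absurd hc (not_next_of_leaf hl')

/-! ### The shape of the tree -/

/-- The key is in the range of the node, but is not its least element. -/
def KeyIn (m : Mem K V T) (n : Addr) (z : K) : Prop := OnPath m z n ∧ ∃ k < z, OnPath m k n

/-- The reachable nodes form a search tree. The function `H` is the height, where tagged nodes are
not counted; the sentinel has no height, as the height of the root can change. -/
structure WF (m : Mem K V T) (H : Addr → ℕ) : Prop where
  entry : ∃ c, IsInternal (m.node entry) [] [c]
  lt : ∀ n, Reachable m n → n < m.next
  shape : ∀ n, Reachable m n → m.node n .kind ≠ .leaf → ∃ ks cs, IsInternal (m.node n) ks cs ∧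
    cs.length = ks.length + 1 ∧ ks.Pairwise (· < ·) ∧ ∀ z ∈ ks, KeyIn m n z
  uniq : ∀ n n' i i' c, Reachable m n → Reachable m n' → m.node n .kind ≠ .leaf →
    m.node n' .kind ≠ .leaf → m.node n (.ptr i) = some c → m.node n' (.ptr i') = some c →
    n = n' ∧ i = i'
  ne_entry : ∀ n, Reachable m n → ¬ IsChild m n OCC.entry
  height_leaf : ∀ n, Reachable m n → m.node n .kind = .leaf → H n = 0
  height : ∀ n c, Reachable m n → n ≠ OCC.entry → IsChild m n c →
    H n = H c + if m.node n .kind = .tagged then 0 else 1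

lemma WF.child_of_ptr {m : Mem K V T} {H : Addr → ℕ} (w : WF m H) {n c : Addr} {i : ℕ}
    (hr : Reachable m n) (hk : m.node n .kind ≠ .leaf) (hp : m.node n (.ptr i) = some c) :
    IsChild m n c := by
  obtain ⟨ks, cs, hi, -⟩ := w.shape n hr hk
  exact IsChild.of_ptr hi hp

lemma WF.parent_unique {m : Mem K V T} {H : Addr → ℕ} (w : WF m H) {n n' c : Addr}
    (hr : Reachable m n) (hr' : Reachable m n') (h : IsChild m n c) (h' : IsChild m n' c) :
    n = n' := by
  obtain ⟨k, i, -, hi⟩ := h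
  obtain ⟨k', i', -, hi'⟩ := h'
  exact (w.uniq n n' i i' c hr hr' k k' hi hi').1

lemma WF.children_nodup {m : Mem K V T} {H : Addr → ℕ} (w : WF m H) {n : Addr} {ks : List K}
    {cs : List Addr} (hr : Reachable m n) (hi : IsInternal (m.node n) ks cs) : cs.Nodup := by
  rw [List.nodup_iff_getElem?_ne_getElem?]
  intro i j hij hj he
  obtain ⟨c, hc⟩ : ∃ c, cs[j]? = some c := ⟨_, List.getElem?_eq_getElem hj⟩
  have := (w.uniq n n i j c hr hr hi.kind_ne hi.kind_ne ((hi.ptr_eq i).trans (he.trans hc))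
    ((hi.ptr_eq j).trans hc)).2
  omega

/-- A node other than the sentinel on the search path of `k` is entered from its parent. -/
lemma OnPath.parent {m : Mem K V T} {k : K} {c : Addr} (h : OnPath m k c) (hc : c ≠ entry) :
    ∃ n, OnPath m k n ∧ Next m k n c := by
  rcases Relation.ReflTransGen.cases_tail h with h | ⟨n, hn, hnc⟩
  · exact absurd h hc
  · exact ⟨n, hn, hnc⟩

lemma WF.onPath_of_child {m : Mem K V T} {H : Addr → ℕ} (w : WF m H) {k : K} {n c : Addr}
    (hr : Reachable m n) (hc : IsChild m n c) (h : OnPath m k c) :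
    OnPath m k n ∧ Next m k n c := by
  obtain ⟨n', hn', hnc⟩ := h.parent (fun he => w.ne_entry n hr (he ▸ hc))
  obtain rfl := w.parent_unique hr hn'.reachable hc hnc.isChild
  exact ⟨hn', hnc⟩

/-- The distance of a node from the sentinel. -/
inductive Depth (m : Mem K V T) : ℕ → Addr → Prop
  | entry : Depth m 0 entry
  | child {d : ℕ} {n c : Addr} : Depth m d n → IsChild m n c → Depth m (d + 1) c

lemma Depth.reachable {m : Mem K V T} {d : ℕ} {n : Addr} (h : Depth m d n) : Reachable m n := by
  induction h with
  | entry => exact reachable_entry m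
  | child _ hc ih => exact ih.child hc

lemma Reachable.depth {m : Mem K V T} {n : Addr} (h : Reachable m n) : ∃ d, Depth m d n := by
  induction h with
  | refl => exact ⟨0, .entry⟩
  | tail _ hc ih => exact ⟨_, ih.choose_spec.child hc⟩

lemma WF.depth_unique {m : Mem K V T} {H : Addr → ℕ} (w : WF m H) {d d' : ℕ} {n : Addr}
    (h : Depth m d n) (h' : Depth m d' n) : d = d' := by
  induction h generalizing d' with
  | entry =>
    cases h' with
    | entry => rfl
    | child h' hc => exact absurd hc (w.ne_entry _ h'.reachable)
  | child h hc ih =>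
    cases h' with
    | entry => exact absurd hc (w.ne_entry _ h.reachable)
    | child h' hc' =>
      obtain rfl := w.parent_unique h.reachable h'.reachable hc hc'
      rw [ih h']

end Tree

end OCC

namespace OCC

section Fragments

variable {K V T : Type} [LinearOrder K]

/-! ### Fragments of the tree -/

/-- The routing keys and the children of a node, where a leaf counts as one anonymous child. -/
inductive Expands (m : Mem K V T) (n : Addr) : List K → List (Option Addr) → Prop
  | leaf : m.node n .kind = .leaf → Expands m n [] [none]
  | internal (ks : List K) (cs : List Addr) : IsInternal (m.node n) ks cs →
      cs.length = ks.length + 1 → Expands m n ks (cs.map some)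

/-- The fragment of the tree that consists of `n` and the descendants `inl` of `n` has, if it is
seen as one large node, the routing keys `KS` and the children `CS`. Leaves of the fragment become
anonymous children `none`, and two adjacent ones can be identified. -/
inductive Frag (m : Mem K V T) (n : Addr) : List K → List (Option Addr) → List Addr → Prop
  | base {KS : List K} {CS : List (Option Addr)} : Expands m n KS CS → Frag m n KS CS []
  | inline {KA KM KB : List K} {A M B : List (Option Addr)} {c : Addr} {inl : List Addr} :
      Frag m n (KA ++ KB) (A ++ some c :: B) inl → Expands m c KM M → KA.length = A.length →
      (KA ++ KM ++ KB).Pairwise (· < ·) → Frag m n (KA ++ KM ++ KB) (A ++ M ++ B) (c :: inl)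
  | collapse {KA KB : List K} {x : K} {A B : List (Option Addr)} {inl : List Addr} :
      Frag m n (KA ++ x :: KB) (A ++ none :: none :: B) inl → KA.length = A.length →
      (KA ++ x :: KB).Pairwise (· < ·) → Frag m n (KA ++ KB) (A ++ none :: B) inl

lemma Expands.length {m : Mem K V T} {n : Addr} {KS : List K} {CS : List (Option Addr)}
    (h : Expands m n KS CS) : CS.length = KS.length + 1 := by
  cases h <;> simp [*]

lemma Expands.mem_iff {m : Mem K V T} {n c : Addr} {KS : List K} {CS : List (Option Addr)}
    (h : Expands m n KS CS) : some c ∈ CS ↔ IsChild m n c := by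
  cases h with
  | leaf h => simp [IsChild, h]
  | internal ks cs h _ => simp [isChild_iff h]

lemma Expands.mem_of_ptr {m : Mem K V T} {n c : Addr} {KS : List K} {CS : List (Option Addr)}
    (h : Expands m n KS CS) (hk : m.node n .kind ≠ .leaf) {i : ℕ}
    (hi : m.node n (.ptr i) = some c) : some c ∈ CS := by
  cases h with
  | leaf h => exact absurd h hk
  | internal ks cs h _ =>
    rw [h.ptr_eq] at hi
    simpa using List.mem_of_getElem? hi

lemma Expands.lookup {m : Mem K V T} {n c : Addr} {KS : List K} {CS : List (Option Addr)} {k : K}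
    (h : Expands m n KS CS) : CS[idx KS k]? = some (some c) ↔ Next m k n c := by
  cases h with
  | leaf h => simp [idx_nil, not_next_of_leaf h]
  | internal ks cs h _ =>
    simp only [List.getElem?_map, Option.map_eq_some_iff, Option.some.injEq, exists_eq_right]
    constructor
    · intro hc
      exact ⟨_, _, h, hc⟩
    · rintro ⟨ks', cs', h', hc⟩
      rwa [h.keys_unique h', h.children_unique h']

/-- A property that is inherited by children holds for all nodes and children of the fragment. -/
lemma Frag.closed {m : Mem K V T} {n : Addr} {KS : List K} {CS : List (Option Addr)}
    {inl : List Addr} (h : Frag m n KS CS inl) {P : Addr → Prop}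
    (hP : ∀ a b, P a → IsChild m a b → P b) (hn : P n) :
    (∀ s ∈ n :: inl, P s) ∧ ∀ c, some c ∈ CS → P c := by
  induction h with
  | base h => exact ⟨by simpa using hn, fun c hc => hP n c hn (h.mem_iff.1 hc)⟩
  | @inline _ _ _ _ _ _ c _ _ he _ _ ih =>
    obtain ⟨h1, h2⟩ := ih
    have hc : P c := h2 c (by simp)
    refine ⟨?_, fun d hd => ?_⟩
    · intro s hs
      simp only [List.mem_cons] at hs h1
      rcases hs with rfl | rfl | hs
      · exact hn
      · exact hc
      · exact h1 s (.inr hs)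
    · simp only [List.mem_append] at hd
      rcases hd with (hd | hd) | hd
      · exact h2 d (by simp [hd])
      · exact hP c d hc (he.mem_iff.1 hd)
      · exact h2 d (by simp [hd])
  | collapse _ _ _ ih =>
    refine ⟨ih.1, fun c hc => ih.2 c ?_⟩
    simpa using hc

lemma Frag.exists_parent {m : Mem K V T} {n : Addr} {KS : List K} {CS : List (Option Addr)}
    {inl : List Addr} (h : Frag m n KS CS inl) {c : Addr} (hc : c ∈ inl ∨ some c ∈ CS) :
    ∃ s ∈ n :: inl, IsChild m s c := by
  induction h generalizing c with
  | base h => exact ⟨n, by simp, h.mem_iff.1 (by simpa using hc)⟩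
  | @inline KA KM KB A M B d inl _ he _ _ ih =>
    have key : some c ∈ M ∨ (c ∈ inl ∨ some c ∈ A ++ some d :: B) := by
      simp only [List.mem_cons, List.mem_append, Option.some.injEq] at hc ⊢
      tauto
    rcases key with h | h
    · exact ⟨d, by simp, he.mem_iff.1 h⟩
    · obtain ⟨s, hs, hsc⟩ := ih h
      exact ⟨s, by simp only [List.mem_cons] at hs ⊢; tauto, hsc⟩
  | collapse _ _ _ ih => exact ih (by simpa using hc)

lemma Frag.child_mem {m : Mem K V T} {n : Addr} {KS : List K} {CS : List (Option Addr)}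
    {inl : List Addr} (h : Frag m n KS CS inl) {s c : Addr} (hs : s ∈ n :: inl)
    (hk : m.node s .kind ≠ .leaf) {i : ℕ} (hc : m.node s (.ptr i) = some c) :
    c ∈ inl ∨ some c ∈ CS := by
  induction h with
  | base h =>
    obtain rfl : s = n := by simpa using hs
    exact .inr (h.mem_of_ptr hk hc)
  | @inline KA KM KB A M B d inl _ he _ _ ih =>
    simp only [List.mem_cons, List.mem_append, Option.some.injEq] at hs ih ⊢
    by_cases hsd : s = d
    · subst hsd
      have := he.mem_of_ptr hk hc
      tauto
    · have := ih (by tauto)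
      tauto
  | collapse _ _ _ ih => simpa using ih hs

/-- The nodes and children of a fragment before and after `d` has been replaced by its children. -/
lemma inline_perm (A M B : List (Option Addr)) (d : Addr) (inl : List Addr) :
    (d :: inl ++ (A ++ M ++ B).reduceOption).Perm
      (M.reduceOption ++ (inl ++ (A ++ some d :: B).reduceOption)) := by
  rw [List.perm_iff_count]
  intro a
  simp only [List.reduceOption_append, List.reduceOption_cons_of_some, List.count_append,
    List.count_cons, List.cons_append]
  omega

/-- The key enters a child of the fragment if the search path of the key leaves it there. -/
lemma Frag.exit_of_lookup {m : Mem K V T} {n : Addr} {KS : List K} {CS : List (Option Addr)}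
    {inl : List Addr} (h : Frag m n KS CS inl) {k : K} {Q : Addr → Prop} (hn : Q n)
    (hQ : ∀ a b, Q a → Next m k a b → Q b) {c : Addr} (hc : CS[idx KS k]? = some (some c)) :
    ∃ s ∈ n :: inl, Q s ∧ Next m k s c := by
  induction h generalizing c with
  | base h => exact ⟨n, by simp, hn, h.lookup.1 hc⟩
  | @inline KA KM KB A M B d inl _ he hA hs ih =>
    rw [splice_lookup hs hA he.length] at hc
    have h2 := splice_lookup (KM := []) (M := [some d]) (A := A) (B := B) (KA := KA) (KB := KB)
      (hs.sublist (by simp)) hA rfl k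
    simp only [List.append_nil, List.append_assoc, List.cons_append, List.nil_append] at h2
    rw [h2] at ih
    have old : ∀ e, (∃ s ∈ n :: inl, Q s ∧ Next m k s e) → ∃ s ∈ n :: d :: inl, Q s ∧ Next m k s e := by
      rintro e ⟨s, hs, h⟩
      exact ⟨s, by simp only [List.mem_cons] at hs ⊢; tauto, h⟩
    split_ifs at hc h2 ih with h1 h3
    · exact old _ (ih hc)
    · exact old _ (ih hc)
    · obtain ⟨s, hs, hQs, hsd⟩ := ih (c := d) (by simp [idx_nil])
      exact ⟨d, by simp, hQ s d hQs hsd, he.lookup.1 hc⟩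
  | collapse _ hA hs ih => exact ih ((collapse_lookup hs hA k c).1 hc)

/-- Conversely, the search path leaves the fragment only where the key enters a child. -/
lemma Frag.lookup_of_exit {m : Mem K V T} {n : Addr} {KS : List K} {CS : List (Option Addr)}
    {inl : List Addr} (h : Frag m n KS CS inl) (hnd : (inl ++ CS.reduceOption).Nodup) {k : K}
    {Q : Addr → Prop}
    (hQ : ∀ c ∈ inl, Q c → ∃ s ∈ n :: inl, Q s ∧ Next m k s c) {s c : Addr} (hs : s ∈ n :: inl)
    (hQs : Q s) (hsc : Next m k s c) (hc : c ∉ inl) : CS[idx KS k]? = some (some c) := by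
  induction h generalizing s c with
  | base h =>
    obtain rfl : s = n := by simpa using hs
    exact h.lookup.2 hsc
  | @inline KA KM KB A M B d inl _ he hA hso ih =>
    have hp := inline_perm A M B d inl
    have hnd' := hp.nodup_iff.1 hnd
    rw [List.nodup_append] at hnd'
    obtain ⟨-, hold, hdis⟩ := hnd'
    -- no child of the inlined node `d` occurs elsewhere in the fragment
    have hdis' : ∀ e, Next m k d e → e ∉ inl ∧ e ≠ d := by
      intro e he'
      have hm : e ∈ M.reduceOption := by
        rw [List.reduceOption_mem_iff]
        exact he.mem_iff.2 he'.isChild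
      refine ⟨fun h => hdis e hm e (by simp [h]) rfl, fun h => hdis e hm d ?_ h⟩
      simp [List.reduceOption_append]
    have hdA : some d ∉ A ∧ some d ∉ B ∧ d ∉ inl := by
      simp only [List.reduceOption_append, List.reduceOption_cons_of_some] at hold
      simp only [← List.reduceOption_mem_iff]
      refine ⟨?_, ?_, ?_⟩ <;> intro hh <;> grind
    have hQ' : ∀ e ∈ inl, Q e → ∃ s ∈ n :: inl, Q s ∧ Next m k s e := by
      intro e hei hQe
      obtain ⟨s', hs', hQ', hn'⟩ := hQ e (by simp [hei]) hQe
      refine ⟨s', ?_, hQ', hn'⟩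
      simp only [List.mem_cons] at hs' ⊢
      rcases hs' with h | rfl | h
      · exact .inl h
      · exact absurd hei (hdis' e hn').1
      · exact .inr h
    have ih' : ∀ {s c : Addr}, s ∈ n :: inl → Q s → Next m k s c → c ∉ inl →
        (A ++ some d :: B)[idx (KA ++ KB) k]? = some (some c) := ih hold hQ'
    have h2 := splice_lookup (KM := []) (M := [some d]) (A := A) (B := B) (KA := KA) (KB := KB)
      (hso.sublist (by simp)) hA rfl k
    simp only [List.append_nil, List.append_assoc, List.cons_append, List.nil_append] at h2
    rw [splice_lookup hso hA he.length]
    simp only [List.mem_cons, not_or] at hc hs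
    by_cases hsd : s = d
    · subst hsd
      obtain ⟨s', hs', hQ', hn'⟩ := hQ s (by simp) hQs
      have hs'' : s' ∈ n :: inl := by
        simp only [List.mem_cons] at hs' ⊢
        rcases hs' with h | rfl | h
        · exact .inl h
        · exact absurd rfl (hdis' _ hn').2
        · exact .inr h
      have := ih' hs'' hQ' hn' hdA.2.2
      rw [h2] at this
      split_ifs at this ⊢ with h1 h3
      · exact absurd (List.mem_of_getElem? this) hdA.1
      · exact absurd (List.mem_of_getElem? this) hdA.2.1
      · exact he.lookup.2 hsc
    · have := ih' (s := s) (c := c) (by simp only [List.mem_cons]; tauto) hQs hsc hc.2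
      rw [h2] at this
      split_ifs at this ⊢ with h1 h3
      · exact this
      · exact this
      · simp [idx_nil] at this
        exact absurd this.symm hc.1
  | collapse _ hA hso ih =>
    refine (collapse_lookup hso hA k c).2 (ih ?_ hQ hs hQs hsc hc)
    simpa [List.reduceOption_append] using hnd

/-- In a tree, no node occurs twice among the nodes and the children of a fragment, as each of them has
only one parent. -/
lemma Frag.nodup {m : Mem K V T} {H : Addr → ℕ} (w : WF m H) {n gp : Addr} {KS : List K}
    {CS : List (Option Addr)} {inl : List Addr} (h : Frag m n KS CS inl) (hgp : Reachable m gp)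
    (hc : IsChild m gp n) (hni : gp ∉ n :: inl) :
    (n :: (inl ++ CS.reduceOption)).Nodup := by
  have hn : Reachable m n := hgp.child hc
  have hr : ∀ {KS : List K} {CS : List (Option Addr)} {inl : List Addr}, Frag m n KS CS inl →
      ∀ s ∈ n :: inl, Reachable m s := fun h => (h.closed (fun _ _ h h' => h.child h') hn).1
  refine List.nodup_cons.2 ⟨fun hm => ?_, ?_⟩
  · rw [List.mem_append, List.reduceOption_mem_iff] at hm
    obtain ⟨s, hs, hsn⟩ := h.exists_parent hm
    obtain rfl := w.parent_unique (hr h s hs) hgp hsn hc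
    exact hni hs
  · induction h with
    | base h =>
      cases h with
      | leaf => simp
      | internal ks cs hi _ =>
        simpa [List.reduceOption, List.filterMap_map] using w.children_nodup hn hi
    | @inline KA KM KB A M B d inl hf he hA hso ih =>
      have hni' : gp ∉ n :: inl := by
        simp only [List.mem_cons] at hni ⊢
        tauto
      have hold := ih hni'
      have hdp : ∀ s ∈ n :: inl, d ≠ s := by
        rintro s hs rfl
        obtain ⟨s', hs', hsd⟩ := hf.exists_parent (c := d) (.inr (by simp))
        simp only [List.mem_cons] at hs
        rcases hs with rfl | hs
        · obtain rfl := w.parent_unique (hr hf s' hs') hgp hsd hc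
          exact hni' hs'
        · simp only [List.reduceOption_append, List.reduceOption_cons_of_some] at hold
          grind
      have hp := inline_perm A M B d inl
      rw [hp.nodup_iff, List.nodup_append]
      have hdr : Reachable m d := hr (.inline hf he hA hso) d (by simp)
      refine ⟨?_, hold, ?_⟩
      · cases he with
        | leaf => simp
        | internal ks cs hi _ =>
          simpa [List.reduceOption, List.filterMap_map] using w.children_nodup hdr hi
      · rintro a ha b hb rfl
        rw [List.reduceOption_mem_iff] at ha
        rw [List.mem_append, List.reduceOption_mem_iff] at hb
        obtain ⟨s, hs, hsa⟩ := hf.exists_parent hb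
        exact hdp s hs (w.parent_unique hdr (hr hf s hs) (he.mem_iff.1 ha) hsa)
    | collapse _ _ _ ih => simpa [List.reduceOption_append] using ih hni

/-- Different pointers of a fragment lead to different nodes. -/
lemma Frag.edge_unique {m : Mem K V T} {n : Addr} {KS : List K} {CS : List (Option Addr)}
    {inl : List Addr} (h : Frag m n KS CS inl) (hnd : (inl ++ CS.reduceOption).Nodup)
    {s s' c : Addr} {i i' : ℕ} (hs : s ∈ n :: inl) (hs' : s' ∈ n :: inl)
    (hk : m.node s .kind ≠ .leaf) (hk' : m.node s' .kind ≠ .leaf)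
    (hc : m.node s (.ptr i) = some c) (hc' : m.node s' (.ptr i') = some c) : s = s' ∧ i = i' := by
  have node : ∀ {s : Addr} {KS : List K} {CS : List (Option Addr)}, Expands m s KS CS →
      CS.reduceOption.Nodup → m.node s .kind ≠ .leaf → m.node s (.ptr i) = some c →
      m.node s (.ptr i') = some c → i = i' := by
    intro s KS CS he hnd hk hc hc'
    cases he with
    | leaf h => exact absurd h hk
    | internal ks cs hi _ =>
      have hnd' : cs.Nodup := by simpa [List.reduceOption, List.filterMap_map] using hnd
      rw [hi.ptr_eq] at hc hc'
      obtain ⟨h1, h2⟩ := List.getElem?_eq_some_iff.1 hc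
      obtain ⟨h3, h4⟩ := List.getElem?_eq_some_iff.1 hc'
      exact (hnd'.getElem_inj_iff).1 (h2.trans h4.symm)
  induction h with
  | base h =>
    obtain rfl : s = n := by simpa using hs
    obtain rfl : s' = s := by simpa using hs'
    exact ⟨rfl, node h (by simpa using hnd) hk hc hc'⟩
  | @inline KA KM KB A M B d inl hf he hA hso ih =>
    have hp := inline_perm A M B d inl
    rw [hp.nodup_iff, List.nodup_append] at hnd
    obtain ⟨hM, hold, hdis⟩ := hnd
    have mixed : ∀ {t i i'}, t ∈ n :: inl → m.node t .kind ≠ .leaf → m.node d .kind ≠ .leaf →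
        m.node t (.ptr i) = some c → m.node d (.ptr i') = some c → False := by
      intro t i i' ht hkt hkd hct hcd
      have h1 := he.mem_of_ptr hkd hcd
      have h2 := hf.child_mem ht hkt hct
      rw [← List.reduceOption_mem_iff] at h1 h2
      exact hdis c h1 c (by simpa using h2) rfl
    simp only [List.mem_cons] at hs hs' ih mixed
    by_cases h1 : s = d <;> by_cases h2 : s' = d
    · subst h1
      subst h2
      exact ⟨rfl, node he hM hk hc hc'⟩
    · subst h1
      exact (mixed (by tauto) hk' hk hc' hc).elim
    · subst h2
      exact (mixed (by tauto) hk hk' hc hc').elim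
    · exact ih hold (by tauto) (by tauto)
  | collapse _ _ _ ih =>
    exact ih (by simpa [List.reduceOption_append] using hnd) hs hs'

lemma Expands.congr {m m' : Mem K V T} {n : Addr} {KS : List K} {CS : List (Option Addr)}
    (h : Expands m n KS CS) (he : m'.node n = m.node n) : Expands m' n KS CS := by
  cases h with
  | leaf h => exact .leaf (by rw [he]; exact h)
  | internal ks cs hi hl => exact .internal _ cs (by rw [he]; exact hi) hl

lemma Frag.congr {m m' : Mem K V T} {n : Addr} {KS : List K} {CS : List (Option Addr)}
    {inl : List Addr} (h : Frag m n KS CS inl) (he : ∀ s ∈ n :: inl, m'.node s = m.node s) :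
    Frag m' n KS CS inl := by
  induction h with
  | base h => exact .base (h.congr (he n (by simp)))
  | inline _ hx hA hs ih =>
    refine .inline (ih fun s hs => he s ?_) (hx.congr (he _ (by simp))) hA hs
    simp only [List.mem_cons] at hs ⊢
    tauto
  | collapse _ hA hs ih => exact .collapse (ih he) hA hs

lemma Frag.backward {m : Mem K V T} {n : Addr} {KS : List K} {CS : List (Option Addr)}
    {inl : List Addr} (h : Frag m n KS CS inl) {Q : Addr → Prop}
    (hQ : ∀ s ∈ n :: inl, ∀ c, IsChild m s c → Q c → Q s) {s : Addr} (hs : s ∈ n :: inl)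
    (hQs : Q s) : Q n := by
  induction h generalizing s with
  | base h =>
    obtain rfl : s = n := by simpa using hs
    exact hQs
  | @inline KA KM KB A M B d inl hf he hA hso ih =>
    have hQ' : ∀ s ∈ n :: inl, ∀ c, IsChild m s c → Q c → Q s := fun s hs => hQ s (by
      simp only [List.mem_cons] at hs ⊢
      tauto)
    by_cases h : s ∈ n :: inl
    · exact ih hQ' h hQs
    · obtain rfl : s = d := by
        simp only [List.mem_cons] at hs h
        tauto
      obtain ⟨s', hs', hsd⟩ := hf.exists_parent (c := s) (.inr (by simp))
      exact ih hQ' hs' (hQ' s' hs' s hsd hQs)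
  | collapse _ _ _ ih => exact ih hQ hs hQs

end Fragments

end OCC

namespace OCC

section Surgery

variable {K V T : Type} [LinearOrder K]

/-! ### Replacing a fragment of the tree -/

/-- In `m'`, the child pointer `i₀` of the node `gp` leads to the new fragment with the nodes
`new :: F`, and not to the fragment with the nodes `p :: X` as in `m`. Seen as one large node, both
fragments have the same routing keys and children. -/
structure Surgery (m m' : Mem K V T) (H H' : Addr → ℕ) (gp : Addr) (i₀ : ℕ) (p new : Addr)
    (KS : List K) (CS : List (Option Addr)) (X F : List Addr) : Prop where
  wf : WF m H
  node_eq : ∀ n, n ≠ gp → m'.node n = m.node n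
  node_gp : m'.node gp = Function.update (m.node gp) (.ptr i₀) (some new)
  next_eq : m'.next = m.next
  gp_reach : Reachable m gp
  gp_kind : m.node gp .kind ≠ .leaf
  gp_ptr : m.node gp (.ptr i₀) = some p
  fragX : Frag m p KS CS X
  gp_not_mem : gp ∉ p :: X
  fragF : Frag m new KS CS F
  fresh : ∀ f ∈ new :: F, ¬ Reachable m f ∧ f < m.next
  nodup : (new :: F).Nodup
  shape : ∀ f ∈ new :: F, m.node f .kind ≠ .leaf → ∃ ks cs, IsInternal (m.node f) ks cs ∧
    cs.length = ks.length + 1 ∧ ks.Pairwise (· < ·) ∧ ∀ z ∈ ks,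
      OnPath m z p ∧ (f = new ∨ Next m z new f) ∧
      ∃ k < z, OnPath m k p ∧ (f = new ∨ Next m k new f)
  height_eq : ∀ n, n ∉ new :: F → H' n = H n
  height_new : gp ≠ entry → H' new = H p
  height_leaf : ∀ f ∈ new :: F, m.node f .kind = .leaf → H' f = 0
  height : ∀ f ∈ new :: F, ∀ c, IsChild m f c →
    H' f = H' c + if m.node f .kind = .tagged then 0 else 1

namespace Surgery

variable {m m' : Mem K V T} {H H' : Addr → ℕ} {gp : Addr} {i₀ : ℕ} {p new : Addr}
    {KS : List K} {CS : List (Option Addr)} {X F : List Addr}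

lemma isChild_gp (s : Surgery m m' H H' gp i₀ p new KS CS X F) : IsChild m gp p :=
  s.wf.child_of_ptr s.gp_reach s.gp_kind s.gp_ptr

lemma p_reach (s : Surgery m m' H H' gp i₀ p new KS CS X F) : Reachable m p :=
  s.gp_reach.child s.isChild_gp

lemma x_reach (s : Surgery m m' H H' gp i₀ p new KS CS X F) : ∀ x ∈ p :: X, Reachable m x :=
  (s.fragX.closed (fun _ _ h h' => h.child h') s.p_reach).1

lemma cs_reach (s : Surgery m m' H H' gp i₀ p new KS CS X F) : ∀ c, some c ∈ CS → Reachable m c :=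
  (s.fragX.closed (fun _ _ h h' => h.child h') s.p_reach).2

lemma nodupX (s : Surgery m m' H H' gp i₀ p new KS CS X F) :
    (p :: (X ++ CS.reduceOption)).Nodup :=
  s.fragX.nodup s.wf s.gp_reach s.isChild_gp s.gp_not_mem

lemma nodupF (s : Surgery m m' H H' gp i₀ p new KS CS X F) : (F ++ CS.reduceOption).Nodup := by
  have h1 := s.nodupX
  rw [List.nodup_cons, List.nodup_append] at h1
  rw [List.nodup_append]
  refine ⟨(List.nodup_cons.1 s.nodup).2, h1.2.2.1, ?_⟩
  rintro a ha b hb rfl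
  rw [List.reduceOption_mem_iff] at hb
  exact (s.fresh a (by simp [ha])).1 (s.cs_reach a hb)

lemma cs_not_mem (s : Surgery m m' H H' gp i₀ p new KS CS X F) {c : Addr} (hc : some c ∈ CS) :
    c ∉ p :: X := by
  have h1 := s.nodupX
  rw [← List.reduceOption_mem_iff] at hc
  intro h
  grind

lemma gp_not_memF (s : Surgery m m' H H' gp i₀ p new KS CS X F) : gp ∉ new :: F := fun h =>
  (s.fresh gp h).1 s.gp_reach

lemma node_F (s : Surgery m m' H H' gp i₀ p new KS CS X F) {f : Addr} (hf : f ∈ new :: F) :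
    m'.node f = m.node f := s.node_eq f fun h => s.gp_not_memF (h ▸ hf)

lemma fragF' (s : Surgery m m' H H' gp i₀ p new KS CS X F) : Frag m' new KS CS F :=
  s.fragF.congr fun _ hf => s.node_F hf

lemma exists_gp (s : Surgery m m' H H' gp i₀ p new KS CS X F) : ∃ ks cs, i₀ < cs.length ∧
    IsInternal (m.node gp) ks cs ∧ IsInternal (m'.node gp) ks (cs.set i₀ new) ∧
    cs[i₀]? = some p := by
  obtain ⟨ks, cs, hi, -⟩ := s.wf.shape gp s.gp_reach s.gp_kind
  have hp := s.gp_ptr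
  rw [hi.ptr_eq] at hp
  refine ⟨ks, cs, (List.getElem?_eq_some_iff.1 hp).1, hi, ?_, hp⟩
  rw [s.node_gp]
  refine ⟨?_, ?_, fun i => ?_, fun i => ?_⟩
  · simpa using hi.kind_ne
  · simpa using hi.size_eq
  · simpa using hi.key_eq i
  · by_cases h : i = i₀
    · subst h
      simp [(List.getElem?_eq_some_iff.1 hp).1]
    · rw [Function.update_of_ne (by simpa using h), hi.ptr_eq, List.getElem?_set_ne (Ne.symm h)]

lemma kind_eq (s : Surgery m m' H H' gp i₀ p new KS CS X F) (n : Addr) :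
    m'.node n .kind = m.node n .kind := by
  by_cases h : n = gp
  · subst h
    rw [s.node_gp]
    simp
  · rw [s.node_eq n h]

lemma ptr_eq (s : Surgery m m' H H' gp i₀ p new KS CS X F) {n : Addr} {i : ℕ}
    (h : ¬ (n = gp ∧ i = i₀)) : m'.node n (.ptr i) = m.node n (.ptr i) := by
  by_cases hn : n = gp
  · subst hn
    rw [s.node_gp, Function.update_of_ne]
    simpa using h
  · rw [s.node_eq n hn]

lemma ptr_gp (s : Surgery m m' H H' gp i₀ p new KS CS X F) :
    m'.node gp (.ptr i₀) = some new := by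
  rw [s.node_gp]
  simp

lemma child_new (s : Surgery m m' H H' gp i₀ p new KS CS X F) : IsChild m' gp new := by
  obtain ⟨ks, cs, h, -, hi, -⟩ := s.exists_gp
  exact IsChild.of_ptr hi s.ptr_gp

/-- Apart from the replaced pointer, the children of a reachable node are the same. -/
lemma isChild_old (s : Surgery m m' H H' gp i₀ p new KS CS X F) {n c : Addr}
    (hn : Reachable m n) : IsChild m' n c ↔
      (n = gp ∧ c = new) ∨ (IsChild m n c ∧ ¬ (n = gp ∧ c = p)) := by
  by_cases h : n = gp
  · subst h
    obtain ⟨ks, cs, hlt, h1, h2, h3⟩ := s.exists_gp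
    rw [isChild_iff h1, isChild_iff h2]
    have hnd := s.wf.children_nodup hn h1
    constructor
    · intro hc
      by_cases hcn : c = new
      · exact .inl ⟨rfl, hcn⟩
      · refine .inr ⟨List.mem_or_eq_of_mem_set hc |>.resolve_right hcn, ?_⟩
        rintro ⟨-, rfl⟩
        obtain ⟨j, hj⟩ := List.mem_iff_getElem?.1 hc
        by_cases hji : j = i₀
        · subst hji
          rw [List.getElem?_set_self hlt] at hj
          exact hcn (by simpa using hj.symm)
        · rw [List.getElem?_set_ne (Ne.symm hji)] at hj
          obtain ⟨a1, a2⟩ := List.getElem?_eq_some_iff.1 hj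
          obtain ⟨a3, a4⟩ := List.getElem?_eq_some_iff.1 h3
          exact hji ((hnd.getElem_inj_iff).1 (a2.trans a4.symm))
    · rintro (⟨-, rfl⟩ | ⟨hc, hne⟩)
      · exact List.mem_iff_getElem?.2 ⟨i₀, List.getElem?_set_self hlt⟩
      · obtain ⟨j, hj⟩ := List.mem_iff_getElem?.1 hc
        refine List.mem_iff_getElem?.2 ⟨j, ?_⟩
        rw [List.getElem?_set_ne, hj]
        rintro rfl
        rw [h3] at hj
        exact hne ⟨rfl, by simpa using hj.symm⟩
  · simp only [IsChild, s.node_eq n h, h, false_and, not_false_eq_true, and_true, false_or]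

lemma isChild_F (s : Surgery m m' H H' gp i₀ p new KS CS X F) {f c : Addr} (hf : f ∈ new :: F) :
    IsChild m' f c ↔ IsChild m f c := by
  simp only [IsChild, s.node_F hf]

lemma isChild_F_mem (s : Surgery m m' H H' gp i₀ p new KS CS X F) {f c : Addr}
    (hf : f ∈ new :: F) (h : IsChild m f c) : c ∈ F ∨ some c ∈ CS := by
  obtain ⟨hk, i, -, hi⟩ := h
  exact s.fragF.child_mem hf hk hi

lemma reach_of_reach' (s : Surgery m m' H H' gp i₀ p new KS CS X F) {n : Addr}
    (h : Reachable m' n) : n ∈ new :: F ∨ (Reachable m n ∧ n ∉ p :: X) := by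
  induction h with
  | refl =>
    refine .inr ⟨reachable_entry m, fun h => ?_⟩
    simp only [List.mem_cons] at h
    rcases h with h | h
    · exact s.wf.ne_entry gp s.gp_reach (h ▸ s.isChild_gp)
    · obtain ⟨x, hx, hxc⟩ := s.fragX.exists_parent (.inl h)
      exact s.wf.ne_entry x (s.x_reach x hx) hxc
  | tail _ hc ih =>
    rename_i n c _
    rcases ih with hf | ⟨hr, hX⟩
    · rw [s.isChild_F hf] at hc
      rcases s.isChild_F_mem hf hc with h | h
      · exact .inl (by simp [h])
      · exact .inr ⟨s.cs_reach c h, s.cs_not_mem h⟩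
    · rcases (s.isChild_old hr).1 hc with ⟨-, rfl⟩ | ⟨hc, hne⟩
      · exact .inl (by simp)
      · refine .inr ⟨hr.child hc, fun h => ?_⟩
        simp only [List.mem_cons] at h
        rcases h with rfl | h
        · exact hne ⟨s.wf.parent_unique hr s.gp_reach hc s.isChild_gp, rfl⟩
        · obtain ⟨x, hx, hxc⟩ := s.fragX.exists_parent (.inl h)
          exact hX (s.wf.parent_unique hr (s.x_reach x hx) hc hxc ▸ hx)

/-- The nodes of the old fragment are farther from the sentinel than the node that points to it. -/
lemma depth_gp_lt (s : Surgery m m' H H' gp i₀ p new KS CS X F) {d e : ℕ} {x : Addr}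
    (hx : x ∈ p :: X) (hd : Depth m d gp) (he : Depth m e x) : d < e := by
  have h := (s.fragX.closed (P := fun x => ∃ e > d, Depth m e x) (by
    rintro a b ⟨e, he, hea⟩ hab
    exact ⟨e + 1, by omega, hea.child hab⟩) ⟨d + 1, by simp, hd.child s.isChild_gp⟩).1 x hx
  obtain ⟨e', hlt, he'⟩ := h
  rw [s.wf.depth_unique he he']
  exact hlt

/-- By induction on the depth: a child of the old fragment is also a child of the new one, which is
reachable as `gp` is, and `gp` is less deep than the old fragment. -/
lemma reach'_of_reach (s : Surgery m m' H H' gp i₀ p new KS CS X F) {n : Addr}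
    (h : Reachable m n) (hX : n ∉ p :: X) : Reachable m' n := by
  obtain ⟨d, hd⟩ := h.depth
  induction d using Nat.strong_induction_on generalizing n with
  | _ d ih =>
    cases hd with
    | entry => exact reachable_entry m'
    | @child d q _ hq hqn =>
      by_cases hqX : q ∈ p :: X
      · obtain ⟨hk, i, -, hi⟩ := hqn
        have hCS : some n ∈ CS := (s.fragX.child_mem hqX hk hi).resolve_left
          (fun h => hX (by simp [h]))
        obtain ⟨e, he⟩ := s.gp_reach.depth
        have hgp := ih e (by have := s.depth_gp_lt hqX he hq; omega) s.gp_reach s.gp_not_mem he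
        exact (s.fragF'.closed (fun _ _ h h' => h.child h') (hgp.child s.child_new)).2 n hCS
      · have := ih d (by omega) hq.reachable hqX hq
        refine this.child ((s.isChild_old hq.reachable).2 (.inr ⟨hqn, ?_⟩))
        rintro ⟨-, rfl⟩
        exact hX (by simp)

lemma reach'_new (s : Surgery m m' H H' gp i₀ p new KS CS X F) : Reachable m' new :=
  (s.reach'_of_reach s.gp_reach s.gp_not_mem).child s.child_new

lemma reach_iff (s : Surgery m m' H H' gp i₀ p new KS CS X F) {n : Addr} :
    Reachable m' n ↔ n ∈ new :: F ∨ (Reachable m n ∧ n ∉ p :: X) := by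
  refine ⟨s.reach_of_reach', ?_⟩
  rintro (h | ⟨h1, h2⟩)
  · exact (s.fragF'.closed (fun _ _ h h' => h.child h') s.reach'_new).1 n h
  · exact s.reach'_of_reach h1 h2

lemma uniq' (s : Surgery m m' H H' gp i₀ p new KS CS X F) (n n' : Addr) (i i' : ℕ) (c : Addr)
    (hr : Reachable m' n) (hr' : Reachable m' n') (hk : m'.node n .kind ≠ .leaf)
    (hk' : m'.node n' .kind ≠ .leaf) (hp : m'.node n (.ptr i) = some c)
    (hp' : m'.node n' (.ptr i') = some c) : n = n' ∧ i = i' := by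
  rw [s.kind_eq] at hk hk'
  -- an old pointer leads to a node outside both fragments, or is the replaced pointer
  have old : ∀ {n i}, Reachable m n → n ∉ p :: X → m.node n .kind ≠ .leaf →
      m'.node n (.ptr i) = some c → (n = gp ∧ i = i₀ ∧ c = new) ∨
        (Reachable m c ∧ m.node n (.ptr i) = some c) := by
    intro n i hr hX hk hp
    by_cases h : n = gp ∧ i = i₀
    · obtain ⟨rfl, rfl⟩ := h
      rw [s.ptr_gp] at hp
      exact .inl ⟨rfl, rfl, by simpa using hp.symm⟩
    · rw [s.ptr_eq h] at hp
      exact .inr ⟨hr.child (s.wf.child_of_ptr hr hk hp), hp⟩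
  have mixed : ∀ {f n i i'}, f ∈ new :: F → Reachable m n → n ∉ p :: X →
      m.node f .kind ≠ .leaf → m.node n .kind ≠ .leaf →
      m'.node f (.ptr i) = some c → m'.node n (.ptr i') = some c → False := by
    intro f n i i' hf hr hX hkf hk hcf hcn
    rw [s.node_F hf] at hcf
    have hm := s.fragF.child_mem hf hkf hcf
    rcases old hr hX hk hcn with ⟨-, -, rfl⟩ | ⟨hrc, hcn⟩
    · rcases hm with h | h
      · exact (List.nodup_cons.1 s.nodup).1 h
      · exact (s.fresh c (by simp)).1 (s.cs_reach c h)
    · rcases hm with h | h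
      · exact (s.fresh c (by simp [h])).1 hrc
      · obtain ⟨x, hx, hxc⟩ := s.fragX.exists_parent (.inr h)
        exact hX (s.wf.parent_unique hr (s.x_reach x hx) (s.wf.child_of_ptr hr hk hcn) hxc ▸ hx)
  rcases s.reach_of_reach' hr with hf | ⟨h1, h2⟩ <;> rcases s.reach_of_reach' hr' with hf' | ⟨h1', h2'⟩
  · rw [s.node_F hf] at hp
    rw [s.node_F hf'] at hp'
    exact s.fragF.edge_unique s.nodupF hf hf' hk hk' hp hp'
  · exact (mixed hf h1' h2' hk hk' hp hp').elim
  · exact (mixed hf' h1 h2 hk' hk hp' hp).elim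
  · rcases old h1 h2 hk hp with ⟨rfl, rfl, rfl⟩ | ⟨hrc, hp⟩ <;>
      rcases old h1' h2' hk' hp' with ⟨rfl, rfl, h⟩ | ⟨hrc', hp'⟩
    · exact ⟨rfl, rfl⟩
    · exact ((s.fresh c (by simp)).1 hrc').elim
    · subst h
      exact ((s.fresh c (by simp)).1 hrc).elim
    · exact s.wf.uniq n n' i i' c h1 h1' hk hk' hp hp'

lemma ne_entry' (s : Surgery m m' H H' gp i₀ p new KS CS X F) (n : Addr) (hr : Reachable m' n) :
    ¬ IsChild m' n entry := by
  intro hc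
  have hne : ∀ f ∈ new :: F, f ≠ entry := by
    rintro f hf rfl
    exact (s.fresh _ hf).1 (reachable_entry m)
  rcases s.reach_of_reach' hr with hf | ⟨h1, h2⟩
  · rw [s.isChild_F hf] at hc
    rcases s.isChild_F_mem hf hc with h | h
    · exact hne _ (by simp [h]) rfl
    · obtain ⟨x, hx, hxc⟩ := s.fragX.exists_parent (.inr h)
      exact s.wf.ne_entry x (s.x_reach x hx) hxc
  · rcases (s.isChild_old h1).1 hc with ⟨-, h⟩ | ⟨hc, -⟩
    · exact hne new (by simp) h.symm
    · exact s.wf.ne_entry n h1 hc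

lemma next_old (s : Surgery m m' H H' gp i₀ p new KS CS X F) {k : K} {n c : Addr}
    (h : ¬ (n = gp ∧ c = p)) (hc : Next m k n c) : Next m' k n c := by
  by_cases hg : n = gp
  · subst hg
    obtain ⟨ks, cs, hlt, h1, h2, h3⟩ := s.exists_gp
    obtain ⟨ks', cs', h1', hc⟩ := hc
    obtain rfl := h1.keys_unique h1'
    obtain rfl := h1.children_unique h1'
    refine ⟨ks, _, h2, ?_⟩
    rw [List.getElem?_set_ne, hc]
    intro he
    rw [← he, h3] at hc
    exact h ⟨rfl, by simpa using hc.symm⟩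
  · obtain ⟨ks, cs, hi, hc⟩ := hc
    exact ⟨ks, cs, by rwa [s.node_eq n hg], hc⟩

lemma next_new (s : Surgery m m' H H' gp i₀ p new KS CS X F) {k : K} :
    Next m' k gp new ↔ Next m k gp p := by
  obtain ⟨ks, cs, hlt, h1, h2, h3⟩ := s.exists_gp
  constructor
  · rintro ⟨ks', cs', h2', hc⟩
    obtain rfl := h2.keys_unique h2'
    obtain rfl := h2.children_unique h2'
    refine ⟨ks, cs, h1, ?_⟩
    by_cases he : idx ks k = i₀
    · rw [he, h3]
    · rw [List.getElem?_set_ne (Ne.symm he)] at hc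
      exact ((s.fresh new (by simp)).1 (s.gp_reach.child
        ((isChild_iff h1).2 (List.mem_of_getElem? hc)))).elim
  · rintro ⟨ks', cs', h1', hc⟩
    obtain rfl := h1.keys_unique h1'
    obtain rfl := h1.children_unique h1'
    refine ⟨ks, _, h2, ?_⟩
    obtain ⟨a1, a2⟩ := List.getElem?_eq_some_iff.1 hc
    obtain ⟨a3, a4⟩ := List.getElem?_eq_some_iff.1 h3
    rw [← ((s.wf.children_nodup s.gp_reach h1).getElem_inj_iff).1 (a2.trans a4.symm),
      List.getElem?_set_self a1]

lemma next_F (s : Surgery m m' H H' gp i₀ p new KS CS X F) {k : K} {f c : Addr}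
    (hf : f ∈ new :: F) : Next m' k f c ↔ Next m k f c := by
  simp only [Next, s.node_F hf]

/-- If the search path of a key leaves the old fragment for `n`, then after the replacement it enters
the new fragment at the same pointer, and leaves it for the same child. -/
lemma onPath'_of_onPath (s : Surgery m m' H H' gp i₀ p new KS CS X F) {k : K} {n : Addr}
    (h : OnPath m k n) (hX : n ∉ p :: X) : OnPath m' k n := by
  obtain ⟨d, hd⟩ := h.reachable.depth
  induction d using Nat.strong_induction_on generalizing n with
  | _ d ih =>
    cases hd with
    | entry => exact onPath_entry m' k
    | @child d q _ hq hqn =>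
      obtain ⟨hkq, hnext⟩ := s.wf.onPath_of_child hq.reachable hqn h
      by_cases hqX : q ∈ p :: X
      · have hkp : OnPath m k p := s.fragX.backward (Q := OnPath m k)
          (fun x hx c hxc hc => (s.wf.onPath_of_child (s.x_reach x hx) hxc hc).1) hqX hkq
        have hlook := s.fragX.lookup_of_exit (List.nodup_cons.1 s.nodupX).2 (Q := OnPath m k)
          (fun c hc hkc => by
            obtain ⟨x, hx, hxc⟩ := s.fragX.exists_parent (.inl hc)
            exact ⟨x, hx, s.wf.onPath_of_child (s.x_reach x hx) hxc hkc⟩) hqX hkq hnext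
          (fun h => hX (by simp [h]))
        obtain ⟨hkgp, hgp⟩ := s.wf.onPath_of_child s.gp_reach s.isChild_gp hkp
        obtain ⟨e, he⟩ := s.gp_reach.depth
        have hgp' := ih e (by have := s.depth_gp_lt hqX he hq; omega) hkgp s.gp_not_mem he
        obtain ⟨f, hf, hkf, hfn⟩ := s.fragF'.exit_of_lookup (Q := OnPath m' k)
          (hgp'.next (s.next_new.2 hgp)) (fun a b h h' => h.next h') hlook
        exact hkf.next hfn
      · refine (ih d (by omega) hkq hqX hq).next (s.next_old ?_ hnext)
        rintro ⟨-, rfl⟩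
        exact hX (by simp)

lemma onPath'_new (s : Surgery m m' H H' gp i₀ p new KS CS X F) {k : K} (h : OnPath m k p) :
    OnPath m' k new := by
  obtain ⟨hkgp, hgp⟩ := s.wf.onPath_of_child s.gp_reach s.isChild_gp h
  exact (s.onPath'_of_onPath hkgp s.gp_not_mem).next (s.next_new.2 hgp)

lemma onPath'_F (s : Surgery m m' H H' gp i₀ p new KS CS X F) {k : K} {f : Addr}
    (h : OnPath m k p) (hf : f = new ∨ Next m k new f) : OnPath m' k f := by
  rcases hf with rfl | hf
  · exact s.onPath'_new h
  · exact (s.onPath'_new h).next ((s.next_F (by simp)).2 hf)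

/-- The tree is still a search tree after the replacement. -/
lemma wf' (s : Surgery m m' H H' gp i₀ p new KS CS X F) : WF m' H' where
  entry := by
    obtain ⟨c, hc⟩ := s.wf.entry
    by_cases h : OCC.entry = gp
    · obtain ⟨ks, cs, hlt, h1, h2, h3⟩ := s.exists_gp
      rw [← h] at h1 h2
      obtain rfl := h1.keys_unique hc
      obtain rfl := h1.children_unique hc
      obtain rfl : i₀ = 0 := by simpa using hlt
      exact ⟨new, h2⟩
    · exact ⟨c, by rwa [s.node_eq _ h]⟩
  lt n hn := by
    rw [s.next_eq]
    rcases s.reach_of_reach' hn with h | h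
    · exact (s.fresh n h).2
    · exact s.wf.lt n h.1
  shape n hn hk := by
    rw [s.kind_eq] at hk
    rcases s.reach_of_reach' hn with h | ⟨h, hX⟩
    · obtain ⟨ks, cs, h1, h2, h3, h4⟩ := s.shape n h hk
      refine ⟨ks, cs, by rwa [s.node_F h], h2, h3, fun z hz => ?_⟩
      obtain ⟨hz1, hz2, k, hkz, hk1, hk2⟩ := h4 z hz
      exact ⟨s.onPath'_F hz1 hz2, k, hkz, s.onPath'_F hk1 hk2⟩
    · have tr : ∀ {ks : List K}, (∀ z ∈ ks, KeyIn m n z) → ∀ z ∈ ks, KeyIn m' n z := by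
        intro ks h z hz
        obtain ⟨h1, k, hkz, h2⟩ := h z hz
        exact ⟨s.onPath'_of_onPath h1 hX, k, hkz, s.onPath'_of_onPath h2 hX⟩
      obtain ⟨ks, cs, h1, h2, h3, h4⟩ := s.wf.shape n h hk
      by_cases hg : n = gp
      · subst hg
        obtain ⟨ks', cs', hlt, h1', h2', h3'⟩ := s.exists_gp
        obtain rfl := h1.keys_unique h1'
        obtain rfl := h1.children_unique h1'
        exact ⟨ks, _, h2', by simpa using h2, h3, tr h4⟩
      · exact ⟨ks, cs, by rwa [s.node_eq n hg], h2, h3, tr h4⟩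
  uniq := s.uniq'
  ne_entry := s.ne_entry'
  height_leaf n hn hk := by
    rw [s.kind_eq] at hk
    rcases s.reach_of_reach' hn with h | ⟨h, hX⟩
    · exact s.height_leaf n h hk
    · rw [s.height_eq n fun hf => (s.fresh n hf).1 h]
      exact s.wf.height_leaf n h hk
  height n c hn hne hc := by
    rw [s.kind_eq]
    rcases s.reach_of_reach' hn with h | ⟨h, hX⟩
    · rw [s.isChild_F h] at hc
      exact s.height n h c hc
    · rw [s.height_eq n fun hf => (s.fresh n hf).1 h]
      rcases (s.isChild_old h).1 hc with ⟨rfl, rfl⟩ | ⟨hc, -⟩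
      · rw [s.height_new hne]
        exact s.wf.height n p h hne s.isChild_gp
      · rw [s.height_eq c fun hf => (s.fresh c hf).1 (h.child hc)]
        exact s.wf.height n c h hne hc

/-- The converse, in which the two fragments exchange their roles. -/
lemma onPath_of_onPath' (s : Surgery m m' H H' gp i₀ p new KS CS X F) {k : K} {n : Addr}
    (h : OnPath m' k n) (hF : n ∉ new :: F) : OnPath m k n := by
  have w := s.wf'
  obtain ⟨d, hd⟩ := h.reachable.depth
  induction d using Nat.strong_induction_on generalizing n with
  | _ d ih =>
    cases hd with
    | entry => exact onPath_entry m k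
    | @child d q _ hq hqn =>
      obtain ⟨hkq, hnext⟩ := w.onPath_of_child hq.reachable hqn h
      have hgp' := s.reach'_of_reach s.gp_reach s.gp_not_mem
      have hF' : ∀ f ∈ new :: F, Reachable m' f := fun f hf => s.reach_iff.2 (.inl hf)
      by_cases hqF : q ∈ new :: F
      · have hkn : OnPath m' k new := s.fragF'.backward (Q := OnPath m' k)
          (fun f hf c hfc hc => (w.onPath_of_child (hF' f hf) hfc hc).1) hqF hkq
        have hlook := s.fragF'.lookup_of_exit s.nodupF (Q := OnPath m' k)
          (fun c hc hkc => by
            obtain ⟨f, hf, hfc⟩ := s.fragF'.exists_parent (.inl hc)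
            exact ⟨f, hf, w.onPath_of_child (hF' f hf) hfc hkc⟩) hqF hkq hnext
          (fun h => hF (by simp [h]))
        obtain ⟨hkgp, hgp⟩ := w.onPath_of_child hgp' s.child_new hkn
        obtain ⟨e, he⟩ := hgp'.depth
        have hlt : e < d := by
          obtain ⟨e', hlt, he'⟩ := (s.fragF'.closed (P := fun x => ∃ e' > e, Depth m' e' x) (by
            rintro a b ⟨e', he', hea⟩ hab
            exact ⟨e' + 1, by omega, hea.child hab⟩) ⟨e + 1, by simp, he.child s.child_new⟩).1 q hqF
          rw [w.depth_unique hq he']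
          exact hlt
        have hgp0 := ih e (by omega) hkgp s.gp_not_memF he
        obtain ⟨x, hx, hkx, hxn⟩ := s.fragX.exit_of_lookup (Q := OnPath m k)
          (hgp0.next (s.next_new.1 hgp)) (fun a b h h' => h.next h') hlook
        exact hkx.next hxn
      · have hkq0 := ih d (by omega) hkq hqF hq
        refine hkq0.next ?_
        by_cases hg : q = gp
        · subst hg
          obtain ⟨ks, cs, hlt, h1, h2, h3⟩ := s.exists_gp
          obtain ⟨ks', cs', h2', hc⟩ := hnext
          obtain rfl := h2.keys_unique h2'
          obtain rfl := h2.children_unique h2'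
          refine ⟨ks, cs, h1, ?_⟩
          by_cases he : i₀ = idx ks k
          · rw [← he, List.getElem?_set_self hlt] at hc
            exact absurd (by simpa using hc.symm) (fun h : n = new => hF (by simp [h]))
          · rwa [List.getElem?_set_ne he] at hc
        · obtain ⟨ks, cs, hi, hc⟩ := hnext
          exact ⟨ks, cs, by rwa [← s.node_eq q hg], hc⟩

/-- Key ranges do not change. -/
lemma onPath_iff (s : Surgery m m' H H' gp i₀ p new KS CS X F) {k : K} {n : Addr}
    (hX : n ∉ p :: X) (hF : n ∉ new :: F) : OnPath m' k n ↔ OnPath m k n :=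
  ⟨fun h => s.onPath_of_onPath' h hF, fun h => s.onPath'_of_onPath h hX⟩

end Surgery

end Surgery

end OCC

namespace OCC

section Struct

variable {K V T : Type} [LinearOrder K]

/-! ### Changes of the memory outside the tree structure -/

/-- The two memories contain the same tree, apart from the contents of the leaves. -/
def SameStruct (m m' : Mem K V T) : Prop :=
  ∀ n, Reachable m n → m'.node n .kind = m.node n .kind ∧ (m.node n .kind ≠ .leaf →
    m'.node n .size = m.node n .size ∧ (∀ i, m'.node n (.key i) = m.node n (.key i)) ∧
    ∀ i, m'.node n (.ptr i) = m.node n (.ptr i))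

namespace SameStruct

variable {m m' : Mem K V T}

lemma isInternal_iff (h : SameStruct m m') {n : Addr} (hn : Reachable m n) {ks : List K}
    {cs : List Addr} : IsInternal (m'.node n) ks cs ↔ IsInternal (m.node n) ks cs := by
  obtain ⟨h1, h2⟩ := h n hn
  constructor
  · rintro ⟨a1, a2, a3, a4⟩
    rw [h1] at a1
    obtain ⟨e1, e2, e3⟩ := h2 a1
    exact ⟨a1, e1.symm.trans a2, fun i => (e2 i).symm.trans (a3 i), fun i => (e3 i).symm.trans (a4 i)⟩
  · rintro ⟨a1, a2, a3, a4⟩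
    obtain ⟨e1, e2, e3⟩ := h2 a1
    exact ⟨h1 ▸ a1, e1.trans a2, fun i => (e2 i).trans (a3 i), fun i => (e3 i).trans (a4 i)⟩

lemma isChild_iff (h : SameStruct m m') {n c : Addr} (hn : Reachable m n) :
    IsChild m' n c ↔ IsChild m n c := by
  obtain ⟨h1, h2⟩ := h n hn
  simp only [IsChild, h1]
  refine and_congr_right fun hk => ?_
  obtain ⟨e1, e2, e3⟩ := h2 hk
  simp only [e1, e3]

lemma reach_iff (h : SameStruct m m') {n : Addr} : Reachable m' n ↔ Reachable m n := by
  constructor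
  · intro hr
    induction hr with
    | refl => exact reachable_entry m
    | tail _ hc ih => exact ih.child ((h.isChild_iff ih).1 hc)
  · intro hr
    induction hr with
    | refl => exact reachable_entry m'
    | tail hr hc ih => exact ih.child ((h.isChild_iff hr).2 hc)

lemma next_iff (h : SameStruct m m') {k : K} {n c : Addr} (hn : Reachable m n) :
    Next m' k n c ↔ Next m k n c := by
  simp only [Next, h.isInternal_iff hn]

lemma onPath_iff (h : SameStruct m m') {k : K} {n : Addr} : OnPath m' k n ↔ OnPath m k n := by
  constructor
  · intro hr
    induction hr with
    | refl => exact onPath_entry m k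
    | tail _ hc ih => exact ih.next ((h.next_iff ih.reachable).1 hc)
  · intro hr
    induction hr with
    | refl => exact onPath_entry m' k
    | tail hr hc ih => exact OnPath.next ih ((h.next_iff (OnPath.reachable hr)).2 hc)

lemma wf (h : SameStruct m m') (hn : m.next ≤ m'.next) {H : Addr → ℕ} (w : WF m H) : WF m' H where
  entry := by
    obtain ⟨c, hc⟩ := w.entry
    exact ⟨c, (h.isInternal_iff (reachable_entry m)).2 hc⟩
  lt n hr := (w.lt n (h.reach_iff.1 hr)).trans_le hn
  shape n hr hk := by
    have hr' := h.reach_iff.1 hr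
    obtain ⟨ks, cs, h1, h2, h3, h4⟩ := w.shape n hr' (by rwa [(h n hr').1] at hk)
    refine ⟨ks, cs, (h.isInternal_iff hr').2 h1, h2, h3, fun z hz => ?_⟩
    simpa only [KeyIn, h.onPath_iff] using h4 z hz
  uniq n n' i i' c hr hr' hk hk' hp hp' := by
    rw [h.reach_iff] at hr hr'
    rw [(h n hr).1] at hk
    rw [(h n' hr').1] at hk'
    rw [((h n hr).2 hk).2.2] at hp
    rw [((h n' hr').2 hk').2.2] at hp'
    exact w.uniq n n' i i' c hr hr' hk hk' hp hp'
  ne_entry n hr := by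
    rw [h.reach_iff] at hr
    rw [h.isChild_iff hr]
    exact w.ne_entry n hr
  height_leaf n hr hk := by
    rw [h.reach_iff] at hr
    exact w.height_leaf n hr (by rwa [(h n hr).1] at hk)
  height n c hr hne hc := by
    rw [h.reach_iff] at hr
    rw [h.isChild_iff hr] at hc
    rw [(h n hr).1]
    exact w.height n c hr hne hc

end SameStruct

/-- The leaf has the pair in one of its slots. -/
def SlotHas (b : ℕ) (nd : Node K V) (k : K) (v : V) : Prop :=
  ∃ i < b, nd (.key i) = some k ∧ nd (.val i) = some v

/-- The contents of a leaf that is not being modified. -/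
structure LeafOK (b : ℕ) (nd : Node K V) : Prop where
  val : ∀ i < b, ∀ k, nd (.key i) = some k → ∃ v, nd (.val i) = some v
  inj : ∀ i < b, ∀ i' < b, ∀ k, nd (.key i) = some k → nd (.key i') = some k → i = i'
  size : nd .size = ((Finset.range b).filter fun i => (nd (.key i)).isSome = true).card

lemma LeafOK.func {b : ℕ} {nd : Node K V} (h : LeafOK b nd) {k : K} {v v' : V}
    (h1 : SlotHas b nd k v) (h2 : SlotHas b nd k v') : v = v' := by
  obtain ⟨i, hi, hk, hv⟩ := h1
  obtain ⟨i', hi', hk', hv'⟩ := h2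
  obtain rfl := h.inj i hi i' hi' k hk hk'
  rw [hv] at hv'
  exact Option.some.inj hv'

end Struct

namespace Prog

variable {K V : Type}

/-- A step that leaves all locks and all existing nodes as they are. -/
def NoWrite : Prog K V → Prop
  | .read _ _ _ => True
  | .alloc _ _ => True
  | .anyKey _ => True
  | .goto _ => True
  | _ => False

/-- A step that is, moreover, neither a jump nor a read of a version. -/
def Calm : Prog K V → Prop
  | .read _ f _ => f ≠ .ver
  | .alloc _ _ => True
  | .anyKey _ => True
  | _ => False

lemma Calm.noWrite {q : Prog K V} (h : q.Calm) : q.NoWrite := by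
  cases q <;> simp_all [Calm, NoWrite]

end Prog

namespace Execution

variable {K V T : Type} [LinearOrder K] [DecidableEq T] {a b : ℕ} (E : Execution K V T a b)

/-! ### Invariants of an execution -/

/-- The node is in the tree in configuration `j`. -/
abbrev Rch (j : ℕ) (n : Addr) : Prop := Reachable (E.cfg j).mem n

/-- The key is in the range of the node in configuration `j`. -/
abbrev On (j : ℕ) (k : K) (n : Addr) : Prop := OnPath (E.cfg j).mem k n

/-- The node is or was in the tree. -/
def Ever (j : ℕ) (n : Addr) : Prop := ∃ m ≤ j, E.Rch m n

/-- The leaf held the pair in one of its slots when its version was last even. -/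
def LE (j : ℕ) (l : Addr) (k : K) (v : V) : Prop :=
  ∃ j' ≤ j, Even ((E.cfg j').mem.node l .ver) ∧ (∀ m, j' < m → m ≤ j → ¬ Even ((E.cfg m).mem.node l .ver)) ∧
    SlotHas b ((E.cfg j').mem.node l) k v

lemma inTree_iff {j : ℕ} {k : K} {v : V} : E.InTree j k v ↔
    ∃ l, E.Rch j l ∧ (E.cfg j).mem.node l .kind = .leaf ∧ E.LE j l k v := Iff.rfl

open Classical in
/-- The abstract dictionary in a configuration. -/
noncomputable def dict (j : ℕ) : Dict K V := fun k =>
  if h : ∃ v, E.InTree j k v then some h.choose else none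

/-- The node was created by the thread. -/
def AllocBy (t : T) (j : ℕ) (n : Addr) : Prop :=
  ∃ ja < j, E.act ja = .internal t ∧ (E.cfg ja).mem.next = n ∧ (E.cfg (ja + 1)).mem.next = n + 1

/-- The invariants of a configuration. A node whose lock is free is not being modified or
unlinked. -/
structure Inv (j : ℕ) : Prop where
  wf : ∃ H, WF (E.cfg j).mem H
  leaf : ∀ l < (E.cfg j).mem.next, (E.cfg j).mem.node l .kind = .leaf → Even ((E.cfg j).mem.node l .ver) →
    LeafOK b ((E.cfg j).mem.node l)
  keys : ∀ l k v, E.Rch j l → (E.cfg j).mem.node l .kind = .leaf → E.LE j l k v → E.On j k l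
  func : ∀ l k v v', E.Rch j l → (E.cfg j).mem.node l .kind = .leaf → E.LE j l k v → E.LE j l k v' → v = v'
  free : ∀ n < (E.cfg j).mem.next, (E.cfg j).mem.lock n = none →
    Even ((E.cfg j).mem.node n .ver) ∧ (E.Ever j n → ¬ E.Rch j n → (E.cfg j).mem.node n .marked = true)

/-- What each step guarantees to the other threads. -/
structure Trans (j : ℕ) : Prop where
  next_le : (E.cfg j).mem.next ≤ (E.cfg (j + 1)).mem.next
  kind : ∀ n < (E.cfg j).mem.next, (E.cfg (j + 1)).mem.node n .kind = (E.cfg j).mem.node n .kind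
  imm : ∀ n < (E.cfg j).mem.next, (E.cfg j).mem.node n .kind ≠ .leaf →
    (E.cfg (j + 1)).mem.node n .size = (E.cfg j).mem.node n .size ∧ ∀ i, (E.cfg (j + 1)).mem.node n (.key i) = (E.cfg j).mem.node n (.key i)
  wr : ∀ n < (E.cfg j).mem.next, ∀ f, (E.cfg (j + 1)).mem.node n f ≠ (E.cfg j).mem.node n f → ∃ t, E.act j = .internal t ∧
    (E.cfg j).mem.lock n = some t ∧ E.Ever j n ∧ (f ≠ .marked → E.Rch j n)
  leafwr : ∀ n < (E.cfg j).mem.next, (E.cfg j).mem.node n .kind = .leaf → ∀ f, f ≠ .ver → f ≠ .marked →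
    (E.cfg (j + 1)).mem.node n f ≠ (E.cfg j).mem.node n f → ¬ Even ((E.cfg j).mem.node n .ver)
  ver : ∀ n < (E.cfg j).mem.next, (E.cfg j).mem.node n .ver ≤ (E.cfg (j + 1)).mem.node n .ver
  lock : ∀ n, (E.cfg (j + 1)).mem.lock n = (E.cfg j).mem.lock n ∨ ∃ t, E.act j = .internal t ∧
    (((E.cfg j).mem.lock n = none ∧ (E.cfg (j + 1)).mem.lock n = some t) ∨
      ((E.cfg j).mem.lock n = some t ∧ (E.cfg (j + 1)).mem.lock n = none))
  unlink : ∀ n, E.Rch j n → ¬ E.Rch (j + 1) n → (E.cfg (j + 1)).mem.node n = (E.cfg j).mem.node n ∧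
    ((E.cfg j).mem.node n .kind = .leaf → Even ((E.cfg j).mem.node n .ver)) ∧
    ∃ t, E.act j = .internal t ∧ (E.cfg j).mem.lock n = some t
  link : ∀ n, E.Rch (j + 1) n → ¬ E.Rch j n → ¬ E.Ever j n ∧
    ∃ t, E.act j = .internal t ∧ E.AllocBy t j n
  range : ∀ n, E.Rch j n → E.Rch (j + 1) n → ∀ k, E.On (j + 1) k n ↔ E.On j k n
  ptr : ∀ n i c, E.Rch j n → (E.cfg j).mem.node n .kind ≠ .leaf → (E.cfg j).mem.node n (.ptr i) = some c →
    (E.cfg (j + 1)).mem.node n (.ptr i) ≠ some c → ¬ E.Rch (j + 1) c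

/-- The dictionary changes at the update points, and only there. -/
def UpdOK (j : ℕ) : Prop :=
  (∀ o op, E.Invokes o op → E.UpdatePoint o j op →
    E.dict (j + 1) = (op.apply (E.dict j)).1 ∧ E.dict (j + 1) ≠ E.dict j ∧
    ∀ u < j, ¬ E.UpdatePoint o u op) ∧
  ((¬ ∃ o op, E.Invokes o op ∧ E.UpdatePoint o j op) → E.dict (j + 1) = E.dict j)

/-- The invariants hold up to a configuration. -/
structure Good (j : ℕ) : Prop where
  inv : ∀ m ≤ j, E.Inv m
  trans : ∀ m < j, E.Trans m
  upd : ∀ m < j, E.UpdOK m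

/-- A step preserves the invariants. -/
structure StepOK (j : ℕ) : Prop where
  inv : E.Inv (j + 1)
  trans : E.Trans j
  upd : E.UpdOK j

variable {E}

lemma Good.mono {j j' : ℕ} (g : E.Good j) (h : j' ≤ j) : E.Good j' :=
  ⟨fun m hm => g.inv m (hm.trans h), fun m hm => g.trans m (hm.trans_le h),
    fun m hm => g.upd m (hm.trans_le h)⟩

lemma Good.succ {j : ℕ} (g : E.Good j) (h : E.StepOK j) : E.Good (j + 1) := by
  refine ⟨fun m hm => ?_, fun m hm => ?_, fun m hm => ?_⟩
  · rcases Nat.lt_or_eq_of_le hm with h' | rfl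
    · exact g.inv m (by omega)
    · exact h.inv
  · rcases Nat.lt_or_eq_of_le (Nat.le_of_lt_succ hm) with h' | rfl
    · exact g.trans m h'
    · exact h.trans
  · rcases Nat.lt_or_eq_of_le (Nat.le_of_lt_succ hm) with h' | rfl
    · exact g.upd m h'
    · exact h.upd

lemma Good.self {j : ℕ} (g : E.Good j) : E.Inv j := g.inv j le_rfl

lemma le_even {j : ℕ} {l : Addr} {k : K} {v : V} (h : Even ((E.cfg j).mem.node l .ver)) :
    E.LE j l k v ↔ SlotHas b ((E.cfg j).mem.node l) k v := by
  constructor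
  · rintro ⟨j', hj, he, ho, hs⟩
    rcases Nat.lt_or_eq_of_le hj with h' | rfl
    · exact absurd h (ho j h' le_rfl)
    · exact hs
  · intro hs
    exact ⟨j, le_rfl, h, fun m h1 h2 => by omega, hs⟩

lemma le_odd {j : ℕ} {l : Addr} {k : K} {v : V} (h : ¬ Even ((E.cfg (j + 1)).mem.node l .ver)) :
    E.LE (j + 1) l k v ↔ E.LE j l k v := by
  constructor
  · rintro ⟨j', hj, he, ho, hs⟩
    rcases Nat.lt_or_eq_of_le hj with h' | rfl
    · exact ⟨j', by omega, he, fun m h1 h2 => ho m h1 (by omega), hs⟩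
    · exact absurd he h
  · rintro ⟨j', hj, he, ho, hs⟩
    refine ⟨j', by omega, he, fun m h1 h2 => ?_, hs⟩
    rcases Nat.lt_or_eq_of_le h2 with h' | rfl
    · exact ho m h1 (by omega)
    · exact h

lemma le_same {j : ℕ} {l : Addr} {k : K} {v : V} (hv : (E.cfg (j + 1)).mem.node l .ver = (E.cfg j).mem.node l .ver)
    (h1 : ∀ i, (E.cfg (j + 1)).mem.node l (.key i) = (E.cfg j).mem.node l (.key i))
    (h2 : ∀ i, (E.cfg (j + 1)).mem.node l (.val i) = (E.cfg j).mem.node l (.val i)) :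
    E.LE (j + 1) l k v ↔ E.LE j l k v := by
  by_cases h : Even ((E.cfg j).mem.node l .ver)
  · rw [le_even h, le_even (by rwa [hv])]
    simp only [SlotHas, h1, h2]
  · exact le_odd (by rwa [hv])

lemma Inv.dict_iff {j : ℕ} (i : E.Inv j) {k : K} {v : V} : E.dict j k = some v ↔ E.InTree j k v := by
  have hu : ∀ v v', E.InTree j k v → E.InTree j k v' → v = v' := by
    rintro v v' ⟨l, hr, hl, hle⟩ ⟨l', hr', hl', hle'⟩
    obtain rfl := (i.keys l k v hr hl hle).leaf_unique (i.keys l' k v' hr' hl' hle') hl hl'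
    exact i.func l k v v' hr hl hle hle'
  unfold dict
  split_ifs with h
  · rw [Option.some.injEq]
    exact ⟨fun e => e ▸ h.choose_spec, fun h' => hu _ _ h.choose_spec h'⟩
  · simp only [false_iff]
    exact fun h' => h ⟨v, h'⟩

/-- The dictionary is determined by the leaf in whose range the key is. -/
lemma Inv.dict_leaf {j : ℕ} (i : E.Inv j) {l : Addr} {k : K} (hr : E.Rch j l)
    (hl : (E.cfg j).mem.node l .kind = .leaf) (hk : E.On j k l) {v : V} :
    E.dict j k = some v ↔ E.LE j l k v := by
  rw [i.dict_iff]
  constructor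
  · rintro ⟨l', hr', hl', hle⟩
    obtain rfl := hk.leaf_unique (i.keys l' k v hr' hl' hle) hl hl'
    exact hle
  · intro h
    exact ⟨l, hr, hl, h⟩

lemma dict_congr {j : ℕ} (i : E.Inv j) (i' : E.Inv (j + 1))
    (h : ∀ k v, E.InTree (j + 1) k v ↔ E.InTree j k v) : E.dict (j + 1) = E.dict j := by
  funext k
  refine Option.ext fun v => ?_
  rw [i.dict_iff, i'.dict_iff, h]

/-! ### Consequences of the invariants -/

lemma Good.next_mono {J : ℕ} (g : E.Good J) {j j' : ℕ} (h : j ≤ j') (hJ : j' ≤ J) :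
    (E.cfg j).mem.next ≤ (E.cfg j').mem.next := by
  induction j', h using Nat.le_induction with
  | base => exact le_rfl
  | succ m h ih => exact (ih (by omega)).trans (g.trans m (by omega)).next_le

lemma Good.kind {J : ℕ} (g : E.Good J) {j j' : ℕ} (h : j ≤ j') (hJ : j' ≤ J) {n : Addr}
    (hn : n < (E.cfg j).mem.next) : (E.cfg j').mem.node n .kind = (E.cfg j).mem.node n .kind := by
  induction j', h using Nat.le_induction with
  | base => rfl
  | succ m h ih =>
    rw [(g.trans m (by omega)).kind n (hn.trans_le (g.next_mono h (by omega))), ih (by omega)]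

lemma Good.imm {J : ℕ} (g : E.Good J) {j j' : ℕ} (h : j ≤ j') (hJ : j' ≤ J) {n : Addr}
    (hn : n < (E.cfg j).mem.next) (hk : (E.cfg j).mem.node n .kind ≠ .leaf) :
    (E.cfg j').mem.node n .size = (E.cfg j).mem.node n .size ∧ ∀ i, (E.cfg j').mem.node n (.key i) = (E.cfg j).mem.node n (.key i) := by
  induction j', h using Nat.le_induction with
  | base => exact ⟨rfl, fun _ => rfl⟩
  | succ m h ih =>
    obtain ⟨h1, h2⟩ := ih (by omega)
    obtain ⟨h3, h4⟩ := (g.trans m (by omega)).imm n (hn.trans_le (g.next_mono h (by omega)))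
      (by rwa [g.kind h (by omega) hn])
    exact ⟨h3.trans h1, fun i => (h4 i).trans (h2 i)⟩

lemma Good.rch_lt {J : ℕ} (g : E.Good J) {j : ℕ} (hJ : j ≤ J) {n : Addr} (h : E.Rch j n) :
    n < (E.cfg j).mem.next := by
  obtain ⟨H, w⟩ := (g.inv j hJ).wf
  exact w.lt n h

lemma Good.ever_lt {J : ℕ} (g : E.Good J) {j : ℕ} (hJ : j ≤ J) {n : Addr} (h : E.Ever j n) :
    n < (E.cfg j).mem.next := by
  obtain ⟨m, hm, h⟩ := h
  exact (g.rch_lt (hm.trans hJ) h).trans_le (g.next_mono hm hJ)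

lemma Ever.mono {j j' : ℕ} {n : Addr} (h : E.Ever j n) (hj : j ≤ j') : E.Ever j' n := by
  obtain ⟨m, hm, h⟩ := h
  exact ⟨m, hm.trans hj, h⟩

lemma ever_of_rch {j : ℕ} {n : Addr} (h : E.Rch j n) : E.Ever j n := ⟨j, le_rfl, h⟩

/-- An unlinked node is never linked again. -/
lemma Good.not_rch {J : ℕ} (g : E.Good J) {j j' : ℕ} (h : j ≤ j') (hJ : j' ≤ J) {n : Addr}
    (he : E.Ever j n) (hn : ¬ E.Rch j n) : ¬ E.Rch j' n := by
  induction j', h using Nat.le_induction with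
  | base => exact hn
  | succ m h ih =>
    intro hr
    exact ((g.trans m (by omega)).link n hr (ih (by omega))).1 (he.mono h)

lemma Good.rch_between {J : ℕ} (g : E.Good J) {j m j' : ℕ} (h : j ≤ m) (h' : m ≤ j') (hJ : j' ≤ J)
    {n : Addr} (h1 : E.Ever j n) (h2 : E.Rch j' n) : E.Rch m n := by
  by_contra hc
  exact g.not_rch h' hJ (h1.mono h) hc h2

lemma Good.on_iff {J : ℕ} (g : E.Good J) {j j' : ℕ} (h : j ≤ j') (hJ : j' ≤ J) {n : Addr} {k : K}
    (h1 : E.Rch j n) (h2 : E.Rch j' n) : E.On j' k n ↔ E.On j k n := by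
  induction j', h using Nat.le_induction with
  | base => rfl
  | succ m h ih =>
    have hm := g.rch_between h (Nat.le_succ m) hJ (ever_of_rch h1) h2
    rw [(g.trans m (by omega)).range n hm h2, ih (by omega) hm]

/-- Apart from its marked bit, an unlinked node does not change. -/
lemma Good.frozen {J : ℕ} (g : E.Good J) {j j' : ℕ} (h : j ≤ j') (hJ : j' ≤ J) {n : Addr}
    (he : E.Ever j n) (hn : ¬ E.Rch j n) {f : Field} (hf : f ≠ .marked) :
    (E.cfg j').mem.node n f = (E.cfg j).mem.node n f := by
  induction j', h using Nat.le_induction with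
  | base => rfl
  | succ m h ih =>
    rw [← ih (by omega)]
    by_contra hc
    obtain ⟨t, -, -, -, hr⟩ := (g.trans m (by omega)).wr n
      ((g.ever_lt (by omega) he).trans_le (g.next_mono h (by omega))) f hc
    exact g.not_rch h (by omega) he hn (hr hf)

lemma exists_unlink {j j' : ℕ} (h : j ≤ j') {n : Addr} (h1 : E.Rch j n) (h2 : ¬ E.Rch j' n) :
    ∃ m, j ≤ m ∧ m < j' ∧ E.Rch m n ∧ ¬ E.Rch (m + 1) n := by
  induction j', h using Nat.le_induction with
  | base => exact absurd h1 h2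
  | succ m h ih =>
    by_cases hm : E.Rch m n
    · exact ⟨m, h, by omega, hm, h2⟩
    · obtain ⟨m', a1, a2, a3⟩ := ih hm
      exact ⟨m', a1, by omega, a3⟩

/-- A child pointer of a node in the tree does not change as long as the child is in the tree. -/
lemma Good.ptr_const {J : ℕ} (g : E.Good J) {j j' : ℕ} (h : j ≤ j') (hJ : j' ≤ J) {n c : Addr}
    {i : ℕ} (h1 : E.Rch j n) (hk : (E.cfg j).mem.node n .kind ≠ .leaf) (hc : (E.cfg j).mem.node n (.ptr i) = some c)
    (h2 : E.Rch j' n) (h3 : E.Rch j' c) : (E.cfg j').mem.node n (.ptr i) = some c := by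
  induction j', h using Nat.le_induction with
  | base => exact hc
  | succ m h ih =>
    have hce : E.Ever j c := by
      obtain ⟨H, w⟩ := (g.inv j (by omega)).wf
      exact ever_of_rch (h1.child (w.child_of_ptr h1 hk hc))
    have hm := g.rch_between h (Nat.le_succ m) hJ (ever_of_rch h1) h2
    have hmc := g.rch_between h (Nat.le_succ m) hJ hce h3
    by_contra hne
    exact (g.trans m (by omega)).ptr n i c hm (by rwa [g.kind h (by omega) (g.rch_lt (by omega) h1)])
      (ih (by omega) hm hmc) hne h3

lemma Good.ver_mono {J : ℕ} (g : E.Good J) {j j' : ℕ} (h : j ≤ j') (hJ : j' ≤ J) {n : Addr}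
    (hn : n < (E.cfg j).mem.next) : (E.cfg j).mem.node n .ver ≤ (E.cfg j').mem.node n .ver := by
  induction j', h using Nat.le_induction with
  | base => exact le_rfl
  | succ m h ih =>
    refine Nat.le_trans (ih (by omega)) ?_
    exact (g.trans m (by omega)).ver n (hn.trans_le (g.next_mono h (by omega)))

/-- A leaf does not change between two reads of the same even version. -/
lemma Good.leaf_const {J : ℕ} (g : E.Good J) {j m j' : ℕ} (h : j ≤ m) (h' : m ≤ j') (hJ : j' ≤ J)
    {l : Addr} (hn : l < (E.cfg j).mem.next) (hl : (E.cfg j).mem.node l .kind = .leaf)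
    (he : Even ((E.cfg j).mem.node l .ver)) (hv : (E.cfg j).mem.node l .ver = (E.cfg j').mem.node l .ver) {f : Field}
    (hf : f ≠ .marked) : (E.cfg m).mem.node l f = (E.cfg j).mem.node l f := by
  have hver : ∀ m, j ≤ m → m ≤ j' → (E.cfg m).mem.node l .ver = (E.cfg j).mem.node l .ver := fun m h h' =>
    le_antisymm (hv ▸ g.ver_mono h' hJ (hn.trans_le (g.next_mono h (by omega))))
      (g.ver_mono h (by omega) hn)
  induction m, h using Nat.le_induction with
  | base => rfl
  | succ m h ih =>
    rw [← ih (by omega)]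
    by_cases hfv : f = .ver
    · subst hfv
      rw [hver m h (by omega), hver (m + 1) (by omega) h']
    · by_contra hc
      refine (g.trans m (by omega)).leafwr l (hn.trans_le (g.next_mono h (by omega)))
        (by rwa [g.kind h (by omega) hn]) f hfv hf hc ?_
      rwa [hver m h (by omega)]

/-- If the node was on the search path of `k` and its child pointer for `k` is read later, then the
child was on the search path in between: if the node has been unlinked since, the pointer was the
same then. -/
lemma Good.on_child {J : ℕ} (g : E.Good J) {m j : ℕ} (h : m ≤ j) (hJ : j ≤ J) {k : K} {n c : Addr}
    {ks : List K} {cs : List Addr} (hon : E.On m k n) (hi : IsInternal ((E.cfg m).mem.node n) ks cs)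
    (hc : (E.cfg j).mem.node n (.ptr (idx ks k)) = some c) : ∃ m', m ≤ m' ∧ m' ≤ j ∧ E.On m' k c := by
  have key : ∀ m', m ≤ m' → m' ≤ J → E.Rch m' n → (E.cfg m').mem.node n (.ptr (idx ks k)) = some c →
      E.On m' k c := by
    intro m' h1 h2 hr hc
    obtain ⟨H, w⟩ := (g.inv m' h2).wf
    have hlt := g.rch_lt (by omega) hon.reachable
    obtain ⟨ks', cs', hi', -⟩ := w.shape n hr (by rw [g.kind h1 h2 hlt]; exact hi.kind_ne)
    obtain rfl : ks = ks' := List.ext_getElem? fun i => by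
      rw [← hi.key_eq, ← hi'.key_eq, (g.imm h1 h2 hlt hi.kind_ne).2]
    rw [hi'.ptr_eq] at hc
    exact ((g.on_iff h1 h2 hon.reachable hr).2 hon).next ⟨ks, cs', hi', hc⟩
  by_cases hr : E.Rch j n
  · exact ⟨j, h, le_rfl, key j h hJ hr hc⟩
  · obtain ⟨m', h1, h2, h3, h4⟩ := exists_unlink h hon.reachable hr
    refine ⟨m', h1, by omega, key m' h1 (by omega) h3 ?_⟩
    rw [← hc, g.frozen h2 hJ ((ever_of_rch h3).mono (by omega)) h4 (by simp),
      ((g.trans m' (by omega)).unlink n h3 h4).1]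

lemma Good.allocBy_unique {J : ℕ} (g : E.Good J) {t t' : T} {j : ℕ} (hJ : j ≤ J) {n : Addr}
    (h : E.AllocBy t j n) (h' : E.AllocBy t' j n) : t = t' := by
  obtain ⟨ja, h1, h2, h3, h4⟩ := h
  obtain ⟨ja', h1', h2', h3', h4'⟩ := h'
  obtain rfl : ja = ja' := by
    rcases lt_trichotomy ja ja' with hlt | rfl | hlt
    · have := g.next_mono (j := ja + 1) (j' := ja') hlt (by omega)
      rw [h4, h3'] at this
      exact absurd this (Nat.not_succ_le_self n)
    · rfl
    · have := g.next_mono (j := ja' + 1) (j' := ja) hlt (by omega)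
      rw [h4', h3] at this
      exact absurd this (Nat.not_succ_le_self n)
  rw [h2] at h2'
  exact Action.internal.inj h2'

lemma AllocBy.mono {t : T} {j j' : ℕ} {n : Addr} (h : E.AllocBy t j n) (hj : j ≤ j') :
    E.AllocBy t j' n := by
  obtain ⟨ja, h1, h2⟩ := h
  exact ⟨ja, h1.trans_le hj, h2⟩

end Execution

end OCC

namespace OCC

namespace Execution

variable {K V T : Type} [LinearOrder K] [DecidableEq T] {a b : ℕ} {E : Execution K V T a b}

/-! ### Steps -/

lemma step_internal {j : ℕ} {t : T} (h : E.act j = .internal t) : ∃ q q',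
    (E.cfg j).thread t = some q ∧ ProgStep a b t (E.cfg j).mem q (E.cfg (j + 1)).mem q' ∧
    (E.cfg (j + 1)).thread = Function.update (E.cfg j).thread t (some q') := by
  have hs := E.step j
  rw [h] at hs
  generalize E.cfg (j + 1) = c' at hs ⊢
  cases hs with
  | internal t q q' m' h1 h2 => exact ⟨q, q', h1, h2, rfl⟩

lemma mem_eq_of_not_internal {j : ℕ} (h : ∀ t, E.act j ≠ .internal t) :
    (E.cfg (j + 1)).mem = (E.cfg j).mem := by
  have hs := E.step j
  generalize hc : E.cfg (j + 1) = c' at hs ⊢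
  generalize ha : E.act j = α at hs h
  cases hs with
  | internal t => exact absurd rfl (h t)
  | _ => rfl

lemma thread_ne_none {o : T × ℕ} {op : Op K V} (hi : E.Invokes o op) {j : ℕ}
    (hp : E.InProgress o j) : (E.cfg j).thread o.1 ≠ none := by
  obtain ⟨hlt, hp⟩ := hp
  induction j, hlt using Nat.le_induction with
  | base =>
    have hs := E.step o.2
    unfold Invokes at hi
    rw [hi] at hs
    generalize E.cfg (o.2 + 1) = c' at hs ⊢
    cases hs
    simp
  | succ m hm ih =>
    have ih := ih fun m' h1 h2 => hp m' h1 (by omega)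
    have hr := hp m hm (by omega)
    have hs := E.step m
    generalize E.cfg (m + 1) = c' at hs ⊢
    generalize E.act m = α at hs hr
    cases hs with
    | invoke t o' idle =>
      by_cases ht : o.1 = t
      · subst ht
        simp
      · simpa [Function.update_of_ne ht] using ih
    | respond t res h =>
      have ht : o.1 ≠ t := by
        rintro rfl
        exact hr res rfl
      simpa [Function.update_of_ne ht] using ih
    | internal t q q' m' h h' =>
      by_cases ht : o.1 = t
      · subst ht
        simp
      · simpa [Function.update_of_ne ht] using ih
    | stutter => exact ih

lemma inst_unique {o o' : T × ℕ} {op op' : Op K V} (hi : E.Invokes o op) (hi' : E.Invokes o' op')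
    {j : ℕ} (hp : E.InProgress o j) (hp' : E.InProgress o' j) (ht : o.1 = o'.1) :
    o = o' ∧ op = op' := by
  have key : ∀ {o o' : T × ℕ} {op op' : Op K V}, E.Invokes o op → E.Invokes o' op' →
      E.InProgress o j → E.InProgress o' j → o.1 = o'.1 → ¬ o.2 < o'.2 := by
    intro o o' op op' hi hi' hp hp' ht hlt
    refine thread_ne_none hi ⟨hlt, fun m h1 h2 => hp.2 m h1 (h2.trans hp'.1)⟩ ?_
    have hs := E.step o'.2
    unfold Invokes at hi'
    rw [hi'] at hs
    generalize E.cfg (o'.2 + 1) = c' at hs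
    cases hs
    rwa [ht]
  have he : o = o' := Prod.ext ht (le_antisymm (not_lt.1 (key hi' hi hp' hp ht.symm))
    (not_lt.1 (key hi hi' hp hp' ht)))
  subst he
  refine ⟨rfl, ?_⟩
  unfold Invokes at hi hi'
  rw [hi] at hi'
  exact (Action.invoke.inj hi').2

lemma UpdatePoint.writes {o : T × ℕ} {j : ℕ} {op : Op K V} (h : E.UpdatePoint o j op) :
    E.InProgress o j ∧ ((∃ l, E.Writes o.1 j l .ver) ∨ E.ReplacesLeaf o j) := by
  cases op with
  | find => exact h.elim
  | insert k v =>
    rcases h with ⟨h1, l, h2, -⟩ | h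
    · exact ⟨h1, .inl ⟨l, h2⟩⟩
    · exact ⟨h.1, .inr h⟩
  | delete k =>
    obtain ⟨h1, l, h2, -⟩ := h
    exact ⟨h1, .inl ⟨l, h2⟩⟩

lemma UpdatePoint.exists_write {o : T × ℕ} {j : ℕ} {op : Op K V} (h : E.UpdatePoint o j op) :
    E.act j = .internal o.1 ∧ ∃ n f x nx, (E.cfg j).thread o.1 = some (.write n f x nx) ∧
      (f = .ver ∨ ∃ i, f = .ptr i) := by
  rcases h.writes.2 with ⟨l, h1, x, nx, h2⟩ | ⟨-, p, i, l, ⟨h1, x, nx, h2⟩, -⟩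
  · exact ⟨h1, _, _, _, _, h2, .inl rfl⟩
  · exact ⟨h1, _, _, _, _, h2, .inr ⟨_, rfl⟩⟩

lemma updOK_of_not {j : ℕ} (hn : ∀ o op, E.Invokes o op → ¬ E.UpdatePoint o j op)
    (hd : E.dict (j + 1) = E.dict j) : E.UpdOK j :=
  ⟨fun o op hi h => absurd h (hn o op hi), fun _ => hd⟩

lemma updOK_of_point {j : ℕ} {o : T × ℕ} {op : Op K V} (hi : E.Invokes o op)
    (hu : E.UpdatePoint o j op) (hd : E.dict (j + 1) = (op.apply (E.dict j)).1)
    (hne : E.dict (j + 1) ≠ E.dict j) (hno : ∀ u < j, ¬ E.UpdatePoint o u op) : E.UpdOK j := by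
  refine ⟨fun o' op' hi' hu' => ?_, fun h => absurd ⟨o, op, hi, hu⟩ h⟩
  have h1 := hu.exists_write.1
  have h2 := hu'.exists_write.1
  rw [h1] at h2
  obtain ⟨rfl, rfl⟩ := inst_unique hi hi' hu.writes.1 hu'.writes.1 (Action.internal.inj h2)
  exact ⟨hd, hne, hno⟩

/-! ### Steps that leave the tree structure as it is -/

/-- A step after which the tree has the same nodes, routing keys and child pointers. -/
lemma stepOK_core {j : ℕ} (g : E.Good j) (hs : SameStruct (E.cfg j).mem (E.cfg (j + 1)).mem)
    (next_le : (E.cfg j).mem.next ≤ (E.cfg (j + 1)).mem.next)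
    (kind : ∀ n < (E.cfg j).mem.next, (E.cfg (j + 1)).mem.node n .kind = (E.cfg j).mem.node n .kind)
    (imm : ∀ n < (E.cfg j).mem.next, (E.cfg j).mem.node n .kind ≠ .leaf →
      (E.cfg (j + 1)).mem.node n .size = (E.cfg j).mem.node n .size ∧ ∀ i, (E.cfg (j + 1)).mem.node n (.key i) = (E.cfg j).mem.node n (.key i))
    (wr : ∀ n < (E.cfg j).mem.next, ∀ f, (E.cfg (j + 1)).mem.node n f ≠ (E.cfg j).mem.node n f → ∃ t,
      E.act j = .internal t ∧ (E.cfg j).mem.lock n = some t ∧ E.Ever j n ∧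
      (f ≠ .marked → E.Rch j n))
    (leafwr : ∀ n < (E.cfg j).mem.next, (E.cfg j).mem.node n .kind = .leaf → ∀ f, f ≠ .ver → f ≠ .marked →
      (E.cfg (j + 1)).mem.node n f ≠ (E.cfg j).mem.node n f → ¬ Even ((E.cfg j).mem.node n .ver))
    (ver : ∀ n < (E.cfg j).mem.next, (E.cfg j).mem.node n .ver ≤ (E.cfg (j + 1)).mem.node n .ver)
    (lock : ∀ n, (E.cfg (j + 1)).mem.lock n = (E.cfg j).mem.lock n ∨ ∃ t, E.act j = .internal t ∧
      (((E.cfg j).mem.lock n = none ∧ (E.cfg (j + 1)).mem.lock n = some t) ∨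
        ((E.cfg j).mem.lock n = some t ∧ (E.cfg (j + 1)).mem.lock n = none)))
    (leaf : ∀ l < (E.cfg (j + 1)).mem.next, (E.cfg (j + 1)).mem.node l .kind = .leaf →
      Even ((E.cfg (j + 1)).mem.node l .ver) → LeafOK b ((E.cfg (j + 1)).mem.node l))
    (keys : ∀ l k v, E.Rch j l → (E.cfg j).mem.node l .kind = .leaf → E.LE (j + 1) l k v → E.On j k l)
    (func : ∀ l k v v', E.Rch j l → (E.cfg j).mem.node l .kind = .leaf → E.LE (j + 1) l k v →
      E.LE (j + 1) l k v' → v = v')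
    (free : ∀ n < (E.cfg (j + 1)).mem.next, (E.cfg (j + 1)).mem.lock n = none →
      Even ((E.cfg (j + 1)).mem.node n .ver) ∧ (E.Ever j n → ¬ E.Rch j n → (E.cfg (j + 1)).mem.node n .marked = true))
    (upd : E.Inv (j + 1) → E.UpdOK j) : E.StepOK j := by
  obtain ⟨H, w⟩ := g.self.wf
  have hk : ∀ {n}, E.Rch (j + 1) n → (E.cfg (j + 1)).mem.node n .kind = (E.cfg j).mem.node n .kind := fun h =>
    (hs _ (hs.reach_iff.1 h)).1
  have hi : E.Inv (j + 1) := by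
    refine ⟨⟨H, hs.wf next_le w⟩, leaf, fun l k v hr hl h => ?_, fun l k v v' hr hl => ?_,
      fun n hn hl => ?_⟩
    · exact hs.onPath_iff.2 (keys l k v (hs.reach_iff.1 hr) ((hk hr).symm.trans hl) h)
    · exact func l k v v' (hs.reach_iff.1 hr) ((hk hr).symm.trans hl)
    · obtain ⟨h1, h2⟩ := free n hn hl
      refine ⟨h1, fun ⟨m, hm, he⟩ hnr => ?_⟩
      have hnr' : ¬ E.Rch j n := fun h => hnr (hs.reach_iff.2 h)
      rcases Nat.lt_or_eq_of_le hm with h' | rfl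
      · exact h2 ⟨m, by omega, he⟩ hnr'
      · exact absurd he hnr
  refine ⟨hi, ⟨next_le, kind, imm, wr, leafwr, ver, lock, fun n h1 h2 => ?_, fun n h1 h2 => ?_,
    fun n h1 h2 k => hs.onPath_iff, fun n i c h1 h2 h3 h4 => ?_⟩, upd hi⟩
  · exact absurd (hs.reach_iff.2 h1) h2
  · exact absurd (hs.reach_iff.1 h1) h2
  · rw [((hs n h1).2 h2).2.2] at h4
    exact absurd h3 h4

/-- Steps that change no existing node. -/
lemma stepOK_nodes {j : ℕ} (g : E.Good j)
    (next_le : (E.cfg j).mem.next ≤ (E.cfg (j + 1)).mem.next)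
    (node : ∀ n < (E.cfg j).mem.next, (E.cfg (j + 1)).mem.node n = (E.cfg j).mem.node n)
    (new : ∀ n < (E.cfg (j + 1)).mem.next, (E.cfg j).mem.next ≤ n →
      Even ((E.cfg (j + 1)).mem.node n .ver) ∧ ((E.cfg (j + 1)).mem.node n .kind = .leaf → LeafOK b ((E.cfg (j + 1)).mem.node n)))
    (lock : ∀ n, (E.cfg (j + 1)).mem.lock n = (E.cfg j).mem.lock n ∨ ∃ t, E.act j = .internal t ∧
      (((E.cfg j).mem.lock n = none ∧ (E.cfg (j + 1)).mem.lock n = some t) ∨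
        ((E.cfg j).mem.lock n = some t ∧ (E.cfg (j + 1)).mem.lock n = none)))
    (free : ∀ n < (E.cfg j).mem.next, (E.cfg (j + 1)).mem.lock n = none →
      (E.cfg j).mem.lock n = none ∨
      Even ((E.cfg j).mem.node n .ver) ∧ (E.Ever j n → ¬ E.Rch j n → (E.cfg j).mem.node n .marked = true))
    (upd : ∀ o op, ¬ E.UpdatePoint o j op) : E.StepOK j := by
  have hlt : ∀ {n}, E.Rch j n → n < (E.cfg j).mem.next := fun h => g.rch_lt le_rfl h
  have hLE : ∀ {l k v}, E.Rch j l → (E.LE (j + 1) l k v ↔ E.LE j l k v) := fun h => by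
    have := node _ (hlt h)
    exact le_same (by rw [this]) (by simp [this]) (by simp [this])
  have hs : SameStruct (E.cfg j).mem (E.cfg (j + 1)).mem := fun n hn => by
    simp [node n (hlt hn)]
  refine stepOK_core g hs next_le (fun n hn => by rw [node n hn])
    (fun n hn _ => by simp [node n hn]) (fun n hn f h => absurd (by rw [node n hn]) h)
    (fun n hn _ f _ _ h => absurd (by rw [node n hn]) h) (fun n hn => by rw [node n hn]) lock ?_ ?_
    ?_ ?_ ?_
  · intro l hl hk he
    rcases lt_or_ge l (E.cfg j).mem.next with h | h
    · rw [node l h] at hk he ⊢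
      exact g.self.leaf l h hk he
    · exact (new l hl h).2 hk
  · intro l k v hr hl h
    exact g.self.keys l k v hr hl ((hLE hr).1 h)
  · intro l k v v' hr hl h h'
    exact g.self.func l k v v' hr hl ((hLE hr).1 h) ((hLE hr).1 h')
  · intro n hn hl
    rcases lt_or_ge n (E.cfg j).mem.next with h | h
    · rw [node n h]
      rcases free n h hl with h' | h'
      · exact g.self.free n h h'
      · exact h'
    · exact ⟨(new n hn h).1, fun he => absurd (g.ever_lt le_rfl he) (not_lt.2 h)⟩
  · intro hi
    refine updOK_of_not (fun o op _ => upd o op) (dict_congr g.self hi fun k v => ?_)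
    simp only [inTree_iff]
    refine exists_congr fun l => ?_
    constructor
    · rintro ⟨h1, h2, h3⟩
      have h1' := hs.reach_iff.1 h1
      rw [node l (hlt h1')] at h2
      exact ⟨h1', h2, (hLE h1').1 h3⟩
    · rintro ⟨h1, h2, h3⟩
      rw [← node l (hlt h1)] at h2
      exact ⟨hs.reach_iff.2 h1, h2, (hLE h1).2 h3⟩

lemma stepOK_same {j : ℕ} (g : E.Good j) (hm : (E.cfg (j + 1)).mem = (E.cfg j).mem)
    (upd : ∀ o op, ¬ E.UpdatePoint o j op) : E.StepOK j :=
  stepOK_nodes g (by rw [hm]) (fun n _ => by rw [hm])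
    (fun n h1 h2 => by rw [hm] at h1; exact absurd h1 (not_lt.2 h2))
    (fun n => .inl (by rw [hm])) (fun n _ h => .inl (by rwa [hm] at h)) upd

/-! ### Writes to a field of a locked node -/

/-- In step `j`, the thread writes `x` to the field `f` of the node `n`. -/
def WriteStep (E : Execution K V T a b) (t : T) (j : ℕ) (n : Addr) (f : Field) (x : f.Ty K V) :
    Prop :=
  E.act j = .internal t ∧ (∃ nx, (E.cfg j).thread t = some (.write n f x nx)) ∧
  (E.cfg (j + 1)).mem = { (E.cfg j).mem with
    node := Function.update (E.cfg j).mem.node n (Function.update ((E.cfg j).mem.node n) f x) }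

lemma WriteStep.node {t : T} {j : ℕ} {n : Addr} {f : Field} {x : f.Ty K V}
    (h : WriteStep E t j n f x) : (E.cfg (j + 1)).mem.node n = Function.update ((E.cfg j).mem.node n) f x := by
  rw [h.2.2]
  simp

lemma WriteStep.node_ne {t : T} {j : ℕ} {n n' : Addr} {f : Field} {x : f.Ty K V}
    (h : WriteStep E t j n f x) (hn : n' ≠ n) : (E.cfg (j + 1)).mem.node n' = (E.cfg j).mem.node n' := by
  rw [h.2.2]
  simp [hn]

lemma WriteStep.lock {t : T} {j : ℕ} {n : Addr} {f : Field} {x : f.Ty K V}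
    (h : WriteStep E t j n f x) : (E.cfg (j + 1)).mem.lock = (E.cfg j).mem.lock := by
  rw [h.2.2]

lemma WriteStep.next {t : T} {j : ℕ} {n : Addr} {f : Field} {x : f.Ty K V}
    (h : WriteStep E t j n f x) : (E.cfg (j + 1)).mem.next = (E.cfg j).mem.next := by
  rw [h.2.2]

lemma WriteStep.field_ne {t : T} {j : ℕ} {n n' : Addr} {f f' : Field} {x : f.Ty K V}
    (h : WriteStep E t j n f x) (hn : n' ≠ n ∨ f' ≠ f) : (E.cfg (j + 1)).mem.node n' f' = (E.cfg j).mem.node n' f' := by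
  by_cases hn' : n' = n
  · subst hn'
    rw [h.node, Function.update_of_ne (by tauto)]
  · rw [h.node_ne hn']

lemma WriteStep.writes {t t' : T} {j : ℕ} {n n' : Addr} {f f' : Field} {x : f.Ty K V}
    (h : WriteStep E t j n f x) (h' : E.Writes t' j n' f') : t' = t ∧ n' = n ∧ f' = f := by
  obtain ⟨h1, ⟨nx, h2⟩, -⟩ := h
  obtain ⟨h1', x', nx', h2'⟩ := h'
  rw [h1] at h1'
  obtain rfl := Action.internal.inj h1'
  rw [h2] at h2'
  have := Option.some.inj h2'
  cases this
  exact ⟨rfl, rfl, rfl⟩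

lemma WriteStep.not_updatePoint {t : T} {j : ℕ} {n : Addr} {f : Field} {x : f.Ty K V}
    (h : WriteStep E t j n f x) (hv : f ≠ .ver) (hp : ∀ i, f ≠ .ptr i) (o : T × ℕ) (op : Op K V) :
    ¬ E.UpdatePoint o j op := by
  intro hu
  rcases hu.writes.2 with ⟨l, hw⟩ | ⟨-, p, i, l, hw, -⟩
  · exact hv (h.writes hw).2.2.symm
  · exact hp i (h.writes hw).2.2.symm

/-- A write to a locked leaf, or to a marked bit. -/
lemma stepOK_write {j : ℕ} (g : E.Good j) {t : T} {n : Addr} {f : Field} {x : f.Ty K V}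
    (hw : WriteStep E t j n f x) (hlock : (E.cfg j).mem.lock n = some t) (hever : E.Ever j n)
    (hf : f = .marked ∨ (E.Rch j n ∧ (E.cfg j).mem.node n .kind = .leaf ∧ f ≠ .kind ∧
      (f ≠ .ver → ¬ Even ((E.cfg j).mem.node n .ver))))
    (hver : (E.cfg j).mem.node n .ver ≤ (E.cfg (j + 1)).mem.node n .ver)
    (hleaf : (E.cfg j).mem.node n .kind = .leaf → Even ((E.cfg (j + 1)).mem.node n .ver) → LeafOK b ((E.cfg (j + 1)).mem.node n))
    (hkeys : ∀ k v, E.Rch j n → (E.cfg j).mem.node n .kind = .leaf → E.LE (j + 1) n k v → E.On j k n)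
    (hfunc : ∀ k v v', E.Rch j n → (E.cfg j).mem.node n .kind = .leaf → E.LE (j + 1) n k v →
      E.LE (j + 1) n k v' → v = v')
    (upd : E.Inv (j + 1) → E.UpdOK j) :
    SameStruct (E.cfg j).mem (E.cfg (j + 1)).mem ∧ E.StepOK j := by
  have hnext := hw.next
  have hLE : ∀ {l k v}, l ≠ n → (E.LE (j + 1) l k v ↔ E.LE j l k v) := fun h =>
    le_same (by rw [hw.node_ne h]) (by simp [hw.node_ne h]) (by simp [hw.node_ne h])
  have hkind : ∀ m, (E.cfg (j + 1)).mem.node m .kind = (E.cfg j).mem.node m .kind := fun m =>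
    hw.field_ne (.inr (by rcases hf with rfl | h; exacts [by simp, fun e => h.2.2.1 e.symm]))
  have hint : ∀ m, (E.cfg j).mem.node m .kind ≠ .leaf → ∀ f', f' ≠ .marked → (E.cfg (j + 1)).mem.node m f' = (E.cfg j).mem.node m f' := by
    intro m hm f' hf'
    refine hw.field_ne ?_
    by_cases hmn : m = n
    · subst hmn
      rcases hf with rfl | h
      · exact .inr hf'
      · exact absurd h.2.1 hm
    · exact .inl hmn
  have hs : SameStruct (E.cfg j).mem (E.cfg (j + 1)).mem := fun m hm =>
    ⟨hkind m, fun hk => ⟨hint m hk _ (by simp), fun i => hint m hk _ (by simp),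
      fun i => hint m hk _ (by simp)⟩⟩
  refine ⟨hs, stepOK_core g hs hnext.ge (fun m _ => hkind m)
    (fun m _ hk => ⟨hint m hk _ (by simp), fun i => hint m hk _ (by simp)⟩) ?_ ?_ ?_
    (fun m => .inl (by rw [hw.lock])) ?_ ?_ ?_ ?_ upd⟩
  · intro m hm f' hne
    have : m = n ∧ f' = f := by
      by_contra hc
      exact hne (hw.field_ne (by tauto))
    obtain ⟨rfl, rfl⟩ := this
    refine ⟨t, hw.1, hlock, hever, fun hm => ?_⟩
    rcases hf with h | h
    · exact absurd h hm
    · exact h.1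
  · intro m hm hk f' h1 h2 hne
    have : m = n ∧ f' = f := by
      by_contra hc
      exact hne (hw.field_ne (by tauto))
    obtain ⟨rfl, rfl⟩ := this
    rcases hf with h | h
    · exact absurd h h2
    · exact h.2.2.2 h1
  · intro m hm
    by_cases h : m = n
    · subst h
      exact hver
    · rw [hw.node_ne h]
  · intro l hl hk he
    rw [hkind] at hk
    by_cases h : l = n
    · subst h
      exact hleaf hk he
    · rw [hw.node_ne h] at he ⊢
      exact g.self.leaf l (by rwa [hnext] at hl) hk he
  · intro l k v hr hl h
    by_cases hn : l = n
    · subst hn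
      exact hkeys k v hr hl h
    · exact g.self.keys l k v hr hl ((hLE hn).1 h)
  · intro l k v v' hr hl h h'
    by_cases hn : l = n
    · subst hn
      exact hfunc k v v' hr hl h h'
    · exact g.self.func l k v v' hr hl ((hLE hn).1 h) ((hLE hn).1 h')
  · intro m hm hl
    rw [hw.lock] at hl
    have : m ≠ n := by
      rintro rfl
      rw [hlock] at hl
      exact absurd hl (by simp)
    rw [hw.node_ne this]
    exact g.self.free m (by rwa [hnext] at hm) hl

/-- Writes that do not change which pairs a leaf is considered to hold. -/
lemma stepOK_write_same {j : ℕ} (g : E.Good j) {t : T} {n : Addr} {f : Field} {x : f.Ty K V}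
    (hw : WriteStep E t j n f x) (hlock : (E.cfg j).mem.lock n = some t) (hever : E.Ever j n)
    (hf : f = .marked ∨ (E.Rch j n ∧ (E.cfg j).mem.node n .kind = .leaf ∧ f ≠ .kind ∧
      (f ≠ .ver → ¬ Even ((E.cfg j).mem.node n .ver))))
    (hver : (E.cfg j).mem.node n .ver ≤ (E.cfg (j + 1)).mem.node n .ver)
    (hleaf : (E.cfg j).mem.node n .kind = .leaf → Even ((E.cfg (j + 1)).mem.node n .ver) → LeafOK b ((E.cfg (j + 1)).mem.node n))
    (hLE : ∀ k v, E.LE (j + 1) n k v ↔ E.LE j n k v) (upd : ∀ o op, E.Invokes o op → ¬ E.UpdatePoint o j op) :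
    SameStruct (E.cfg j).mem (E.cfg (j + 1)).mem ∧ E.StepOK j := by
  have hkind : ∀ m, (E.cfg (j + 1)).mem.node m .kind = (E.cfg j).mem.node m .kind := fun m =>
    hw.field_ne (.inr (by rcases hf with rfl | h; exacts [by simp, fun e => h.2.2.1 e.symm]))
  have hLE' : ∀ {l k v}, E.LE (j + 1) l k v ↔ E.LE j l k v := by
    intro l k v
    by_cases h : l = n
    · subst h
      exact hLE k v
    · exact le_same (by rw [hw.node_ne h]) (by simp [hw.node_ne h]) (by simp [hw.node_ne h])
  have hs : SameStruct (E.cfg j).mem (E.cfg (j + 1)).mem := by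
    intro m hm
    refine ⟨hkind m, fun hk => ?_⟩
    have : ∀ f', f' ≠ .marked → (E.cfg (j + 1)).mem.node m f' = (E.cfg j).mem.node m f' := by
      intro f' hf'
      refine hw.field_ne ?_
      by_cases hmn : m = n
      · subst hmn
        rcases hf with rfl | h
        · exact .inr hf'
        · exact absurd h.2.1 hk
      · exact .inl hmn
    exact ⟨this _ (by simp), fun i => this _ (by simp), fun i => this _ (by simp)⟩
  refine stepOK_write g hw hlock hever hf hver hleaf
    (fun k v hr hl h => g.self.keys n k v hr hl (hLE'.1 h))
    (fun k v v' hr hl h h' => g.self.func n k v v' hr hl (hLE'.1 h) (hLE'.1 h')) fun hi => ?_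
  refine updOK_of_not upd (dict_congr g.self hi fun k v => ?_)
  simp only [inTree_iff, hs.reach_iff, hkind, hLE']

/-- Marking a node. -/
lemma stepOK_mark {j : ℕ} (g : E.Good j) {t : T} {n : Addr}
    (hw : WriteStep E t j n .marked true) (hlock : (E.cfg j).mem.lock n = some t)
    (hever : E.Ever j n) : SameStruct (E.cfg j).mem (E.cfg (j + 1)).mem ∧ E.StepOK j := by
  have hne : ∀ f', f' ≠ .marked → (E.cfg (j + 1)).mem.node n f' = (E.cfg j).mem.node n f' := fun f' h =>
    hw.field_ne (.inr h)
  refine stepOK_write_same g hw hlock hever (.inl rfl) (hne _ (by simp)).ge ?_ ?_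
    (fun o op _ => hw.not_updatePoint (by simp) (by simp) o op)
  · intro hk he
    rw [hne _ (by simp)] at he
    obtain ⟨h1, h2, h3⟩ := g.self.leaf n (g.ever_lt le_rfl hever) hk he
    refine ⟨?_, ?_, ?_⟩ <;> simpa only [hne _ (by simp : Field.key _ ≠ .marked),
      hne _ (by simp : Field.val _ ≠ .marked), hne _ (by simp : Field.size ≠ .marked)]
  · intro k v
    exact le_same (hne _ (by simp)) (fun i => hne _ (by simp)) fun i => hne _ (by simp)

/-- Changing a slot or the size of a leaf while its version is odd. -/
lemma stepOK_slot {j : ℕ} (g : E.Good j) {t : T} {n : Addr} {f : Field} {x : f.Ty K V}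
    (hw : WriteStep E t j n f x) (hlock : (E.cfg j).mem.lock n = some t) (hr : E.Rch j n)
    (hk : (E.cfg j).mem.node n .kind = .leaf) (hf : f = .size ∨ (∃ i, f = .key i) ∨ ∃ i, f = .val i)
    (hodd : ¬ Even ((E.cfg j).mem.node n .ver)) :
    SameStruct (E.cfg j).mem (E.cfg (j + 1)).mem ∧ E.StepOK j ∧
      ∀ k v, E.LE (j + 1) n k v ↔ E.LE j n k v := by
  have hf' : f ≠ .ver ∧ f ≠ .kind ∧ ∀ i, f ≠ .ptr i := by
    rcases hf with rfl | ⟨i, rfl⟩ | ⟨i, rfl⟩ <;> simp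
  have hv : (E.cfg (j + 1)).mem.node n .ver = (E.cfg j).mem.node n .ver := hw.field_ne (.inr hf'.1.symm)
  have hLE : ∀ k v, E.LE (j + 1) n k v ↔ E.LE j n k v := fun k v => le_odd (by rwa [hv])
  obtain ⟨h1, h2⟩ := stepOK_write_same g hw hlock (ever_of_rch hr)
    (.inr ⟨hr, hk, hf'.2.1, fun _ => hodd⟩) hv.ge (fun _ he => absurd (hv ▸ he) hodd) hLE
    (fun o op _ => hw.not_updatePoint hf'.1 hf'.2.2 o op)
  exact ⟨h1, h2, hLE⟩

/-- The first increment of a version. -/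
lemma stepOK_ver_odd {j : ℕ} (g : E.Good j) {t : T} {n : Addr}
    (hw : WriteStep E t j n .ver (((E.cfg j).mem.node n .ver + 1 : ℕ)))
    (hlock : (E.cfg j).mem.lock n = some t) (hr : E.Rch j n) (hk : (E.cfg j).mem.node n .kind = .leaf)
    (he : Even ((E.cfg j).mem.node n .ver)) (upd : ∀ o op, E.Invokes o op → ¬ E.UpdatePoint o j op) :
    SameStruct (E.cfg j).mem (E.cfg (j + 1)).mem ∧ E.StepOK j ∧
      ∀ k v, E.LE (j + 1) n k v ↔ E.LE j n k v := by
  have hv : (E.cfg (j + 1)).mem.node n .ver = ((E.cfg j).mem.node n .ver + 1 : ℕ) := by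
    rw [hw.node, Function.update_self]
  have ho : ¬ Even ((E.cfg (j + 1)).mem.node n .ver) := by
    rw [hv, Nat.even_add_one]
    exact not_not.2 he
  have hLE : ∀ k v, E.LE (j + 1) n k v ↔ E.LE j n k v := fun k v => le_odd ho
  obtain ⟨h1, h2⟩ := stepOK_write_same g hw hlock (ever_of_rch hr)
    (.inr ⟨hr, hk, by simp, fun h => absurd rfl h⟩) (hv ▸ Nat.le_succ _)
    (fun _ h => absurd h ho) hLE upd
  exact ⟨h1, h2, hLE⟩

/-- The second increment of a version changes the entry of one key in the dictionary. -/
lemma stepOK_ver_even {j : ℕ} (g : E.Good j) {t : T} {n : Addr}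
    (hw : WriteStep E t j n .ver (((E.cfg j).mem.node n .ver + 1 : ℕ)))
    (hlock : (E.cfg j).mem.lock n = some t) (hr : E.Rch j n) (hk : (E.cfg j).mem.node n .kind = .leaf)
    (ho : ¬ Even ((E.cfg j).mem.node n .ver)) (hleaf : LeafOK b ((E.cfg j).mem.node n)) {k₀ : K} {r : Option V}
    (hk₀ : E.On j k₀ n)
    (hslot : ∀ k v, SlotHas b ((E.cfg j).mem.node n) k v ↔ if k = k₀ then r = some v else E.LE j n k v)
    (upd : E.dict (j + 1) = Function.update (E.dict j) k₀ r → E.UpdOK j) :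
    SameStruct (E.cfg j).mem (E.cfg (j + 1)).mem ∧ E.StepOK j := by
  have hv : (E.cfg (j + 1)).mem.node n .ver = ((E.cfg j).mem.node n .ver + 1 : ℕ) := by
    rw [hw.node, Function.update_self]
  have hne : ∀ f', f' ≠ .ver → (E.cfg (j + 1)).mem.node n f' = (E.cfg j).mem.node n f' := fun f' h =>
    hw.field_ne (.inr h)
  have he : Even ((E.cfg (j + 1)).mem.node n .ver) := by
    rw [hv, Nat.even_add_one]
    exact ho
  have hleaf' : LeafOK b ((E.cfg (j + 1)).mem.node n) := by
    obtain ⟨h1, h2, h3⟩ := hleaf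
    refine ⟨?_, ?_, ?_⟩ <;> simpa only [hne _ (by simp : Field.key _ ≠ .ver),
      hne _ (by simp : Field.val _ ≠ .ver), hne _ (by simp : Field.size ≠ .ver)]
  have hsl : ∀ k v, SlotHas b ((E.cfg (j + 1)).mem.node n) k v ↔ SlotHas b ((E.cfg j).mem.node n) k v := fun k v => by
    simp only [SlotHas, hne _ (by simp : Field.key _ ≠ .ver),
      hne _ (by simp : Field.val _ ≠ .ver)]
  have hLE : ∀ k v, E.LE (j + 1) n k v ↔ if k = k₀ then r = some v else E.LE j n k v :=
    fun k v => by rw [le_even he, hsl, hslot]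
  have hLE' : ∀ {l k v}, l ≠ n → (E.LE (j + 1) l k v ↔ E.LE j l k v) := fun h =>
    le_same (by rw [hw.node_ne h]) (by simp [hw.node_ne h]) (by simp [hw.node_ne h])
  have hkind : ∀ m, (E.cfg (j + 1)).mem.node m .kind = (E.cfg j).mem.node m .kind := fun m => hw.field_ne (.inr (by simp))
  have hs : SameStruct (E.cfg j).mem (E.cfg (j + 1)).mem := by
    intro m hm
    refine ⟨hkind m, fun hk' => ?_⟩
    have hmn : m ≠ n := by
      rintro rfl
      exact hk' hk
    simp [hw.node_ne hmn]
  refine stepOK_write g hw hlock (ever_of_rch hr)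
    (.inr ⟨hr, hk, by simp, fun h => absurd rfl h⟩) (hv ▸ Nat.le_succ _) (fun _ _ => hleaf')
    (fun k v _ _ h => ?_) (fun k v v' _ _ h h' => ?_) fun hi => upd ?_
  · rw [hLE] at h
    split_ifs at h with hkk
    · exact hkk ▸ hk₀
    · exact g.self.keys n k v hr hk h
  · rw [le_even he] at h h'
    exact hleaf'.func h h'
  · funext k
    refine Option.ext fun v => ?_
    have hr' : E.Rch (j + 1) n := hs.reach_iff.2 hr
    have hk' : (E.cfg (j + 1)).mem.node n .kind = .leaf := (hkind n).trans hk
    by_cases hkn : E.On j k n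
    · rw [hi.dict_leaf hr' hk' (hs.onPath_iff.2 hkn), hLE]
      by_cases hkk : k = k₀
      · subst hkk
        simp
      · rw [Function.update_of_ne hkk, g.self.dict_leaf hr hk hkn, if_neg hkk]
    · have hkk : k ≠ k₀ := by
        rintro rfl
        exact hkn hk₀
      rw [Function.update_of_ne hkk, hi.dict_iff, g.self.dict_iff]
      simp only [inTree_iff, hs.reach_iff, hkind]
      refine exists_congr fun l => and_congr_right fun h1 => and_congr_right fun h2 => ?_
      by_cases hln : l = n
      · subst hln
        rw [hLE, if_neg hkk]
      · exact hLE' hln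

/-! ### Replacing a child pointer -/

/-- The replaced fragment has to be locked as a whole, so that nodes with a free lock are not unlinked. -/
lemma WriteStep.link_inv {j : ℕ} (g : E.Good j) {t : T} {H H' : Addr → ℕ} {gp p new : Addr} {i₀ : ℕ}
    {KS : List K} {CS : List (Option Addr)} {X F : List Addr}
    (hw : WriteStep E t j gp (.ptr i₀) (some new))
    (s : Surgery (E.cfg j).mem (E.cfg (j + 1)).mem H H' gp i₀ p new KS CS X F)
    (lock : ∀ n ∈ gp :: p :: X, (E.cfg j).mem.lock n = some t)
    (keysF : ∀ f ∈ new :: F, (E.cfg j).mem.node f .kind = .leaf → Even ((E.cfg j).mem.node f .ver) ∧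
      ∀ k v, SlotHas b ((E.cfg j).mem.node f) k v → E.On (j + 1) k f) : E.Inv (j + 1) := by
  have hnext := hw.next
  have hsame : ∀ {l f}, (∀ i, f ≠ .ptr i) → (E.cfg (j + 1)).mem.node l f = (E.cfg j).mem.node l f := fun h =>
    hw.field_ne (.inr (h i₀))
  have hLE : ∀ {l k v}, E.LE (j + 1) l k v ↔ E.LE j l k v :=
    le_same (hsame (by simp)) (fun i => hsame (by simp)) fun i => hsame (by simp)
  refine ⟨⟨H', s.wf'⟩, ?_, ?_, ?_, ?_⟩
  · intro l hl hk he
    rw [hsame (by simp)] at hk he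
    rw [hnext] at hl
    obtain ⟨h1, h2, h3⟩ := g.self.leaf l hl hk he
    refine ⟨?_, ?_, ?_⟩ <;> simpa only [hsame (by simp : ∀ i, Field.key _ ≠ .ptr i),
      hsame (by simp : ∀ i, Field.val _ ≠ .ptr i), hsame (by simp : ∀ i, Field.size ≠ .ptr i)]
  · intro l k v hr hk h
    rw [hsame (by simp)] at hk
    rw [hLE] at h
    rcases s.reach_of_reach' hr with hf | ⟨h1, h2⟩
    · obtain ⟨h3, h4⟩ := keysF l hf hk
      exact h4 k v ((le_even h3).1 h)
    · exact s.onPath'_of_onPath (g.self.keys l k v h1 hk h) h2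
  · intro l k v v' hr hk h h'
    rw [hsame (by simp)] at hk
    rw [hLE] at h h'
    rcases s.reach_of_reach' hr with hf | ⟨h1, h2⟩
    · obtain ⟨h3, h4⟩ := keysF l hf hk
      rw [le_even h3] at h h'
      exact (g.self.leaf l (s.fresh l hf).2 hk h3).func h h'
    · exact g.self.func l k v v' h1 hk h h'
  · intro n hn hl
    rw [hnext] at hn
    rw [hw.lock] at hl
    rw [hsame (by simp), hsame (by simp)]
    obtain ⟨h1, h2⟩ := g.self.free n hn hl
    refine ⟨h1, fun ⟨m, hm, he⟩ hnr => ?_⟩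
    rcases Nat.lt_or_eq_of_le hm with h' | rfl
    · refine h2 ⟨m, by omega, he⟩ fun hr => hnr (s.reach'_of_reach hr fun hX => ?_)
      rw [lock n (by simp only [List.mem_cons] at hX ⊢; tauto)] at hl
      exact absurd hl (by simp)
    · exact absurd he hnr

/-- The unlinked nodes are locked, the linked ones are new, and key ranges do not change. -/
lemma WriteStep.link_trans {j : ℕ} {t : T} {H H' : Addr → ℕ} {gp p new : Addr}
    {i₀ : ℕ} {KS : List K} {CS : List (Option Addr)} {X F : List Addr}
    (hw : WriteStep E t j gp (.ptr i₀) (some new))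
    (s : Surgery (E.cfg j).mem (E.cfg (j + 1)).mem H H' gp i₀ p new KS CS X F)
    (lock : ∀ n ∈ gp :: p :: X, (E.cfg j).mem.lock n = some t)
    (even : ∀ x ∈ p :: X, Even ((E.cfg j).mem.node x .ver))
    (own : ∀ f ∈ new :: F, ¬ E.Ever j f ∧ E.AllocBy t j f) : E.Trans j := by
  have hnext := hw.next
  have hsame : ∀ {l f}, (∀ i, f ≠ .ptr i) → (E.cfg (j + 1)).mem.node l f = (E.cfg j).mem.node l f := fun h =>
    hw.field_ne (.inr (h i₀))
  have hp : p ∉ new :: F := fun h => (s.fresh p h).1 s.p_reach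
  refine ⟨hnext.ge, fun n _ => hsame (by simp), fun n _ _ => ⟨hsame (by simp), fun i => hsame (by simp)⟩,
    ?_, ?_, fun n _ => (hsame (by simp)).ge, fun n => .inl (by rw [hw.lock]), ?_, ?_, ?_, ?_⟩
  · intro n hn f hne
    have : n = gp := by
      by_contra hc
      exact hne (hw.field_ne (.inl hc))
    subst this
    exact ⟨t, hw.1, lock n (by simp), ever_of_rch s.gp_reach, fun _ => s.gp_reach⟩
  · intro n hn hk f _ _ hne
    have : n = gp := by
      by_contra hc
      exact hne (hw.field_ne (.inl hc))
    subst this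
    exact absurd hk s.gp_kind
  · intro n h1 h2
    have hX : n ∈ p :: X := by
      by_contra hX
      exact h2 (s.reach'_of_reach h1 hX)
    have hng : n ≠ gp := fun h => s.gp_not_mem (h ▸ hX)
    exact ⟨hw.node_ne hng, fun _ => even n hX, t, hw.1,
      lock n (by simp only [List.mem_cons] at hX ⊢; tauto)⟩
  · intro n h1 h2
    have hF : n ∈ new :: F := (s.reach_of_reach' h1).resolve_right fun h => h2 h.1
    exact ⟨(own n hF).1, t, hw.1, (own n hF).2⟩
  · intro n h1 h2 k
    refine s.onPath_iff (fun hX => ?_) fun hF => (s.fresh n hF).1 h1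
    rcases s.reach_of_reach' h2 with h | h
    · exact (s.fresh n h).1 h1
    · exact h.2 hX
  · intro n i c h1 h2 h3 h4 h5
    have : n = gp ∧ i = i₀ := by
      by_contra hc
      rw [s.ptr_eq hc] at h4
      exact h4 h3
    obtain ⟨rfl, rfl⟩ := this
    obtain rfl : c = p := Option.some.inj (h3.symm.trans s.gp_ptr)
    rcases s.reach_of_reach' h5 with h | h
    · exact hp h
    · exact h.2 (by simp)

/-- The pairs in the tree before and after the replacement. -/
lemma WriteStep.link_inTree {j : ℕ} {t : T} {H H' : Addr → ℕ} {gp p new : Addr}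
    {i₀ : ℕ} {KS : List K} {CS : List (Option Addr)} {X F : List Addr}
    (hw : WriteStep E t j gp (.ptr i₀) (some new))
    (s : Surgery (E.cfg j).mem (E.cfg (j + 1)).mem H H' gp i₀ p new KS CS X F)
    (evenF : ∀ f ∈ new :: F, Even ((E.cfg j).mem.node f .ver))
    (even : ∀ x ∈ p :: X, Even ((E.cfg j).mem.node x .ver)) (k : K) (v : V) :
    ∃ rest : Prop,
      (E.InTree j k v ↔
        (∃ x ∈ p :: X, (E.cfg j).mem.node x .kind = .leaf ∧ SlotHas b ((E.cfg j).mem.node x) k v) ∨ rest) ∧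
      (E.InTree (j + 1) k v ↔
        (∃ f ∈ new :: F, (E.cfg j).mem.node f .kind = .leaf ∧ SlotHas b ((E.cfg j).mem.node f) k v) ∨ rest) := by
  have hsame : ∀ {l f}, (∀ i, f ≠ .ptr i) → (E.cfg (j + 1)).mem.node l f = (E.cfg j).mem.node l f := fun h =>
    hw.field_ne (.inr (h i₀))
  have hLE : ∀ {l k v}, E.LE (j + 1) l k v ↔ E.LE j l k v :=
    le_same (hsame (by simp)) (fun i => hsame (by simp)) fun i => hsame (by simp)
  refine ⟨∃ l, E.Rch j l ∧ l ∉ p :: X ∧ (E.cfg j).mem.node l .kind = .leaf ∧ E.LE j l k v, ?_, ?_⟩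
  · rw [inTree_iff]
    constructor
    · rintro ⟨l, h1, h2, h3⟩
      by_cases hX : l ∈ p :: X
      · exact .inl ⟨l, hX, h2, (le_even (even l hX)).1 h3⟩
      · exact .inr ⟨l, h1, hX, h2, h3⟩
    · rintro (⟨l, hX, h2, h3⟩ | ⟨l, h1, -, h2, h3⟩)
      · exact ⟨l, s.x_reach l hX, h2, (le_even (even l hX)).2 h3⟩
      · exact ⟨l, h1, h2, h3⟩
  · rw [inTree_iff]
    constructor
    · rintro ⟨l, h1, h2, h3⟩
      rw [hsame (by simp)] at h2
      rw [hLE] at h3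
      rcases s.reach_of_reach' h1 with h | h
      · exact .inl ⟨l, h, h2, (le_even (evenF l h)).1 h3⟩
      · exact .inr ⟨l, h.1, h.2, h2, h3⟩
    · rintro (⟨l, hF, h2, h3⟩ | ⟨l, h1, hX, h2, h3⟩)
      · exact ⟨l, s.reach_iff.2 (.inl hF), by rwa [hsame (by simp)],
          hLE.2 ((le_even (evenF l hF)).2 h3)⟩
      · exact ⟨l, s.reach_iff.2 (.inr ⟨h1, hX⟩), by rwa [hsame (by simp)], hLE.2 h3⟩

end Execution

end OCC

namespace OCC

namespace Execution

variable {K V T : Type} [LinearOrder K] [DecidableEq T] {a b : ℕ} {E : Execution K V T a b}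

/-! ### Stability under the steps of other threads -/

lemma own_noWrite {j : ℕ} {t : T} {q : Prog K V} (ha : E.act j = .internal t)
    (hq : (E.cfg j).thread t = some q) (hn : q.NoWrite) :
    (E.cfg (j + 1)).mem.lock = (E.cfg j).mem.lock ∧
    (∀ n < (E.cfg j).mem.next, (E.cfg (j + 1)).mem.node n = (E.cfg j).mem.node n) := by
  obtain ⟨q', q'', h1, h2, -⟩ := step_internal ha
  obtain rfl : q = q' := Option.some.inj (hq.symm.trans h1)
  generalize (E.cfg (j + 1)).mem = m' at h2 ⊢
  cases h2 with
  | alloc =>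
    refine ⟨rfl, fun n hn => ?_⟩
    exact Function.update_of_ne hn.ne _ _
  | write => exact hn.elim
  | lock => exact hn.elim
  | unlock => exact hn.elim
  | _ => exact ⟨rfl, fun _ _ => rfl⟩

/-- The thread takes no step in which it writes, locks or unlocks. -/
def MHold (E : Execution K V T a b) (t : T) (j₀ j : ℕ) : Prop :=
  ∀ m, j₀ ≤ m → m < j → ∀ q, E.act m = .internal t → (E.cfg m).thread t = some q → q.NoWrite

/-- A step in which the thread does not write, lock or unlock leaves its locked nodes, and the nodes
that it has created and not linked, as they are. -/
lemma frame_step {t : T} {j : ℕ} (g : E.Good (j + 1))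
    (h : ∀ q, E.act j = .internal t → (E.cfg j).thread t = some q → q.NoWrite) :
    (∀ n, (E.cfg (j + 1)).mem.lock n = some t ↔ (E.cfg j).mem.lock n = some t) ∧
    (∀ n < (E.cfg j).mem.next, (E.cfg j).mem.lock n = some t →
      (E.cfg (j + 1)).mem.node n = (E.cfg j).mem.node n ∧ (E.Rch j n → E.Rch (j + 1) n)) ∧
    (∀ n < (E.cfg j).mem.next, E.AllocBy t j n → ¬ E.Ever j n →
      (E.cfg (j + 1)).mem.node n = (E.cfg j).mem.node n ∧ ¬ E.Ever (j + 1) n) := by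
  have ever : ∀ {n}, ¬ E.Ever j n → ¬ E.Rch (j + 1) n → ¬ E.Ever (j + 1) n := by
    rintro n h1 h2 ⟨m, hm, hr⟩
    rcases Nat.lt_or_eq_of_le hm with h' | rfl
    · exact h1 ⟨m, by omega, hr⟩
    · exact h2 hr
  by_cases ha : E.act j = .internal t
  · obtain ⟨q, -, hq, -⟩ := step_internal ha
    obtain ⟨h1, h2⟩ := own_noWrite ha hq (h q ha hq)
    have hs : SameStruct (E.cfg j).mem (E.cfg (j + 1)).mem := fun n hn => by
      simp [h2 n (g.rch_lt (Nat.le_succ j) hn)]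
    refine ⟨fun n => by rw [h1], fun n hn _ => ⟨h2 n hn, hs.reach_iff.2⟩, fun n hn _ he =>
      ⟨h2 n hn, ever he fun hr => he (ever_of_rch (hs.reach_iff.1 hr))⟩⟩
  · have tr := g.trans j (Nat.lt_succ_self j)
    have ne : ∀ {t'}, E.act j = .internal t' → t' ≠ t := by
      intro t' h' he
      exact ha (he ▸ h')
    refine ⟨fun n => ?_, fun n hn hl => ⟨?_, fun hr => ?_⟩, fun n hn hA he => ⟨?_, ever he fun hr => ?_⟩⟩
    · rcases tr.lock n with h1 | ⟨t', h1, ⟨h2, h3⟩ | ⟨h2, h3⟩⟩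
      · rw [h1]
      · simp [h2, h3, ne h1]
      · simp [h2, h3, ne h1]
    · funext f
      by_contra hc
      obtain ⟨t', h1, h2, -⟩ := tr.wr n hn f hc
      rw [hl] at h2
      exact ne h1 (Option.some.inj h2).symm
    · by_contra hc
      obtain ⟨-, -, t', h1, h2⟩ := tr.unlink n hr hc
      rw [hl] at h2
      exact ne h1 (Option.some.inj h2).symm
    · funext f
      by_contra hc
      obtain ⟨t', h1, h2, h3, -⟩ := tr.wr n hn f hc
      exact he h3
    · obtain ⟨h1, t', h2, h3⟩ := tr.link n hr fun hr => he (ever_of_rch hr)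
      exact ne h2 (g.allocBy_unique (Nat.le_succ j) h3 hA)

lemma frame_lock {t : T} {j₀ j : ℕ} (h : j₀ ≤ j) (g : E.Good j) (hm : MHold E t j₀ j) (n : Addr) :
    (E.cfg j).mem.lock n = some t ↔ (E.cfg j₀).mem.lock n = some t := by
  induction j, h using Nat.le_induction with
  | base => rfl
  | succ j h ih =>
    rw [(frame_step g (hm j h (Nat.lt_succ_self j))).1,
      ih (g.mono (Nat.le_succ j)) fun m h1 h2 => hm m h1 (by omega)]

/-- A locked node does not change, and stays in the tree, unless the owner of the lock acts. -/
lemma frame_node {t : T} {j₀ j : ℕ} (h : j₀ ≤ j) (g : E.Good j) (hm : MHold E t j₀ j) {n : Addr}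
    (hn : n < (E.cfg j₀).mem.next) (hl : (E.cfg j₀).mem.lock n = some t) :
    (E.cfg j).mem.node n = (E.cfg j₀).mem.node n ∧ (E.Rch j₀ n → E.Rch j n) := by
  induction j, h using Nat.le_induction with
  | base => exact ⟨rfl, id⟩
  | succ j h ih =>
    have hm' : MHold E t j₀ j := fun m h1 h2 => hm m h1 (by omega)
    obtain ⟨h1, h2⟩ := ih (g.mono (Nat.le_succ j)) hm'
    obtain ⟨h3, h4⟩ := (frame_step g (hm j h (Nat.lt_succ_self j))).2.1 n
      (hn.trans_le (g.next_mono h (Nat.le_succ j)))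
      ((frame_lock h (g.mono (Nat.le_succ j)) hm' n).2 hl)
    exact ⟨h3.trans h1, fun hr => h4 (h2 hr)⟩

/-- The nodes that a thread has created, with their contents, and has not yet linked. -/
def FreshAll (E : Execution K V T a b) (t : T) (Fr : List (Addr × Node K V)) (j : ℕ) : Prop :=
  (Fr.map Prod.fst).Nodup ∧ ∀ x ∈ Fr, x.1 < (E.cfg j).mem.next ∧ (E.cfg j).mem.node x.1 = x.2 ∧
    ¬ E.Ever j x.1 ∧ E.AllocBy t j x.1

lemma frame_fresh {t : T} {j₀ j : ℕ} (h : j₀ ≤ j) (g : E.Good j) (hm : MHold E t j₀ j)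
    {Fr : List (Addr × Node K V)} (hf : FreshAll E t Fr j₀) : FreshAll E t Fr j := by
  refine ⟨hf.1, fun x hx => ?_⟩
  obtain ⟨h1, h2, h3, h4⟩ := hf.2 x hx
  induction j, h using Nat.le_induction with
  | base => exact ⟨h1, h2, h3, h4⟩
  | succ j h ih =>
    obtain ⟨a1, a2, a3, a4⟩ := ih (g.mono (Nat.le_succ j)) fun m h1 h2 => hm m h1 (by omega)
    obtain ⟨h5, h6⟩ := (frame_step g (hm j h (Nat.lt_succ_self j))).2.2 x.1 a1 a4 a3
    exact ⟨a1.trans_le (g.next_mono (Nat.le_succ j) le_rfl), h5.trans a2, h6,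
      a4.mono (Nat.le_succ j)⟩

/-! ### What a thread knows at a jump and at a response -/

/-- The operation instance has written no version and no pointer. -/
def Pre (E : Execution K V T a b) (t : T) (i j : ℕ) : Prop :=
  ∀ m, i < m → m < j → (∀ l, ¬ E.Writes t m l .ver) ∧ ∀ n k, ¬ E.Writes t m n (.ptr k)

/-- The operation has had its update point, and has to return `res`. -/
def Post (E : Execution K V T a b) (t : T) (i : ℕ) (op : Op K V) (j : ℕ) (res : Option V) : Prop :=
  ∃ u < j, E.UpdatePoint (t, i) u op ∧ res = (op.apply (E.dict u)).2

/-- The thread holds no lock. -/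
def NoLocks (E : Execution K V T a b) (t : T) (j : ℕ) : Prop :=
  ∀ n, (E.cfg j).mem.lock n ≠ some t

/-- The node was on the search path of the key after the last start of a search. -/
def SeenOn (E : Execution K V T a b) (t : T) (i j : ℕ) (k : K) (n : Addr) : Prop :=
  ∃ m, i < m ∧ m ≤ j ∧ E.On m k n ∧ ∀ s, m < s → s < j → ¬ E.StartsSearch t s

/-- The node `n` was once seen as the child of the internal node `p` with index `x`. -/
def EdgeSeen (E : Execution K V T a b) (j : ℕ) (p : Addr) (x : ℕ) (n : Addr) : Prop :=
  ∃ j₁ j₂, j₁ ≤ j₂ ∧ j₂ ≤ j ∧ E.Rch j₁ p ∧ (E.cfg j₁).mem.node p .kind ≠ .leaf ∧ (E.cfg j₂).mem.node p (.ptr x) = some n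

/-- The parents that a search has recorded were once seen to have the recorded children. -/
def PathOK (E : Execution K V T a b) (j : ℕ) (path : PathInfo) : Prop :=
  (∀ p, path.p = some p → EdgeSeen E j p path.nIdx path.n) ∧
  ∀ gp p, path.gp = some gp → path.p = some p → EdgeSeen E j gp path.pIdx p

/-- The nodes of the pending calls of `fixTagged` have been created. Since the kind of a node does not
change from then on, a tagged node stays tagged. -/
def TodoOK (E : Execution K V T a b) (j : ℕ) (todo : List Task) : Prop :=
  ∀ n, Task.fixTagged n ∈ todo → n < (E.cfg j).mem.next

/-- What is known about the caller of a search: an operation has not modified anything yet, and the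
rebalancing steps run after the update point of the operation. -/
def CallerOK (E : Execution K V T a b) (t : T) (i : ℕ) (op : Op K V) (j : ℕ) (key : K)
    (target : Option Addr) : Caller K V → Prop
  | .op o => o = op ∧ Pre E t i j ∧ key = op.key ∧ target = none
  | .fixTagged n todo res => n < (E.cfg j).mem.next ∧ (E.cfg j).mem.node n .kind = .tagged ∧
      TodoOK E j todo ∧ Post E t i op j res
  | .fixUnderfull _ todo res => TodoOK E j todo ∧ Post E t i op j res

/-- The assertions at the labels of the code. -/
def LInv (E : Execution K V T a b) (t : T) (i : ℕ) (op : Op K V) (j : ℕ) : Label K V → Prop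
  | .search c key target path => NoLocks E t j ∧ SeenOn E t i j key path.n ∧ PathOK E j path ∧
      CallerOK E t i op j key target c
  | .searchLeaf o path => NoLocks E t j ∧ o = op ∧ Pre E t i j ∧ SeenOn E t i j op.key path.n ∧
      (E.cfg j).mem.node path.n .kind = .leaf ∧ PathOK E j path
  | .rebalance todo res => NoLocks E t j ∧ TodoOK E j todo ∧ Post E t i op j res

/-- The operation returns a correct value at step `r`. -/
def ResOK (E : Execution K V T a b) (t : T) (i : ℕ) (op : Op K V) (r : ℕ) (res : Option V) : Prop :=
  Post E t i op r res ∨ ((∀ u < r, ¬ E.UpdatePoint (t, i) u op) ∧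
    (∃ j, E.ReadPoint (t, i) r j op) ∧
    ∀ j, E.ReadPoint (t, i) r j op → i < j ∧ j ≤ r ∧ op.apply (E.dict j) = (E.dict j, res))

/-! ### Safety of code -/

/-- From configuration `j` to configuration `j'` the thread is about to execute `q`. -/
structure Waits (E : Execution K V T a b) (t : T) (i : ℕ) (q : Prog K V) (j j' : ℕ) : Prop where
  le : j ≤ j'
  good : E.Good j'
  prog : ∀ m, j ≤ m → m ≤ j' → (E.cfg m).thread t = some q
  quiet : ∀ m, j ≤ m → m < j' → E.act m ≠ .internal t
  inProgress : E.InProgress (t, i) j'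

/-- In step `j'`, the thread executes the first step of `q`. -/
structure Takes (E : Execution K V T a b) (t : T) (i : ℕ) (q : Prog K V) (j j' : ℕ) : Prop
    extends Waits E t i q j j' where
  act : E.act j' = .internal t

/-- The code that the thread `t` has reached in configuration `j`, while it executes the operation
`op` that it has invoked in step `i`, keeps the invariants, whatever the other threads do. -/
def Safe (E : Execution K V T a b) (t : T) (i : ℕ) (op : Op K V) : Prog K V → ℕ → Prop
  | .read n f nx, j => ∀ j', Takes E t i (.read n f nx) j j' → E.Good (j' + 1) →
      Safe E t i op (nx ((E.cfg j').mem.node n f)) (j' + 1)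
  | .write n f x nx, j => ∀ j', Takes E t i (.write n f x nx) j j' → WriteStep E t j' n f x →
      E.StepOK j' ∧ (E.Good (j' + 1) → Safe E t i op nx (j' + 1))
  | .lock n nx, j => ∀ j', Takes E t i (.lock n nx) j j' → (E.cfg j').mem.lock n = none →
      (E.cfg (j' + 1)).mem =
        { (E.cfg j').mem with lock := Function.update (E.cfg j').mem.lock n (some t) } →
      E.Good (j' + 1) → Safe E t i op nx (j' + 1)
  | .unlock n nx, j => ∀ j', Takes E t i (.unlock n nx) j j' →
      ((E.cfg j').mem.lock n = some t ∧ Even ((E.cfg j').mem.node n .ver) ∧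
        (E.Ever j' n → ¬ E.Rch j' n → (E.cfg j').mem.node n .marked = true)) ∧
      ((E.cfg (j' + 1)).mem =
        { (E.cfg j').mem with lock := Function.update (E.cfg j').mem.lock n none } →
      E.Good (j' + 1) → Safe E t i op nx (j' + 1))
  | .alloc nd nx, j => ∀ j', Takes E t i (.alloc nd nx) j j' →
      (Even (nd .ver) ∧ (nd .kind = .leaf → LeafOK b nd)) ∧
      ((E.cfg (j' + 1)).mem = { (E.cfg j').mem with
        node := Function.update (E.cfg j').mem.node (E.cfg j').mem.next nd
        next := (E.cfg j').mem.next + 1 } →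
      E.Good (j' + 1) → Safe E t i op (nx (E.cfg j').mem.next) (j' + 1))
  | .anyKey nx, j => ∀ j' k, Takes E t i (.anyKey nx) j j' → E.Good (j' + 1) →
      Safe E t i op (nx k) (j' + 1)
  | .goto l, j => ∀ j', Waits E t i (.goto l) j j' → LInv E t i op j' l
  | .ret res, j => ∀ j', Waits E t i (.ret res) j j' → E.act j' = .respond t res →
      NoLocks E t j' ∧ ResOK E t i op j' res
  | .crash, _ => True

/-- Since configuration `j₀`, the thread has neither changed the memory (apart from creating the
nodes `Fr`) nor read a version nor started a search. -/
structure Keeps (E : Execution K V T a b) (t : T) (j₀ : ℕ) (Fr : List (Addr × Node K V)) (j : ℕ) :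
    Prop where
  le : j₀ ≤ j
  good : E.Good j
  calm : ∀ m, j₀ ≤ m → m < j → ∀ q, E.act m = .internal t → (E.cfg m).thread t = some q → q.Calm
  noStart : ∀ m, j₀ ≤ m → m < j → ¬ E.StartsSearch t m
  fresh : FreshAll E t Fr j

lemma Keeps.mhold {t : T} {j₀ j : ℕ} {Fr : List (Addr × Node K V)} (k : Keeps E t j₀ Fr j) :
    MHold E t j₀ j := fun m h1 h2 q h3 h4 => (k.calm m h1 h2 q h3 h4).noWrite

lemma Keeps.node {t : T} {j₀ j : ℕ} {Fr : List (Addr × Node K V)} (k : Keeps E t j₀ Fr j)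
    {n : Addr} (hn : n < (E.cfg j₀).mem.next) (hl : (E.cfg j₀).mem.lock n = some t) :
    (E.cfg j).mem.node n = (E.cfg j₀).mem.node n := (frame_node k.le k.good k.mhold hn hl).1

lemma Keeps.rch {t : T} {j₀ j : ℕ} {Fr : List (Addr × Node K V)} (k : Keeps E t j₀ Fr j)
    {n : Addr} (hl : (E.cfg j₀).mem.lock n = some t) (hr : E.Rch j₀ n) :
    E.Rch j n := (frame_node k.le k.good k.mhold (k.good.rch_lt k.le hr) hl).2 hr

lemma Keeps.noEvent {t : T} {j₀ j : ℕ} {Fr : List (Addr × Node K V)} (k : Keeps E t j₀ Fr j)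
    {m : ℕ} (h1 : j₀ ≤ m) (h2 : m < j) : (∀ n f, ¬ E.Writes t m n f) ∧ (∀ n, ¬ E.Locks t m n) ∧
      ∀ n, ¬ E.Reads t m n .ver := by
  refine ⟨?_, ?_, ?_⟩
  · rintro n f ⟨h3, x, nx, h4⟩
    exact k.calm m h1 h2 _ h3 h4
  · rintro n ⟨h3, nx, h4⟩
    exact k.calm m h1 h2 _ h3 h4
  · rintro n ⟨h3, nx, h4⟩
    exact k.calm m h1 h2 _ h3 h4 rfl

lemma Keeps.wait {t : T} {i j₀ j j' : ℕ} {Fr : List (Addr × Node K V)} {q : Prog K V}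
    (k : Keeps E t j₀ Fr j) (w : Waits E t i q j j')
    (hq : ∀ c key target, q ≠ .goto (.search c key target PathInfo.start)) :
    Keeps E t j₀ Fr j' := by
  refine ⟨k.le.trans w.le, w.good, ?_, ?_, ?_⟩
  · intro m h1 h2 q' h3 h4
    rcases lt_or_ge m j with h | h
    · exact k.calm m h1 h q' h3 h4
    · exact absurd h3 (w.quiet m h h2)
  · intro m h1 h2
    rcases lt_or_ge m j with h | h
    · exact k.noStart m h1 h
    · rintro ⟨c, key, target, h'⟩
      rw [w.prog m h h2.le] at h'
      exact hq c key target (Option.some.inj h')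
  · exact frame_fresh w.le w.good (fun m h1 h2 q h3 _ => absurd h3 (w.quiet m h1 h2)) k.fresh

lemma Keeps.succ {t : T} {i j₀ j j' : ℕ} {Fr : List (Addr × Node K V)} {q : Prog K V}
    (k : Keeps E t j₀ Fr j') (w : Takes E t i q j j') (hq : q.Calm) (g : E.Good (j' + 1)) :
    Keeps E t j₀ Fr (j' + 1) := by
  have hp := w.prog j' w.le le_rfl
  refine ⟨k.le.trans (Nat.le_succ _), g, ?_, ?_, ?_⟩
  · intro m h1 h2 q' h3 h4
    rcases Nat.lt_succ_iff_lt_or_eq.1 h2 with h | rfl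
    · exact k.calm m h1 h q' h3 h4
    · obtain rfl : q = q' := Option.some.inj (hp.symm.trans h4)
      exact hq
  · intro m h1 h2
    rcases Nat.lt_succ_iff_lt_or_eq.1 h2 with h | rfl
    · exact k.noStart m h1 h
    · rintro ⟨c, key, target, h'⟩
      obtain rfl := Option.some.inj (hp.symm.trans h')
      exact hq
  · refine frame_fresh (Nat.le_succ _) g (fun m h1 h2 q' h3 h4 => ?_) k.fresh
    obtain rfl : m = j' := by omega
    obtain rfl : q = q' := Option.some.inj (hp.symm.trans h4)
    exact hq.noWrite

/-- The code is safe in every configuration up to which the facts about configuration `j₀` are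
kept. -/
def SafeFrom (E : Execution K V T a b) (t : T) (i : ℕ) (op : Op K V) (j₀ : ℕ)
    (Fr : List (Addr × Node K V)) (q : Prog K V) : Prop :=
  ∀ j, Keeps E t j₀ Fr j → Safe E t i op q j

section Rules

variable {t : T} {i : ℕ} {op : Op K V} {j₀ : ℕ} {Fr : List (Addr × Node K V)}

lemma safeFrom_crash : SafeFrom E t i op j₀ Fr .crash := fun _ _ => trivial

lemma SafeFrom.start {q : Prog K V} {j : ℕ} (h : SafeFrom E t i op j [] q) (g : E.Good j) :
    Safe E t i op q j :=
  h j ⟨le_rfl, g, fun m h1 h2 => by omega, fun m h1 h2 => by omega, by simp [FreshAll]⟩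

lemma safeFrom_read {n : Addr} {f : Field} {nx : f.Ty K V → Prog K V} (hf : f ≠ .ver)
    (h : ∀ j, Keeps E t j₀ Fr j → E.Reads t j n f → SafeFrom E t i op j₀ Fr (nx ((E.cfg j).mem.node n f))) :
    SafeFrom E t i op j₀ Fr (.read n f nx) := by
  intro j k j' tk g
  have k' := k.wait tk.toWaits (by simp)
  exact h j' k' ⟨tk.act, nx, tk.prog j' tk.le le_rfl⟩ _ (k'.succ tk hf g)

lemma safeFrom_read_const {n : Addr} {f : Field} {nx : f.Ty K V → Prog K V} (hf : f ≠ .ver)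
    (x : f.Ty K V) (hx : ∀ j, Keeps E t j₀ Fr j → (E.cfg j).mem.node n f = x)
    (h : SafeFrom E t i op j₀ Fr (nx x)) : SafeFrom E t i op j₀ Fr (.read n f nx) :=
  safeFrom_read hf fun j k _ => by rwa [hx j k]

/-- Reading a field of a locked node. -/
lemma safeFrom_read_locked {n : Addr} {f : Field} {nx : f.Ty K V → Prog K V} (hf : f ≠ .ver)
    (hn : n < (E.cfg j₀).mem.next) (hl : (E.cfg j₀).mem.lock n = some t)
    (h : SafeFrom E t i op j₀ Fr (nx ((E.cfg j₀).mem.node n f))) : SafeFrom E t i op j₀ Fr (.read n f nx) :=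
  safeFrom_read_const hf _ (fun j k => by rw [k.node hn hl]) h

lemma safeFrom_anyKey {nx : K → Prog K V} (h : ∀ k, SafeFrom E t i op j₀ Fr (nx k)) :
    SafeFrom E t i op j₀ Fr (.anyKey nx) := by
  intro j k j' key tk g
  have k' := k.wait tk.toWaits (by simp)
  exact h key _ (k'.succ tk trivial g)

lemma safeFrom_alloc {nd : Node K V} {nx : Addr → Prog K V} (hv : Even (nd .ver))
    (hl : nd .kind = .leaf → LeafOK b nd)
    (h : ∀ new, SafeFrom E t i op j₀ ((new, nd) :: Fr) (nx new)) :
    SafeFrom E t i op j₀ Fr (.alloc nd nx) := by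
  intro j k j' tk
  refine ⟨⟨hv, hl⟩, fun hm g => ?_⟩
  have k' := k.wait tk.toWaits (by simp)
  have k'' := k'.succ tk trivial g
  refine h _ _ ⟨k''.le, k''.good, k''.calm, k''.noStart, ?_, ?_⟩
  · rw [List.map_cons, List.nodup_cons]
    refine ⟨fun hmem => ?_, k''.fresh.1⟩
    obtain ⟨x, hx, he⟩ := List.mem_map.1 hmem
    exact absurd (k'.fresh.2 x hx).1 (by rw [he]; exact lt_irrefl _)
  · intro x hx
    rcases List.mem_cons.1 hx with rfl | hx
    · refine ⟨by rw [hm]; exact Nat.lt_succ_self _, by rw [hm]; simp, ?_, j', Nat.lt_succ_self j',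
        tk.act, rfl, by rw [hm]⟩
      rintro ⟨m, hm', hr⟩
      have hr' : m ≤ j' ∧ E.Rch m (E.cfg j').mem.next ∨ E.Rch j' (E.cfg j').mem.next := by
        rcases Nat.lt_or_eq_of_le hm' with h' | rfl
        · exact .inl ⟨by omega, hr⟩
        · right
          have hs : SameStruct (E.cfg j').mem (E.cfg (j' + 1)).mem := fun n hn => by
            rw [hm]
            simp [(tk.good.rch_lt le_rfl hn).ne]
          exact hs.reach_iff.1 hr
      rcases hr' with ⟨h1, h2⟩ | h2
      · exact absurd (tk.good.rch_lt h1 h2) (not_lt.2 (tk.good.next_mono h1 le_rfl))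
      · exact lt_irrefl _ (tk.good.rch_lt le_rfl h2)
    · exact k''.fresh.2 x hx

lemma safeFrom_write {n : Addr} {f : Field} {x : f.Ty K V} {nx : Prog K V}
    (h : ∀ j, Keeps E t j₀ Fr j → E.InProgress (t, i) j → WriteStep E t j n f x →
      E.StepOK j ∧ (E.Good (j + 1) → SafeFrom E t i op (j + 1) [] nx)) :
    SafeFrom E t i op j₀ Fr (.write n f x nx) := by
  intro j k j' tk hw
  obtain ⟨h1, h2⟩ := h j' (k.wait tk.toWaits (by simp)) tk.inProgress hw
  exact ⟨h1, fun g => (h2 g).start g⟩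

lemma safeFrom_lock {n : Addr} {nx : Prog K V}
    (h : ∀ j, Keeps E t j₀ Fr j → E.Good (j + 1) → E.Locks t j n → (E.cfg j).mem.lock n = none →
      (E.cfg (j + 1)).mem =
        { (E.cfg j).mem with lock := Function.update (E.cfg j).mem.lock n (some t) } →
      SafeFrom E t i op (j + 1) [] nx) :
    SafeFrom E t i op j₀ Fr (.lock n nx) := by
  intro j k j' tk hn hm g
  exact (h j' (k.wait tk.toWaits (by simp)) g ⟨tk.act, nx, tk.prog j' tk.le le_rfl⟩ hn hm).start g

lemma safeFrom_unlock {n : Addr} {nx : Prog K V}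
    (h : ∀ j, Keeps E t j₀ Fr j →
      ((E.cfg j).mem.lock n = some t ∧ Even ((E.cfg j).mem.node n .ver) ∧
        (E.Ever j n → ¬ E.Rch j n → (E.cfg j).mem.node n .marked = true)) ∧
      (E.act j = .internal t → (E.cfg j).thread t = some (.unlock n nx) →
      (E.cfg (j + 1)).mem =
        { (E.cfg j).mem with lock := Function.update (E.cfg j).mem.lock n none } →
      E.Good (j + 1) → SafeFrom E t i op (j + 1) [] nx)) :
    SafeFrom E t i op j₀ Fr (.unlock n nx) := by
  intro j k j' tk
  obtain ⟨h1, h2⟩ := h j' (k.wait tk.toWaits (by simp))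
  exact ⟨h1, fun hm g => (h2 tk.act (tk.prog j' tk.le le_rfl) hm g).start g⟩

/-- A jump to a label that is not the start of a search. -/
lemma safeFrom_goto {l : Label K V}
    (hl : ∀ c key target, l ≠ .search c key target PathInfo.start)
    (h : ∀ j, Keeps E t j₀ Fr j → LInv E t i op j l) : SafeFrom E t i op j₀ Fr (.goto l) := by
  intro j k j' w
  exact h j' (k.wait w fun c key target he => hl c key target (Prog.goto.inj he))

/-- A jump to the start of a search. -/
lemma safeFrom_goto_start {c : Caller K V} {key : K} {target : Option Addr}
    (h : ∀ j, j₀ ≤ j → E.Good j →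
      (∀ m, j₀ ≤ m → m < j → ∀ q, E.act m = .internal t → (E.cfg m).thread t = some q → q.Calm) →
      NoLocks E t j ∧ CallerOK E t i op j key target c) :
    SafeFrom E t i op j₀ Fr (.goto (.search c key target PathInfo.start)) := by
  intro j k j' w
  obtain ⟨h1, h2⟩ := h j' (k.le.trans w.le) w.good fun m h1 h2 q h3 h4 => by
    rcases lt_or_ge m j with h | h
    · exact k.calm m h1 h q h3 h4
    · exact absurd h3 (w.quiet m h h2)
  exact ⟨h1, ⟨j', w.inProgress.1, le_rfl, onPath_entry _ _, fun s h1 h2 => by omega⟩,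
    ⟨by simp [PathInfo.start], by simp [PathInfo.start]⟩, h2⟩

end Rules

/-! ### Facts that are never lost -/

lemma EdgeSeen.mono {j j' : ℕ} {p n : Addr} {x : ℕ} (h : EdgeSeen E j p x n) (hj : j ≤ j') :
    EdgeSeen E j' p x n := by
  obtain ⟨j₁, j₂, h1, h2, h3⟩ := h
  exact ⟨j₁, j₂, h1, h2.trans hj, h3⟩

lemma PathOK.mono {j j' : ℕ} {path : PathInfo} (h : PathOK E j path) (hj : j ≤ j') :
    PathOK E j' path :=
  ⟨fun p hp => (h.1 p hp).mono hj, fun gp p h1 h2 => (h.2 gp p h1 h2).mono hj⟩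

lemma Post.mono {t : T} {i : ℕ} {op : Op K V} {j j' : ℕ} {res : Option V}
    (h : Post E t i op j res) (hj : j ≤ j') : Post E t i op j' res := by
  obtain ⟨u, hu, h⟩ := h
  exact ⟨u, hu.trans_le hj, h⟩

lemma TodoOK.mono {J j j' : ℕ} (g : E.Good J) {todo : List Task} (h : TodoOK E j todo) (hj : j ≤ j')
    (hJ : j' ≤ J) : TodoOK E j' todo := fun n hn => (h n hn).trans_le (g.next_mono hj hJ)

lemma Pre.extend {t : T} {i j j' : ℕ} (h : Pre E t i j)
    (hc : ∀ m, j ≤ m → m < j' → ∀ q, E.act m = .internal t → (E.cfg m).thread t = some q →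
      ∀ n f x nx, q = .write n f x nx → f ≠ .ver ∧ ∀ k, f ≠ .ptr k) : Pre E t i j' := by
  intro m h1 h2
  rcases lt_or_ge m j with h' | h'
  · exact h m h1 h'
  · refine ⟨?_, ?_⟩
    · rintro l ⟨h3, x, nx, h4⟩
      exact (hc m h' h2 _ h3 h4 _ _ _ _ rfl).1 rfl
    · rintro n k ⟨h3, x, nx, h4⟩
      exact (hc m h' h2 _ h3 h4 _ _ _ _ rfl).2 k rfl

lemma Pre.not_updatePoint {t : T} {i j u : ℕ} {op : Op K V} (h : Pre E t i j) (hu : u < j) :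
    ¬ E.UpdatePoint (t, i) u op := by
  intro h'
  obtain ⟨⟨h1, -⟩, h2⟩ := h'.writes
  obtain ⟨h3, h4⟩ := h u h1 hu
  rcases h2 with ⟨l, hw⟩ | ⟨-, p, x, l, hw, -⟩
  · exact h3 l hw
  · exact h4 p x hw

end Execution

end OCC

namespace OCC

namespace Execution

variable {K V T : Type} [LinearOrder K] [DecidableEq T] {a b : ℕ} {E : Execution K V T a b}

/-! ### Locked nodes -/

/-- The thread holds exactly the locks of the nodes in `S`. Those of them that have been unlinked
are marked, except for the nodes in `M`. -/
structure Held (E : Execution K V T a b) (t : T) (S M : List Addr) (j : ℕ) : Prop where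
  lock : ∀ n, (E.cfg j).mem.lock n = some t ↔ n ∈ S
  ever : ∀ n ∈ S, E.Ever j n
  even : ∀ n ∈ S, Even ((E.cfg j).mem.node n .ver)
  clean : ∀ n ∈ S, n ∉ M → ¬ E.Rch j n → (E.cfg j).mem.node n .marked = true

lemma Held.congr {t : T} {S S' M : List Addr} {j : ℕ} (h : Held E t S M j)
    (hS : ∀ n, n ∈ S' ↔ n ∈ S) : Held E t S' M j :=
  ⟨fun n => (h.lock n).trans (hS n).symm, fun n hn => h.ever n ((hS n).1 hn),
    fun n hn => h.even n ((hS n).1 hn), fun n hn => h.clean n ((hS n).1 hn)⟩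

lemma NoLocks.held {t : T} {j : ℕ} (h : NoLocks E t j) : Held E t [] [] j :=
  ⟨fun n => by simpa using h n, by simp, by simp, by simp⟩

lemma Held.noLocks {t : T} {M : List Addr} {j : ℕ} (h : Held E t [] M j) : NoLocks E t j :=
  fun n hn => by simpa using (h.lock n).1 hn

lemma Held.frame {t : T} {S M : List Addr} {j₀ j : ℕ} (h : Held E t S M j₀) (hj : j₀ ≤ j)
    (g : E.Good j) (hm : MHold E t j₀ j) : Held E t S M j := by
  have hn : ∀ n ∈ S, (E.cfg j).mem.node n = (E.cfg j₀).mem.node n ∧ (E.Rch j₀ n → E.Rch j n) :=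
    fun n hn => frame_node hj g hm (g.ever_lt hj (h.ever n hn)) ((h.lock n).2 hn)
  refine ⟨fun n => (frame_lock hj g hm n).trans (h.lock n), fun n hS => (h.ever n hS).mono hj,
    fun n hS => ?_, fun n hS hM hr => ?_⟩
  · rw [(hn n hS).1]
    exact h.even n hS
  · rw [(hn n hS).1]
    exact h.clean n hS hM fun hr' => hr ((hn n hS).2 hr')

lemma Held.rch {t : T} {S : List Addr} {j : ℕ} (h : Held E t S [] j) {n : Addr} (hn : n ∈ S)
    (hm : (E.cfg j).mem.node n .marked ≠ true) : E.Rch j n := by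
  by_contra hc
  exact hm (h.clean n hn (by simp) hc)

lemma Held.marked {t : T} {S M : List Addr} {j : ℕ} (h : Held E t S M j)
    (hM : ∀ n ∈ M, (E.cfg j).mem.node n .marked = true) : Held E t S [] j :=
  ⟨h.lock, h.ever, h.even, fun n hn _ hr => by_contra fun hm =>
    hm (h.clean n hn (fun hn' => hm (hM n hn')) hr)⟩

lemma Held.weaken {t : T} {S M M' : List Addr} {j : ℕ} (h : Held E t S M j)
    (hM : ∀ n ∈ M, n ∈ M') : Held E t S M' j :=
  ⟨h.lock, h.ever, h.even, fun n hn hn' => h.clean n hn fun h' => hn' (hM n h')⟩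

lemma Held.locked {t : T} {S : List Addr} {n : Addr} {j : ℕ} (h : Held E t S [] j) (g : E.Good j)
    (he : E.Ever j n) (hl : (E.cfg j).mem.lock n = none)
    (hm : (E.cfg (j + 1)).mem =
      { (E.cfg j).mem with lock := Function.update (E.cfg j).mem.lock n (some t) })
    (hr : ∀ n, E.Rch (j + 1) n ↔ E.Rch j n) : Held E t (n :: S) [] (j + 1) := by
  obtain ⟨f1, f2⟩ := g.self.free n (g.ever_lt le_rfl he) hl
  refine ⟨fun n' => ?_, fun n' hn' => ?_, fun n' hn' => ?_, fun n' hn' _ hr' => ?_⟩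
  · rw [hm]
    by_cases hn : n' = n
    · simp [hn]
    · simpa [hn] using h.lock n'
  · rcases List.mem_cons.1 hn' with rfl | hn'
    · exact he.mono (Nat.le_succ j)
    · exact (h.ever n' hn').mono (Nat.le_succ j)
  · rw [hm]
    rcases List.mem_cons.1 hn' with rfl | hn'
    · exact f1
    · exact h.even n' hn'
  · rw [hr] at hr'
    rw [hm]
    rcases List.mem_cons.1 hn' with rfl | hn'
    · exact f2 he hr'
    · exact h.clean n' hn' (by simp) hr'

lemma Held.unlocked {t : T} {S S' : List Addr} {n : Addr} {j : ℕ} (h : Held E t S [] j)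
    (hS : ∀ n', n' ∈ S' ↔ n' ∈ S ∧ n' ≠ n)
    (hm : (E.cfg (j + 1)).mem =
      { (E.cfg j).mem with lock := Function.update (E.cfg j).mem.lock n none })
    (hr : ∀ n, E.Rch (j + 1) n ↔ E.Rch j n) : Held E t S' [] (j + 1) := by
  refine ⟨fun n' => ?_, fun n' hn' => (h.ever n' ((hS n').1 hn').1).mono (Nat.le_succ j),
    fun n' hn' => ?_, fun n' hn' _ hr' => ?_⟩
  · rw [hm, hS]
    by_cases hn : n' = n
    · simp [hn]
    · simpa [hn] using h.lock n'
  · rw [hm]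
    exact h.even n' ((hS n').1 hn').1
  · rw [hr] at hr'
    rw [hm]
    exact h.clean n' ((hS n').1 hn').1 (by simp) hr'

lemma rch_of_node_eq {j : ℕ} (hm : (E.cfg (j + 1)).mem.node = (E.cfg j).mem.node) (n : Addr) :
    E.Rch (j + 1) n ↔ E.Rch j n := by
  have hs : SameStruct (E.cfg j).mem (E.cfg (j + 1)).mem := fun n hn => by simp [hm]
  exact hs.reach_iff

/-- The thread writes no version and no pointer. -/
def Quiet (E : Execution K V T a b) (t : T) (j j' : ℕ) : Prop :=
  ∀ m, j ≤ m → m < j' → ∀ q, E.act m = .internal t → (E.cfg m).thread t = some q →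
    ∀ n f x nx, q = .write n f x nx → f ≠ .ver ∧ ∀ k, f ≠ .ptr k

lemma Quiet.refl {t : T} {j : ℕ} : Quiet E t j j := fun m h1 h2 => by omega

lemma MHold.quiet {t : T} {j j' : ℕ} (h : MHold E t j j') : Quiet E t j j' := by
  intro m h1 h2 q h3 h4 n f x nx he
  subst he
  exact absurd (h m h1 h2 _ h3 h4) (by simp [Prog.NoWrite])

lemma Quiet.trans {t : T} {j j' j'' : ℕ} (h : Quiet E t j j') (h' : Quiet E t j' j'') :
    Quiet E t j j'' := fun m h1 h2 => by
  rcases lt_or_ge m j' with h3 | h3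
  · exact h m h1 h3
  · exact h' m h3 h2

lemma Quiet.step {t : T} {j : ℕ} {q : Prog K V} (hq : (E.cfg j).thread t = some q)
    (h : ∀ n f x nx, q = .write n f x nx → f ≠ .ver ∧ ∀ k, f ≠ .ptr k) : Quiet E t j (j + 1) := by
  intro m h1 h2 q' h3 h4
  obtain rfl : m = j := by omega
  obtain rfl : q = q' := Option.some.inj (hq.symm.trans h4)
  exact h

lemma MHold.trans {t : T} {j j' j'' : ℕ} (h : MHold E t j j') (h' : MHold E t j' j'') :
    MHold E t j j'' := fun m h1 h2 => by
  rcases lt_or_ge m j' with h3 | h3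
  · exact h m h1 h3
  · exact h' m h3 h2

lemma MHold.step {t : T} {j : ℕ} {q : Prog K V} (hq : (E.cfg j).thread t = some q)
    (h : q.NoWrite) : MHold E t j (j + 1) := by
  intro m h1 h2 q' h3 h4
  obtain rfl : m = j := by omega
  obtain rfl : q = q' := Option.some.inj (hq.symm.trans h4)
  exact h

lemma Reads.mhold {t : T} {j : ℕ} {n : Addr} {f : Field} (h : E.Reads t j n f) :
    MHold E t j (j + 1) := by
  obtain ⟨-, nx, h⟩ := h
  exact MHold.step h trivial

lemma Keeps.trans {t : T} {j₀ j j' : ℕ} {Fr Fr' : List (Addr × Node K V)}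
    (k : Keeps E t j₀ Fr j) (k' : Keeps E t j Fr' j') : Keeps E t j₀ Fr' j' := by
  refine ⟨k.le.trans k'.le, k'.good, fun m h1 h2 => ?_, fun m h1 h2 => ?_, k'.fresh⟩
  · rcases lt_or_ge m j with h | h
    · exact k.calm m h1 h
    · exact k'.calm m h h2
  · rcases lt_or_ge m j with h | h
    · exact k.noStart m h1 h
    · exact k'.noStart m h h2

lemma Keeps.refl {t : T} {j : ℕ} (g : E.Good j) : Keeps E t j [] j :=
  ⟨le_rfl, g, fun m h1 h2 => by omega, fun m h1 h2 => by omega, by simp [FreshAll]⟩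

section Rules

variable {t : T} {i : ℕ} {op : Op K V} {j₀ : ℕ} {Fr : List (Addr × Node K V)}

/-- A read after which more is to be remembered. -/
lemma safeFrom_read_succ {n : Addr} {f : Field} {nx : f.Ty K V → Prog K V} (hf : f ≠ .ver)
    (h : ∀ j, Keeps E t j₀ Fr j → Keeps E t j₀ Fr (j + 1) → E.Reads t j n f →
      SafeFrom E t i op (j + 1) Fr (nx ((E.cfg j).mem.node n f))) :
    SafeFrom E t i op j₀ Fr (.read n f nx) := by
  intro j k j' tk g
  have k' := k.wait tk.toWaits (by simp)
  have k'' := k'.succ tk hf g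
  exact h j' k' k'' ⟨tk.act, nx, tk.prog j' tk.le le_rfl⟩ _ ⟨le_rfl, g, fun m h1 h2 => by omega,
    fun m h1 h2 => by omega, k''.fresh⟩

lemma safeFrom_read_ver {n : Addr} {nx : ℕ → Prog K V}
    (h : ∀ j, Keeps E t j₀ Fr j → E.Good (j + 1) → E.InProgress (t, i) j → E.Reads t j n .ver →
      SafeFrom E t i op (j + 1) [] (nx ((E.cfg j).mem.node n .ver))) :
    SafeFrom E t i op j₀ Fr (.read n .ver nx) := by
  intro j k j' tk g
  have k' := k.wait tk.toWaits (by simp)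
  exact (h j' k' g tk.inProgress ⟨tk.act, nx, tk.prog j' tk.le le_rfl⟩).start g

/-- Incrementing the version of a locked node. -/
lemma safeFrom_incVer {n : Addr} {nx : Prog K V} (hn : n < (E.cfg j₀).mem.next)
    (hl : (E.cfg j₀).mem.lock n = some t)
    (h : ∀ j, j₀ ≤ j → E.Good j → MHold E t j₀ j → E.InProgress (t, i) j →
      WriteStep E t j n .ver (((E.cfg j).mem.node n .ver + 1 : ℕ)) →
      E.StepOK j ∧ (E.Good (j + 1) → SafeFrom E t i op (j + 1) [] nx)) :
    SafeFrom E t i op j₀ Fr (incVer n nx) := by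
  refine safeFrom_read_ver fun j k g hp hr => safeFrom_write fun j' k' hp' hw => ?_
  have hm : MHold E t j₀ j' := (k.mhold.trans hr.mhold).trans k'.mhold
  have hj : j₀ ≤ j' := k.le.trans ((Nat.le_succ j).trans k'.le)
  refine h j' hj k'.good hm hp' ?_
  rwa [(frame_node hj k'.good hm hn hl).1, ← k.node hn hl]

lemma safeFrom_lockAll {as : List Addr} {next : Prog K V} (hne : as ≠ []) : ∀ {S : List Addr}
    {j₀ : ℕ} {Fr : List (Addr × Node K V)}, Held E t S [] j₀ → (∀ n ∈ as, E.Ever j₀ n) → S.Nodup →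
    (∀ j, j₀ ≤ j → E.Good j → Quiet E t j₀ j → Held E t (as ++ S) [] j → (as ++ S).Nodup →
      SafeFrom E t i op j [] next) → SafeFrom E t i op j₀ Fr (lockAll as next) := by
  induction as with
  | nil => exact absurd rfl hne
  | cons n as ih =>
    intro S j₀ Fr hS he hnd h
    refine safeFrom_lock fun j k g hlk hl hm => ?_
    have hS' := (hS.frame k.le k.good k.mhold).locked k.good ((he n (by simp)).mono k.le) hl hm
      (rch_of_node_eq (by rw [hm]))
    have hq : Quiet E t j₀ (j + 1) := k.mhold.quiet.trans <| by
      obtain ⟨-, nx, h'⟩ := hlk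
      exact Quiet.step h' (by simp)
    have hnd' : (n :: S).Nodup := by
      refine List.nodup_cons.2 ⟨fun hn => ?_, hnd⟩
      have := ((hS.frame k.le k.good k.mhold).lock n).2 hn
      rw [hl] at this
      exact absurd this (by simp)
    have perm : (as ++ n :: S).Perm (n :: as ++ S) := List.perm_middle
    have hj : j₀ ≤ j + 1 := k.le.trans (Nat.le_succ j)
    rcases eq_or_ne as [] with rfl | has
    · exact h (j + 1) hj g hq hS' hnd'
    · refine ih has hS' (fun n' h' => (he n' (by simp [h'])).mono hj) hnd' ?_
      intro j' hj' g' hq' hS'' hnd''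
      exact h j' (hj.trans hj') g' (hq.trans hq') (hS''.congr fun n' => perm.symm.mem_iff)
        (perm.nodup_iff.1 hnd'')

lemma safeFrom_unlockAll {as : List Addr} {next : Prog K V} (hne : as ≠ []) : ∀ {j₀ : ℕ}
    {Fr : List (Addr × Node K V)}, Held E t as [] j₀ → as.Nodup →
    (∀ j, j₀ ≤ j → E.Good j → Quiet E t j₀ j → NoLocks E t j →
      SafeFrom E t i op j [] next) → SafeFrom E t i op j₀ Fr (unlockAll as next) := by
  induction as with
  | nil => exact absurd rfl hne
  | cons n as ih =>
    intro j₀ Fr hS hnd h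
    refine safeFrom_unlock fun j k => ?_
    have hS' := hS.frame k.le k.good k.mhold
    refine ⟨⟨(hS'.lock n).2 (by simp), hS'.even n (by simp),
      fun _ => hS'.clean n (by simp) (by simp)⟩, fun _ hq hm g => ?_⟩
    have hnd' := List.nodup_cons.1 hnd
    have hS'' : Held E t as [] (j + 1) := hS'.unlocked (n := n) (fun n' => by
      rw [List.mem_cons]
      constructor
      · exact fun h' => ⟨.inr h', fun e => hnd'.1 (e ▸ h')⟩
      · exact fun h' => h'.1.resolve_left h'.2) hm (rch_of_node_eq (by rw [hm]))
    have hq' : Quiet E t j₀ (j + 1) := k.mhold.quiet.trans (Quiet.step hq (by simp))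
    have hj : j₀ ≤ j + 1 := k.le.trans (Nat.le_succ j)
    rcases eq_or_ne as [] with rfl | has
    · exact h (j + 1) hj g hq' hS''.noLocks
    · exact ih has hS'' hnd'.2 fun j' hj' g' hq'' hN =>
        h j' (hj.trans hj') g' (hq'.trans hq'') hN

/-- Marking nodes, in particular the ones that have been unlinked. -/
lemma safeFrom_markAll {as S : List Addr} {next : Prog K V} (hne : as ≠ []) : ∀ {j₀ : ℕ}
    {Fr : List (Addr × Node K V)}, Held E t S as j₀ → (∀ n ∈ as, n ∈ S) →
    (∀ j, j₀ ≤ j → E.Good j → Held E t S [] j →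
      (∀ n ∈ S, (E.Rch j₀ n → E.Rch j n) ∧
        (n ∈ as ∨ (E.cfg j₀).mem.node n .marked = true → (E.cfg j).mem.node n .marked = true)) →
      SafeFrom E t i op j [] next) →
      SafeFrom E t i op j₀ Fr (markAll as next) := by
  induction as with
  | nil => exact absurd rfl hne
  | cons n as ih =>
    intro j₀ Fr hS has h
    refine safeFrom_write fun j k _ hw => ?_
    have hS' := hS.frame k.le k.good k.mhold
    have hn := has n (by simp)
    obtain ⟨hs, hok⟩ := stepOK_mark k.good hw ((hS'.lock n).2 hn) (hS'.ever n hn)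
    refine ⟨hok, fun g => ?_⟩
    have hmark : ∀ n', n' = n ∨ (E.cfg j).mem.node n' .marked = true →
        (E.cfg (j + 1)).mem.node n' .marked = true := by
      intro n' h'
      by_cases he : n' = n
      · subst he
        rw [hw.node, Function.update_self]
      · rw [hw.node_ne he]
        exact h'.resolve_left he
    have hS'' : Held E t S as (j + 1) := by
      refine ⟨fun n' => by rw [hw.lock]; exact hS'.lock n', fun n' h' =>
        (hS'.ever n' h').mono (Nat.le_succ j), fun n' h' => ?_, fun n' h' hM hr => hmark n' ?_⟩
      · rw [hw.field_ne (.inr (by simp))]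
        exact hS'.even n' h'
      · by_cases he : n' = n
        · exact .inl he
        · exact .inr (hS'.clean n' h' (by simp [he, hM]) fun hr' => hr (hs.reach_iff.2 hr'))
    have hj : j₀ ≤ j + 1 := k.le.trans (Nat.le_succ j)
    have hstep : ∀ n' ∈ S, (E.Rch j₀ n' → E.Rch (j + 1) n') ∧
        (n' = n ∨ (E.cfg j₀).mem.node n' .marked = true →
          (E.cfg (j + 1)).mem.node n' .marked = true) := by
      intro n' h'
      have hl := (hS.lock n').2 h'
      refine ⟨fun hr => hs.reach_iff.2 (k.rch hl hr), fun hm => hmark n' ?_⟩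
      rwa [k.node (k.good.ever_lt k.le (hS.ever n' h')) hl]
    rcases eq_or_ne as [] with rfl | hne'
    · exact h (j + 1) hj g hS'' fun n' h' => by simpa using hstep n' h'
    · refine ih hne' hS'' (fun n' h' => has n' (by simp [h'])) fun j' hj' g' hH hst =>
        h j' (hj.trans hj') g' hH fun n' h' => ⟨fun hr => (hst n' h').1 ((hstep n' h').1 hr),
          fun hm => (hst n' h').2 ?_⟩
      rw [List.mem_cons] at hm
      rcases hm with (hm | hm) | hm
      · exact .inr ((hstep n' h').2 (.inl hm))
      · exact .inl hm
      · exact .inr ((hstep n' h').2 (.inr hm))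

lemma safeFrom_ifMarked {S : List Addr} (hS : Held E t S [] j₀) (g : E.Good j₀)
    {as : List Addr} {yes no : Prog K V} (has : ∀ n ∈ as, n ∈ S)
    (hy : SafeFrom E t i op j₀ Fr yes)
    (hn : (∀ n ∈ as, E.Rch j₀ n) → SafeFrom E t i op j₀ Fr no) :
    SafeFrom E t i op j₀ Fr (ifMarked as yes no) := by
  induction as with
  | nil => exact hn (by simp)
  | cons n as ih =>
    have hnS : n ∈ S := has n (by simp)
    refine safeFrom_read_locked (by simp) (g.ever_lt le_rfl (hS.ever n hnS)) ((hS.lock n).2 hnS) ?_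
    split_ifs with hm
    · exact hy
    · refine ih (fun n' h' => has n' (by simp [h'])) fun h' => hn fun n' hn' => ?_
      rcases List.mem_cons.1 hn' with rfl | hn'
      · exact hS.rch hnS hm
      · exact h' n' hn'

lemma safeFrom_ifTagged {S : List Addr} (hS : Held E t S [] j₀) (g : E.Good j₀)
    {as : List Addr} {yes no : Prog K V} (has : ∀ n ∈ as, n ∈ S)
    (hy : SafeFrom E t i op j₀ Fr yes)
    (hn : (∀ n ∈ as, (E.cfg j₀).mem.node n .kind ≠ .tagged) → SafeFrom E t i op j₀ Fr no) :
    SafeFrom E t i op j₀ Fr (ifTagged as yes no) := by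
  induction as with
  | nil => exact hn (by simp)
  | cons n as ih =>
    have hnS : n ∈ S := has n (by simp)
    refine safeFrom_read_locked (by simp) (g.ever_lt le_rfl (hS.ever n hnS)) ((hS.lock n).2 hnS) ?_
    split_ifs with hm
    · exact hy
    · refine ih (fun n' h' => has n' (by simp [h'])) fun h' => hn fun n' hn' => ?_
      rcases List.mem_cons.1 hn' with rfl | hn'
      · exact hm
      · exact h' n' hn'

lemma safeFrom_readKeys {n : Addr} (hn : n < (E.cfg j₀).mem.next)
    (hl : (E.cfg j₀).mem.lock n = some t) {ks : List K}
    (hk : ∀ x, (E.cfg j₀).mem.node n (.key x) = ks[x]?) :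
    ∀ {next : List K → Prog K V} {x fuel : ℕ}, x + fuel = ks.length →
      SafeFrom E t i op j₀ Fr (next (ks.drop x)) →
      SafeFrom E t i op j₀ Fr (readKeys n next x fuel) := by
  intro next x fuel
  induction fuel generalizing next x with
  | zero =>
    intro hx h
    rwa [List.drop_of_length_le (by omega)] at h
  | succ fuel ih =>
    intro hx h
    have hlt : x < ks.length := by omega
    refine safeFrom_read_locked (by simp) hn hl ?_
    rw [hk, List.getElem?_eq_getElem hlt]
    exact ih (by omega) (by rwa [List.drop_eq_getElem_cons hlt] at h)

lemma safeFrom_readPtrs {n : Addr} (hn : n < (E.cfg j₀).mem.next)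
    (hl : (E.cfg j₀).mem.lock n = some t) {cs : List Addr}
    (hk : ∀ x, (E.cfg j₀).mem.node n (.ptr x) = cs[x]?) :
    ∀ {next : List Addr → Prog K V} {x fuel : ℕ}, x + fuel = cs.length →
      SafeFrom E t i op j₀ Fr (next (cs.drop x)) →
      SafeFrom E t i op j₀ Fr (readPtrs n next x fuel) := by
  intro next x fuel
  induction fuel generalizing next x with
  | zero =>
    intro hx h
    rwa [List.drop_of_length_le (by omega)] at h
  | succ fuel ih =>
    intro hx h
    have hlt : x < cs.length := by omega
    refine safeFrom_read_locked (by simp) hn hl ?_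
    rw [hk, List.getElem?_eq_getElem hlt]
    exact ih (by omega) (by rwa [List.drop_eq_getElem_cons hlt] at h)

lemma safeFrom_readInternal {n : Addr} (hn : n < (E.cfg j₀).mem.next)
    (hl : (E.cfg j₀).mem.lock n = some t) {ks : List K} {cs : List Addr}
    (hi : IsInternal ((E.cfg j₀).mem.node n) ks cs) (hlen : cs.length = ks.length + 1)
    {next : List K → List Addr → Prog K V} (h : SafeFrom E t i op j₀ Fr (next ks cs)) :
    SafeFrom E t i op j₀ Fr (readInternal n next) := by
  refine safeFrom_read_locked (by simp) hn hl ?_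
  refine safeFrom_readKeys hn hl hi.key_eq (by rw [hi.size_eq, hlen]; simp) ?_
  exact safeFrom_readPtrs hn hl hi.ptr_eq (by rw [hi.size_eq]; simp) (by simpa using h)

/-- The pairs in the slots `x, ..., x + fuel - 1` of a leaf. -/
def pairsFrom (nd : Node K V) : ℕ → ℕ → List (K × V)
  | _, 0 => []
  | x, fuel + 1 =>
    match nd (.key x), nd (.val x) with
    | some k, some v => (k, v) :: pairsFrom nd (x + 1) fuel
    | _, _ => pairsFrom nd (x + 1) fuel

lemma safeFrom_readPairs {n : Addr} (hn : n < (E.cfg j₀).mem.next)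
    (hl : (E.cfg j₀).mem.lock n = some t) : ∀ {next : List (K × V) → Prog K V} {x fuel : ℕ},
      SafeFrom E t i op j₀ Fr (next (pairsFrom ((E.cfg j₀).mem.node n) x fuel)) →
      SafeFrom E t i op j₀ Fr (readPairs n next x fuel) := by
  intro next x fuel
  induction fuel generalizing next x with
  | zero => exact id
  | succ fuel ih =>
    intro h
    refine safeFrom_read_locked (by simp) hn hl ?_
    rw [pairsFrom] at h
    cases hk : (E.cfg j₀).mem.node n (.key x) with
    | none => exact ih (by rwa [hk] at h)
    | some k =>
      refine safeFrom_read_locked (by simp) hn hl ?_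
      cases hv : (E.cfg j₀).mem.node n (.val x) with
      | none => exact safeFrom_crash
      | some v => exact ih (by rwa [hk, hv] at h)

lemma safeFrom_findSlot {n : Addr} (hn : n < (E.cfg j₀).mem.next)
    (hl : (E.cfg j₀).mem.lock n = some t) {y : Option K} {found : ℕ → Prog K V}
    {notFound : Prog K V}
    (hf : ∀ x < b, (E.cfg j₀).mem.node n (.key x) = y → SafeFrom E t i op j₀ Fr (found x))
    (hnf : (∀ x < b, (E.cfg j₀).mem.node n (.key x) ≠ y) → SafeFrom E t i op j₀ Fr notFound) :
    SafeFrom E t i op j₀ Fr (findSlot n y found notFound 0 b) := by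
  have key : ∀ fuel x, x + fuel = b → (∀ x' < x, (E.cfg j₀).mem.node n (.key x') ≠ y) →
      SafeFrom E t i op j₀ Fr (findSlot n y found notFound x fuel) := by
    intro fuel
    induction fuel with
    | zero =>
      intro x hx h
      exact hnf fun x' hx' => h x' (by omega)
    | succ fuel ih =>
      intro x hx h
      refine safeFrom_read_locked (by simp) hn hl ?_
      split_ifs with hy
      · exact hf x (by omega) hy
      · refine ih (x + 1) (by omega) fun x' hx' => ?_
        rcases Nat.lt_succ_iff_lt_or_eq.1 hx' with h' | rfl
        · exact h x' h'
        · exact hy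
  exact key b 0 (by omega) fun x' h => by omega

/-- Scanning a leaf without holding its lock. -/
lemma safeFrom_findSlot_unlocked {s : ℕ} {n : Addr} {y : Option K} {found : ℕ → Prog K V}
    {notFound : Prog K V} {B : ℕ}
    (hf : ∀ j x, Keeps E t s Fr j → Keeps E t s Fr (j + 1) → x < B →
      (E.cfg j).mem.node n (.key x) = y → SafeFrom E t i op (j + 1) Fr (found x))
    (hnf : ∀ j, Keeps E t s Fr j → (∀ x < B, ∃ m, s ≤ m ∧ m ≤ j ∧
      (E.cfg m).mem.node n (.key x) ≠ y) → SafeFrom E t i op j Fr notFound) :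
    ∀ (fuel x j : ℕ), x + fuel = B → Keeps E t s Fr j →
      (∀ x' < x, ∃ m, s ≤ m ∧ m ≤ j ∧ (E.cfg m).mem.node n (.key x') ≠ y) →
      SafeFrom E t i op j Fr (findSlot n y found notFound x fuel) := by
  intro fuel
  induction fuel with
  | zero =>
    intro x j hx k h
    exact hnf j k fun x' hx' => h x' (by omega)
  | succ fuel ih =>
    intro x j hx k h
    refine safeFrom_read_succ (by simp) fun j' k' k'' _ => ?_
    split_ifs with hy
    · exact hf j' x (k.trans k') (k.trans k'') (by omega) hy
    · refine ih (x + 1) (j' + 1) (by omega) (k.trans k'') fun x' hx' => ?_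
      rcases Nat.lt_succ_iff_lt_or_eq.1 hx' with h' | rfl
      · obtain ⟨m, h1, h2, h3⟩ := h x' h'
        exact ⟨m, h1, h2.trans k''.le, h3⟩
      · exact ⟨j', (k.trans k').le, Nat.le_succ _, hy⟩

/-- The inner loop of a search follows the routing keys, which are immutable. -/
lemma safeFrom_route {n : Addr} {key : K} {ks : List K} (hs : ks.Pairwise (· < ·))
    (hk : ∀ j, Keeps E t j₀ Fr j → ∀ x, (E.cfg j).mem.node n (.key x) = ks[x]?)
    {next : ℕ → Prog K V} (h : SafeFrom E t i op j₀ Fr (next (idx ks key))) :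
    SafeFrom E t i op j₀ Fr (route key n next 0 ks.length) := by
  have aux : ∀ fuel x, x + fuel = ks.length → (∀ z ∈ ks.take x, z ≤ key) →
      SafeFrom E t i op j₀ Fr (route key n next x fuel) := by
    intro fuel
    induction fuel with
    | zero =>
      intro x hx h'
      rw [show x = ks.length by omega, List.take_length] at h'
      rw [idx_eq_length.2 h'] at h
      rwa [show x = ks.length by omega]
    | succ fuel ih =>
      intro x hx h'
      have hlt : x < ks.length := by omega
      refine safeFrom_read_const (by simp) _ (fun j k => hk j k x) ?_
      rw [List.getElem?_eq_getElem hlt]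
      dsimp only
      split_ifs with hle
      · refine ih (x + 1) (by omega) fun z hz => ?_
        rw [List.take_succ_eq_append_getElem hlt, List.mem_append, List.mem_singleton] at hz
        rcases hz with hz | rfl
        · exact h' z hz
        · exact hle
      · have : idx ks key = x := by
          conv_lhs => rw [← List.take_append_drop x ks]
          rw [idx_append, idx_eq_length.2 h', idx_eq_zero.2, List.length_take]
          · omega
          · intro z hz
            rw [List.drop_eq_getElem_cons hlt] at hz
            have hs' := hs.sublist (List.drop_sublist x ks)
            rw [List.drop_eq_getElem_cons hlt] at hs'
            rcases List.mem_cons.1 hz with rfl | hz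
            · exact not_le.1 hle
            · exact (not_le.1 hle).trans ((List.pairwise_cons.1 hs').1 z hz)
        rwa [this] at h
  exact aux ks.length 0 (by omega) (by simp)

end Rules

end Execution

end OCC

namespace OCC

namespace Execution

variable {K V T : Type} [LinearOrder K] [DecidableEq T] {a b : ℕ} {E : Execution K V T a b}

/-! ### Searches -/

lemma NoLocks.frame {t : T} {j j' : ℕ} (h : NoLocks E t j) (hj : j ≤ j') (g : E.Good j')
    (hm : MHold E t j j') : NoLocks E t j' := (h.held.frame hj g hm).noLocks

lemma SeenOn.mono {t : T} {i j j' : ℕ} {k : K} {n : Addr} (h : SeenOn E t i j k n) (hj : j ≤ j')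
    (hs : ∀ s, j ≤ s → s < j' → ¬ E.StartsSearch t s) : SeenOn E t i j' k n := by
  obtain ⟨m, h1, h2, h3, h4⟩ := h
  refine ⟨m, h1, h2.trans hj, h3, fun s h5 h6 => ?_⟩
  rcases lt_or_ge s j with h' | h'
  · exact h4 s h5 h'
  · exact hs s h' h6

lemma SeenOn.ever {t : T} {i j : ℕ} {k : K} {n : Addr} (h : SeenOn E t i j k n) : E.Ever j n := by
  obtain ⟨m, -, h2, h3, -⟩ := h
  exact ⟨m, h2, OnPath.reachable h3⟩

lemma Pre.quiet {t : T} {i j j' : ℕ} (h : Pre E t i j) (hq : Quiet E t j j') : Pre E t i j' :=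
  h.extend hq

lemma CallerOK.mono {t : T} {i j j' : ℕ} {op : Op K V} {key : K} {target : Option Addr}
    {c : Caller K V} (h : CallerOK E t i op j key target c) (hj : j ≤ j') (g : E.Good j')
    (hq : Quiet E t j j') : CallerOK E t i op j' key target c := by
  cases c with
  | op o => exact ⟨h.1, h.2.1.quiet hq, h.2.2⟩
  | fixTagged n todo res =>
    obtain ⟨h1, h2, h3, h4⟩ := h
    exact ⟨h1.trans_le (g.next_mono hj le_rfl), (g.kind hj le_rfl h1).trans h2,
      h3.mono g hj le_rfl, h4.mono hj⟩
  | fixUnderfull n todo res => exact ⟨h.1.mono g hj le_rfl, h.2.mono hj⟩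

/-- The assertion at the head of the loop still holds after the jump. -/
lemma LInv.enter {t : T} {i j : ℕ} {op : Op K V} {c : Caller K V} {key : K}
    {target : Option Addr} {path : PathInfo} (h : LInv E t i op j (.search c key target path))
    (hp : (E.cfg j).thread t = some (.goto (.search c key target path))) (g : E.Good (j + 1)) :
    LInv E t i op (j + 1) (.search c key target path) := by
  obtain ⟨h1, h2, h3, h4⟩ := h
  have hm : MHold E t j (j + 1) := MHold.step hp trivial
  refine ⟨h1.frame (Nat.le_succ j) g hm, ?_, h3.mono (Nat.le_succ j),
    h4.mono (Nat.le_succ j) g hm.quiet⟩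
  by_cases hst : path = PathInfo.start
  · obtain ⟨m, hm1, hm2, -⟩ := h2
    subst hst
    exact ⟨j, hm1.trans_le hm2, Nat.le_succ j, onPath_entry _ _, fun s h1 h2 => by omega⟩
  · refine h2.mono (Nat.le_succ j) fun s hs1 hs2 => ?_
    obtain rfl : s = j := by omega
    rintro ⟨c', key', target', h'⟩
    rw [hp] at h'
    have := Prog.goto.inj (Option.some.inj h')
    cases this
    exact hst rfl

section

variable {t : T} {i : ℕ} {op : Op K V} {j : ℕ}

lemma safeFrom_searchIter {c : Caller K V} {key : K} {target : Option Addr} {path : PathInfo}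
    (g : E.Good j) (h : LInv E t i op j (.search c key target path))
    (hT : ∀ todo res, c = .fixTagged path.n todo res →
      SafeFrom E t i op j [] (fixTaggedFound b path.n path todo res))
    (hU : ∀ todo res, c = .fixUnderfull path.n todo res →
      SafeFrom E t i op j [] (fixUnderfullFound a b path.n path todo res)) :
    SafeFrom E t i op j [] (searchIter a b c key target path) := by
  obtain ⟨hN, hs, hp, hc⟩ := h
  have hlt := g.ever_lt le_rfl hs.ever
  refine safeFrom_read_const (by simp) _ (fun j' k => k.good.kind k.le le_rfl hlt) ?_
  split_ifs with hk
  · cases c with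
    | op o =>
      refine safeFrom_goto (by simp) fun j' k => ?_
      obtain ⟨h1, h2, h3, h4⟩ := hc
      refine ⟨hN.frame k.le k.good k.mhold, h1, h2.quiet k.mhold.quiet, ?_, ?_, hp.mono k.le⟩
      · rw [← h3]
        exact hs.mono k.le k.noStart
      · rw [k.good.kind k.le le_rfl hlt]
        simpa [h4] using hk
    | fixTagged node todo res =>
      simp only [searchDone]
      split_ifs with hn
      · subst hn
        exact hT todo res rfl
      · refine safeFrom_goto (by simp) fun j' k => ?_
        exact ⟨hN.frame k.le k.good k.mhold, hc.2.2.1.mono k.good k.le le_rfl,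
          hc.2.2.2.mono k.le⟩
    | fixUnderfull node todo res =>
      simp only [searchDone]
      split_ifs with hn
      · subst hn
        exact hU todo res rfl
      · refine safeFrom_goto (by simp) fun j' k => ?_
        exact ⟨hN.frame k.le k.good k.mhold, hc.1.mono k.good k.le le_rfl, hc.2.mono k.le⟩
  · have hk' : (E.cfg j).mem.node path.n .kind ≠ .leaf := fun h => hk (.inl h)
    obtain ⟨m, hm1, hm2, hm3, hm4⟩ := hs
    obtain ⟨H, w⟩ := (g.inv m hm2).wf
    have hltm := g.rch_lt hm2 (OnPath.reachable hm3)
    have hkm : (E.cfg m).mem.node path.n .kind ≠ .leaf := by rwa [← g.kind hm2 le_rfl hltm]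
    obtain ⟨ks, cs, hi, hlen, hsort, -⟩ := w.shape path.n (OnPath.reachable hm3) hkm
    have himm : ∀ j', Keeps E t j [] j' → (E.cfg j').mem.node path.n .size = (ks.length + 1 : ℕ) ∧
        ∀ x, (E.cfg j').mem.node path.n (.key x) = ks[x]? := fun j' k => by
      obtain ⟨e1, e2⟩ := k.good.imm (hm2.trans k.le) le_rfl hltm hkm
      exact ⟨by rw [e1, hi.size_eq, hlen], fun x => by rw [e2, hi.key_eq]⟩
    refine safeFrom_read_const (by simp) _ (fun j' k => (himm j' k).1) ?_
    simp only [Nat.add_sub_cancel]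
    refine safeFrom_route hsort (fun j' k => (himm j' k).2) ?_
    refine safeFrom_read_succ (by simp) fun j' k k' _ => ?_
    cases hptr : (E.cfg j').mem.node path.n (.ptr (idx ks key)) with
    | none => exact safeFrom_crash
    | some child =>
      refine safeFrom_goto (by simp [PathInfo.start]) fun j'' k₂ => ?_
      have k'' := k'.trans k₂
      have hj' : j' ≤ j'' := (Nat.le_succ j').trans k₂.le
      refine ⟨hN.frame k''.le k''.good k''.mhold, ?_, ⟨?_, ?_⟩,
        hc.mono k''.le k''.good k''.mhold.quiet⟩
      · obtain ⟨m', a1, a2, a3⟩ := k''.good.on_child (hm2.trans k.le) hj' hm3 hi hptr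
        refine ⟨m', hm1.trans_le a1, a2.trans hj', a3, fun s h1 h2 => ?_⟩
        rcases lt_or_ge s j with h' | h'
        · exact hm4 s (by omega) h'
        · exact k''.noStart s h' h2
      · rintro p h
        obtain rfl := Option.some.inj h
        exact ⟨m, j', hm2.trans k.le, hj', OnPath.reachable hm3, hkm, hptr⟩
      · rintro gp p h1 h2
        obtain rfl := Option.some.inj h2
        exact (hp.1 gp h1).mono k''.le

end

/-! ### Operations that do not modify the dictionary -/

/-- An operation that returns `res` as the entry of its key does not modify the dictionary. -/
def _root_.OCC.Op.ReadOnly : Op K V → Option V → Prop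
  | .find _, _ => True
  | .insert _ _, res => res.isSome = true
  | .delete _, res => res = none

lemma apply_of_readOnly {D : Dict K V} {op : Op K V} {res : Option V} (h : D op.key = res)
    (hop : op.ReadOnly res) : op.apply D = (D, res) := by
  cases op with
  | find k => exact Prod.ext rfl h
  | insert k v =>
    obtain ⟨w, rfl⟩ := Option.isSome_iff_exists.1 hop
    change D k = some w at h
    simp [Op.apply, h]
  | delete k =>
    obtain rfl := hop
    change D k = none at h
    simp [Op.apply, h]

lemma Reads.unique {t : T} {j : ℕ} {n n' : Addr} {f f' : Field} (h : E.Reads t j n f)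
    (h' : E.Reads t j n' f') : n = n' ∧ f = f' := by
  obtain ⟨-, nx, h⟩ := h
  obtain ⟨-, nx', h'⟩ := h'
  rw [h] at h'
  have := Option.some.inj h'
  cases this
  exact ⟨rfl, rfl⟩

/-- The operations that are decided by `searchLeaf`. Between the two reads of the same even version
the leaf is constant, and whenever it is in the tree it determines the entry of the key. If it has been
unlinked before, then this happened after the search visited it, at configuration `m` or later, and the
leaf has not changed since. -/
lemma resOK_of_searchLeaf {t : T} {i r m s₁ s₂ : ℕ} {op : Op K V} {l : Addr} {res : Option V}
    (g : E.Good r) (hpre : Pre E t i r) (him : i < m) (hm : m ≤ s₁) (hon : E.On m op.key l)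
    (h12 : s₁ < s₂) (h2r : s₂ < r) (hr1 : E.Reads t s₁ l .ver) (hr2 : E.Reads t s₂ l .ver)
    (hk : (E.cfg m).mem.node l .kind = .leaf)
    (hv : (E.cfg s₁).mem.node l .ver = (E.cfg s₂).mem.node l .ver)
    (he : Even ((E.cfg s₁).mem.node l .ver))
    (c1 : ∀ u, s₁ < u → u < s₂ → (∀ n, ¬ E.Locks t u n) ∧ ∀ n, ¬ E.Reads t u n .ver)
    (c2 : ∀ u, s₂ < u → u < r → (∀ n, ¬ E.Locks t u n) ∧ ∀ n, ¬ E.Reads t u n .ver)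
    (hN : ∀ u, s₂ < u → u ≤ r → NoLocks E t u)
    (hslot : ∀ v, res = some v ↔ SlotHas b ((E.cfg s₁).mem.node l) op.key v)
    (hop : op.ReadOnly res) : ResOK E t i op r res := by
  have hlt : l < (E.cfg m).mem.next := g.rch_lt (by omega) (OnPath.reachable hon)
  have hlt1 := hlt.trans_le (g.next_mono hm (by omega))
  have hk1 : (E.cfg s₁).mem.node l .kind = .leaf := (g.kind hm (by omega) hlt).trans hk
  have nolock2 : ∀ n, ¬ E.Locks t s₂ n := by
    rintro n ⟨-, nx, h⟩
    obtain ⟨-, nx', h'⟩ := hr2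
    rw [h'] at h
    exact absurd (Option.some.inj h) (by simp)
  -- the dictionary at a configuration in which the leaf is in the tree
  have hdict : ∀ j, m ≤ j → j ≤ r → E.Rch j l → Even ((E.cfg j).mem.node l .ver) →
      (∀ f, f ≠ .marked → (E.cfg j).mem.node l f = (E.cfg s₁).mem.node l f) →
      op.apply (E.dict j) = (E.dict j, res) := by
    intro j h1 h2 hr hev hf
    refine apply_of_readOnly ?_ hop
    refine Option.ext fun v => ?_
    rw [(g.inv j h2).dict_leaf hr ((g.kind h1 h2 hlt).trans hk)
      ((g.on_iff h1 h2 (OnPath.reachable hon) hr).2 hon), le_even hev, hslot]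
    simp only [SlotHas, hf _ (by simp : Field.key _ ≠ .marked),
      hf _ (by simp : Field.val _ ≠ .marked)]
  have hin : ∀ j, s₁ ≤ j → j ≤ s₂ → E.Rch j l → op.apply (E.dict j) = (E.dict j, res) := by
    intro j h1 h2 hr
    have hc : ∀ f, f ≠ .marked → (E.cfg j).mem.node l f = (E.cfg s₁).mem.node l f := fun f hf =>
      g.leaf_const h1 h2 h2r.le hlt1 hk1 he hv hf
    exact hdict j (by omega) (by omega) hr (by rwa [hc .ver (by simp)]) hc
  -- likewise just before the leaf is unlinked
  have hout : ∀ j, j < s₁ → E.Rch j l → ¬ E.Rch (j + 1) l →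
      m ≤ j ∧ op.apply (E.dict j) = (E.dict j, res) := by
    intro j h1 hr hnr
    have hmj : m ≤ j := by
      by_contra hc
      exact g.not_rch (j := j + 1) (j' := m) (by omega) (by omega)
        ((ever_of_rch hr).mono (Nat.le_succ j)) hnr (OnPath.reachable hon)
    obtain ⟨u1, u2, -⟩ := (g.trans j (by omega)).unlink l hr hnr
    refine ⟨hmj, hdict j hmj (by omega) hr (u2 ((g.kind hmj (by omega) hlt).trans hk))
      fun f hf => ?_⟩
    rw [← u1, g.frozen (j := j + 1) (j' := s₁) (by omega) (by omega)
      ((ever_of_rch hr).mono (Nat.le_succ j)) hnr hf]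
  have hci : E.ConsistentInterval (t, i) r l s₁ s₂ := by
    refine ⟨by dsimp only; omega, h12, h2r, hr1, hr2, hv, he, fun u n h1 h2 hu => ?_,
      fun u n h1 h2 => ?_⟩
    · rcases lt_trichotomy u s₂ with h | h | h
      · exact absurd hu ((c1 u h1 h).2 n)
      · exact h
      · exact absurd hu ((c2 u h h2).2 n)
    · rcases lt_trichotomy u s₂ with h | rfl | h
      · exact (c1 u h1 h).1 n
      · exact nolock2 n
      · exact (c2 u h h2).1 n
  -- the reads of the version after which the operation returns are the ones of the definition
  have huniq : ∀ {l' s₁' s₂'}, E.ConsistentInterval (t, i) r l' s₁' s₂' →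
      l' = l ∧ s₁' = s₁ ∧ s₂' = s₂ := by
    rintro l' s₁' s₂' ⟨-, b2, b3, b4, b5, -, -, b8, -⟩
    obtain rfl : s₂' = s₂ := by
      rcases lt_or_ge s₁' s₂ with h | h
      · exact (b8 s₂ l h h2r hr2).symm
      · exact absurd b5 ((c2 s₂' (by omega) b3).2 l')
    obtain rfl : s₁' = s₁ := by
      rcases lt_trichotomy s₁' s₁ with h | h | h
      · have := b8 s₁ l h (by omega) hr1
        omega
      · exact h
      · exact absurd b4 ((c1 s₁' h b2).2 l')
    exact ⟨(b4.unique hr1).1, rfl, rfl⟩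
  have hsearch : ∀ j, E.SearchPoint (t, i) r j → i < j ∧ j ≤ r ∧
      op.apply (E.dict j) = (E.dict j, res) := by
    rintro j ⟨l', s₁', s₂', hci', hj⟩
    obtain ⟨rfl, rfl, rfl⟩ := huniq hci'
    rcases hj with ⟨h1, h2, h3⟩ | ⟨-, h1, h2, h3, h4⟩
    · exact ⟨by omega, by omega, hin j h1 h2 h3⟩
    · exact ⟨h1, by omega, (hout j h2 h3 h4).2⟩
  have hno : ∀ j, ¬ E.LockPoint (t, i) r j := by
    rintro j ⟨h1, h2, ⟨l', -, h3⟩, h4⟩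
    rcases lt_or_ge s₂ j with h | h
    · exact hN j h h2 l' h3
    · exact (h4 s₂ l h h2r).2 hr2
  have hex : ∃ j, E.SearchPoint (t, i) r j := by
    by_cases hx : ∃ u, s₁ ≤ u ∧ u ≤ s₂ ∧ E.Rch u l
    · obtain ⟨u, h1, h2, h3⟩ := hx
      exact ⟨u, l, s₁, s₂, hci, .inl ⟨h1, h2, h3⟩⟩
    · have hx' : ∀ u, s₁ ≤ u → u ≤ s₂ → ¬ E.Rch u l := fun u h1 h2 h3 => hx ⟨u, h1, h2, h3⟩
      obtain ⟨u, h1, h2, h3, h4⟩ := exists_unlink hm (OnPath.reachable hon) (hx' s₁ le_rfl h12.le)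
      exact ⟨u, l, s₁, s₂, hci, .inr ⟨hx', by dsimp only; omega, h2, h3, h4⟩⟩
  refine .inr ⟨fun u hu => hpre.not_updatePoint hu, ?_, fun j hj => ?_⟩
  · obtain ⟨j, hj⟩ := hex
    cases op with
    | find => exact ⟨j, hj⟩
    | insert => exact ⟨j, .inl hj⟩
    | delete => exact ⟨j, .inl hj⟩
  · cases op with
    | find => exact hsearch j hj
    | insert => exact hsearch j (hj.resolve_right (hno j))
    | delete => exact hsearch j (hj.resolve_right (hno j))

/-- The operations that lock a leaf in step `s`, do not modify it, unlock it in step `u`, and return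
in step `r`. -/
lemma resOK_of_lock {t : T} {i r m s u : ℕ} {op : Op K V} {l : Addr} {res : Option V}
    (g : E.Good r) (hpre : Pre E t i r) (him : i < m) (hm : m ≤ s) (hon : E.On m op.key l)
    (hk : (E.cfg m).mem.node l .kind = .leaf) (hsu : s + 1 ≤ u) (hur : u < r)
    (hls : E.Locks t s l) (hh : Held E t [l] [] (s + 1)) (hr : E.Rch (s + 1) l)
    (c : ∀ w, s < w → w < r → (∀ n, ¬ E.Locks t w n) ∧ ∀ n, ¬ E.Reads t w n .ver)
    (hmh : MHold E t (s + 1) u) (hN : ∀ w, u < w → w ≤ r → NoLocks E t w)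
    (hslot : ∀ v, res = some v ↔ SlotHas b ((E.cfg (s + 1)).mem.node l) op.key v)
    (hop : op.ReadOnly res) (hf : ∀ k, op ≠ .find k) : ResOK E t i op r res := by
  have hlt : l < (E.cfg m).mem.next := g.rch_lt (by omega) (OnPath.reachable hon)
  have hframe : ∀ j, s + 1 ≤ j → j ≤ u → (E.cfg j).mem.node l = (E.cfg (s + 1)).mem.node l ∧
      E.Rch j l := fun j h1 h2 => by
    obtain ⟨f1, f2⟩ := frame_node h1 (g.mono (by omega)) (fun w h3 h4 => hmh w h3 (by omega))
      (hlt.trans_le (g.next_mono (by omega) (by omega))) ((hh.lock l).2 (by simp))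
    exact ⟨f1, f2 hr⟩
  have hlp : ∀ j, E.LockPoint (t, i) r j → i < j ∧ j ≤ r ∧
      op.apply (E.dict j) = (E.dict j, res) := by
    rintro j ⟨h1, h2, ⟨l', -, h3⟩, h4⟩
    refine ⟨h1, h2, ?_⟩
    have hsj : s + 1 ≤ j := by
      by_contra hc
      exact (h4 s l (by omega) (by omega)).1 hls
    have hju : j ≤ u := by
      by_contra hc
      exact hN j (by omega) h2 l' h3
    obtain ⟨f1, f2⟩ := hframe j hsj hju
    refine apply_of_readOnly ?_ hop
    refine Option.ext fun v => ?_
    rw [(g.inv j h2).dict_leaf f2 ((g.kind (by omega) h2 hlt).trans hk)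
      ((g.on_iff (by omega) h2 (OnPath.reachable hon) f2).2 hon),
      le_even (by rw [f1]; exact hh.even l (by simp)), hslot, f1]
  have hsp : ∀ j, ¬ E.SearchPoint (t, i) r j := by
    rintro j ⟨l', s₁, s₂, ⟨-, b2, b3, b4, b5, -, -, -, b9⟩, -⟩
    rcases lt_trichotomy s₁ s with h | rfl | h
    · exact b9 s l h (by omega) hls
    · obtain ⟨-, nx, h'⟩ := hls
      obtain ⟨-, nx', h''⟩ := b4
      rw [h'] at h''
      exact absurd (Option.some.inj h'') (by simp)
    · exact (c s₁ h (by omega)).2 l' b4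
  have hex : E.LockPoint (t, i) r (s + 1) := by
    refine ⟨by dsimp only; omega, by omega, ⟨l, (g.kind (by omega) (by omega) hlt).trans hk,
      (hh.lock l).2 (by simp)⟩, fun w n h1 h2 => ?_⟩
    exact ⟨(c w (by omega) h2).1 n, (c w (by omega) h2).2 n⟩
  refine .inr ⟨fun u hu => hpre.not_updatePoint hu, ⟨s + 1, ?_⟩, fun j hj => ?_⟩
  · cases op with
    | find k => exact absurd rfl (hf k)
    | insert => exact .inr hex
    | delete => exact .inr hex
  · cases op with
    | find k => exact absurd rfl (hf k)
    | insert => exact hlp j (hj.resolve_left (hsp j))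
    | delete => exact hlp j (hj.resolve_left (hsp j))

end Execution

end OCC

namespace OCC

section LeafUpdates

variable {K V : Type} {b : ℕ} {nd nd' : Node K V} {x : ℕ} {k : K} {v : V}

/-! ### Changing a slot of a leaf -/

lemma LeafOK.congr (h : LeafOK b nd) (hf : ∀ f, f ≠ .ver → nd' f = nd f) : LeafOK b nd' := by
  obtain ⟨h1, h2, h3⟩ := h
  refine ⟨?_, ?_, ?_⟩ <;> simpa only [hf _ (by simp : Field.key _ ≠ .ver),
    hf _ (by simp : Field.val _ ≠ .ver), hf _ (by simp : Field.size ≠ .ver)]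

lemma SlotHas.congr (hf : ∀ f, f ≠ .ver → nd' f = nd f) : SlotHas b nd' k v ↔ SlotHas b nd k v := by
  simp only [SlotHas, hf _ (by simp : Field.key _ ≠ .ver), hf _ (by simp : Field.val _ ≠ .ver)]

lemma LeafOK.insert (h : LeafOK b nd) (hx : x < b) (hn : nd (.key x) = none)
    (hk : ∀ y < b, nd (.key y) ≠ some k)
    (h1 : ∀ y, nd' (.key y) = if y = x then some k else nd (.key y))
    (h2 : ∀ y, nd' (.val y) = if y = x then some v else nd (.val y))
    (h3 : nd' .size = (nd .size + 1 : ℕ)) : LeafOK b nd' := by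
  refine ⟨fun y hy k' hk' => ?_, fun y hy y' hy' k' e1 e2 => ?_, ?_⟩
  · rw [h1] at hk'
    rw [h2]
    split_ifs at hk' ⊢ with hyx
    · exact ⟨v, rfl⟩
    · exact h.val y hy k' hk'
  · rw [h1] at e1 e2
    split_ifs at e1 e2 with hyx hyx' hyx'
    · rw [hyx, hyx']
    · exact absurd (e2.trans e1.symm) (hk y' hy')
    · exact absurd (e1.trans e2.symm) (hk y hy)
    · exact h.inj y hy y' hy' k' e1 e2
  · rw [h3, h.size, ← Finset.card_insert_of_notMem (a := x)]
    · congr 1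
      ext y
      simp only [Finset.mem_insert, Finset.mem_filter, Finset.mem_range, h1]
      by_cases hyx : y = x
      · simp [hyx, hx]
      · simp [hyx]
    · simp [hn]

lemma slotHas_insert (hx : x < b) (hn : nd (.key x) = none) (hk : ∀ y < b, nd (.key y) ≠ some k)
    (h1 : ∀ y, nd' (.key y) = if y = x then some k else nd (.key y))
    (h2 : ∀ y, nd' (.val y) = if y = x then some v else nd (.val y)) [DecidableEq K] (k' : K)
    (v' : V) : SlotHas b nd' k' v' ↔ if k' = k then some v = some v' else SlotHas b nd k' v' := by
  constructor
  · rintro ⟨y, hy, e1, e2⟩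
    rw [h1] at e1
    rw [h2] at e2
    split_ifs at e1 e2 with hyx
    · rw [if_pos (Option.some.inj e1).symm]
      exact e2
    · rw [if_neg]
      · exact ⟨y, hy, e1, e2⟩
      · rintro rfl
        exact hk y hy e1
  · intro h
    split_ifs at h with hkk
    · subst hkk
      exact ⟨x, hx, by simp [h1], by simp [h2, h]⟩
    · obtain ⟨y, hy, e1, e2⟩ := h
      have hyx : y ≠ x := by
        rintro rfl
        rw [hn] at e1
        exact absurd e1 (by simp)
      exact ⟨y, hy, by rw [h1, if_neg hyx, e1], by rw [h2, if_neg hyx, e2]⟩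

lemma LeafOK.delete (h : LeafOK b nd) (hx : x < b) (hn : nd (.key x) = some k)
    (h1 : ∀ y, nd' (.key y) = if y = x then none else nd (.key y))
    (h2 : ∀ y, nd' (.val y) = nd (.val y))
    (h3 : nd' .size = (nd .size - 1 : ℕ)) : LeafOK b nd' := by
  refine ⟨fun y hy k' hk' => ?_, fun y hy y' hy' k' e1 e2 => ?_, ?_⟩
  · rw [h1] at hk'
    rw [h2]
    split_ifs at hk' with hyx
    exact h.val y hy k' hk'
  · rw [h1] at e1 e2
    split_ifs at e1 e2 with hyx hyx'
    exact h.inj y hy y' hy' k' e1 e2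
  · rw [h3, h.size, ← Finset.card_erase_of_mem (a := x)]
    · congr 1
      ext y
      simp only [Finset.mem_erase, Finset.mem_filter, Finset.mem_range, h1]
      by_cases hyx : y = x
      · simp [hyx]
      · simp [hyx]
    · simp [hn, hx]

lemma slotHas_delete (h : LeafOK b nd) (hx : x < b) (hn : nd (.key x) = some k)
    (h1 : ∀ y, nd' (.key y) = if y = x then none else nd (.key y))
    (h2 : ∀ y, nd' (.val y) = nd (.val y)) [DecidableEq K] (k' : K)
    (v' : V) : SlotHas b nd' k' v' ↔
      if k' = k then (none : Option V) = some v' else SlotHas b nd k' v' := by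
  constructor
  · rintro ⟨y, hy, e1, e2⟩
    rw [h1] at e1
    rw [h2] at e2
    split_ifs at e1 with hyx
    rw [if_neg]
    · exact ⟨y, hy, e1, e2⟩
    · rintro rfl
      exact hyx (h.inj y hy x hx k' e1 hn)
  · intro h'
    split_ifs at h' with hkk
    obtain ⟨y, hy, e1, e2⟩ := h'
    have hyx : y ≠ x := by
      rintro rfl
      exact hkk (Option.some.inj (e1.symm.trans hn))
    exact ⟨y, hy, by rw [h1, if_neg hyx, e1], by rw [h2, e2]⟩

end LeafUpdates

namespace Execution

variable {K V T : Type} [LinearOrder K] [DecidableEq T] {a b : ℕ} {E : Execution K V T a b}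

lemma Reads.noStart {t : T} {j : ℕ} {n : Addr} {f : Field} (h : E.Reads t j n f) :
    ¬ E.StartsSearch t j := by
  rintro ⟨c, key, target, h'⟩
  obtain ⟨-, nx, h⟩ := h
  rw [h] at h'
  exact absurd (Option.some.inj h') (by simp)

/-- As long as its version is odd, a leaf counts as holding what it held before the first increment. -/
lemma le_since {j₁ j : ℕ} {l : Addr} {k : K} {v : V} (h : j₁ ≤ j)
    (he : Even ((E.cfg j₁).mem.node l .ver))
    (ho : ∀ m, j₁ < m → m ≤ j → ¬ Even ((E.cfg m).mem.node l .ver)) :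
    E.LE j l k v ↔ SlotHas b ((E.cfg j₁).mem.node l) k v := by
  induction j, h using Nat.le_induction with
  | base => exact le_even he
  | succ j h ih =>
    rw [le_odd (ho (j + 1) (by omega) le_rfl), ih fun m h1 h2 => ho m h1 (by omega)]

/-- While the operation modifies the leaf `l`: since the first increment of the version in step
`j₁`, when the leaf was `nd₀`, its fields have become those of `nd`. -/
structure Mid (E : Execution K V T a b) (t : T) (i : ℕ) (op : Op K V) (l : Addr) (nd₀ : Node K V)
    (j₁ : ℕ) (nd : Node K V) (j : ℕ) : Prop where
  lt : j₁ < j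
  start : i < j₁
  pre : Pre E t i j₁
  first : E.Writes t j₁ l .ver
  quiet : Quiet E t (j₁ + 1) j
  lock : ∀ n, (E.cfg j).mem.lock n = some t ↔ n = l
  rch : E.Rch j l
  kind : (E.cfg j).mem.node l .kind = .leaf
  on : E.On j op.key l
  node : ∀ f, f ≠ .ver → (E.cfg j).mem.node l f = nd f
  even : Even ((E.cfg j₁).mem.node l .ver)
  odd : ∀ m, j₁ < m → m ≤ j → ¬ Even ((E.cfg m).mem.node l .ver)
  old : (E.cfg j₁).mem.node l = nd₀

section

variable {t : T} {i : ℕ} {op : Op K V} {l : Addr} {nd₀ nd : Node K V} {j₁ j₀ : ℕ}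
  {Fr : List (Addr × Node K V)}

lemma Mid.frame {j : ℕ} (h : Mid E t i op l nd₀ j₁ nd j) {j' : ℕ} (hj : j ≤ j') (g : E.Good j')
    (hm : MHold E t j j') : Mid E t i op l nd₀ j₁ nd j' := by
  have hl := (h.lock l).2 rfl
  have hf : ∀ m, j ≤ m → m ≤ j' →
      (E.cfg m).mem.node l = (E.cfg j).mem.node l ∧ (E.Rch j l → E.Rch m l) := fun m h1 h2 =>
    frame_node h1 (g.mono h2) (fun u h3 h4 => hm u h3 (by omega)) (g.rch_lt hj h.rch) hl
  obtain ⟨f1, f2⟩ := hf j' hj le_rfl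
  refine ⟨h.lt.trans_le hj, h.start, h.pre, h.first, h.quiet.trans hm.quiet,
    fun n => (frame_lock hj g hm n).trans (h.lock n), f2 h.rch, by rw [f1]; exact h.kind,
    (g.on_iff hj le_rfl h.rch (f2 h.rch)).2 h.on, fun f hne => by rw [f1]; exact h.node f hne,
    h.even, fun m h1 h2 => ?_, h.old⟩
  rcases lt_or_ge m j with h' | h'
  · exact h.odd m h1 h'.le
  · rw [(hf m h' h2).1]
    exact h.odd j h.lt le_rfl

/-- Writes to the slots and the size of the leaf while its version is odd. -/
lemma safeFrom_mid_write {f : Field} {x : f.Ty K V} {nx : Prog K V}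
    (h : Mid E t i op l nd₀ j₁ nd j₀) (hf : f = .size ∨ (∃ i, f = .key i) ∨ ∃ i, f = .val i)
    (hnx : ∀ j, E.Good j → Mid E t i op l nd₀ j₁ (Function.update nd f x) j →
      SafeFrom E t i op j [] nx) : SafeFrom E t i op j₀ Fr (.write l f x nx) := by
  refine safeFrom_write fun j k _ hw => ?_
  have hj := h.frame k.le k.good k.mhold
  have hf' : f ≠ .ver ∧ f ≠ .kind ∧ ∀ i, f ≠ .ptr i := by
    rcases hf with rfl | ⟨i, rfl⟩ | ⟨i, rfl⟩ <;> simp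
  obtain ⟨hs, hok, -⟩ := stepOK_slot k.good hw ((hj.lock l).2 rfl) hj.rch hj.kind hf
    (hj.odd j hj.lt le_rfl)
  refine ⟨hok, fun g => hnx _ g ⟨hj.lt.trans (Nat.lt_succ_self j), hj.start, hj.pre, hj.first,
    hj.quiet.trans ?_, fun n => ?_, hs.reach_iff.2 hj.rch, ?_, hs.onPath_iff.2 hj.on,
    fun f' hne => ?_, hj.even, fun m h1 h2 => ?_, hj.old⟩⟩
  · obtain ⟨nx', h'⟩ := hw.2.1
    refine Quiet.step h' fun n' f' x' nx'' he => ?_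
    cases he
    exact ⟨hf'.1, hf'.2.2⟩
  · rw [hw.lock]
    exact hj.lock n
  · rw [hw.field_ne (.inr hf'.2.1.symm)]
    exact hj.kind
  · by_cases hff : f' = f
    · subst hff
      rw [hw.node, Function.update_self, Function.update_self]
    · rw [hw.field_ne (.inr hff), Function.update_of_ne hff, hj.node f' hne]
  · rcases Nat.lt_or_eq_of_le h2 with h' | rfl
    · exact hj.odd m h1 (by omega)
    · rw [hw.field_ne (.inr hf'.1.symm)]
      exact hj.odd j hj.lt le_rfl

lemma safeFrom_mid_read {f : Field} {nx : f.Ty K V → Prog K V} (hf : f ≠ .ver)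
    (h : Mid E t i op l nd₀ j₁ nd j₀) (hnx : SafeFrom E t i op j₀ Fr (nx (nd f))) :
    SafeFrom E t i op j₀ Fr (.read l f nx) :=
  safeFrom_read_const hf _ (fun _ k => (h.frame k.le k.good k.mhold).node f hf) hnx

/-- The second increment of the version. -/
lemma safeFrom_mid_incVer {nx : Prog K V} {r res : Option V} (hi : E.Invokes (t, i) op)
    (g₀ : E.Good j₀)
    (h : Mid E t i op l nd₀ j₁ nd j₀) (hok : LeafOK b nd)
    (hslot : ∀ k v, SlotHas b nd k v ↔ if k = op.key then r = some v else SlotHas b nd₀ k v)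
    (hop : ∀ D : Dict K V, (∀ v, D op.key = some v ↔ SlotHas b nd₀ op.key v) →
      op.apply D = (Function.update D op.key r, res) ∧ Function.update D op.key r ≠ D)
    (hsec : ∀ j, E.SecondIncrement (t, i) j → E.UpdatePoint (t, i) j op)
    (hnx : ∀ j, E.Good j → Post E t i op j res → Held E t [l] [] j → E.Rch j l →
      SafeFrom E t i op j [] nx) : SafeFrom E t i op j₀ Fr (incVer l nx) := by
  refine safeFrom_incVer (g₀.rch_lt le_rfl h.rch) ((h.lock l).2 rfl) fun j hj g hm hp hw => ?_
  have hj := h.frame hj g hm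
  have hn1 : ∀ m, j₁ < m → m < j → (∀ l, ¬ E.Writes t m l .ver) ∧ ∀ n k, ¬ E.Writes t m n (.ptr k) := by
    intro m h1 h2
    refine ⟨?_, ?_⟩
    · rintro n ⟨h3, x, nx, h4⟩
      exact (hj.quiet m h1 h2 _ h3 h4 _ _ _ _ rfl).1 rfl
    · rintro n k ⟨h3, x, nx, h4⟩
      exact (hj.quiet m h1 h2 _ h3 h4 _ _ _ _ rfl).2 k rfl
  have hpoint : E.UpdatePoint (t, i) j op := by
    obtain ⟨nx', h'⟩ := hw.2.1
    refine hsec j ⟨hp, l, ⟨hw.1, _, nx', h'⟩, j₁, ⟨hj.start, hj.lt, hj.first⟩, ?_⟩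
    rintro m ⟨h1, h2, h3⟩
    rcases lt_trichotomy m j₁ with h' | h' | h'
    · exact absurd h3 ((hj.pre m h1 h').1 l)
    · exact h'
    · exact absurd h3 ((hn1 m h' h2).1 l)
  -- the first increment is no update point, as no increment precedes it
  have hbefore : ∀ u < j, ¬ E.UpdatePoint (t, i) u op := by
    intro u hu hu'
    rcases lt_trichotomy u j₁ with h' | rfl | h'
    · exact hj.pre.not_updatePoint h' hu'
    · have hv : ∀ {n f}, E.Writes t u n f → f = .ver := by
        rintro n f ⟨-, x, nx, h1⟩
        obtain ⟨-, x', nx', h2⟩ := hj.first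
        rw [h1] at h2
        have := Option.some.inj h2
        cases this
        rfl
      have hsecond : ¬ E.SecondIncrement (t, i) u := by
        rintro ⟨-, l', -, m, ⟨h1, h2, h3⟩, -⟩
        exact (hj.pre m h1 h2).1 l' h3
      cases op with
      | find => exact hu'
      | insert =>
        rcases hu' with h | ⟨-, p, x, l', h, -⟩
        · exact hsecond h
        · exact absurd (hv h) (by simp)
      | delete => exact hsecond hu'
    · rcases hu'.writes.2 with ⟨l', h⟩ | ⟨-, p, x, l', h, -⟩
      · exact (hn1 u h' hu).1 l' h
      · exact (hn1 u h' hu).2 p x h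
  have hle : ∀ k v, E.LE j l k v ↔ SlotHas b nd₀ k v := fun k v => by
    rw [le_since hj.lt.le hj.even hj.odd, hj.old]
  have hd := hop (E.dict j) fun v => by
    rw [g.self.dict_leaf hj.rch hj.kind hj.on, hle]
  obtain ⟨hs, hstep⟩ := stepOK_ver_even g hw ((hj.lock l).2 rfl) hj.rch hj.kind
    (hj.odd j hj.lt le_rfl) (hok.congr hj.node) hj.on (r := r)
    (fun k v => by rw [SlotHas.congr hj.node, hslot, hle]) fun hdict => by
      refine updOK_of_point hi hpoint ?_ ?_ hbefore
      · rw [hdict, hd.1]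
      · rw [hdict]
        exact hd.2
  refine ⟨hstep, fun g' => hnx (j + 1) g' ⟨j, Nat.lt_succ_self j, hpoint, by rw [hd.1]⟩ ?_
    (hs.reach_iff.2 hj.rch)⟩
  refine ⟨fun n => by rw [hw.lock, hj.lock]; simp, fun n hn => ?_, fun n hn => ?_,
    fun n hn _ hr => ?_⟩
  · obtain rfl := List.mem_singleton.1 hn
    exact ever_of_rch (hs.reach_iff.2 hj.rch)
  · obtain rfl := List.mem_singleton.1 hn
    have hv : (E.cfg (j + 1)).mem.node n .ver = ((E.cfg j).mem.node n .ver + 1 : ℕ) := by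
      rw [hw.node, Function.update_self]
    rw [hv, Nat.even_add_one]
    exact hj.odd j hj.lt le_rfl
  · obtain rfl := List.mem_singleton.1 hn
    exact absurd (hs.reach_iff.2 hj.rch) hr

/-- The operation has locked the leaf `l` in step `s`, in its search range. -/
structure AtLeaf (E : Execution K V T a b) (t : T) (i : ℕ) (op : Op K V) (l : Addr) (s : ℕ) :
    Prop where
  good : E.Good (s + 1)
  pre : Pre E t i (s + 1)
  seen : ∃ m, i < m ∧ m ≤ s ∧ E.On m op.key l
  kind : (E.cfg (s + 1)).mem.node l .kind = .leaf
  locks : E.Locks t s l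
  held : Held E t [l] [] (s + 1)

variable {s : ℕ}

lemma AtLeaf.lt (h : AtLeaf E t i op l s) : l < (E.cfg (s + 1)).mem.next :=
  h.good.ever_lt le_rfl (h.held.ever l (by simp))

lemma AtLeaf.lock (h : AtLeaf E t i op l s) : (E.cfg (s + 1)).mem.lock l = some t :=
  (h.held.lock l).2 (by simp)

lemma AtLeaf.leafOK (h : AtLeaf E t i op l s) : LeafOK b ((E.cfg (s + 1)).mem.node l) :=
  h.good.self.leaf l h.lt h.kind (h.held.even l (by simp))

lemma AtLeaf.on (h : AtLeaf E t i op l s) (hr : E.Rch (s + 1) l) : E.On (s + 1) op.key l := by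
  obtain ⟨m, h1, h2, h3⟩ := h.seen
  exact (h.good.on_iff (by omega) le_rfl (OnPath.reachable h3) hr).2 h3

lemma safeFrom_startOp {j : ℕ} (hN : NoLocks E t j) (hp : Pre E t i j) :
    SafeFrom E t i op j Fr (startOp op) := by
  refine safeFrom_goto_start fun j' hj g hc => ?_
  have hm : MHold E t j j' := fun m h1 h2 q h3 h4 => (hc m h1 h2 q h3 h4).noWrite
  exact ⟨hN.frame hj g hm, rfl, hp.quiet hm.quiet, rfl, rfl⟩

lemma safeFrom_ret {res : Option V} (h : ∀ j, Keeps E t j₀ Fr j → E.act j = .respond t res →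
    NoLocks E t j ∧ ResOK E t i op j res) : SafeFrom E t i op j₀ Fr (.ret res) := by
  intro j k j' w ha
  exact h j' (k.wait w (by simp)) ha

/-- Releasing the lock and returning. -/
lemma AtLeaf.safeFrom_unlock_ret (h : AtLeaf E t i op l s) (hr : E.Rch (s + 1) l) {res : Option V}
    (hslot : ∀ v, res = some v ↔ SlotHas b ((E.cfg (s + 1)).mem.node l) op.key v)
    (hop : op.ReadOnly res) (hf : ∀ k, op ≠ .find k) :
    SafeFrom E t i op (s + 1) [] (.unlock l (.ret res)) := by
  refine safeFrom_unlock fun u k => ?_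
  have hu := h.held.frame k.le k.good k.mhold
  refine ⟨⟨(hu.lock l).2 (by simp), hu.even l (by simp),
      fun _ => hu.clean l (by simp) (by simp)⟩, fun hact hq hm g => safeFrom_ret fun r k' _ => ?_⟩
  have hN : NoLocks E t (u + 1) := by
    have : Held E t [] [] (u + 1) :=
      hu.unlocked (n := l) (by simp) hm (rch_of_node_eq (by rw [hm]))
    exact this.noLocks
  have hN' : ∀ w, u < w → w ≤ r → NoLocks E t w := fun w h1 h2 =>
    hN.frame h1 (k'.good.mono h2) fun m h3 h4 => k'.mhold m h3 (by omega)
  refine ⟨hN' r k'.le le_rfl, ?_⟩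
  obtain ⟨m, m1, m2, m3⟩ := h.seen
  have hsu := k.le
  have hur := k'.le
  refine resOK_of_lock k'.good ?_ m1 m2 m3 ?_ hsu hur h.locks h.held hr ?_ k.mhold hN' hslot hop hf
  · exact h.pre.quiet ((k.mhold.quiet.trans (Quiet.step hq (by simp))).trans k'.mhold.quiet)
  · rw [← h.good.kind (j := m) (j' := s + 1) (by omega) le_rfl
      (h.good.rch_lt (by omega) (OnPath.reachable m3))]
    exact h.kind
  · intro w h1 h2
    rcases lt_trichotomy w u with h' | rfl | h'
    · exact (k.noEvent h1 h').2
    · refine ⟨?_, ?_⟩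
      · rintro n ⟨-, nx, h3⟩
        rw [hq] at h3
        exact absurd (Option.some.inj h3) (by simp)
      · rintro n ⟨-, nx, h3⟩
        rw [hq] at h3
        exact absurd (Option.some.inj h3) (by simp)
    · exact (k'.noEvent h' h2).2

/-- The first increment of the version. -/
lemma AtLeaf.safeFrom_incVer (h : AtLeaf E t i op l s) (hi : E.Invokes (t, i) op)
    (hr : E.Rch (s + 1) l) {nx : Prog K V}
    (hnx : ∀ j₁ j, E.Good j → Mid E t i op l ((E.cfg j₁).mem.node l) j₁
      ((E.cfg (s + 1)).mem.node l) j → (E.cfg j₁).mem.node l = (E.cfg (s + 1)).mem.node l →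
      SafeFrom E t i op j [] nx) : SafeFrom E t i op (s + 1) [] (incVer l nx) := by
  refine Execution.safeFrom_incVer h.lt h.lock fun j hj g hm hp hw => ?_
  obtain ⟨f1, f2⟩ := frame_node hj g hm h.lt h.lock
  have hpre := h.pre.quiet hm.quiet
  have hev : Even ((E.cfg j).mem.node l .ver) := by
    rw [f1]
    exact h.held.even l (by simp)
  have hk : (E.cfg j).mem.node l .kind = .leaf := by
    rw [f1]
    exact h.kind
  obtain ⟨nx', hq⟩ := hw.2.1
  obtain ⟨hs, hok, -⟩ := stepOK_ver_odd g hw ((frame_lock hj g hm l).2 h.lock) (f2 hr) hk hev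
    fun o op' hi' hu => by
      have hu' := hu.exists_write.1
      rw [hw.1] at hu'
      obtain ⟨rfl, rfl⟩ := inst_unique hi hi' hp hu.writes.1 (Action.internal.inj hu')
      have hsecond : ¬ E.SecondIncrement (t, i) j := by
        rintro ⟨-, l', -, m, ⟨h1, h2, h3⟩, -⟩
        exact (hpre m h1 h2).1 l' h3
      cases op with
      | find => exact hu
      | insert =>
        rcases hu with h | ⟨-, p, x, l', h, -⟩
        · exact hsecond h
        · exact absurd (hw.writes h).2.2 (by simp)
      | delete => exact hsecond hu
  have hst : i < j := hp.1
  refine ⟨hok, fun g' => hnx j (j + 1) g' ⟨Nat.lt_succ_self j, hst, hpre, ⟨hw.1, _, nx', hq⟩,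
    Quiet.refl, fun n => ?_, hs.reach_iff.2 (f2 hr), ?_, hs.onPath_iff.2 ?_, fun f hf => ?_, hev,
    fun m h1 h2 => ?_, rfl⟩ f1⟩
  · rw [hw.lock, frame_lock hj g hm n, h.held.lock]
    simp
  · rw [hw.field_ne (.inr (by simp))]
    exact hk
  · exact (g.on_iff hj le_rfl hr (f2 hr)).2 (h.on hr)
  · rw [hw.field_ne (.inr hf), f1]
  · obtain rfl : m = j + 1 := by omega
    have hv : (E.cfg (j + 1)).mem.node l .ver = ((E.cfg j).mem.node l .ver + 1 : ℕ) := by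
      rw [hw.node, Function.update_self]
    rw [hv, Nat.even_add_one]
    exact not_not.2 hev

/-! ### The code of the operations -/

lemma LInv.searchLeaf_mono {j j' : ℕ} {o : Op K V} {path : PathInfo}
    (h : LInv E t i op j (.searchLeaf o path)) (hj : j ≤ j') (g : E.Good j')
    (hm : MHold E t j j') (hs : ∀ s, j ≤ s → s < j' → ¬ E.StartsSearch t s) :
    LInv E t i op j' (.searchLeaf o path) := by
  obtain ⟨h1, h2, h3, h4, h5, h6⟩ := h
  exact ⟨h1.frame hj g hm, h2, h3.quiet hm.quiet, h4.mono hj hs,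
    by rw [g.kind hj le_rfl (g.ever_lt hj (h4.ever))]; exact h5, h6.mono hj⟩

/-- Locking the leaf that the search has found. -/
lemma LInv.atLeaf {j : ℕ} {o : Op K V} {path : PathInfo} (g : E.Good j)
    (h : LInv E t i op j (.searchLeaf o path)) {nx : Prog K V}
    (hnx : ∀ s, j ≤ s → AtLeaf E t i op path.n s → SafeFrom E t i op (s + 1) [] nx) :
    SafeFrom E t i op j [] (.lock path.n nx) := by
  refine safeFrom_lock fun s k g' hlk hl hm => ?_
  obtain ⟨h1, h2, h3, h4, h5, h6⟩ := h
  have hmh := k.mhold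
  have hq : Quiet E t j (s + 1) := hmh.quiet.trans <| by
    obtain ⟨-, nx, h'⟩ := hlk
    exact Quiet.step h' (by simp)
  refine hnx s k.le ⟨g', h3.quiet hq, ?_, ?_, hlk, ?_⟩
  · obtain ⟨m, m1, m2, m3, -⟩ := h4
    exact ⟨m, m1, m2.trans k.le, m3⟩
  · rw [g'.kind (k.le.trans (Nat.le_succ s)) le_rfl (g.ever_lt le_rfl h4.ever)]
    exact h5
  · exact (h1.frame k.le k.good hmh).held.locked k.good (h4.ever.mono k.le) hl hm
      (rch_of_node_eq (by rw [hm]))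

lemma Held.safeFrom_unlock_startOp {j : ℕ} (h : Held E t [l] [] j) (hp : Pre E t i j) :
    SafeFrom E t i op j Fr (.unlock l (startOp op)) :=
  safeFrom_unlockAll (as := [l]) (by simp) h (by simp) fun _ _ _ hq hN =>
    safeFrom_startOp hN (hp.quiet hq)

/-- The key range of the leaf is the same as when the search visited it, so that after a look at its
slots, under the lock, the entry of the key in the dictionary is known. -/
lemma safeFrom_deleteLocked {j : ℕ} {key : K} {path : PathInfo} (hi : E.Invokes (t, i) (.delete key))
    (g : E.Good j) (h : LInv E t i (.delete key) j (.searchLeaf (.delete key) path)) :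
    SafeFrom E t i (.delete key) j [] (deleteLocked a b key path) := by
  refine h.atLeaf g fun s hs hL => ?_
  refine safeFrom_read_locked (by simp) hL.lt hL.lock ?_
  split_ifs with hmk
  · exact hL.held.safeFrom_unlock_startOp hL.pre
  have hr : E.Rch (s + 1) path.n := hL.held.rch (by simp) hmk
  refine safeFrom_findSlot hL.lt hL.lock (fun x hx hkx => ?_) fun hnk => ?_
  · obtain ⟨w, hw⟩ := hL.leafOK.val x hx key hkx
    refine safeFrom_read_locked (by simp) hL.lt hL.lock ?_
    rw [hw]
    refine hL.safeFrom_incVer hi hr fun j₁ j gj hM hnd => ?_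
    refine safeFrom_mid_write hM (by simp) fun j gj hM => ?_
    refine safeFrom_mid_read (by simp) hM ?_
    refine safeFrom_mid_write hM (by simp) fun j gj hM => ?_
    have e1 : ∀ y, Function.update (Function.update ((E.cfg (s + 1)).mem.node path.n) (.key x) none)
        .size ((E.cfg (s + 1)).mem.node path.n .size - 1 : ℕ) (.key y) =
          if y = x then none else (E.cfg (s + 1)).mem.node path.n (.key y) := fun y => by
      rw [Function.update_of_ne (by simp)]
      split_ifs with h
      · subst h
        simp
      · rw [Function.update_of_ne (by simpa using h)]
    have e2 : ∀ y, Function.update (Function.update ((E.cfg (s + 1)).mem.node path.n) (.key x) none)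
        .size ((E.cfg (s + 1)).mem.node path.n .size - 1 : ℕ) (.val y) =
          (E.cfg (s + 1)).mem.node path.n (.val y) := fun y => by
      rw [Function.update_of_ne (by simp), Function.update_of_ne (by simp)]
    refine safeFrom_mid_incVer (r := none) (res := some w) hi gj hM
      (hL.leafOK.delete hx hkx e1 e2 (by simp)) (fun k v => ?_) (fun D hD => ?_)
      (fun _ h => h) fun j gj hpost hH hr => ?_
    · rw [hnd]
      exact slotHas_delete hL.leafOK hx hkx e1 e2 k v
    · have hDw : D key = some w := (hD w).2 (by rw [hnd]; exact ⟨x, hx, hkx, hw⟩)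
      refine ⟨Prod.ext rfl hDw, fun he => ?_⟩
      have := congrFun he key
      simp [Op.key, hDw] at this
    · refine safeFrom_read (by simp) fun j' k' _ => ?_
      refine safeFrom_unlockAll (as := [path.n]) (by simp) hH (by simp)
        fun j'' hj'' gj'' _ hN => ?_
      refine safeFrom_goto (by simp) fun j3 k3 => ⟨hN.frame k3.le k3.good k3.mhold, ?_,
        hpost.mono (hj''.trans k3.le)⟩
      intro n hn
      split_ifs at hn <;> simp at hn
  · refine hL.safeFrom_unlock_ret hr (fun v => ?_) rfl (by simp)
    simp only [reduceCtorEq, false_iff]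
    rintro ⟨x, hx, h1, -⟩
    exact hnk x hx h1

/-- The part of `insert` that follows the splitting test is passed as an argument. -/
lemma safeFrom_insertLocked {j : ℕ} {key : K} {val : V} {path : PathInfo}
    (hi : E.Invokes (t, i) (.insert key val))
    (g : E.Good j) (h : LInv E t i (.insert key val) j (.searchLeaf (.insert key val) path))
    (hsplit : ∀ parent s, path.p = some parent → j ≤ s →
      AtLeaf E t i (.insert key val) path.n s → E.Rch (s + 1) path.n →
      (∀ x < b, (E.cfg (s + 1)).mem.node path.n (.key x) ≠ some key) →
      b ≤ (E.cfg (s + 1)).mem.node path.n .size →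
      SafeFrom E t i (.insert key val) (s + 1) [] (
        .lock parent <|
        .read parent .marked fun m' =>
        if m' = true then unlockAll [path.n, parent] (startOp (.insert key val)) else
        readPairs path.n (fun L =>
          allocLeaves (sortPairs ((key, val) :: L)) fun l x r =>
          allocInternal (topKind parent) [x] [l, r] fun new =>
          .write parent (.ptr path.nIdx) (some new) <|
          .write path.n .marked true <|
          unlockAll [path.n, parent] <|
          .goto (.rebalance [.fixTagged new] none)) 0 b)) :
    SafeFrom E t i (.insert key val) j [] (insertLocked b key val path) := by
  unfold insertLocked
  dsimp only
  cases hp : path.p with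
  | none => exact safeFrom_crash
  | some parent =>
  refine h.atLeaf g fun s hs hL => ?_
  refine safeFrom_read_locked (by simp) hL.lt hL.lock ?_
  split_ifs with hmk
  · exact hL.held.safeFrom_unlock_startOp hL.pre
  have hr : E.Rch (s + 1) path.n := hL.held.rch (by simp) hmk
  refine safeFrom_findSlot hL.lt hL.lock (fun x hx hkx => ?_) fun hnk => ?_
  · obtain ⟨w, hw⟩ := hL.leafOK.val x hx key hkx
    refine safeFrom_read_locked (by simp) hL.lt hL.lock ?_
    rw [hw]
    refine hL.safeFrom_unlock_ret hr (fun v => ?_) rfl (by simp)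
    rw [Option.some.injEq]
    constructor
    · rintro rfl
      exact ⟨x, hx, hkx, hw⟩
    · exact hL.leafOK.func ⟨x, hx, hkx, hw⟩
  refine safeFrom_read_locked (by simp) hL.lt hL.lock ?_
  split_ifs with hsz
  · refine safeFrom_findSlot hL.lt hL.lock (fun x hx hkx => ?_) fun _ => safeFrom_crash
    refine hL.safeFrom_incVer hi hr fun j₁ j gj hM hnd => ?_
    refine safeFrom_mid_write hM (by simp) fun j gj hM => ?_
    refine safeFrom_mid_write hM (by simp) fun j gj hM => ?_
    refine safeFrom_mid_read (by simp) hM ?_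
    refine safeFrom_mid_write hM (by simp) fun j gj hM => ?_
    have e1 : ∀ y, Function.update (Function.update (Function.update
        ((E.cfg (s + 1)).mem.node path.n) (.key x) (some key)) (.val x) (some val))
        .size ((E.cfg (s + 1)).mem.node path.n .size + 1 : ℕ) (.key y) =
          if y = x then some key else (E.cfg (s + 1)).mem.node path.n (.key y) := fun y => by
      rw [Function.update_of_ne (by simp), Function.update_of_ne (by simp)]
      split_ifs with h
      · subst h
        simp
      · rw [Function.update_of_ne (by simpa using h)]
    have e2 : ∀ y, Function.update (Function.update (Function.update
        ((E.cfg (s + 1)).mem.node path.n) (.key x) (some key)) (.val x) (some val))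
        .size ((E.cfg (s + 1)).mem.node path.n .size + 1 : ℕ) (.val y) =
          if y = x then some val else (E.cfg (s + 1)).mem.node path.n (.val y) := fun y => by
      rw [Function.update_of_ne (by simp)]
      split_ifs with h
      · subst h
        simp
      · rw [Function.update_of_ne (by simpa using h), Function.update_of_ne (by simp)]
    have e3 : Function.update (Function.update ((E.cfg (s + 1)).mem.node path.n) (.key x) (some key))
        (.val x) (some val) .size = (E.cfg (s + 1)).mem.node path.n .size := by
      rw [Function.update_of_ne (by simp), Function.update_of_ne (by simp)]
    rw [e3] at hM
    refine safeFrom_mid_incVer (r := some val) (res := none) hi gj hM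
      (hL.leafOK.insert hx hkx hnk e1 e2 (by simp)) (fun k v => ?_) (fun D hD => ?_)
      (fun _ h => .inl h) fun j gj hpost hH hr => ?_
    · rw [hnd]
      exact slotHas_insert hx hkx hnk e1 e2 k v
    · have hDw : D key = none := by
        refine Option.eq_none_iff_forall_ne_some.2 fun v hv => ?_
        have := (hD v).1 hv
        rw [hnd] at this
        obtain ⟨y, hy, h1, -⟩ := this
        exact hnk y hy h1
      refine ⟨by simp [Op.apply, hDw, Op.key], fun he => ?_⟩
      have := congrFun he key
      simp [Op.key, hDw] at this
    · refine safeFrom_unlockAll (as := [path.n]) (by simp) hH (by simp)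
        fun j'' hj'' gj'' _ hN => ?_
      exact safeFrom_ret fun r k _ => ⟨hN.frame k.le k.good k.mhold,
        .inl (hpost.mono (hj''.trans k.le))⟩
  · exact hsplit parent s hp hs hL hr hnk (not_lt.1 hsz)

end

end Execution

end OCC

namespace OCC

namespace Execution

variable {K V T : Type} [LinearOrder K] [DecidableEq T] {a b : ℕ} {E : Execution K V T a b}
  {t : T} {i : ℕ} {op : Op K V}

/-! ### The code of `searchLeaf` -/

/-- The second read of the version, and what follows it. -/
lemma safeFrom_finish {j₀ s₁ j : ℕ} {path : PathInfo} {res : Option V} (g : E.Good j₀)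
    (h : LInv E t i op j₀ (.searchLeaf op path)) (k₁ : Keeps E t j₀ [] s₁)
    (hr1 : E.Reads t s₁ path.n .ver) (hev : ¬ Odd ((E.cfg s₁).mem.node path.n .ver))
    (k : Keeps E t (s₁ + 1) [] j)
    (hslot : ∀ s₂, E.Good s₂ → j ≤ s₂ → (∀ m, s₁ ≤ m → m ≤ s₂ → ∀ f, f ≠ .marked →
      (E.cfg m).mem.node path.n f = (E.cfg s₁).mem.node path.n f) →
      ∀ v, res = some v ↔ SlotHas b ((E.cfg s₁).mem.node path.n) op.key v)
    (hins : ∀ j', LInv E t i op j' (.searchLeaf op path) → E.Good j' → ∀ key val,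
      op = .insert key val → SafeFrom E t i op j' [] (insertLocked b key val path))
    (hdel : ∀ j', LInv E t i op j' (.searchLeaf op path) → E.Good j' → ∀ key, op = .delete key →
      SafeFrom E t i op j' [] (deleteLocked a b key path)) :
    SafeFrom E t i op j [] (.read path.n .ver fun ver2 =>
      if (E.cfg s₁).mem.node path.n .ver = ver2 then afterSearchLeaf a b path res op
      else .goto (.searchLeaf op path)) := by
  refine safeFrom_read_ver fun s₂ k₂ g₂ _ hr2 => ?_
  have hle1 := k₁.le
  have hle := k.le
  have hle2 := k₂.le
  have hmh : MHold E t j₀ (s₂ + 1) :=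
    ((k₁.mhold.trans hr1.mhold).trans (k.trans k₂).mhold).trans hr2.mhold
  have hns : ∀ s, j₀ ≤ s → s < s₂ + 1 → ¬ E.StartsSearch t s := by
    intro s h1 h2
    rcases lt_trichotomy s s₁ with h' | rfl | h'
    · exact k₁.noStart s h1 h'
    · exact hr1.noStart
    · rcases Nat.lt_succ_iff_lt_or_eq.1 h2 with h'' | rfl
      · exact (k.trans k₂).noStart s h' h''
      · exact hr2.noStart
  have hL : LInv E t i op (s₂ + 1) (.searchLeaf op path) :=
    h.searchLeaf_mono (by omega) g₂ hmh hns
  split_ifs with hv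
  · obtain ⟨hN, -, hpre, ⟨m, m1, m2, m3, m4⟩, hkind, -⟩ := h
    have he : Even ((E.cfg s₁).mem.node path.n .ver) := Nat.not_odd_iff_even.1 hev
    have hlt : path.n < (E.cfg m).mem.next := g.rch_lt m2 (OnPath.reachable m3)
    have hkm : (E.cfg m).mem.node path.n .kind = .leaf := by rwa [← g.kind m2 le_rfl hlt]
    have hconst : ∀ m, s₁ ≤ m → m ≤ s₂ → ∀ f, f ≠ .marked →
        (E.cfg m).mem.node path.n f = (E.cfg s₁).mem.node path.n f := fun u h1 h2 f hf =>
      k₂.good.leaf_const h1 h2 le_rfl (hlt.trans_le (k₂.good.next_mono (by omega) (by omega)))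
        ((k₂.good.kind (by omega) (by omega) hlt).trans hkm) he hv hf
    have hret : op.ReadOnly res → SafeFrom E t i op (s₂ + 1) [] (.ret res) := by
      intro hop
      refine safeFrom_ret fun r k₃ _ => ?_
      have hle3 := k₃.le
      have hN' : ∀ u, s₂ < u → u ≤ r → NoLocks E t u := fun u h1 h2 =>
        hN.frame (by omega) (k₃.good.mono h2) fun w h3 h4 => (hmh.trans k₃.mhold) w h3 (by omega)
      refine ⟨hN' r (by omega) le_rfl, ?_⟩
      refine resOK_of_searchLeaf k₃.good (hpre.quiet (hmh.trans k₃.mhold).quiet) m1 (by omega) m3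
        (by omega) (by omega) hr1 hr2 hkm hv he (fun u h1 h2 => ((k.trans k₂).noEvent h1 h2).2)
        (fun u h1 h2 => (k₃.noEvent h1 h2).2) hN' (hslot s₂ k₂.good k₂.le hconst) hop
    cases op with
    | find key => exact hret trivial
    | insert key val =>
      simp only [afterSearchLeaf]
      split_ifs with hres
      · exact hret hres
      · exact hins _ hL g₂ key val rfl
    | delete key =>
      simp only [afterSearchLeaf]
      split_ifs with hres
      · exact hdel _ hL g₂ key rfl
      · obtain rfl : res = none := by simpa using hres
        exact hret rfl
  · refine safeFrom_goto (by simp) fun j' k' => ?_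
    exact hL.searchLeaf_mono k'.le k'.good k'.mhold k'.noStart

lemma safeFrom_searchLeaf {j₀ : ℕ} {o : Op K V} {path : PathInfo} (g : E.Good j₀)
    (h : LInv E t i op j₀ (.searchLeaf o path))
    (hins : ∀ j', LInv E t i op j' (.searchLeaf op path) → E.Good j' → ∀ key val,
      op = .insert key val → SafeFrom E t i op j' [] (insertLocked b key val path))
    (hdel : ∀ j', LInv E t i op j' (.searchLeaf op path) → E.Good j' → ∀ key, op = .delete key →
      SafeFrom E t i op j' [] (deleteLocked a b key path)) :
    SafeFrom E t i op j₀ [] (searchLeaf a b o path) := by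
  obtain rfl : o = op := h.2.1
  refine safeFrom_read_ver fun s₁ k₁ g₁ _ hr1 => ?_
  have hle1 := k₁.le
  have hlt := g.ever_lt le_rfl h.2.2.2.1.ever
  have hlt1 := hlt.trans_le (g₁.next_mono hle1 (Nat.le_succ s₁))
  split_ifs with hodd
  · refine safeFrom_goto (by simp) fun j' k' => ?_
    have hle' := k'.le
    refine h.searchLeaf_mono (by omega) k'.good ((k₁.mhold.trans hr1.mhold).trans k'.mhold) ?_
    intro s h1 h2
    rcases lt_trichotomy s s₁ with h' | rfl | h'
    · exact k₁.noStart s h1 h'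
    · exact hr1.noStart
    · exact k'.noStart s h' h2
  have hk1 : (E.cfg s₁).mem.node path.n .kind = .leaf := by
    rw [k₁.good.kind hle1 le_rfl hlt]
    exact h.2.2.2.2.1
  have hok : LeafOK b ((E.cfg s₁).mem.node path.n) :=
    k₁.good.self.leaf path.n (hlt.trans_le (k₁.good.next_mono hle1 le_rfl)) hk1
      (Nat.not_odd_iff_even.1 hodd)
  refine safeFrom_findSlot_unlocked (s := s₁ + 1) (B := b) (fun j x k k' hx hkx => ?_)
    (fun j k hk => ?_) b 0 (s₁ + 1) (by omega) (Keeps.refl g₁) (by omega)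
  · refine safeFrom_read_succ (by simp) fun j' k₂ k₂' _ => ?_
    refine safeFrom_finish g h k₁ hr1 hodd (k'.trans k₂') (fun s₂ g₂ hs hc v => ?_) hins hdel
    have e0 := k.le
    have e1 := k₂.le
    rw [hc j (by omega) (by omega) _ (by simp)] at hkx
    rw [hc j' (by omega) (by omega) _ (by simp)]
    constructor
    · intro hv
      exact ⟨x, hx, hkx, hv⟩
    · rintro ⟨y, hy, h1, h2⟩
      obtain rfl := hok.inj y hy x hx _ h1 hkx
      exact h2
  · refine safeFrom_finish g h k₁ hr1 hodd k (fun s₂ g₂ hs hc v => ?_) hins hdel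
    simp only [reduceCtorEq, false_iff]
    rintro ⟨y, hy, h1, -⟩
    obtain ⟨m, m1, m2, m3⟩ := hk y hy
    rw [hc m (by omega) (by omega) _ (by simp)] at m3
    exact m3 h1

end Execution

end OCC

namespace OCC

section Sites

variable {K V T : Type} [LinearOrder K] {m : Mem K V T} {H : Addr → ℕ}

/-! ### Keys of adjacent nodes -/

lemma idx_append_eq {KA KB : List K} {k : K} (hs : (KA ++ KB).Pairwise (· < ·))
    (h : idx (KA ++ KB) k = KA.length) : (∀ y ∈ KA, y ≤ k) ∧ ∀ y ∈ KB, k < y := by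
  rw [idx_append] at h
  have hB : ∀ y ∈ KB, k < y := by
    by_contra hc
    push Not at hc
    obtain ⟨y, hy, hyk⟩ := hc
    have hA : idx KA k = KA.length := idx_eq_length.2 fun z hz =>
      ((List.pairwise_append.1 hs).2.2 z hz y hy).le.trans hyk
    have : idx KB k = 0 := by omega
    exact absurd (idx_eq_zero.1 this y hy) (not_lt.2 hyk)
  refine ⟨idx_eq_length.1 ?_, hB⟩
  rw [idx_eq_zero.2 hB] at h
  exact h

/-- A key between two blocks of routing keys leads to the child between them. -/
lemma next_of_between {n c : Addr} {KA KB : List K} {A B : List Addr}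
    (hi : IsInternal (m.node n) (KA ++ KB) (A ++ c :: B)) (hA : KA.length = A.length) {k : K}
    (h1 : ∀ y ∈ KA, y ≤ k) (h2 : ∀ y ∈ KB, k < y) : Next m k n c := by
  refine ⟨_, _, hi, ?_⟩
  rw [idx_append, idx_eq_length.2 h1, idx_eq_zero.2 h2, hA]
  simp

lemma between_of_next (w : WF m H) {n c : Addr} (hr : Reachable m n) {KA KB : List K}
    {A B : List Addr} (hi : IsInternal (m.node n) (KA ++ KB) (A ++ c :: B))
    (hs : (KA ++ KB).Pairwise (· < ·)) (hA : KA.length = A.length) {k : K} (h : Next m k n c) :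
    (∀ y ∈ KA, y ≤ k) ∧ ∀ y ∈ KB, k < y := by
  obtain ⟨ks, cs, hi', hc⟩ := h
  obtain rfl := hi.keys_unique hi'
  obtain rfl := hi.children_unique hi'
  refine idx_append_eq hs ?_
  have hc' : (A ++ c :: B)[A.length]? = some c := by simp
  rw [hA]
  exact (List.getElem?_inj (List.getElem?_eq_some_iff.1 hc).1 (w.children_nodup hr hi)).1
    (hc.trans hc'.symm)

/-- The keys of a child lie strictly between the routing keys of its parent. -/
lemma keyIn_between (w : WF m H) {n c : Addr} (hr : Reachable m n) {KA KB : List K}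
    {A B : List Addr} (hi : IsInternal (m.node n) (KA ++ KB) (A ++ c :: B))
    (hs : (KA ++ KB).Pairwise (· < ·)) (hA : KA.length = A.length) {z : K} (h : KeyIn m c z) :
    (∀ y ∈ KA, y < z) ∧ ∀ y ∈ KB, z < y := by
  have hc : IsChild m n c := (isChild_iff hi).2 (by simp)
  obtain ⟨h1, k, hk, h2⟩ := h
  obtain ⟨-, h3⟩ := w.onPath_of_child hr hc h1
  obtain ⟨-, h4⟩ := w.onPath_of_child hr hc h2
  exact ⟨fun y hy => ((between_of_next w hr hi hs hA h4).1 y hy).trans_lt hk,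
    (between_of_next w hr hi hs hA h3).2⟩

lemma KeyIn.of_child (w : WF m H) {n c : Addr} (hr : Reachable m n) (hc : IsChild m n c) {z : K}
    (h : KeyIn m c z) : KeyIn m n z := by
  obtain ⟨h1, k, hk, h2⟩ := h
  exact ⟨(w.onPath_of_child hr hc h1).1, k, hk, (w.onPath_of_child hr hc h2).1⟩

/-- The keys of a new child of a new node are strictly inside of its range. -/
lemma keyIn_new {n c p : Addr} {KA KB : List K} {A B : List Addr}
    (hi : IsInternal (m.node n) (KA ++ KB) (A ++ c :: B)) (hA : KA.length = A.length)
    (hp : ∀ z ∈ KA, KeyIn m p z) (hs : KA.Pairwise (· < ·)) {z : K} (hz : KeyIn m p z)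
    (h1 : ∀ y ∈ KA, y < z) (h2 : ∀ y ∈ KB, z < y) :
    OnPath m z p ∧ Next m z n c ∧ ∃ k < z, OnPath m k p ∧ Next m k n c := by
  refine ⟨hz.1, next_of_between hi hA (fun y hy => (h1 y hy).le) h2, ?_⟩
  rcases List.eq_nil_or_concat KA with rfl | ⟨KA', u, rfl⟩
  · obtain ⟨k, hk, hk'⟩ := hz.2
    exact ⟨k, hk, hk', next_of_between hi hA (by simp) fun y hy => hk.trans (h2 y hy)⟩
  · refine ⟨u, h1 u (by simp), (hp u (by simp)).1, next_of_between hi hA (fun y hy => ?_)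
      fun y hy => (h1 u (by simp)).trans (h2 y hy)⟩
    rw [List.concat_eq_append, List.mem_append, List.mem_singleton] at hy
    rw [List.concat_eq_append, List.pairwise_append] at hs
    rcases hy with hy | rfl
    · exact (hs.2.2 y hy u (by simp)).le
    · exact le_rfl

/-! ### Constructing fragments -/

lemma Frag.one {n c : Addr} {KA KM KB : List K} {A B M : List (Option Addr)}
    (h : Expands m n (KA ++ KB) (A ++ some c :: B)) (hc : Expands m c KM M)
    (hA : KA.length = A.length) (hs : (KA ++ KM ++ KB).Pairwise (· < ·)) :
    Frag m n (KA ++ KM ++ KB) (A ++ M ++ B) [c] :=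
  .inline (.base h) hc hA hs

lemma Frag.two {n l r : Addr} {KA KL KR KB : List K} {x : K} {A B L R : List (Option Addr)}
    (h : Expands m n (KA ++ x :: KB) (A ++ some l :: some r :: B)) (hl : Expands m l KL L)
    (hr : Expands m r KR R) (hA : KA.length = A.length)
    (hs : (KA ++ KL ++ x :: KR ++ KB).Pairwise (· < ·)) :
    Frag m n (KA ++ KL ++ x :: KR ++ KB) (A ++ L ++ R ++ B) [r, l] := by
  have h1 : Frag m n (KA ++ KL ++ x :: KB) (A ++ L ++ some r :: B) [l] :=
    .inline (KA := KA) (KM := KL) (KB := x :: KB) (.base h) hl hA (hs.sublist (by simp))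
  have h2 : Frag m n ((KA ++ KL ++ [x]) ++ KR ++ KB) ((A ++ L) ++ R ++ B) [r, l] :=
    .inline (by simpa using h1) hr (by simp [hA, hl.length]) (by simpa using hs)
  simpa using h2

/-- Two adjacent leaves are seen as one. -/
lemma Frag.two_leaves {n l r : Addr} {KA KB : List K} {x : K} {A B : List (Option Addr)}
    (h : Expands m n (KA ++ x :: KB) (A ++ some l :: some r :: B))
    (hl : m.node l .kind = .leaf) (hr : m.node r .kind = .leaf) (hA : KA.length = A.length)
    (hs : (KA ++ x :: KB).Pairwise (· < ·)) :
    Frag m n (KA ++ KB) (A ++ none :: B) [r, l] := by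
  have := Frag.two h (.leaf hl) (.leaf hr) hA (by simpa using hs)
  exact .collapse (by simpa using this) hA hs

/-! ### Constructing replacements -/

/-- The memory after a child pointer has been written. -/
def link (m : Mem K V T) (gp : Addr) (i₀ : ℕ) (new : Addr) : Mem K V T :=
  { m with node := Function.update m.node gp (Function.update (m.node gp) (.ptr i₀) (some new)) }

open Classical in
/-- The new heights. -/
noncomputable def newHeight (H : Addr → ℕ) (new : Addr) (F : List Addr) (hN hF : ℕ) : Addr → ℕ :=
  fun n => if n = new then hN else if n ∈ F then hF else H n

/-- Inside of the node `gp`, the child `p` is to be replaced. -/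
structure Site (m : Mem K V T) (H : Addr → ℕ) (gp : Addr) (i₀ : ℕ) (p : Addr) : Prop where
  wf : WF m H
  gp_reach : Reachable m gp
  gp_kind : m.node gp .kind ≠ .leaf
  gp_ptr : m.node gp (.ptr i₀) = some p

lemma Site.child {gp p : Addr} {i₀ : ℕ} (s : Site m H gp i₀ p) : IsChild m gp p :=
  s.wf.child_of_ptr s.gp_reach s.gp_kind s.gp_ptr

lemma Site.reach {gp p : Addr} {i₀ : ℕ} (s : Site m H gp i₀ p) : Reachable m p :=
  s.gp_reach.child s.child

lemma Site.ne_entry {gp p : Addr} {i₀ : ℕ} (s : Site m H gp i₀ p) : p ≠ entry := by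
  rintro rfl
  exact s.wf.ne_entry gp s.gp_reach s.child

lemma Site.surgery {gp p new : Addr} {i₀ : ℕ} (s : Site m H gp i₀ p) {KS : List K}
    {CS : List (Option Addr)} {X F : List Addr} {hN hF : ℕ} (fragX : Frag m p KS CS X)
    (gp_not_mem : gp ∉ p :: X) (fragF : Frag m new KS CS F)
    (fresh : ∀ f ∈ new :: F, ¬ Reachable m f ∧ f < m.next) (nodup : (new :: F).Nodup)
    (shape : ∀ f ∈ new :: F, m.node f .kind ≠ .leaf → ∃ ks cs, IsInternal (m.node f) ks cs ∧
      cs.length = ks.length + 1 ∧ ks.Pairwise (· < ·) ∧ ∀ z ∈ ks,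
        OnPath m z p ∧ (f = new ∨ Next m z new f) ∧
        ∃ k < z, OnPath m k p ∧ (f = new ∨ Next m k new f))
    (height_new : gp ≠ entry → hN = H p)
    (leaf_new : m.node new .kind = .leaf → hN = 0)
    (leaf_F : ∀ f ∈ F, m.node f .kind = .leaf → hF = 0)
    (child_new : ∀ c, IsChild m new c →
      (c ∈ F ∧ hN = hF + if m.node new .kind = .tagged then 0 else 1) ∨
      (Reachable m c ∧ hN = H c + if m.node new .kind = .tagged then 0 else 1))
    (child_F : ∀ f ∈ F, ∀ c, IsChild m f c →
      Reachable m c ∧ hF = H c + if m.node f .kind = .tagged then 0 else 1) :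
    Surgery m (link m gp i₀ new) H (newHeight H new F hN hF) gp i₀ p new KS CS X F := by
  have hnF : new ∉ F := (List.nodup_cons.1 nodup).1
  have e1 : newHeight H new F hN hF new = hN := by simp [newHeight]
  have e2 : ∀ f ∈ F, newHeight H new F hN hF f = hF := fun f hf => by
    have : f ≠ new := fun h => hnF (h ▸ hf)
    simp [newHeight, this, hf]
  have e3 : ∀ n, n ∉ new :: F → newHeight H new F hN hF n = H n := fun n hn => by
    simp only [List.mem_cons, not_or] at hn
    simp [newHeight, hn]
  have e4 : ∀ n, Reachable m n → newHeight H new F hN hF n = H n := fun n hn =>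
    e3 n fun h => (fresh n h).1 hn
  refine ⟨s.wf, fun n hn => by simp [link, hn], by simp [link], rfl, s.gp_reach, s.gp_kind,
    s.gp_ptr, fragX, gp_not_mem, fragF, fresh, nodup, shape, e3, fun h => e1.trans (height_new h),
    ?_, ?_⟩
  · intro f hf hk
    rcases List.mem_cons.1 hf with rfl | hf
    · rw [e1, leaf_new hk]
    · rw [e2 f hf, leaf_F f hf hk]
  · intro f hf c hc
    rcases List.mem_cons.1 hf with rfl | hf
    · rw [e1]
      rcases child_new c hc with ⟨h1, h2⟩ | ⟨h1, h2⟩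
      · rw [e2 c h1, ← h2]
      · rw [e4 c h1, ← h2]
    · obtain ⟨h1, h2⟩ := child_F f hf c hc
      rw [e2 f hf, e4 c h1, ← h2]

end Sites

end OCC

namespace OCC

section Sites

variable {K V T : Type} [LinearOrder K] {m : Mem K V T} {H : Addr → ℕ} {gp p new : Addr} {i₀ : ℕ}

lemma Expands.isChild {n c : Addr} {KS : List K} {cs : List (Option Addr)} (h : Expands m n KS cs)
    (hc : IsChild m n c) : some c ∈ cs := h.mem_iff.2 hc

lemma Expands.shape {n : Addr} {KS : List K} {CS : List (Option Addr)} (h : Expands m n KS CS)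
    (hk : m.node n .kind ≠ .leaf) : ∃ cs, IsInternal (m.node n) KS cs ∧ CS = cs.map some ∧
      cs.length = KS.length + 1 := by
  cases h with
  | leaf h => exact absurd h hk
  | internal ks cs h hl => exact ⟨cs, h, rfl, hl⟩

/-- Replacing the subtree by a single node with the same keys and children. -/
lemma Site.zero (s : Site m H gp i₀ p) {KS : List K} {CS : List (Option Addr)} {X : List Addr}
    (fragX : Frag m p KS CS X) (gp_not_mem : gp ∉ p :: X) (hn : Expands m new KS CS)
    (hs : KS.Pairwise (· < ·)) (hk : ∀ z ∈ KS, KeyIn m p z)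
    (fresh : ¬ Reachable m new ∧ new < m.next) {hN : ℕ} (height_new : gp ≠ entry → hN = H p)
    (leaf_new : m.node new .kind = .leaf → hN = 0) (tag : m.node new .kind ≠ .tagged)
    (height : ∀ c, some c ∈ CS → Reachable m c ∧ hN = H c + 1) :
    Surgery m (link m gp i₀ new) H (newHeight H new [] hN 0) gp i₀ p new KS CS X [] := by
  refine s.surgery fragX gp_not_mem (.base hn) (by simpa using fresh) (by simp) ?_ height_new
    leaf_new (by simp) (fun c hc => .inr ?_) (by simp)
  · intro f hf hkf
    obtain rfl : f = new := by simpa using hf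
    obtain ⟨cs, hi, -, hl⟩ := hn.shape hkf
    refine ⟨KS, cs, hi, hl, hs, fun z hz => ?_⟩
    obtain ⟨h1, k, h2, h3⟩ := hk z hz
    exact ⟨h1, .inl rfl, k, h2, h3, .inl rfl⟩
  · simpa [tag] using height c (hn.isChild hc)

/-- Replacing the subtree by a node with one new child. -/
lemma Site.one (s : Site m H gp i₀ p) {KS : List K} {CS : List (Option Addr)} {X : List Addr}
    (fragX : Frag m p KS CS X) (gp_not_mem : gp ∉ p :: X) {c : Addr} {KA KM KB : List K}
    {A B : List Addr} {M : List (Option Addr)}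
    (hn : IsInternal (m.node new) (KA ++ KB) (A ++ c :: B)) (hA : KA.length = A.length)
    (hB : KB.length = B.length)
    (hc : Expands m c KM M) (hs : (KA ++ KM ++ KB).Pairwise (· < ·))
    (hk : ∀ z ∈ KA ++ KM ++ KB, KeyIn m p z) (fragF : Frag m new KS CS [c])
    (fresh : ∀ f ∈ [new, c], ¬ Reachable m f ∧ f < m.next) (nodup : new ≠ c) {hF : ℕ}
    (height_new : H p = hF + 1) (leaf : m.node c .kind = .leaf → hF = 0)
    (tag : m.node new .kind ≠ .tagged) (tag' : m.node c .kind ≠ .tagged)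
    (height : ∀ d ∈ A ++ B, Reachable m d ∧ H p = H d + 1)
    (heightF : ∀ d, some d ∈ M → Reachable m d ∧ hF = H d + 1) :
    Surgery m (link m gp i₀ new) H (newHeight H new [c] (H p) hF) gp i₀ p new KS CS X [c] := by
  have hs' := hs
  simp only [List.append_assoc, List.pairwise_append, List.mem_append] at hs'
  refine s.surgery fragX gp_not_mem fragF fresh (by simpa using nodup) ?_ (fun _ => rfl)
    (fun h => absurd h hn.kind_ne) (fun f hf => ?_) (fun d hd => ?_) (fun f hf d hd => ?_)
  · intro f hf hkf
    simp only [List.mem_cons, List.not_mem_nil, or_false] at hf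
    rcases hf with rfl | rfl
    · refine ⟨_, _, hn, by simp [hA, hB]; omega, hs.sublist (by simp), fun z hz => ?_⟩
      obtain ⟨h1, k, h2, h3⟩ := hk z (by
        simp only [List.mem_append] at hz ⊢
        tauto)
      exact ⟨h1, .inl rfl, k, h2, h3, .inl rfl⟩
    · obtain ⟨cs, hi, -, hl⟩ := hc.shape hkf
      refine ⟨KM, cs, hi, hl, hs'.2.1.1, fun z hz => ?_⟩
      obtain ⟨h1, h2, k, h3, h4, h5⟩ := keyIn_new hn hA (fun y hy => hk y (by simp [hy])) hs'.1
        (hk z (by simp [hz])) (fun y hy => hs'.2.2 y hy z (.inl hz)) (hs'.2.1.2.2 z hz)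
      exact ⟨h1, .inr h2, k, h3, h4, .inr h5⟩
  · obtain rfl : f = c := by simpa using hf
    exact leaf
  · rw [isChild_iff hn] at hd
    simp only [tag, if_false]
    rcases eq_or_ne d c with rfl | hdc
    · exact .inl ⟨by simp, height_new⟩
    · exact .inr (height d (by simpa [hdc] using hd))
  · obtain rfl : f = c := by simpa using hf
    simpa [tag'] using heightF d (hc.isChild hd)

/-- Replacing the subtree by a node with two new adjacent children. -/
lemma Site.two (s : Site m H gp i₀ p) {KS : List K} {CS : List (Option Addr)} {X : List Addr}
    (fragX : Frag m p KS CS X) (gp_not_mem : gp ∉ p :: X) {l r : Addr} {KA KL KR KB : List K}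
    {x : K} {A B : List Addr} {L R : List (Option Addr)}
    (hn : IsInternal (m.node new) (KA ++ x :: KB) (A ++ l :: r :: B)) (hA : KA.length = A.length)
    (hB : KB.length = B.length) (hl : Expands m l KL L) (hr : Expands m r KR R)
    (hs : (KA ++ KL ++ x :: KR ++ KB).Pairwise (· < ·))
    (hk : ∀ z ∈ KA ++ KL ++ x :: KR ++ KB, KeyIn m p z) (fragF : Frag m new KS CS [r, l])
    (fresh : ∀ f ∈ [new, r, l], ¬ Reachable m f ∧ f < m.next) (nodup : [new, r, l].Nodup)
    {hN hF : ℕ} (height_new : gp ≠ entry → hN = H p)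
    (height_top : hN = hF + if m.node new .kind = .tagged then 0 else 1)
    (leafL : m.node l .kind = .leaf → hF = 0) (leafR : m.node r .kind = .leaf → hF = 0)
    (tagL : m.node l .kind ≠ .tagged) (tagR : m.node r .kind ≠ .tagged)
    (height : ∀ d ∈ A ++ B, Reachable m d ∧
      hN = H d + if m.node new .kind = .tagged then 0 else 1)
    (heightF : ∀ d, some d ∈ L ++ R → Reachable m d ∧ hF = H d + 1) :
    Surgery m (link m gp i₀ new) H (newHeight H new [r, l] hN hF) gp i₀ p new KS CS X [r, l] := by
  have hs' := hs
  simp only [List.append_assoc, List.pairwise_append, List.mem_append, List.cons_append,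
    List.pairwise_cons, List.mem_cons] at hs'
  obtain ⟨sA, ⟨sL, ⟨sx, sR, sB, sRB⟩, sL2⟩, sA2⟩ := hs'
  refine s.surgery fragX gp_not_mem fragF fresh nodup ?_ height_new
    (fun h => absurd h hn.kind_ne) (fun f hf => ?_) (fun d hd => ?_) (fun f hf d hd => ?_)
  · intro f hf hkf
    simp only [List.mem_cons, List.not_mem_nil, or_false] at hf
    rcases hf with rfl | rfl | rfl
    · refine ⟨_, _, hn, by simp [hA, hB]; omega, hs.sublist (by simp), fun z hz => ?_⟩
      obtain ⟨h1, k, h2, h3⟩ := hk z (by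
        simp only [List.mem_append, List.mem_cons] at hz ⊢
        tauto)
      exact ⟨h1, .inl rfl, k, h2, h3, .inl rfl⟩
    · obtain ⟨cs, hi, -, hl'⟩ := hr.shape hkf
      refine ⟨KR, cs, hi, hl', sR, fun z hz => ?_⟩
      obtain ⟨h1, h2, k, h3, h4, h5⟩ := keyIn_new (n := new) (c := f) (p := p) (KA := KA ++ [x])
        (KB := KB) (A := A ++ [l]) (B := B) (by simpa using hn) (by simp [hA])
        (fun y hy => hk y (by
          simp only [List.mem_append, List.mem_cons, List.not_mem_nil, or_false] at hy ⊢
          tauto)) (hs.sublist (by simp))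
        (hk z (by simp [hz])) (fun y hy => by
          simp only [List.mem_append, List.mem_cons, List.not_mem_nil, or_false] at hy
          rcases hy with hy | rfl
          · exact sA2 y hy z (.inr (.inr (.inl hz)))
          · exact sx z (.inl hz)) (sRB z hz)
      exact ⟨h1, .inr h2, k, h3, h4, .inr h5⟩
    · obtain ⟨cs, hi, -, hl'⟩ := hl.shape hkf
      refine ⟨KL, cs, hi, hl', sL, fun z hz => ?_⟩
      obtain ⟨h1, h2, k, h3, h4, h5⟩ := keyIn_new hn hA (fun y hy => hk y (by simp [hy])) sA
        (hk z (by simp [hz])) (fun y hy => sA2 y hy z (.inl hz)) (fun y hy => by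
          rcases List.mem_cons.1 hy with rfl | hy
          · exact sL2 z hz y (.inl rfl)
          · exact sL2 z hz y (.inr (.inr hy)))
      exact ⟨h1, .inr h2, k, h3, h4, .inr h5⟩
  · simp only [List.mem_cons, List.not_mem_nil, or_false] at hf
    rcases hf with rfl | rfl
    · exact leafR
    · exact leafL
  · rw [isChild_iff hn] at hd
    by_cases hdc : d ∈ [r, l]
    · exact .inl ⟨hdc, height_top⟩
    · refine .inr (height d ?_)
      simp only [List.mem_append, List.mem_cons, List.not_mem_nil, or_false, not_or] at hd hdc ⊢
      rcases hd with hd | hd | hd | hd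
      · exact .inl hd
      · exact absurd hd hdc.2
      · exact absurd hd hdc.1
      · exact .inr hd
  · simp only [List.mem_cons, List.not_mem_nil, or_false] at hf
    rcases hf with rfl | rfl
    · simpa [tagR] using heightF d (by simp [hr.isChild hd])
    · simpa [tagL] using heightF d (by simp [hl.isChild hd])

/-! ### Two adjacent siblings -/

/-- Inside of the node `gp`, the child `p` is to be replaced, together with its adjacent children
`l` and `r`. -/
structure Pair (m : Mem K V T) (H : Addr → ℕ) (gp : Addr) (i₀ : ℕ) (p l r : Addr) (KA : List K)
    (x₀ : K) (KB : List K) (A B : List Addr) : Prop extends Site m H gp i₀ p where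
  int : IsInternal (m.node p) (KA ++ x₀ :: KB) (A ++ l :: r :: B)
  lenA : KA.length = A.length
  lenB : KB.length = B.length
  p_tag : m.node p .kind ≠ .tagged
  l_tag : m.node l .kind ≠ .tagged
  r_tag : m.node r .kind ≠ .tagged
  gp_not_mem : gp ∉ [p, r, l]

namespace Pair

variable {l r : Addr} {KA KB : List K} {x₀ : K} {A B : List Addr}

lemma expands (q : Pair m H gp i₀ p l r KA x₀ KB A B) :
    Expands m p (KA ++ x₀ :: KB) (A.map some ++ some l :: some r :: B.map some) := by
  have := Expands.internal _ _ q.int (by simp [q.lenA, q.lenB]; omega)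
  simpa using this

lemma keys (q : Pair m H gp i₀ p l r KA x₀ KB A B) :
    (KA ++ x₀ :: KB).Pairwise (· < ·) ∧ ∀ z ∈ KA ++ x₀ :: KB, KeyIn m p z := by
  obtain ⟨ks, cs, hi, -, h1, h2⟩ := q.wf.shape p q.reach q.int.kind_ne
  obtain rfl := q.int.keys_unique hi
  exact ⟨h1, h2⟩

lemma child (q : Pair m H gp i₀ p l r KA x₀ KB A B) {c : Addr} (hc : c ∈ A ++ l :: r :: B) :
    IsChild m p c ∧ Reachable m c ∧ H p = H c + 1 := by
  have h := (isChild_iff q.int).2 hc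
  refine ⟨h, q.reach.child h, ?_⟩
  simpa [q.p_tag] using q.wf.height p c q.reach q.ne_entry h

lemma leaf_iff (q : Pair m H gp i₀ p l r KA x₀ KB A B) :
    m.node l .kind = .leaf ↔ m.node r .kind = .leaf := by
  have key : ∀ {c}, c ∈ A ++ l :: r :: B → m.node c .kind ≠ .tagged →
      (m.node c .kind = .leaf ↔ H c = 0) := by
    intro c hc ht
    obtain ⟨h1, h2, -⟩ := q.child hc
    refine ⟨q.wf.height_leaf c h2, fun h0 => by_contra fun hk => ?_⟩
    obtain ⟨ks, cs, hi, hlen, -⟩ := q.wf.shape c h2 hk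
    cases cs with
    | nil => simp at hlen
    | cons d cs =>
      have := q.wf.height c d h2 (fun h => q.wf.ne_entry p q.reach (h ▸ h1))
        ((isChild_iff hi).2 (by simp))
      simp [ht] at this
      omega
  have h1 := (q.child (c := l) (by simp)).2.2
  have h2 := (q.child (c := r) (by simp)).2.2
  rw [key (c := l) (by simp) q.l_tag, key (c := r) (by simp) q.r_tag]
  omega

lemma frag_leaf (q : Pair m H gp i₀ p l r KA x₀ KB A B) (hl : m.node l .kind = .leaf) :
    Frag m p (KA ++ KB) (A.map some ++ none :: B.map some) [r, l] :=
  Frag.two_leaves q.expands hl (q.leaf_iff.1 hl) (by simp [q.lenA]) q.keys.1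

/-- The routing keys and children of two internal siblings. -/
lemma internal (q : Pair m H gp i₀ p l r KA x₀ KB A B) {KL KR : List K} {L R : List Addr}
    (hl : IsInternal (m.node l) KL L) (hr : IsInternal (m.node r) KR R) :
    (KA ++ KL ++ x₀ :: KR ++ KB).Pairwise (· < ·) ∧
    (∀ z ∈ KA ++ KL ++ x₀ :: KR ++ KB, KeyIn m p z) ∧
    (∀ d ∈ L ++ R, Reachable m d ∧ H l = H d + 1) ∧
    L.length = KL.length + 1 ∧ R.length = KR.length + 1 ∧
    Frag m p (KA ++ KL ++ x₀ :: KR ++ KB) ((A ++ L ++ R ++ B).map some) [r, l] := by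
  obtain ⟨cl, rl, el⟩ := q.child (c := l) (by simp)
  obtain ⟨cr, rr, er⟩ := q.child (c := r) (by simp)
  obtain ⟨ks, cs, hi, lenL, sL, kL⟩ := q.wf.shape l rl hl.kind_ne
  obtain rfl := hl.keys_unique hi
  obtain rfl := hl.children_unique hi
  obtain ⟨ks, cs, hi', lenR, sR, kR⟩ := q.wf.shape r rr hr.kind_ne
  obtain rfl := hr.keys_unique hi'
  obtain rfl := hr.children_unique hi'
  obtain ⟨sp, kp⟩ := q.keys
  have bL : ∀ z ∈ KL, (∀ y ∈ KA, y < z) ∧ ∀ y ∈ x₀ :: KB, z < y := fun z hz =>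
    keyIn_between q.wf q.reach q.int sp q.lenA (kL z hz)
  have bR : ∀ z ∈ KR, (∀ y ∈ KA ++ [x₀], y < z) ∧ ∀ y ∈ KB, z < y := fun z hz =>
    keyIn_between q.wf q.reach (KA := KA ++ [x₀]) (KB := KB) (A := A ++ [l]) (B := B) (c := r)
      (by simpa using q.int) (by simpa using sp) (by simp [q.lenA]) (kR z hz)
  have hs : (KA ++ KL ++ x₀ :: KR ++ KB).Pairwise (· < ·) := by
    simp only [List.append_assoc, List.pairwise_append, List.mem_append, List.cons_append,
      List.pairwise_cons, List.mem_cons, List.not_mem_nil, or_false] at sp bL bR ⊢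
    refine ⟨sp.1, ⟨sL, ⟨?_, sR, sp.2.1.2, fun z hz y hy => (bR z hz).2 y hy⟩, ?_⟩, ?_⟩
    · rintro y (hy | hy)
      · exact (bR y hy).1 x₀ (.inr rfl)
      · exact sp.2.1.1 y hy
    · rintro z hz y (rfl | hy | hy)
      · exact (bL z hz).2 y (.inl rfl)
      · exact ((bL z hz).2 x₀ (.inl rfl)).trans ((bR y hy).1 x₀ (.inr rfl))
      · exact (bL z hz).2 y (.inr hy)
    · rintro z hz y (hy | rfl | hy | hy)
      · exact (bL y hy).1 z hz
      · exact sp.2.2 z hz y (.inl rfl)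
      · exact (bR y hy).1 z (.inl hz)
      · exact sp.2.2 z hz y (.inr hy)
  refine ⟨hs, ?_, ?_, lenL, lenR, ?_⟩
  · intro z hz
    simp only [List.mem_append, List.mem_cons] at hz kp
    rcases hz with ((hz | hz) | hz | hz) | hz
    · exact kp z (.inl hz)
    · exact (kL z hz).of_child q.wf q.reach cl
    · exact kp z (.inr (.inl hz))
    · exact (kR z hz).of_child q.wf q.reach cr
    · exact kp z (.inr (.inr hz))
  · intro d hd
    rcases List.mem_append.1 hd with hd | hd
    · have hc := (isChild_iff hl).2 hd
      refine ⟨rl.child hc, ?_⟩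
      simpa [q.l_tag] using q.wf.height l d rl (fun h => q.wf.ne_entry p q.reach (h ▸ cl)) hc
    · have hc := (isChild_iff hr).2 hd
      refine ⟨rr.child hc, ?_⟩
      have := q.wf.height r d rr (fun h => q.wf.ne_entry p q.reach (h ▸ cr)) hc
      simp only [q.r_tag, if_false] at this
      omega
  · have := Frag.two q.expands (.internal _ _ hl lenL) (.internal _ _ hr lenR) (by simp [q.lenA]) hs
    simpa using this

variable {l' r' : Addr} {x : K}

/-- New siblings below a new parent. -/
lemma distribute (q : Pair m H gp i₀ p l r KA x₀ KB A B) {KS : List K} {CS : List (Option Addr)}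
    (fragX : Frag m p KS CS [r, l]) (hn : m.node new .kind ≠ .tagged) {KL KR : List K}
    {L R : List (Option Addr)}
    (hi : IsInternal (m.node new) (KA ++ x :: KB) (A ++ l' :: r' :: B))
    (hl : Expands m l' KL L) (hr : Expands m r' KR R)
    (hs : (KA ++ KL ++ x :: KR ++ KB).Pairwise (· < ·))
    (hk : ∀ z ∈ KA ++ KL ++ x :: KR ++ KB, KeyIn m p z) (fragF : Frag m new KS CS [r', l'])
    (fresh : ∀ f ∈ [new, r', l'], ¬ Reachable m f ∧ f < m.next) (nodup : [new, r', l'].Nodup)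
    (leafL : m.node l' .kind = .leaf → H l = 0) (leafR : m.node r' .kind = .leaf → H l = 0)
    (tagL : m.node l' .kind ≠ .tagged) (tagR : m.node r' .kind ≠ .tagged)
    (heightF : ∀ d, some d ∈ L ++ R → Reachable m d ∧ H l = H d + 1) :
    Surgery m (link m gp i₀ new) H (newHeight H new [r', l'] (H p) (H l)) gp i₀ p new KS CS
      [r, l] [r', l'] := by
  refine q.toSite.two fragX q.gp_not_mem hi q.lenA q.lenB hl hr hs hk fragF fresh nodup
    (fun _ => rfl) ?_ leafL leafR tagL tagR (fun d hd => ?_) heightF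
  · simpa [hn] using (q.child (c := l) (by simp)).2.2
  · simpa [hn] using (q.child (c := d) (by
      simp only [List.mem_append, List.mem_cons] at hd ⊢
      tauto)).2

/-- A new node in the place of the siblings, below a new parent. -/
lemma merge (q : Pair m H gp i₀ p l r KA x₀ KB A B) {KS : List K} {CS : List (Option Addr)}
    (fragX : Frag m p KS CS [r, l]) (hn : m.node new .kind ≠ .tagged) {KM : List K}
    {M : List (Option Addr)} (hi : IsInternal (m.node new) (KA ++ KB) (A ++ l' :: B))
    (hl : Expands m l' KM M) (hs : (KA ++ KM ++ KB).Pairwise (· < ·))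
    (hk : ∀ z ∈ KA ++ KM ++ KB, KeyIn m p z) (fragF : Frag m new KS CS [l'])
    (fresh : ∀ f ∈ [new, l'], ¬ Reachable m f ∧ f < m.next) (nodup : new ≠ l')
    (leaf : m.node l' .kind = .leaf → H l = 0) (tag : m.node l' .kind ≠ .tagged)
    (heightF : ∀ d, some d ∈ M → Reachable m d ∧ H l = H d + 1) :
    Surgery m (link m gp i₀ new) H (newHeight H new [l'] (H p) (H l)) gp i₀ p new KS CS
      [r, l] [l'] := by
  refine q.toSite.one fragX q.gp_not_mem hi q.lenA q.lenB hl hs hk fragF fresh nodup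
    (q.child (c := l) (by simp)).2.2 leaf hn tag (fun d hd => ?_) heightF
  exact (q.child (c := d) (by
      simp only [List.mem_append, List.mem_cons] at hd ⊢
      tauto)).2

end Pair

end Sites

end OCC

namespace OCC

section Lists

open Execution (pairsFrom)

variable {K V : Type} {b : ℕ}

/-! ### The contents of leaves as lists -/

lemma slotHas_mkLeaf {sk : K} {L : List (K × V)} (h : L.length ≤ b) {k : K} {v : V} :
    SlotHas b (mkLeaf sk L) k v ↔ (k, v) ∈ L := by
  simp only [SlotHas, mkLeaf, Option.map_eq_some_iff, List.mem_iff_getElem?]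
  constructor
  · rintro ⟨i, hi, ⟨x, h1, rfl⟩, y, h2, rfl⟩
    rw [h1] at h2
    obtain rfl := Option.some.inj h2
    exact ⟨i, h1⟩
  · rintro ⟨i, hi⟩
    have := (List.getElem?_eq_some_iff.1 hi).1
    exact ⟨i, by omega, ⟨_, hi, rfl⟩, _, hi, rfl⟩

lemma leafOK_mkLeaf {sk : K} {L : List (K × V)} (h : L.length ≤ b) (hn : (L.map Prod.fst).Nodup) :
    LeafOK b (mkLeaf sk L) := by
  refine ⟨fun i _ k hk => ?_, fun i _ i' _ k hk hk' => ?_, ?_⟩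
  · simp only [mkLeaf, Option.map_eq_some_iff] at hk ⊢
    obtain ⟨x, hx, -⟩ := hk
    exact ⟨x.2, x, hx, rfl⟩
  · simp only [mkLeaf, ← List.getElem?_map] at hk hk'
    exact (List.getElem?_inj (List.getElem?_eq_some_iff.1 hk).1 hn).1 (hk.trans hk'.symm)
  · have : (Finset.range b).filter (fun i => (mkLeaf sk L (.key i)).isSome = true) =
        Finset.range L.length := by
      ext i
      simp [mkLeaf]
      omega
    rw [this, Finset.card_range]
    rfl

lemma mem_pairsFrom {nd : Node K V} {k : K} {v : V} {x fuel : ℕ} : (k, v) ∈ pairsFrom nd x fuel ↔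
    ∃ y, x ≤ y ∧ y < x + fuel ∧ nd (.key y) = some k ∧ nd (.val y) = some v := by
  induction fuel generalizing x with
  | zero =>
    simp only [pairsFrom, List.not_mem_nil, false_iff]
    rintro ⟨y, h1, h2, -⟩
    omega
  | succ fuel ih =>
    have key : (∃ y, x ≤ y ∧ y < x + (fuel + 1) ∧ nd (.key y) = some k ∧ nd (.val y) = some v) ↔
        (nd (.key x) = some k ∧ nd (.val x) = some v) ∨ (k, v) ∈ pairsFrom nd (x + 1) fuel := by
      rw [ih]
      constructor
      · rintro ⟨y, h1, h2, h3⟩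
        rcases Nat.lt_or_eq_of_le h1 with h | rfl
        · exact .inr ⟨y, h, by omega, h3⟩
        · exact .inl h3
      · rintro (h | ⟨y, h1, h2, h3⟩)
        · exact ⟨x, le_rfl, by omega, h⟩
        · exact ⟨y, by omega, by omega, h3⟩
    rw [key]
    simp only [pairsFrom]
    cases hk : nd (.key x) <;> cases hv : nd (.val x) <;> simp [eq_comm]

lemma pairsFrom_nodup {nd : Node K V} (h : LeafOK b nd) {x fuel : ℕ} (hx : x + fuel ≤ b) :
    ((pairsFrom nd x fuel).map Prod.fst).Nodup := by
  induction fuel generalizing x with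
  | zero => simp [pairsFrom]
  | succ fuel ih =>
    have ih := ih (x := x + 1) (by omega)
    simp only [pairsFrom]
    cases hk : nd (.key x) with
    | none => exact ih
    | some k =>
      cases hv : nd (.val x) with
      | none => exact ih
      | some v =>
        rw [List.map_cons, List.nodup_cons]
        refine ⟨fun hm => ?_, ih⟩
        obtain ⟨⟨k', v'⟩, hk', he⟩ := List.mem_map.1 hm
        obtain rfl : k' = k := he
        obtain ⟨y, h1, h2, h3, -⟩ := mem_pairsFrom.1 hk'
        have := h.inj x (by omega) y (by omega) _ hk h3
        omega

lemma pairsFrom_length {nd : Node K V} (h : LeafOK b nd) {x fuel : ℕ} (hx : x + fuel ≤ b) :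
    (pairsFrom nd x fuel).length =
      ((Finset.Ico x (x + fuel)).filter fun i => (nd (.key i)).isSome = true).card := by
  induction fuel generalizing x with
  | zero => simp [pairsFrom]
  | succ fuel ih =>
    have ih := ih (x := x + 1) (by omega)
    rw [Finset.card_filter] at ih ⊢
    rw [Finset.sum_eq_sum_Ico_succ_bot (by omega), show x + (fuel + 1) = x + 1 + fuel by omega, ← ih]
    simp only [pairsFrom]
    cases hk : nd (.key x) with
    | none => simp
    | some k =>
      obtain ⟨v, hv⟩ := h.val x (by omega) k hk
      simp [hv]
      omega

/-- The pairs of a leaf. -/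
lemma pairs_spec {nd : Node K V} (h : LeafOK b nd) :
    (∀ k v, (k, v) ∈ pairsFrom nd 0 b ↔ SlotHas b nd k v) ∧
    ((pairsFrom nd 0 b).map Prod.fst).Nodup ∧ (pairsFrom nd 0 b).length = nd .size ∧
    (pairsFrom nd 0 b).length ≤ b := by
  have hl := pairsFrom_length h (x := 0) (fuel := b) (by omega)
  rw [zero_add, ← Finset.range_eq_Ico] at hl
  refine ⟨fun k v => ?_, pairsFrom_nodup h (by omega), by rw [hl, h.size], ?_⟩
  · rw [mem_pairsFrom]
    simp [SlotHas]
  · rw [hl]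
    exact (Finset.card_filter_le _ _).trans (by simp)

lemma sortPairs_perm [LinearOrder K] (L : List (K × V)) : (sortPairs L).Perm L :=
  List.perm_insertionSort _ _

lemma sortPairs_sorted [LinearOrder K] {L : List (K × V)} (h : (L.map Prod.fst).Nodup) :
    (sortPairs L).Pairwise fun x y => x.1 < y.1 := by
  have h1 : (sortPairs L).Pairwise fun x y => x.1 ≤ y.1 := by
    have : Std.Total (fun x y : K × V => x.1 ≤ y.1) := ⟨fun x y => le_total x.1 y.1⟩
    have : IsTrans (K × V) (fun x y => x.1 ≤ y.1) := ⟨fun x y z => le_trans⟩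
    exact List.pairwise_insertionSort _ _
  have h2 : ((sortPairs L).map Prod.fst).Nodup := ((sortPairs_perm L).map _).nodup_iff.2 h
  rw [List.Nodup, List.pairwise_map] at h2
  exact (h1.and h2).imp fun ⟨h, h'⟩ => lt_of_le_of_ne h h'

/-- Two halves of a sorted list of pairs. -/
lemma halves_spec [LinearOrder K] {N L R : List (K × V)} {x : K × V}
    (hs : N.Pairwise fun x y => x.1 < y.1) (hL : N.take (N.length / 2) = L)
    (hR : N.drop (N.length / 2) = x :: R) (h2 : 2 ≤ N.length) :
    (∀ y, y ∈ N ↔ y ∈ L ∨ y ∈ x :: R) ∧ (∀ y ∈ L, y.1 < x.1) ∧ (∀ y ∈ x :: R, x.1 ≤ y.1) ∧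
    L ≠ [] ∧ (L.map Prod.fst).Nodup ∧ ((x :: R).map Prod.fst).Nodup ∧
    L.length = N.length / 2 ∧ (x :: R).length = N.length - N.length / 2 := by
  have he : N = L ++ x :: R := by rw [← hL, ← hR, List.take_append_drop]
  have hl : L.length = N.length / 2 := by rw [← hL, List.length_take]; omega
  have hr : (x :: R).length = N.length - N.length / 2 := by rw [← hR, List.length_drop]
  rw [he, List.pairwise_append] at hs
  obtain ⟨s1, s2, s3⟩ := hs
  refine ⟨fun y => by rw [he, List.mem_append], fun y hy => s3 y hy x (by simp), fun y hy => ?_,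
    fun h => ?_, ?_, ?_, hl, hr⟩
  · rcases List.mem_cons.1 hy with rfl | hy
    · exact le_rfl
    · exact ((List.pairwise_cons.1 s2).1 y hy).le
  · rw [h] at hl
    simp at hl
    omega
  · rw [List.Nodup, List.pairwise_map]
    exact s1.imp fun h => h.ne
  · rw [List.Nodup, List.pairwise_map]
    exact s2.imp fun h => h.ne

end Lists

namespace Execution

variable {K V T : Type} [LinearOrder K] [DecidableEq T] {a b : ℕ} {E : Execution K V T a b}
  {t : T} {i : ℕ} {op : Op K V}

/-! ### Writing a child pointer -/

lemma link_step {j : ℕ} (g : E.Good j) {S : List Addr} (hS : Held E t S [] j)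
    {H H' : Addr → ℕ} {gp p new : Addr} {i₀ : ℕ} {KS : List K} {CS : List (Option Addr)}
    {X F : List Addr} (hw : WriteStep E t j gp (.ptr i₀) (some new))
    (s : Surgery (E.cfg j).mem (link (E.cfg j).mem gp i₀ new) H H' gp i₀ p new KS CS X F)
    (hX : ∀ n ∈ gp :: p :: X, n ∈ S)
    (hF : ∀ f ∈ new :: F, ¬ E.Ever j f ∧ E.AllocBy t j f ∧ Even ((E.cfg j).mem.node f .ver))
    (keysF : ∀ f ∈ new :: F, (E.cfg j).mem.node f .kind = .leaf →
      ∀ k v, SlotHas b ((E.cfg j).mem.node f) k v →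
        E.On j k p ∧ (f = new ∨ Next (E.cfg j).mem k new f))
    (upd : Surgery (E.cfg j).mem (E.cfg (j + 1)).mem H H' gp i₀ p new KS CS X F →
      E.Inv (j + 1) → E.UpdOK j) :
    E.StepOK j ∧ Held E t S (p :: X) (j + 1) ∧ E.Rch (j + 1) new ∧
      ∀ n, n ∉ p :: X → E.Rch j n → E.Rch (j + 1) n := by
  have hm : (E.cfg (j + 1)).mem = link (E.cfg j).mem gp i₀ new := hw.2.2
  rw [← hm] at s
  have lock : ∀ n ∈ gp :: p :: X, (E.cfg j).mem.lock n = some t := fun n hn =>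
    (hS.lock n).2 (hX n hn)
  have hi := hw.link_inv g s lock fun f hf hk => ⟨(hF f hf).2.2, fun k v h => by
    obtain ⟨h1, h2⟩ := keysF f hf hk k v h
    exact s.onPath'_F h1 h2⟩
  have htr := hw.link_trans s lock (fun x hx => hS.even x (hX x (by
    simp only [List.mem_cons] at hx ⊢
    exact .inr hx))) fun f hf => ⟨(hF f hf).1, (hF f hf).2.1⟩
  refine ⟨⟨hi, htr, upd s hi⟩, ⟨fun n => by rw [hw.lock]; exact hS.lock n,
    fun n hn => (hS.ever n hn).mono (Nat.le_succ j), fun n hn => ?_, fun n hn hnX hr => ?_⟩,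
    s.reach_iff.2 (.inl (by simp)), fun n hn hr => s.reach'_of_reach hr hn⟩
  · rw [hw.field_ne (.inr (by simp))]
    exact hS.even n hn
  · rw [hw.field_ne (.inr (by simp))]
    exact hS.clean n hn (by simp) fun hr' => hr (s.reach'_of_reach hr' hnX)

/-- A replacement that keeps the pairs in the tree is no update. -/
lemma link_updOK {j : ℕ} (g : E.Good j) {H H' : Addr → ℕ} {gp p new : Addr} {i₀ : ℕ} {KS : List K}
    {CS : List (Option Addr)} {X F : List Addr} (hw : WriteStep E t j gp (.ptr i₀) (some new))
    (s : Surgery (E.cfg j).mem (E.cfg (j + 1)).mem H H' gp i₀ p new KS CS X F)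
    (hi : E.Inv (j + 1)) (hp : (E.cfg j).mem.node p .kind ≠ .leaf)
    (evenX : ∀ x ∈ p :: X, Even ((E.cfg j).mem.node x .ver))
    (evenF : ∀ f ∈ new :: F, Even ((E.cfg j).mem.node f .ver))
    (slots : ∀ k v, (∃ x ∈ p :: X, (E.cfg j).mem.node x .kind = .leaf ∧
        SlotHas b ((E.cfg j).mem.node x) k v) ↔
      ∃ f ∈ new :: F, (E.cfg j).mem.node f .kind = .leaf ∧
        SlotHas b ((E.cfg j).mem.node f) k v) : E.UpdOK j := by
  refine updOK_of_not (fun o op' _ hu => ?_) (dict_congr g.self hi fun k v => ?_)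
  · rcases hu.writes.2 with ⟨l, h⟩ | ⟨-, p', x, l, h, h1, h2⟩
    · exact absurd (hw.writes h).2.2 (by simp)
    · obtain ⟨-, rfl, h3⟩ := hw.writes h
      obtain rfl : x = i₀ := by simpa using h3
      rw [s.gp_ptr] at h1
      obtain rfl := Option.some.inj h1
      exact hp h2
  · obtain ⟨rest, h1, h2⟩ := hw.link_inTree s evenF evenX k v
    rw [h1, h2, slots]

lemma EdgeSeen.child {J j : ℕ} {p n : Addr} {x : ℕ} (h : EdgeSeen E j p x n) (g : E.Good J)
    (hj : j ≤ J) : E.Ever j p ∧ E.Ever j n ∧ (E.cfg j).mem.node p .kind ≠ .leaf := by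
  obtain ⟨j₁, j₂, h1, h2, h3, h4, h5⟩ := h
  have hlt := g.rch_lt (by omega) h3
  refine ⟨⟨j₁, by omega, h3⟩, ?_, by rwa [g.kind (h1.trans h2) hj hlt]⟩
  have key : ∀ m, j₁ ≤ m → m ≤ j → E.Rch m p → (E.cfg m).mem.node p (.ptr x) = some n → E.Rch m n := by
    intro m m1 m2 hr hp
    obtain ⟨H, w⟩ := (g.inv m (by omega)).wf
    exact Reachable.child hr (w.child_of_ptr hr (by rwa [g.kind m1 (by omega) hlt]) hp)
  by_cases hr : E.Rch j₂ p
  · exact ⟨j₂, h2, key j₂ h1 h2 hr h5⟩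
  · obtain ⟨m, m1, m2, m3, m4⟩ := exists_unlink h1 h3 hr
    refine ⟨m, by omega, key m m1 (by omega) m3 ?_⟩
    rw [← h5, g.frozen m2 (by omega) ((ever_of_rch m3).mono (Nat.le_succ m)) m4 (by simp),
      ((g.trans m (by omega)).unlink p m3 m4).1]

/-- An edge that was seen is present if both nodes are still in the tree. -/
lemma EdgeSeen.ptr {J j : ℕ} {p n : Addr} {x : ℕ} (h : EdgeSeen E j p x n) (g : E.Good J)
    (hj : j ≤ J) (hp : E.Rch j p) (hn : E.Rch j n) : (E.cfg j).mem.node p (.ptr x) = some n := by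
  obtain ⟨j₁, j₂, h1, h2, h3, h4, h5⟩ := h
  have hlt := g.rch_lt (by omega) h3
  exact g.ptr_const h2 hj (g.rch_between h1 h2 hj (ever_of_rch h3) hp)
    (by rwa [g.kind h1 (by omega) hlt]) h5 hp hn

/-- The nodes that a thread has created. -/
lemma Keeps.fresh_spec {j₀ j : ℕ} {Fr : List (Addr × Node K V)} (k : Keeps E t j₀ Fr j) {n : Addr}
    {nd : Node K V} (h : (n, nd) ∈ Fr) : n < (E.cfg j).mem.next ∧ (E.cfg j).mem.node n = nd ∧
      ¬ E.Ever j n ∧ AllocBy E t j n ∧ ¬ E.Rch j n := by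
  obtain ⟨h1, h2, h3, h4⟩ := k.fresh.2 _ h
  exact ⟨h1, h2, h3, h4, fun hr => h3 (ever_of_rch hr)⟩

section

variable {j₀ : ℕ} {Fr : List (Addr × Node K V)}

lemma safeFrom_allocLeaf {N : List (K × V)} {next : Addr → Prog K V} (hN : N.length ≤ b)
    (hd : (N.map Prod.fst).Nodup)
    (h : ∀ sk new, SafeFrom E t i op j₀ ((new, mkLeaf sk N) :: Fr) (next new)) :
    SafeFrom E t i op j₀ Fr (allocLeaf N next) :=
  safeFrom_anyKey fun sk => safeFrom_alloc ⟨0, rfl⟩ (fun _ => leafOK_mkLeaf hN hd) (h sk)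

lemma safeFrom_allocInternal {kd : Kind} (hk : kd ≠ .leaf) {ks : List K} {cs : List Addr}
    {next : Addr → Prog K V}
    (h : ∀ sk new, SafeFrom E t i op j₀ ((new, mkInternal kd sk ks cs) :: Fr) (next new)) :
    SafeFrom E t i op j₀ Fr (allocInternal kd ks cs next) :=
  safeFrom_anyKey fun sk => safeFrom_alloc ⟨0, rfl⟩ (fun h => absurd h hk) (h sk)

lemma safeFrom_allocLeaves {N : List (K × V)} {next : Addr → K → Addr → Prog K V}
    (hs : N.Pairwise fun x y => x.1 < y.1) (h2 : 2 ≤ N.length) (hN : N.length - N.length / 2 ≤ b)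
    (h : ∀ x R, N.drop (N.length / 2) = x :: R → ∀ sk l sk' r, SafeFrom E t i op j₀
      ((r, mkLeaf sk' (x :: R)) :: (l, mkLeaf sk (N.take (N.length / 2))) :: Fr) (next l x.1 r)) :
    SafeFrom E t i op j₀ Fr (allocLeaves N next) := by
  unfold allocLeaves
  cases hd : N.drop (N.length / 2) with
  | nil => exact safeFrom_crash
  | cons x R =>
    obtain ⟨-, -, -, -, e1, e2, e3, e4⟩ := halves_spec hs rfl hd h2
    exact safeFrom_allocLeaf (by omega) e1 fun sk l => safeFrom_allocLeaf (by omega) e2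
      fun sk' r => h x R hd sk l sk' r

lemma safeFrom_allocInternals {ks : List K} {cs : List Addr} {next : Addr → K → Addr → Prog K V}
    (h : ∀ x R, ks.drop (cs.length / 2 - 1) = x :: R → ∀ sk l sk' r, SafeFrom E t i op j₀
      ((r, mkInternal .internal sk' R (cs.drop (cs.length / 2))) ::
        (l, mkInternal .internal sk (ks.take (cs.length / 2 - 1)) (cs.take (cs.length / 2))) :: Fr)
      (next l x r)) :
    SafeFrom E t i op j₀ Fr (allocInternals ks cs next) := by
  unfold allocInternals
  cases hd : ks.drop (cs.length / 2 - 1) with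
  | nil => exact safeFrom_crash
  | cons x R =>
    exact safeFrom_allocInternal (by simp) fun sk l => safeFrom_allocInternal (by simp)
      fun sk' r => h x R hd sk l sk' r

end

end Execution

end OCC

namespace OCC

section Sites

variable {K V T : Type} [LinearOrder K] {m : Mem K V T}

/-- The routing key between two adjacent children separates their ranges. -/
lemma next_of_halves {n l r : Addr} {KA KB : List K} {x : K} {A B : List Addr}
    (hi : IsInternal (m.node n) (KA ++ x :: KB) (A ++ l :: r :: B)) (hA : KA.length = A.length)
    {k : K} (h1 : ∀ y ∈ KA, y ≤ k) (h2 : ∀ y ∈ KB, k < y) :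
    (k < x → Next m k n l) ∧ ((∀ y ∈ KA, y ≤ x) → x ≤ k → Next m k n r) := by
  refine ⟨fun h => next_of_between hi hA h1 fun y hy => ?_, fun _ h =>
    next_of_between (KA := KA ++ [x]) (KB := KB) (A := A ++ [l]) (B := B) (by simpa using hi)
      (by simp [hA]) (fun y hy => ?_) h2⟩
  · rcases List.mem_cons.1 hy with rfl | hy
    · exact h
    · exact h2 y hy
  · rcases List.mem_append.1 hy with hy | hy
    · exact h1 y hy
    · rwa [List.mem_singleton.1 hy]

end Sites

namespace Execution

variable {K V T : Type} [LinearOrder K] [DecidableEq T] {a b : ℕ} {E : Execution K V T a b}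
  {t : T} {i : ℕ} {op : Op K V}

/-! ### Splitting inserts -/

lemma topKind_ne (n : Addr) : topKind n ≠ .leaf := by
  unfold topKind
  split_ifs <;> simp

lemma Keeps.internal {j₀ j : ℕ} {Fr : List (Addr × Node K V)} (k : Keeps E t j₀ Fr j) {n : Addr}
    {kd : Kind} {sk : K} {ks : List K} {cs : List Addr} (hk : kd ≠ .leaf)
    (h : (n, mkInternal kd sk ks cs) ∈ Fr) : IsInternal ((E.cfg j).mem.node n) ks cs := by
  rw [(k.fresh_spec h).2.1]
  exact isInternal_mkInternal hk sk ks cs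

/-- The leaf and its parent are locked and in the tree, so that the parent still points to the leaf. The
keys of the two new leaves are the keys of the old one and the new key, all of which are in the range
of the old leaf. -/
lemma safeFrom_split {j : ℕ} {key : K} {val : V} {leaf parent : Addr} {x₀ : ℕ}
    (hb : 2 ≤ b) (hi : E.Invokes (t, i) (.insert key val)) (hedge : EdgeSeen E j parent x₀ leaf)
    (hL : AtLeaf E t i (.insert key val) leaf j) (hr : E.Rch (j + 1) leaf)
    (hnk : ∀ x < b, (E.cfg (j + 1)).mem.node leaf (.key x) ≠ some key)
    (hsz : b ≤ (E.cfg (j + 1)).mem.node leaf .size) :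
    SafeFrom E t i (.insert key val) (j + 1) [] (
      .lock parent <|
      .read parent .marked fun m' =>
      if m' = true then unlockAll [leaf, parent] (startOp (.insert key val)) else
      readPairs leaf (fun L =>
        allocLeaves (sortPairs ((key, val) :: L)) fun l x r =>
        allocInternal (topKind parent) [x] [l, r] fun new =>
        .write parent (.ptr x₀) (some new) <|
        .write leaf .marked true <|
        unlockAll [leaf, parent] <|
        .goto (.rebalance [.fixTagged new] none)) 0 b) := by
  refine safeFrom_lock fun j₁ k₁ g hlk hl hm => ?_
  obtain ⟨eP, -, kP⟩ := hedge.child hL.good (Nat.le_succ j)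
  have hj : j ≤ j₁ + 1 := (Nat.le_succ j).trans (k₁.le.trans (Nat.le_succ _))
  have hmem : ∀ n, E.Rch (j₁ + 1) n ↔ E.Rch j₁ n := rch_of_node_eq (by rw [hm])
  have hH : Held E t [parent, leaf] [] (j₁ + 1) :=
    (hL.held.frame k₁.le k₁.good k₁.mhold).locked k₁.good (eP.mono ((Nat.le_succ j).trans k₁.le)) hl hm hmem
  have hne : parent ≠ leaf := by
    rintro rfl
    exact kP (by rw [← hL.kind, hL.good.kind (Nat.le_succ j) le_rfl (hL.good.ever_lt (Nat.le_succ j) eP)])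
  have hq : Quiet E t (j + 1) (j₁ + 1) := k₁.mhold.quiet.trans <| by
    obtain ⟨-, nx, h'⟩ := hlk
    exact Quiet.step h' (by simp)
  have hH' : Held E t [leaf, parent] [] (j₁ + 1) := hH.congr fun n => by simp [or_comm]
  have ltP := g.ever_lt le_rfl (hH.ever parent (by simp))
  have ltL := g.ever_lt le_rfl (hH.ever leaf (by simp))
  have lkP := (hH.lock parent).2 (by simp)
  have lkL := (hH.lock leaf).2 (by simp)
  refine safeFrom_read_locked (by simp) ltP lkP ?_
  split_ifs with hmk
  · exact safeFrom_unlockAll (by simp) hH' (by simpa using hne.symm) fun j' _ _ hq' hN =>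
      safeFrom_startOp hN (hL.pre.quiet (hq.trans hq'))
  have rP : E.Rch (j₁ + 1) parent := hH.rch (by simp) hmk
  have rL : E.Rch (j₁ + 1) leaf := (hmem leaf).2 (k₁.rch hL.lock hr)
  have hptr := (hedge.mono hj).ptr g le_rfl rP rL
  have nodeL : (E.cfg (j₁ + 1)).mem.node leaf = (E.cfg (j + 1)).mem.node leaf := by
    rw [hm]
    exact k₁.node hL.lt hL.lock
  have okL : LeafOK b ((E.cfg (j₁ + 1)).mem.node leaf) := nodeL ▸ hL.leafOK
  have kindL : (E.cfg (j₁ + 1)).mem.node leaf .kind = .leaf := nodeL ▸ hL.kind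
  have kindP : (E.cfg (j₁ + 1)).mem.node parent .kind ≠ .leaf := by
    rwa [g.kind hj le_rfl (hL.good.ever_lt (Nat.le_succ j) eP)]
  obtain ⟨hpairs, hnd, hlen, hlenb⟩ := pairs_spec okL
  refine safeFrom_readPairs ltL lkL ?_
  set L₀ := pairsFrom ((E.cfg (j₁ + 1)).mem.node leaf) 0 b with hL₀
  have hkey : ∀ v, (key, v) ∉ L₀ := fun v hv => by
    obtain ⟨x, hx, h1, -⟩ := (hpairs key v).1 hv
    exact hnk x hx (by rwa [nodeL] at h1)
  have hnd' : (((key, val) :: L₀).map Prod.fst).Nodup := by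
    rw [List.map_cons, List.nodup_cons]
    refine ⟨fun h => ?_, hnd⟩
    obtain ⟨⟨k', v⟩, hv, rfl⟩ := List.mem_map.1 h
    exact hkey v hv
  have hNlen : (sortPairs ((key, val) :: L₀)).length = b + 1 := by
    rw [(sortPairs_perm _).length_eq, List.length_cons]
    rw [nodeL] at hlen
    omega
  have hN : ∀ k v, (k, v) ∈ sortPairs ((key, val) :: L₀) ↔ (k = key ∧ v = val) ∨
      SlotHas b ((E.cfg (j₁ + 1)).mem.node leaf) k v := fun k v => by
    rw [(sortPairs_perm _).mem_iff, List.mem_cons, hpairs, Prod.mk.injEq]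
  refine safeFrom_allocLeaves (sortPairs_sorted hnd') (by omega) (by omega)
    fun x R hR skl l skr r => ?_
  obtain ⟨hmemN, hlt, hge, -, ndL, ndR, lenL, lenR⟩ :=
    halves_spec (sortPairs_sorted hnd') rfl hR (by omega)
  refine safeFrom_allocInternal (topKind_ne _) fun skn new => ?_
  refine safeFrom_write fun u k hp hw => ?_
  -- the memory just before the write
  have gu := k.good
  have hHu := hH.frame k.le gu k.mhold
  have nodeU : (E.cfg u).mem.node leaf = (E.cfg (j₁ + 1)).mem.node leaf := k.node ltL lkL
  have kindU : (E.cfg u).mem.node leaf .kind = .leaf := by rwa [nodeU]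
  have kindPU : (E.cfg u).mem.node parent .kind ≠ .leaf := by rwa [k.node ltP lkP]
  have ptrU : (E.cfg u).mem.node parent (.ptr x₀) = some leaf := by rwa [k.node ltP lkP]
  have rLU := k.rch lkL rL
  have evenU : Even ((E.cfg u).mem.node leaf .ver) := hHu.even leaf (by simp)
  obtain ⟨H, w⟩ := gu.self.wf
  have site : Site (E.cfg u).mem H parent x₀ leaf := ⟨w, k.rch lkP rP, kindPU, ptrU⟩
  have onN : ∀ y ∈ sortPairs ((key, val) :: L₀), E.On u y.1 leaf := by
    rintro ⟨k', v⟩ hy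
    rcases (hN k' v).1 hy with ⟨rfl, -⟩ | hs
    · exact (gu.on_iff (k₁.le.trans ((Nat.le_succ _).trans k.le)) le_rfl hr rLU).2 (hL.on hr)
    · rw [← nodeU] at hs
      exact gu.self.keys leaf k' v rLU kindU ((le_even evenU).2 hs)
  have memR : ∀ y ∈ x :: R, y ∈ sortPairs ((key, val) :: L₀) := fun y hy => (hmemN y).2 (.inr hy)
  have memL : ∀ y ∈ (sortPairs ((key, val) :: L₀)).take
      ((sortPairs ((key, val) :: L₀)).length / 2), y ∈ sortPairs ((key, val) :: L₀) :=
    fun y hy => (hmemN y).2 (.inl hy)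
  have keyx : KeyIn (E.cfg u).mem leaf x.1 := by
    refine ⟨onN x (memR x (by simp)), ?_⟩
    obtain ⟨y, hy⟩ := List.exists_mem_of_ne_nil
      ((sortPairs ((key, val) :: L₀)).take ((sortPairs ((key, val) :: L₀)).length / 2))
      (fun h => by rw [h] at lenL; simp at lenL; omega)
    exact ⟨y.1, hlt y hy, onN y (memL y hy)⟩
  have fr := fun n nd (h : (n, nd) ∈ _) => k.fresh_spec (n := n) (nd := nd) h
  obtain ⟨n1, n2, n3, n4, n5⟩ := fr new _ List.mem_cons_self
  obtain ⟨r1, r2, r3, r4, r5⟩ := fr r (mkLeaf skr (x :: R)) (by simp)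
  obtain ⟨l1, l2, l3, l4, l5⟩ := fr l (mkLeaf skl _) (List.mem_cons_of_mem _
    (List.mem_cons_of_mem _ List.mem_cons_self))
  have hnodup : [new, r, l].Nodup := k.fresh.1
  have hint : IsInternal ((E.cfg u).mem.node new) ([] ++ x.1 :: []) ([] ++ l :: r :: []) :=
    k.internal (topKind_ne _) List.mem_cons_self
  have kl : (E.cfg u).mem.node l .kind = .leaf := by rw [l2]; rfl
  have kr : (E.cfg u).mem.node r .kind = .leaf := by rw [r2]; rfl
  have kn : (E.cfg u).mem.node new .kind = topKind parent := by rw [n2]; rfl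
  have fragF : Frag (E.cfg u).mem new ([] ++ []) ([] ++ none :: []) [r, l] :=
    Frag.two_leaves (KA := []) (KB := []) (x := x.1) (A := []) (B := [])
      (Expands.internal _ _ hint rfl) kl kr rfl (by simp)
  -- the old leaf and the new node, with its two leaves merged, look like one anonymous child
  have hsurg := site.two (hN := if parent = entry then 1 else 0) (hF := 0)
    (.base (.leaf kindU)) (by simpa using hne) hint rfl rfl (.leaf kl) (.leaf kr) (by simp)
    (by simpa using keyx) fragF (by simp [n1, n5, r1, r5, l1, l5]) hnodup
    (fun h => by simp [h, w.height_leaf leaf rLU kindU]) (by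
      rw [kn]
      unfold topKind
      split_ifs <;> simp_all) (fun _ => rfl) (fun _ => rfl) (by simp [kl]) (by simp [kr])
    (by simp) (by simp)
  -- the new leaves hold the old pairs and the new one
  have slotF : ∀ k' v, (∃ f ∈ [new, r, l], (E.cfg u).mem.node f .kind = .leaf ∧
      SlotHas b ((E.cfg u).mem.node f) k' v) ↔ (k', v) ∈ sortPairs ((key, val) :: L₀) := by
    intro k' v
    have e1 : (E.cfg u).mem.node new .kind ≠ .leaf := by
      rw [kn]
      exact topKind_ne _
    simp only [List.mem_cons, List.not_mem_nil, or_false, exists_eq_or_imp, exists_eq_left, e1,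
      false_and, false_or, kl, kr, true_and]
    rw [r2, l2, slotHas_mkLeaf (by omega), slotHas_mkLeaf (by omega), hmemN, or_comm]
  have dnone : E.dict u key = none := by
    refine Option.eq_none_iff_forall_ne_some.2 fun v hv => hkey v ?_
    rw [gu.self.dict_leaf rLU kindU (onN (key, val) ((hN _ _).2 (.inl ⟨rfl, rfl⟩))), le_even evenU,
      nodeU] at hv
    exact (hpairs key v).2 hv
  have hpoint : E.UpdatePoint (t, i) u (.insert key val) :=
    .inr ⟨hp, parent, x₀, leaf, ⟨hw.1, _, hw.2.1⟩, ptrU, kindU⟩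
  obtain ⟨hok, hH2, rnew, hstay⟩ := link_step gu hHu hw hsurg (by simp) (fun f hf => by
    simp only [List.mem_cons, List.not_mem_nil, or_false] at hf
    rcases hf with rfl | rfl | rfl
    · exact ⟨n3, n4, by rw [n2]; exact ⟨0, rfl⟩⟩
    · exact ⟨r3, r4, by rw [r2]; exact ⟨0, rfl⟩⟩
    · exact ⟨l3, l4, by rw [l2]; exact ⟨0, rfl⟩⟩) (fun f hf hk k' v hs => by
    simp only [List.mem_cons, List.not_mem_nil, or_false] at hf
    have hnext := next_of_halves hint rfl (k := k') (by simp) (by simp)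
    rcases hf with rfl | rfl | rfl
    · exact absurd hk (by rw [kn]; exact topKind_ne _)
    · rw [r2, slotHas_mkLeaf (by omega)] at hs
      exact ⟨onN _ (memR _ hs), .inr (hnext.2 (by simp) (hge _ hs))⟩
    · rw [l2, slotHas_mkLeaf (by omega)] at hs
      exact ⟨onN _ (memL _ hs), .inr (hnext.1 (hlt _ hs))⟩) (fun s hinv => by
    have hdict : E.dict (u + 1) = Function.update (E.dict u) key (some val) := by
      funext k'
      refine Option.ext fun v => ?_
      obtain ⟨rest, h1, h2⟩ := hw.link_inTree s (fun f hf => by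
        simp only [List.mem_cons, List.not_mem_nil, or_false] at hf
        rcases hf with rfl | rfl | rfl
        · rw [n2]; exact ⟨0, rfl⟩
        · rw [r2]; exact ⟨0, rfl⟩
        · rw [l2]; exact ⟨0, rfl⟩) (by simpa using evenU) k' v
      rw [hinv.dict_iff, h2, slotF, hN, ← nodeU]
      simp only [List.mem_cons, List.not_mem_nil, or_false, exists_eq_left, kindU,
        true_and] at h1
      rw [or_assoc, ← h1, ← gu.self.dict_iff]
      by_cases hkk : k' = key
      · subst hkk
        simp [dnone, eq_comm]
      · simp [hkk]
    have happ : ((Op.insert key val).apply (E.dict u)).1 =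
        Function.update (E.dict u) key (some val) := by simp [Op.apply, dnone]
    refine updOK_of_point hi hpoint (by rw [hdict, happ]) (fun he => ?_) fun v hv =>
      (hL.pre.quiet (hq.trans k.mhold.quiet)).not_updatePoint hv
    have := congrFun (hdict.symm.trans he) key
    simp [dnone] at this)
  refine ⟨hok, fun g' => ?_⟩
  refine safeFrom_markAll (as := [leaf]) (by simp) hH2 (by simp) fun j₂ hj₂ g₂ hH3 _ => ?_
  refine safeFrom_unlockAll (as := [leaf, parent]) (by simp) (hH3.congr fun n => by simp [or_comm])
    (by simpa using hne.symm) fun j₃ hj₃ g₃ _ hN3 => ?_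
  refine safeFrom_goto (by simp) fun j₄ k₄ => ⟨hN3.frame k₄.le k₄.good k₄.mhold, ?_, u, ?_, hpoint, ?_⟩
  · intro n hn
    simp only [List.mem_singleton, Task.fixTagged.injEq] at hn
    subst hn
    have hle : u + 1 ≤ j₄ := hj₂.trans (hj₃.trans k₄.le)
    exact (k₄.good.rch_lt hle rnew).trans_le (k₄.good.next_mono hle le_rfl)
  · have := k₄.le
    omega
  · simp [Op.apply, dnone]

end Execution

end OCC

namespace OCC

section Sites

variable {K V T : Type} [LinearOrder K] {m : Mem K V T} {H : Addr → ℕ} {gp p new : Addr} {i₀ : ℕ}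

/-! ### Replacing a tagged node -/

/-- The two halves of the routing keys and the children of an internal node. -/
lemma internals_spec {ks R : List K} {cs : List Addr} {x : K} (hlen : cs.length = ks.length + 1)
    (h : ks.drop (cs.length / 2 - 1) = x :: R) :
    ks.take (cs.length / 2 - 1) ++ x :: R = ks ∧
    (cs.take (cs.length / 2)).length = (ks.take (cs.length / 2 - 1)).length + 1 ∧
    (cs.drop (cs.length / 2)).length = R.length + 1 := by
  have hl := congrArg List.length h
  simp only [List.length_drop, List.length_cons] at hl
  refine ⟨by rw [← h, List.take_append_drop], ?_, ?_⟩
  · simp only [List.length_take]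
    omega
  · simp only [List.length_drop]
    omega

/-- Inside of the node `gp`, the child `p` is to be replaced, together with its tagged child `c`. -/
structure TagSite (m : Mem K V T) (H : Addr → ℕ) (gp : Addr) (i₀ : ℕ) (p c : Addr)
    (KA KM KB : List K) (A M B : List Addr) : Prop extends Site m H gp i₀ p where
  int : IsInternal (m.node p) (KA ++ KB) (A ++ c :: B)
  intc : IsInternal (m.node c) KM M
  lenA : KA.length = A.length
  p_tag : m.node p .kind ≠ .tagged
  c_tag : m.node c .kind = .tagged
  gp_not_mem : gp ∉ [p, c]

namespace TagSite

variable {c : Addr} {KA KM KB : List K} {A M B : List Addr}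

lemma spec (q : TagSite m H gp i₀ p c KA KM KB A M B) :
    (KA ++ KM ++ KB).Pairwise (· < ·) ∧ (∀ z ∈ KA ++ KM ++ KB, KeyIn m p z) ∧
    Frag m p (KA ++ KM ++ KB) ((A ++ M ++ B).map some) [c] ∧
    (A ++ M ++ B).length = (KA ++ KM ++ KB).length + 1 ∧
    ∀ d ∈ A ++ M ++ B, Reachable m d ∧ H p = H d + 1 := by
  obtain ⟨ks, cs, hi, lenp, sp, kp⟩ := q.wf.shape p q.reach q.int.kind_ne
  obtain rfl := q.int.keys_unique hi
  obtain rfl := q.int.children_unique hi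
  have cc : IsChild m p c := (isChild_iff q.int).2 (by simp)
  have rc : Reachable m c := q.reach.child cc
  have hc : c ≠ entry := fun h => q.wf.ne_entry p q.reach (h ▸ cc)
  obtain ⟨ks, cs, hi', lenc, sc, kc⟩ := q.wf.shape c rc q.intc.kind_ne
  obtain rfl := q.intc.keys_unique hi'
  obtain rfl := q.intc.children_unique hi'
  have bc : ∀ z ∈ KM, (∀ y ∈ KA, y < z) ∧ ∀ y ∈ KB, z < y := fun z hz =>
    keyIn_between q.wf q.reach q.int sp q.lenA (kc z hz)
  have hs : (KA ++ KM ++ KB).Pairwise (· < ·) := by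
    rw [List.append_assoc, List.pairwise_append, List.pairwise_append]
    rw [List.pairwise_append] at sp
    refine ⟨sp.1, ⟨sc, sp.2.1, fun z hz => (bc z hz).2⟩, fun y hy z hz => ?_⟩
    rcases List.mem_append.1 hz with hz | hz
    · exact (bc z hz).1 y hy
    · exact sp.2.2 y hy z hz
  have hp : ∀ d ∈ A ++ c :: B, Reachable m d ∧ H p = H d + 1 := fun d hd => by
    have h := (isChild_iff q.int).2 hd
    refine ⟨q.reach.child h, ?_⟩
    simpa [q.p_tag] using q.wf.height p d q.reach q.ne_entry h
  refine ⟨hs, fun z hz => ?_, ?_, ?_, fun d hd => ?_⟩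
  · rw [List.append_assoc, List.mem_append, List.mem_append] at hz
    rcases hz with hz | hz | hz
    · exact kp z (by simp [hz])
    · exact (kc z hz).of_child q.wf q.reach cc
    · exact kp z (by simp [hz])
  · have := Frag.one (KA := KA) (KB := KB) (A := A.map some) (B := B.map some)
      (by simpa using Expands.internal _ _ q.int lenp) (.internal _ _ q.intc lenc) (by simp [q.lenA]) hs
    simpa using this
  · simp only [List.length_append, List.length_cons] at lenp ⊢
    omega
  · simp only [List.mem_append] at hd
    rcases hd with (hd | hd) | hd
    · exact hp d (by simp [hd])
    · have h := (isChild_iff q.intc).2 hd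
      refine ⟨rc.child h, ?_⟩
      have h1 := q.wf.height c d rc hc h
      rw [q.c_tag, if_pos rfl] at h1
      rw [← Nat.add_zero (H d), ← h1]
      exact (hp c (by simp)).2
    · exact hp d (by simp [hd])

/-- The tagged node is absorbed into its parent. -/
lemma absorb (q : TagSite m H gp i₀ p c KA KM KB A M B)
    (hn : IsInternal (m.node new) (KA ++ KM ++ KB) (A ++ M ++ B)) (tag : m.node new .kind ≠ .tagged)
    (fresh : ¬ Reachable m new ∧ new < m.next) :
    Surgery m (link m gp i₀ new) H (newHeight H new [] (H p) 0) gp i₀ p new (KA ++ KM ++ KB)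
      ((A ++ M ++ B).map some) [c] [] := by
  obtain ⟨hs, hk, hf, hl, hh⟩ := q.spec
  refine q.toSite.zero hf q.gp_not_mem (.internal _ _ hn hl) hs hk fresh (fun _ => rfl)
    (fun h => absurd h hn.kind_ne) tag fun d hd => hh d ?_
  rw [List.mem_map] at hd
  obtain ⟨d', hd', he⟩ := hd
  rwa [← Option.some.inj he]

/-- The contents of the tagged node and its parent are distributed among two new nodes. -/
lemma split (q : TagSite m H gp i₀ p c KA KM KB A M B) {l r : Addr} {x : K} {R : List K}
    (hR : (KA ++ KM ++ KB).drop ((A ++ M ++ B).length / 2 - 1) = x :: R)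
    (hn : IsInternal (m.node new) [x] [l, r]) (kn : m.node new .kind = topKind gp)
    (hl : IsInternal (m.node l) ((KA ++ KM ++ KB).take ((A ++ M ++ B).length / 2 - 1))
      ((A ++ M ++ B).take ((A ++ M ++ B).length / 2)))
    (hr : IsInternal (m.node r) R ((A ++ M ++ B).drop ((A ++ M ++ B).length / 2)))
    (tagL : m.node l .kind ≠ .tagged) (tagR : m.node r .kind ≠ .tagged)
    (fresh : ∀ f ∈ [new, r, l], ¬ Reachable m f ∧ f < m.next) (nodup : [new, r, l].Nodup) :
    ∃ H', Surgery m (link m gp i₀ new) H H' gp i₀ p new (KA ++ KM ++ KB)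
      ((A ++ M ++ B).map some) [c] [r, l] := by
  obtain ⟨hs, hk, hf, hlen, hh⟩ := q.spec
  obtain ⟨e1, e2, e3⟩ := internals_spec hlen hR
  have e4 := List.take_append_drop ((A ++ M ++ B).length / 2) (A ++ M ++ B)
  have exn := Expands.internal _ _ hn rfl
  have exl := Expands.internal _ _ hl e2
  have exr := Expands.internal _ _ hr e3
  generalize (KA ++ KM ++ KB).take ((A ++ M ++ B).length / 2 - 1) = KL at *
  generalize (A ++ M ++ B).take ((A ++ M ++ B).length / 2) = CL at *
  generalize (A ++ M ++ B).drop ((A ++ M ++ B).length / 2) = CR at *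
  rw [← e1] at hs hk hf ⊢
  rw [← e4] at hh hf ⊢
  have fragF := Frag.two (KA := []) (KB := []) (A := []) (B := []) exn exl exr rfl (by simpa using hs)
  refine ⟨_, q.toSite.two (KA := []) (KB := []) (A := []) (B := []) hf q.gp_not_mem
    (hN := if gp = entry then H p + 1 else H p) (hF := H p) hn rfl rfl exl exr (by simpa using hs)
    (by simpa using hk) (by simpa using fragF) fresh nodup (fun h => by simp [h]) ?_
    (fun h => absurd h hl.kind_ne) (fun h => absurd h hr.kind_ne) tagL tagR (by simp) fun d hd => ?_⟩
  · rw [kn]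
    unfold topKind
    split_ifs <;> simp_all
  · rw [← List.map_append, List.mem_map] at hd
    obtain ⟨d', hd', he⟩ := hd
    rw [← Option.some.inj he]
    exact hh d' hd'

end TagSite

end Sites

namespace Execution

variable {K V T : Type} [LinearOrder K] [DecidableEq T] {a b : ℕ} {E : Execution K V T a b}
  {t : T} {i : ℕ} {op : Op K V}

lemma safeFrom_release {j : ℕ} {Fr : List (Addr × Node K V)} {as : List Addr} {todo : List Task}
    {res : Option V} (hne : as ≠ []) (hH : Held E t as [] j) (hnd : as.Nodup)
    (ht : TodoOK E j todo) (hp : Post E t i op j res) :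
    SafeFrom E t i op j Fr (unlockAll as (.goto (.rebalance todo res))) :=
  safeFrom_unlockAll hne hH hnd fun j' hj' _ _ hN => safeFrom_goto (by simp) fun _ k =>
    ⟨hN.frame k.le k.good k.mhold, ht.mono k.good (hj'.trans k.le) le_rfl, hp.mono (hj'.trans k.le)⟩

/-- A replacement in which no leaf takes part. -/
lemma link_internal {j : ℕ} (g : E.Good j) {S : List Addr} (hS : Held E t S [] j)
    {H H' : Addr → ℕ} {gp p new : Addr} {i₀ : ℕ} {KS : List K} {CS : List (Option Addr)}
    {X F : List Addr} (hw : WriteStep E t j gp (.ptr i₀) (some new))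
    (s : Surgery (E.cfg j).mem (link (E.cfg j).mem gp i₀ new) H H' gp i₀ p new KS CS X F)
    (hX : ∀ n ∈ gp :: p :: X, n ∈ S)
    (kindX : ∀ x ∈ p :: X, (E.cfg j).mem.node x .kind ≠ .leaf)
    (hF : ∀ f ∈ new :: F, ¬ E.Ever j f ∧ E.AllocBy t j f ∧ Even ((E.cfg j).mem.node f .ver))
    (kindF : ∀ f ∈ new :: F, (E.cfg j).mem.node f .kind ≠ .leaf) :
    E.StepOK j ∧ Held E t S (p :: X) (j + 1) ∧ E.Rch (j + 1) new ∧
      ∀ n, n ∉ p :: X → E.Rch j n → E.Rch (j + 1) n :=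
  link_step g hS hw s hX hF (fun f hf hk => absurd hk (kindF f hf)) fun s hi =>
    link_updOK g hw s hi (kindX p (by simp)) (fun x hx => hS.even x (hX x (by
      simp only [List.mem_cons] at hx ⊢
      exact .inr hx))) (fun f hf => (hF f hf).2.2) fun k v =>
      ⟨fun ⟨x, h1, h2, _⟩ => absurd h2 (kindX x h1), fun ⟨f, h1, h2, _⟩ => absurd h2 (kindF f h1)⟩

/-- The routing keys and children around a child. -/
lemma exists_around {ks : List K} {cs : List Addr} {c : Addr} {x : ℕ}
    (hlen : cs.length = ks.length + 1) (h : cs[x]? = some c) :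
    ks = ks.take x ++ ks.drop x ∧ cs = cs.take x ++ c :: cs.drop (x + 1) ∧
    (ks.take x).length = (cs.take x).length ∧ (cs.take x).length = x := by
  obtain ⟨h1, h2⟩ := List.getElem?_eq_some_iff.1 h
  refine ⟨(List.take_append_drop _ _).symm, ?_, ?_, ?_⟩
  · rw [← h2, ← List.drop_eq_getElem_cons, List.take_append_drop]
  · simp only [List.length_take]
    omega
  · simp only [List.length_take]
    omega

/-- The nodes are marked before they are unlinked, which is harmless as they are locked until then. -/
lemma safeFrom_fixTaggedFound {j : ℕ} {key : K} {target : Option Addr} {path : PathInfo}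
    {todo : List Task} {res : Option V} (g : E.Good j)
    (h : LInv E t i op j (.search (.fixTagged path.n todo res) key target path)) :
    SafeFrom E t i op j [] (fixTaggedFound b path.n path todo res) := by
  obtain ⟨hN, -, ⟨hedge, hedge'⟩, hnlt, hntag, htodo, hpost⟩ := h
  unfold fixTaggedFound
  cases hp : path.p with
  | none => exact safeFrom_crash
  | some p =>
  cases hgp : path.gp with
  | none => exact safeFrom_crash
  | some gp =>
  have hedge := hedge p hp
  have hedge' := hedge' gp p hgp hp
  dsimp only
  generalize path.nIdx = x at *
  generalize path.pIdx = i₀ at *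
  generalize path.n = node at *
  obtain ⟨ep, en, kp⟩ := hedge.child g le_rfl
  obtain ⟨egp, -, kgp⟩ := hedge'.child g le_rfl
  refine safeFrom_lockAll (by simp) hN.held (by simp [en, ep, egp]) (by simp)
    fun j₁ hj₁ g₁ _ hH₁ hnd => ?_
  rw [List.append_nil] at hH₁ hnd
  have kind₁ : ∀ {n}, E.Ever j n → (E.cfg j₁).mem.node n .kind = (E.cfg j).mem.node n .kind :=
    fun h => g₁.kind hj₁ le_rfl (g.ever_lt le_rfl h)
  have hretry : SafeFrom E t i op j₁ [] (unlockAll [node, p, gp]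
      (.goto (.rebalance (.fixTagged node :: todo) res))) := by
    refine safeFrom_release (by simp) hH₁ hnd (fun n hn => ?_) (hpost.mono hj₁)
    simp only [List.mem_cons, Task.fixTagged.injEq] at hn
    rcases hn with rfl | hn
    · exact hnlt.trans_le (g₁.next_mono hj₁ le_rfl)
    · exact htodo.mono g₁ hj₁ le_rfl n hn
  refine safeFrom_ifMarked hH₁ g₁ (by simp) hretry fun hR₁ => ?_
  refine safeFrom_ifTagged hH₁ g₁ (by simp) hretry fun htag => ?_
  have htag := htag p (by simp)
  refine safeFrom_markAll (as := [node, p]) (by simp) (hH₁.weaken (by simp)) (by simp)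
    fun j₂ hj₂ g₂ hH₂ hst => ?_
  have hj : j ≤ j₂ := hj₁.trans hj₂
  have hR₂ : ∀ n ∈ [node, p, gp], E.Rch j₂ n := fun n hn => (hst n hn).1 (hR₁ n hn)
  have hM₂ : ∀ n ∈ [p, node], (E.cfg j₂).mem.node n .marked = true := fun n hn =>
    (hst n (by simp at hn ⊢; tauto)).2 (.inl (by simp at hn ⊢; tauto))
  have kind₂ : ∀ {n}, E.Ever j n → (E.cfg j₂).mem.node n .kind = (E.cfg j).mem.node n .kind :=
    fun h => g₂.kind hj le_rfl (g.ever_lt le_rfl h)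
  have lk : ∀ n ∈ [node, p, gp], (E.cfg j₂).mem.lock n = some t := fun n hn => (hH₂.lock n).2 hn
  have lt : ∀ n ∈ [node, p, gp], n < (E.cfg j₂).mem.next := fun n hn =>
    g₂.ever_lt le_rfl (hH₂.ever n hn)
  have hptr := (hedge.mono hj).ptr g₂ le_rfl (hR₂ p (by simp)) (hR₂ node (by simp))
  have hptr' := (hedge'.mono hj).ptr g₂ le_rfl (hR₂ gp (by simp)) (hR₂ p (by simp))
  obtain ⟨H₂, w₂⟩ := g₂.self.wf
  obtain ⟨ks, cs, hi, hlen, -⟩ := w₂.shape p (hR₂ p (by simp)) (by rwa [kind₂ ep])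
  obtain ⟨KM, M, hi', hlen', -⟩ := w₂.shape node (hR₂ node (by simp)) (by
    rw [kind₂ en, hntag]
    simp)
  rw [hi.ptr_eq] at hptr
  obtain ⟨eks, ecs, lenA, -⟩ := exists_around hlen hptr
  refine safeFrom_readInternal (lt p (by simp)) (lk p (by simp)) hi hlen ?_
  refine safeFrom_readInternal (lt node (by simp)) (lk node (by simp)) hi' hlen' ?_
  -- the situation just before the write
  have hsite : ∀ {u Fr}, Keeps E t j₂ Fr u → ∃ H, TagSite (E.cfg u).mem H gp i₀ p node (ks.take x)
      KM (ks.drop x) (cs.take x) M (cs.drop (x + 1)) := fun {u Fr} k => by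
    have e : ∀ n ∈ [node, p, gp], (E.cfg u).mem.node n = (E.cfg j₂).mem.node n := fun n hn =>
      k.node (lt n hn) (lk n hn)
    obtain ⟨H, w⟩ := k.good.self.wf
    refine ⟨H, ⟨w, k.rch (lk gp (by simp)) (hR₂ gp (by simp)), ?_, ?_⟩, ?_, ?_, lenA, ?_, ?_, ?_⟩
    · rwa [e gp (by simp), kind₂ egp]
    · rwa [e gp (by simp)]
    · rwa [e p (by simp), ← eks, ← ecs]
    · rwa [e node (by simp)]
    · rwa [e p (by simp), kind₂ ep, ← kind₁ ep]
    · rwa [e node (by simp), kind₂ en]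
    · simp only [List.nodup_cons, List.mem_cons, List.not_mem_nil, or_false] at hnd ⊢
      tauto
  have hkindX : ∀ {u Fr}, Keeps E t j₂ Fr u → ∀ n ∈ [p, node],
      (E.cfg u).mem.node n .kind ≠ .leaf := fun {u Fr} k n hn => by
    obtain ⟨H, q⟩ := hsite k
    simp only [List.mem_cons, List.not_mem_nil, or_false] at hn
    rcases hn with rfl | rfl
    · exact q.int.kind_ne
    · exact q.intc.kind_ne
  -- after the write, the unlinked nodes are already marked
  have hmark : ∀ {u Fr new}, Keeps E t j₂ Fr u → WriteStep E t u gp (.ptr i₀) new →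
      Held E t [node, p, gp] [p, node] (u + 1) → Held E t [node, p, gp] [] (u + 1) :=
    fun {u Fr new} k hw hH => hH.marked fun n hn => by
      have hn' : n ∈ [node, p, gp] := by simp at hn ⊢; tauto
      rw [hw.field_ne (.inr (by simp)), k.node (lt n hn') (lk n hn')]
      exact hM₂ n hn
  split_ifs with hsz
  · refine safeFrom_allocInternal (by simp) fun sk new => safeFrom_write fun u k _ hw => ?_
    obtain ⟨H, q⟩ := hsite k
    obtain ⟨n1, n2, n3, n4, n5⟩ := k.fresh_spec List.mem_cons_self
    have hint := k.internal (by simp) List.mem_cons_self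
    obtain ⟨hok, hH₃, -, -⟩ := link_internal k.good (hH₂.frame k.le k.good k.mhold) hw
      (q.absorb hint (by rw [n2]; simp [mkInternal]) ⟨n5, n1⟩) (by simp) (hkindX k)
      (by simpa [n2, mkInternal] using ⟨n3, n4⟩) (by simpa using hint.kind_ne)
    refine ⟨hok, fun g' => ?_⟩
    have hj' : j ≤ u + 1 := hj.trans (k.le.trans (Nat.le_succ u))
    exact safeFrom_release (by simp) (hmark k hw hH₃) hnd (htodo.mono g' hj' le_rfl)
      (hpost.mono hj')
  · refine safeFrom_allocInternals fun y R hR skl l skr r => ?_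
    refine safeFrom_allocInternal (topKind_ne gp) fun sk new => safeFrom_write fun u k _ hw => ?_
    obtain ⟨H, q⟩ := hsite k
    obtain ⟨n1, n2, n3, n4, n5⟩ := k.fresh_spec List.mem_cons_self
    obtain ⟨r1, r2, r3, r4, r5⟩ := k.fresh_spec (List.mem_cons_of_mem _ List.mem_cons_self)
    obtain ⟨l1, l2, l3, l4, l5⟩ := k.fresh_spec
      (List.mem_cons_of_mem _ (List.mem_cons_of_mem _ List.mem_cons_self))
    have hintn := k.internal (topKind_ne gp) List.mem_cons_self
    have hintr := k.internal (by simp) (List.mem_cons_of_mem _ List.mem_cons_self)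
    have hintl := k.internal (by simp)
      (List.mem_cons_of_mem _ (List.mem_cons_of_mem _ List.mem_cons_self))
    obtain ⟨H', hs⟩ := q.split hR hintn (by rw [n2]; rfl) hintl hintr (by rw [l2]; simp [mkInternal])
      (by rw [r2]; simp [mkInternal]) (by simp [n1, n5, r1, r5, l1, l5]) k.fresh.1
    obtain ⟨hok, hH₃, hnew, -⟩ := link_internal k.good (hH₂.frame k.le k.good k.mhold) hw hs
      (by simp) (hkindX k) (by simp [n2, r2, l2, n3, r3, l3, n4, r4, l4, mkInternal])
      (by simp [hintn.kind_ne, hintr.kind_ne, hintl.kind_ne])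
    refine ⟨hok, fun g' => ?_⟩
    have hj' : j ≤ u + 1 := hj.trans (k.le.trans (Nat.le_succ u))
    refine safeFrom_release (by simp) (hmark k hw hH₃) hnd (fun n hn => ?_) (hpost.mono hj')
    simp only [List.mem_cons, Task.fixTagged.injEq] at hn
    rcases hn with rfl | hn
    · exact g'.rch_lt le_rfl hnew
    · exact htodo.mono g' hj' le_rfl n hn

end Execution

end OCC

namespace OCC

namespace Execution

variable {K V T : Type} [LinearOrder K] [DecidableEq T] {a b : ℕ} {E : Execution K V T a b}
  {t : T} {i : ℕ} {op : Op K V}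

/-! ### Replacing two siblings -/

/-- The thread has locked two siblings, their parent and their grandparent, which are all in the
tree. -/
structure Siblings (E : Execution K V T a b) (t : T) (j : ℕ) (gp : Addr) (i₀ : ℕ) (p l r : Addr)
    (KA : List K) (x₀ : K) (KB : List K) (A B : List Addr) : Prop where
  good : E.Good j
  held : Held E t [l, r, p, gp] [] j
  nodup : [l, r, p, gp].Nodup
  rch : ∀ n ∈ [l, r, p, gp], E.Rch j n
  gp_kind : (E.cfg j).mem.node gp .kind ≠ .leaf
  gp_ptr : (E.cfg j).mem.node gp (.ptr i₀) = some p
  int : IsInternal ((E.cfg j).mem.node p) (KA ++ x₀ :: KB) (A ++ l :: r :: B)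
  lenA : KA.length = A.length
  lenB : KB.length = B.length
  tag : ∀ n ∈ [l, r, p], (E.cfg j).mem.node n .kind ≠ .tagged

/-- Nodes that the thread has created and not yet linked. -/
structure NewNodes (E : Execution K V T a b) (t : T) (j : ℕ) (F : List Addr) : Prop where
  nodup : F.Nodup
  lt : ∀ f ∈ F, f < (E.cfg j).mem.next
  ever : ∀ f ∈ F, ¬ E.Ever j f
  alloc : ∀ f ∈ F, E.AllocBy t j f
  even : ∀ f ∈ F, Even ((E.cfg j).mem.node f .ver)

lemma Keeps.newNodes {j₀ j : ℕ} {Fr : List (Addr × Node K V)} (k : Keeps E t j₀ Fr j)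
    (he : ∀ x ∈ Fr, Even (x.2 .ver)) : NewNodes E t j (Fr.map Prod.fst) := by
  have key : ∀ f ∈ Fr.map Prod.fst, f < (E.cfg j).mem.next ∧ ¬ E.Ever j f ∧ E.AllocBy t j f ∧
      Even ((E.cfg j).mem.node f .ver) := by
    intro f hf
    obtain ⟨⟨f, nd⟩, hm, rfl⟩ := List.mem_map.1 hf
    obtain ⟨h1, h2, h3, h4, -⟩ := k.fresh_spec hm
    exact ⟨h1, h3, h4, by rw [h2]; exact he _ hm⟩
  exact ⟨k.fresh.1, fun f hf => (key f hf).1, fun f hf => (key f hf).2.1,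
    fun f hf => (key f hf).2.2.1, fun f hf => (key f hf).2.2.2⟩

namespace NewNodes

variable {j : ℕ} {F : List Addr}

lemma fresh (h : NewNodes E t j F) : ∀ f ∈ F, ¬ E.Rch j f ∧ f < (E.cfg j).mem.next :=
  fun f hf => ⟨fun hr => h.ever f hf (ever_of_rch hr), h.lt f hf⟩

lemma spec (h : NewNodes E t j F) : ∀ f ∈ F, ¬ E.Ever j f ∧ E.AllocBy t j f ∧
    Even ((E.cfg j).mem.node f .ver) := fun f hf => ⟨h.ever f hf, h.alloc f hf, h.even f hf⟩

end NewNodes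

namespace Siblings

variable {j : ℕ} {gp : Addr} {i₀ : ℕ} {p l r : Addr} {KA KB : List K} {x₀ : K} {A B : List Addr}

lemma mono (q : Siblings E t j gp i₀ p l r KA x₀ KB A B) {u : ℕ} {Fr : List (Addr × Node K V)}
    (k : Keeps E t j Fr u) : Siblings E t u gp i₀ p l r KA x₀ KB A B ∧
      ∀ n ∈ [l, r, p, gp], (E.cfg u).mem.node n = (E.cfg j).mem.node n := by
  have e : ∀ n ∈ [l, r, p, gp], (E.cfg u).mem.node n = (E.cfg j).mem.node n := fun n hn =>
    k.node (q.good.ever_lt le_rfl (q.held.ever n hn)) ((q.held.lock n).2 hn)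
  refine ⟨⟨k.good, q.held.frame k.le k.good k.mhold, q.nodup,
    fun n hn => k.rch ((q.held.lock n).2 hn) (q.rch n hn), ?_, ?_, ?_, q.lenA, q.lenB,
    fun n hn => ?_⟩, e⟩
  · rw [e gp (by simp)]; exact q.gp_kind
  · rw [e gp (by simp)]; exact q.gp_ptr
  · rw [e p (by simp)]; exact q.int
  · rw [e n (by simp only [List.mem_cons] at hn ⊢; tauto)]; exact q.tag n hn

lemma pair (q : Siblings E t j gp i₀ p l r KA x₀ KB A B) :
    ∃ H, Pair (E.cfg j).mem H gp i₀ p l r KA x₀ KB A B := by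
  obtain ⟨H, w⟩ := q.good.self.wf
  refine ⟨H, ⟨w, q.rch gp (by simp), q.gp_kind, q.gp_ptr⟩, q.int, q.lenA, q.lenB,
    q.tag p (by simp), q.tag l (by simp), q.tag r (by simp), ?_⟩
  have := q.nodup
  simp only [List.nodup_cons, List.mem_cons, List.not_mem_nil, or_false] at this ⊢
  tauto

lemma even (q : Siblings E t j gp i₀ p l r KA x₀ KB A B) {n : Addr} (hn : n ∈ [l, r, p, gp]) :
    Even ((E.cfg j).mem.node n .ver) := q.held.even n hn

lemma leafOK (q : Siblings E t j gp i₀ p l r KA x₀ KB A B) {n : Addr} (hn : n ∈ [l, r, p, gp])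
    (hk : (E.cfg j).mem.node n .kind = .leaf) : LeafOK b ((E.cfg j).mem.node n) :=
  q.good.self.leaf n (q.good.ever_lt le_rfl (q.held.ever n hn)) hk (q.even hn)

lemma kind_r (q : Siblings E t j gp i₀ p l r KA x₀ KB A B) :
    (E.cfg j).mem.node l .kind = .leaf ↔ (E.cfg j).mem.node r .kind = .leaf := by
  obtain ⟨H, h⟩ := q.pair
  exact h.leaf_iff

/-- The keys of two sibling leaves. -/
lemma on (q : Siblings E t j gp i₀ p l r KA x₀ KB A B)
    (hl : (E.cfg j).mem.node l .kind = .leaf) {k : K} {v : V}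
    (h : SlotHas b ((E.cfg j).mem.node l) k v ∨ SlotHas b ((E.cfg j).mem.node r) k v) :
    E.On j k p ∧ (∀ y ∈ KA, y ≤ k) ∧ ∀ y ∈ KB, k < y := by
  obtain ⟨H, h'⟩ := q.pair
  obtain ⟨hs, -⟩ := h'.keys
  rcases h with h | h
  · have hon := q.good.self.keys l k v (q.rch l (by simp)) hl ((le_even (q.even (by simp))).2 h)
    obtain ⟨h1, h2⟩ := h'.wf.onPath_of_child h'.reach (h'.child (by simp)).1 hon
    obtain ⟨h3, h4⟩ := between_of_next h'.wf h'.reach h'.int hs h'.lenA h2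
    exact ⟨h1, h3, fun y hy => h4 y (by simp [hy])⟩
  · have hon := q.good.self.keys r k v (q.rch r (by simp)) (q.kind_r.1 hl)
      ((le_even (q.even (by simp))).2 h)
    obtain ⟨h1, h2⟩ := h'.wf.onPath_of_child h'.reach (h'.child (by simp)).1 hon
    obtain ⟨h3, h4⟩ := between_of_next h'.wf h'.reach (KA := KA ++ [x₀]) (KB := KB) (A := A ++ [l])
      (B := B) (by simpa using h'.int) (by simpa using hs) (by simp [h'.lenA]) h2
    exact ⟨h1, fun y hy => h3 y (by simp [hy]), h4⟩

/-- The sorted list of the pairs of two sibling leaves. -/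
lemma pairs (q : Siblings E t j gp i₀ p l r KA x₀ KB A B)
    (hl : (E.cfg j).mem.node l .kind = .leaf) {N : List (K × V)}
    (hN : N = sortPairs (pairsFrom ((E.cfg j).mem.node l) 0 b ++
      pairsFrom ((E.cfg j).mem.node r) 0 b)) :
    (∀ k v, (k, v) ∈ N ↔
      SlotHas b ((E.cfg j).mem.node l) k v ∨ SlotHas b ((E.cfg j).mem.node r) k v) ∧
    (N.Pairwise fun x y => x.1 < y.1) ∧ (N.map Prod.fst).Nodup ∧
    N.length = (E.cfg j).mem.node l .size + (E.cfg j).mem.node r .size ∧ N.length ≤ 2 * b := by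
  subst hN
  have hr := q.kind_r.1 hl
  obtain ⟨l1, l2, l3, l4⟩ := pairs_spec (q.leafOK (by simp) hl)
  obtain ⟨r1, r2, r3, r4⟩ := pairs_spec (q.leafOK (n := r) (by simp) hr)
  have hnd : ((pairsFrom ((E.cfg j).mem.node l) 0 b ++
      pairsFrom ((E.cfg j).mem.node r) 0 b).map Prod.fst).Nodup := by
    rw [List.map_append, List.nodup_append]
    refine ⟨l2, r2, fun k hk k' hk' he => ?_⟩
    subst he
    obtain ⟨⟨k, v⟩, hv, rfl⟩ := List.mem_map.1 hk
    obtain ⟨⟨k', v'⟩, hv', he⟩ := List.mem_map.1 hk'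
    obtain rfl : k' = k := he
    have h1 := q.good.self.keys l k' v (q.rch l (by simp)) hl
      ((le_even (q.even (by simp))).2 ((l1 _ _).1 hv))
    have h2 := q.good.self.keys r k' v' (q.rch r (by simp)) hr
      ((le_even (q.even (by simp))).2 ((r1 _ _).1 hv'))
    have := q.nodup
    simp [h1.leaf_unique h2 hl hr] at this
  refine ⟨fun k v => by rw [(sortPairs_perm _).mem_iff, List.mem_append, l1, r1],
    sortPairs_sorted hnd, ((sortPairs_perm _).map _).nodup_iff.2 hnd, ?_, ?_⟩
  · rw [(sortPairs_perm _).length_eq, List.length_append, l3, r3]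
  · rw [(sortPairs_perm _).length_eq, List.length_append]
    omega

variable {new : Addr} {N : List (K × V)}

/-- A replacement of two leaves that keeps their contents. -/
lemma link_leaves (q : Siblings E t j gp i₀ p l r KA x₀ KB A B)
    (hl : (E.cfg j).mem.node l .kind = .leaf)
    (hN : ∀ k v, (k, v) ∈ N ↔
      SlotHas b ((E.cfg j).mem.node l) k v ∨ SlotHas b ((E.cfg j).mem.node r) k v)
    {H H' : Addr → ℕ} {KS : List K} {CS : List (Option Addr)} {F : List Addr}
    (hw : WriteStep E t j gp (.ptr i₀) (some new))
    (s : Surgery (E.cfg j).mem (link (E.cfg j).mem gp i₀ new) H H' gp i₀ p new KS CS [r, l] F)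
    (hF : NewNodes E t j (new :: F))
    (hslot : ∀ k v, (∃ f ∈ new :: F, (E.cfg j).mem.node f .kind = .leaf ∧
      SlotHas b ((E.cfg j).mem.node f) k v) ↔ (k, v) ∈ N)
    (hnext : ∀ f ∈ new :: F, (E.cfg j).mem.node f .kind = .leaf → ∀ k v,
      SlotHas b ((E.cfg j).mem.node f) k v → f = new ∨ Next (E.cfg j).mem k new f) :
    E.StepOK j ∧ Held E t [l, r, p, gp] [p, r, l] (j + 1) := by
  obtain ⟨h1, h2, -, -⟩ := link_step q.good q.held hw s (by simp) hF.spec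
    (fun f hf hk k v hs => ⟨(q.on hl ((hN k v).1 ((hslot k v).1 ⟨f, hf, hk, hs⟩))).1,
      hnext f hf hk k v hs⟩) fun s hi =>
    link_updOK q.good hw s hi q.int.kind_ne (fun x hx => q.even (by
      simp only [List.mem_cons] at hx ⊢
      tauto)) hF.even fun k v => by
        rw [hslot, hN]
        simp [q.int.kind_ne, hl, q.kind_r.1 hl, or_comm]
  exact ⟨h1, h2⟩

lemma distribute_leaves (q : Siblings E t j gp i₀ p l r KA x₀ KB A B)
    (hl : (E.cfg j).mem.node l .kind = .leaf)
    (hN : ∀ k v, (k, v) ∈ N ↔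
      SlotHas b ((E.cfg j).mem.node l) k v ∨ SlotHas b ((E.cfg j).mem.node r) k v)
    (hs : N.Pairwise fun x y => x.1 < y.1) (h2 : 2 ≤ N.length) (hb : N.length ≤ 2 * b)
    {y : K × V} {R : List (K × V)} (hR : N.drop (N.length / 2) = y :: R) {l' r' : Addr}
    {skl skr : K} (hw : WriteStep E t j gp (.ptr i₀) (some new))
    (hF : NewNodes E t j [new, r', l'])
    (hn : IsInternal ((E.cfg j).mem.node new) (KA ++ y.1 :: KB) (A ++ l' :: r' :: B))
    (tag : (E.cfg j).mem.node new .kind ≠ .tagged)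
    (nl : (E.cfg j).mem.node l' = mkLeaf skl (N.take (N.length / 2)))
    (nr : (E.cfg j).mem.node r' = mkLeaf skr (y :: R)) :
    E.StepOK j ∧ Held E t [l, r, p, gp] [p, r, l] (j + 1) := by
  obtain ⟨H, h⟩ := q.pair
  obtain ⟨hmem, hlt, hge, hne, -, -, lenL, lenR⟩ := halves_spec hs rfl hR h2
  have hon : ∀ z ∈ N, E.On j z.1 p ∧ (∀ y ∈ KA, y ≤ z.1) ∧ ∀ y ∈ KB, z.1 < y := fun z hz =>
    q.on hl ((hN z.1 z.2).1 hz)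
  obtain ⟨z, hz⟩ := List.exists_mem_of_ne_nil _ hne
  have hy := hon y ((hmem y).2 (by simp))
  have hz' := hon z ((hmem z).2 (.inl hz))
  have hky : KeyIn (E.cfg j).mem p y.1 := ⟨hy.1, z.1, hlt z hz, hz'.1⟩
  obtain ⟨ks, kk⟩ := h.keys
  have kl : (E.cfg j).mem.node l' .kind = .leaf := by rw [nl]; rfl
  have kr : (E.cfg j).mem.node r' .kind = .leaf := by rw [nr]; rfl
  have hl0 := h.wf.height_leaf l (q.rch l (by simp)) hl
  have hsort : (KA ++ y.1 :: KB).Pairwise (· < ·) := by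
    rw [List.pairwise_append, List.pairwise_cons] at ks ⊢
    refine ⟨ks.1, ⟨hy.2.2, ks.2.1.2⟩, fun w hw w' hw' => ?_⟩
    rcases List.mem_cons.1 hw' with rfl | hw'
    · exact (hz'.2.1 w hw).trans_lt (hlt z hz)
    · exact ks.2.2 w hw w' (by simp [hw'])
  have exn : Expands (E.cfg j).mem new (KA ++ y.1 :: KB)
      (A.map some ++ some l' :: some r' :: B.map some) := by
    have := Expands.internal _ _ hn (by simp [q.lenA, q.lenB]; omega)
    simpa using this
  have s := h.distribute (h.frag_leaf hl) tag hn (.leaf kl) (.leaf kr) (by simpa using hsort)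
    (fun w hw => by
      have hw : w ∈ KA ∨ w = y.1 ∨ w ∈ KB := by simpa using hw
      rcases hw with hw | rfl | hw
      · exact kk w (by simp [hw])
      · exact hky
      · exact kk w (by simp [hw]))
    (Frag.two_leaves exn kl kr (by simp [q.lenA]) hsort) hF.fresh hF.nodup (fun _ => hl0)
    (fun _ => hl0) (by simp [kl]) (by simp [kr]) (by simp)
  have lenL' : (N.take (N.length / 2)).length ≤ b := by omega
  refine q.link_leaves hl hN hw s hF (fun k v => ?_) fun f hf hk k v hs => ?_
  · simp only [List.mem_cons, List.not_mem_nil, or_false, exists_eq_or_imp, exists_eq_left,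
      hn.kind_ne, false_and, false_or, kl, kr, true_and]
    rw [nr, nl, slotHas_mkLeaf (by omega), slotHas_mkLeaf lenL', hmem, or_comm]
  · simp only [List.mem_cons, List.not_mem_nil, or_false] at hf
    rcases hf with rfl | rfl | rfl
    · exact .inl rfl
    · rw [nr, slotHas_mkLeaf (by omega)] at hs
      have := hon _ ((hmem (k, v)).2 (.inr hs))
      exact .inr ((next_of_halves hn q.lenA this.2.1 this.2.2).2 hy.2.1 (hge _ hs))
    · rw [nl, slotHas_mkLeaf lenL'] at hs
      have := hon _ ((hmem (k, v)).2 (.inl hs))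
      exact .inr ((next_of_halves hn q.lenA this.2.1 this.2.2).1 (hlt _ hs))

lemma merge_leaves (q : Siblings E t j gp i₀ p l r KA x₀ KB A B)
    (hl : (E.cfg j).mem.node l .kind = .leaf)
    (hN : ∀ k v, (k, v) ∈ N ↔
      SlotHas b ((E.cfg j).mem.node l) k v ∨ SlotHas b ((E.cfg j).mem.node r) k v)
    (hb : N.length ≤ b) {l' : Addr} {sk : K} (hw : WriteStep E t j gp (.ptr i₀) (some new))
    (hF : NewNodes E t j [new, l'])
    (hn : IsInternal ((E.cfg j).mem.node new) (KA ++ KB) (A ++ l' :: B))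
    (tag : (E.cfg j).mem.node new .kind ≠ .tagged)
    (nl : (E.cfg j).mem.node l' = mkLeaf sk N) :
    E.StepOK j ∧ Held E t [l, r, p, gp] [p, r, l] (j + 1) := by
  obtain ⟨H, h⟩ := q.pair
  obtain ⟨ks, kk⟩ := h.keys
  have kl : (E.cfg j).mem.node l' .kind = .leaf := by rw [nl]; rfl
  have exn : Expands (E.cfg j).mem new (KA ++ KB) (A.map some ++ some l' :: B.map some) := by
    have := Expands.internal _ _ hn (by simp [q.lenA, q.lenB]; omega)
    simpa using this
  have hsort : (KA ++ KB).Pairwise (· < ·) := ks.sublist (by simp)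
  have fragF := Frag.one exn (.leaf kl) (by simp [q.lenA]) (by simpa using hsort)
  have s := h.merge (h.frag_leaf hl) tag hn (.leaf kl) (by simpa using hsort) (fun w hw => kk w (by
      simp only [List.append_nil, List.mem_append, List.mem_cons] at hw ⊢
      tauto)) (by simpa using fragF) hF.fresh (by simpa using hF.nodup)
    (fun _ => h.wf.height_leaf l (q.rch l (by simp)) hl) (by simp [kl]) (by simp)
  refine q.link_leaves hl hN hw s hF (fun k v => ?_) fun f hf hk k v hs => ?_
  · simp only [List.mem_cons, List.not_mem_nil, or_false, exists_eq_or_imp, exists_eq_left,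
      hn.kind_ne, false_and, false_or, kl, true_and]
    rw [nl, slotHas_mkLeaf hb]
  · simp only [List.mem_cons, List.not_mem_nil, or_false] at hf
    rcases hf with rfl | rfl
    · exact .inl rfl
    · rw [nl, slotHas_mkLeaf hb, hN] at hs
      have := q.on hl hs
      exact .inr (next_of_between hn q.lenA this.2.1 this.2.2)

lemma merge_leaves_root (q : Siblings E t j entry i₀ p l r [] x₀ [] [] [])
    (hl : (E.cfg j).mem.node l .kind = .leaf)
    (hN : ∀ k v, (k, v) ∈ N ↔
      SlotHas b ((E.cfg j).mem.node l) k v ∨ SlotHas b ((E.cfg j).mem.node r) k v)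
    (hb : N.length ≤ b) {sk : K} (hw : WriteStep E t j entry (.ptr i₀) (some new))
    (hF : NewNodes E t j [new]) (nl : (E.cfg j).mem.node new = mkLeaf sk N) :
    E.StepOK j ∧ Held E t [l, r, p, entry] [p, r, l] (j + 1) := by
  obtain ⟨H, h⟩ := q.pair
  have kl : (E.cfg j).mem.node new .kind = .leaf := by rw [nl]; rfl
  have s := h.toSite.zero (hN := 0) (h.frag_leaf hl) h.gp_not_mem (.leaf kl) (by simp) (by simp)
    (hF.fresh new (by simp)) (by simp) (fun _ => rfl) (by simp [kl]) (by simp)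
  refine q.link_leaves hl hN hw s hF (fun k v => ?_) fun f hf _ k v _ => .inl (by simpa using hf)
  simp only [List.mem_cons, List.not_mem_nil, or_false, exists_eq_left, kl, true_and]
  rw [nl, slotHas_mkLeaf hb]

variable {KL KR : List K} {L R : List Addr}

lemma distribute_internals (q : Siblings E t j gp i₀ p l r KA x₀ KB A B)
    (hl : IsInternal ((E.cfg j).mem.node l) KL L) (hr : IsInternal ((E.cfg j).mem.node r) KR R)
    {x : K} {R' : List K} (hR : (KL ++ x₀ :: KR).drop ((L ++ R).length / 2 - 1) = x :: R')
    {l' r' : Addr} (hw : WriteStep E t j gp (.ptr i₀) (some new))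
    (hF : NewNodes E t j [new, r', l'])
    (hn : IsInternal ((E.cfg j).mem.node new) (KA ++ x :: KB) (A ++ l' :: r' :: B))
    (tag : (E.cfg j).mem.node new .kind ≠ .tagged)
    (nl : IsInternal ((E.cfg j).mem.node l') ((KL ++ x₀ :: KR).take ((L ++ R).length / 2 - 1))
      ((L ++ R).take ((L ++ R).length / 2)))
    (nr : IsInternal ((E.cfg j).mem.node r') R' ((L ++ R).drop ((L ++ R).length / 2)))
    (tagL : (E.cfg j).mem.node l' .kind ≠ .tagged) (tagR : (E.cfg j).mem.node r' .kind ≠ .tagged) :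
    E.StepOK j ∧ Held E t [l, r, p, gp] [p, r, l] (j + 1) := by
  obtain ⟨H, h⟩ := q.pair
  obtain ⟨hs, hk, hh, len1, len2, hf⟩ := h.internal hl hr
  obtain ⟨e1, e2, e3⟩ := internals_spec (ks := KL ++ x₀ :: KR) (cs := L ++ R)
    (by simp [len1, len2]; omega) hR
  have e4 := List.take_append_drop ((L ++ R).length / 2) (L ++ R)
  have exl := Expands.internal _ _ nl e2
  have exr := Expands.internal _ _ nr e3
  have exn : Expands (E.cfg j).mem new (KA ++ x :: KB)
      (A.map some ++ some l' :: some r' :: B.map some) := by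
    have := Expands.internal _ _ hn (by simp [q.lenA, q.lenB]; omega)
    simpa using this
  have a1 : KA ++ KL ++ x₀ :: KR ++ KB = KA ++ (KL ++ x₀ :: KR) ++ KB := by simp
  have a2 : A ++ L ++ R ++ B = A ++ (L ++ R) ++ B := by simp
  rw [a1] at hs hk hf
  rw [a2] at hf
  generalize (KL ++ x₀ :: KR).take ((L ++ R).length / 2 - 1) = NL at *
  generalize (L ++ R).take ((L ++ R).length / 2) = CL at *
  generalize (L ++ R).drop ((L ++ R).length / 2) = CR at *
  rw [← e1] at hs hk hf
  rw [← e4] at hh hf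
  have fragF := Frag.two exn exl exr (by simp [q.lenA]) (by simpa using hs)
  have s := h.distribute hf tag hn exl exr (by simpa using hs) (by simpa using hk)
    (by simpa using fragF) hF.fresh hF.nodup (fun h => absurd h nl.kind_ne)
    (fun h => absurd h nr.kind_ne) tagL tagR fun d hd => hh d (by simpa using hd)
  obtain ⟨h1, h2, -⟩ := link_internal q.good q.held hw s (by simp)
    (by simp [q.int.kind_ne, hl.kind_ne, hr.kind_ne]) hF.spec
    (by simp [hn.kind_ne, nl.kind_ne, nr.kind_ne])
  exact ⟨h1, h2⟩

lemma merge_internals (q : Siblings E t j gp i₀ p l r KA x₀ KB A B)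
    (hl : IsInternal ((E.cfg j).mem.node l) KL L) (hr : IsInternal ((E.cfg j).mem.node r) KR R)
    {l' : Addr} (hw : WriteStep E t j gp (.ptr i₀) (some new)) (hF : NewNodes E t j [new, l'])
    (hn : IsInternal ((E.cfg j).mem.node new) (KA ++ KB) (A ++ l' :: B))
    (tag : (E.cfg j).mem.node new .kind ≠ .tagged)
    (nl : IsInternal ((E.cfg j).mem.node l') (KL ++ x₀ :: KR) (L ++ R))
    (tagL : (E.cfg j).mem.node l' .kind ≠ .tagged) :
    E.StepOK j ∧ Held E t [l, r, p, gp] [p, r, l] (j + 1) := by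
  obtain ⟨H, h⟩ := q.pair
  obtain ⟨hs, hk, hh, len1, len2, hf⟩ := h.internal hl hr
  have exl := Expands.internal _ _ nl (by simp [len1, len2]; omega)
  have exn : Expands (E.cfg j).mem new (KA ++ KB) (A.map some ++ some l' :: B.map some) := by
    have := Expands.internal _ _ hn (by simp [q.lenA, q.lenB]; omega)
    simpa using this
  have fragF := Frag.one exn exl (by simp [q.lenA]) (by simpa using hs)
  have s := h.merge hf tag hn exl (by simpa using hs) (by simpa using hk)
    (by simpa using fragF) hF.fresh (by simpa using hF.nodup) (fun h => absurd h nl.kind_ne) tagL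
    fun d hd => hh d (by simpa using hd)
  obtain ⟨h1, h2, -⟩ := link_internal q.good q.held hw s (by simp)
    (by simp [q.int.kind_ne, hl.kind_ne, hr.kind_ne]) hF.spec (by simp [hn.kind_ne, nl.kind_ne])
  exact ⟨h1, h2⟩

lemma merge_internals_root (q : Siblings E t j entry i₀ p l r [] x₀ [] [] [])
    (hl : IsInternal ((E.cfg j).mem.node l) KL L) (hr : IsInternal ((E.cfg j).mem.node r) KR R)
    (hw : WriteStep E t j entry (.ptr i₀) (some new)) (hF : NewNodes E t j [new])
    (nl : IsInternal ((E.cfg j).mem.node new) (KL ++ x₀ :: KR) (L ++ R))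
    (tagL : (E.cfg j).mem.node new .kind ≠ .tagged) :
    E.StepOK j ∧ Held E t [l, r, p, entry] [p, r, l] (j + 1) := by
  obtain ⟨H, h⟩ := q.pair
  obtain ⟨hs, hk, hh, len1, len2, hf⟩ := h.internal hl hr
  have exl := Expands.internal _ _ nl (by simp [len1, len2]; omega)
  have s := h.toSite.zero (hN := H l) (by simpa using hf) h.gp_not_mem exl (by simpa using hs)
    (by simpa using hk) (hF.fresh new (by simp)) (by simp) (fun h => absurd h nl.kind_ne) tagL
    fun d hd => hh d (by simpa using hd)
  obtain ⟨h1, h2, -⟩ := link_internal q.good q.held hw s (by simp)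
    (by simp [q.int.kind_ne, hl.kind_ne, hr.kind_ne]) hF.spec (by simp [nl.kind_ne])
  exact ⟨h1, h2⟩

end Siblings

end Execution

end OCC

namespace OCC

namespace Execution

variable {K V T : Type} [LinearOrder K] [DecidableEq T] {a b : ℕ} {E : Execution K V T a b}
  {t : T} {i : ℕ} {op : Op K V}

/-! ### Underfull nodes -/

/-- The routing keys and children around two adjacent children. -/
lemma exists_around_two {ks : List K} {cs : List Addr} {l r : Addr} {x : ℕ}
    (hlen : cs.length = ks.length + 1) (hl : cs[x]? = some l) (hr : cs[x + 1]? = some r) :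
    ∃ KA x₀ KB A B, ks = KA ++ x₀ :: KB ∧ cs = A ++ l :: r :: B ∧ KA.length = A.length ∧
      KB.length = B.length ∧ A.length = x := by
  obtain ⟨l1, rfl⟩ := List.getElem?_eq_some_iff.1 hl
  obtain ⟨r1, rfl⟩ := List.getElem?_eq_some_iff.1 hr
  have hx : x < ks.length := by omega
  refine ⟨ks.take x, ks[x], ks.drop (x + 1), cs.take x, cs.drop (x + 2), ?_, ?_, ?_, ?_, ?_⟩
  · rw [← List.drop_eq_getElem_cons, List.take_append_drop]
  · rw [← List.drop_eq_getElem_cons, ← List.drop_eq_getElem_cons, List.take_append_drop]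
  all_goals
    simp only [List.length_take, List.length_drop]
    omega

section

variable {j : ℕ} {Fr : List (Addr × Node K V)} {todo : List Task} {res : Option V}

lemma safeFrom_fixUnderfullRetry {node : Addr} (hN : NoLocks E t j) (ht : TodoOK E j todo)
    (hp : Post E t i op j res) : SafeFrom E t i op j Fr (fixUnderfullRetry node todo res) := by
  refine safeFrom_read (by simp) fun _ _ _ => safeFrom_goto_start fun j' hj' g hc => ?_
  exact ⟨hN.frame hj' g fun m h1 h2 q h3 h4 => (hc m h1 h2 q h3 h4).noWrite, ht.mono g hj' le_rfl,
    hp.mono hj'⟩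

/-- The node and its sibling, both adjacent children of `p`, are treated as the left sibling `l` and the
right sibling `r`, whichever of them is the underfull node. -/
lemma safeFrom_fixUnderfullFound (ha : 2 ≤ a) (hab : 2 * a ≤ b + 1) {key : K}
    {target : Option Addr} {path : PathInfo}
    (h : LInv E t i op j (.search (.fixUnderfull path.n todo res) key target path)) :
    SafeFrom E t i op j [] (fixUnderfullFound a b path.n path todo res) := by
  obtain ⟨hN, -, ⟨hedge, hedge'⟩, htodo, hpost⟩ := h
  unfold fixUnderfullFound
  cases hp : path.p with
  | none => exact safeFrom_crash
  | some p =>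
  cases hgp : path.gp with
  | none => exact safeFrom_crash
  | some gp =>
  have hedge := hedge p hp
  have hedge' := hedge' gp p hgp hp
  dsimp only
  generalize path.nIdx = x at *
  generalize path.pIdx = i₀ at *
  generalize path.n = node at *
  refine safeFrom_read_succ (by simp) fun j₀ k₀ k₀' _ => ?_
  cases hsib : (E.cfg j₀).mem.node p (.ptr (if x = 0 then 1 else x - 1)) with
  | none =>
    exact safeFrom_fixUnderfullRetry (hN.frame k₀'.le k₀'.good k₀'.mhold)
      (htodo.mono k₀'.good k₀'.le le_rfl) (hpost.mono k₀'.le)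
  | some sib =>
  dsimp only
  have hsib : EdgeSeen E (j₀ + 1) p (if x = 0 then 1 else x - 1) sib := by
    obtain ⟨j₁, j₂, h1, h2, h3, h4, -⟩ := hedge
    exact ⟨j₁, j₀, h1.trans (h2.trans k₀.le), Nat.le_succ j₀, h3, h4, hsib⟩
  have hN := hN.frame k₀'.le k₀'.good k₀'.mhold
  have hedge := hedge.mono k₀'.le
  have hedge' := hedge'.mono k₀'.le
  have htodo := htodo.mono k₀'.good k₀'.le le_rfl
  have hpost := hpost.mono k₀'.le
  have g := k₀'.good
  clear k₀ k₀'
  generalize j₀ + 1 = j at *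
  -- the siblings from left to right
  have hl : EdgeSeen E j p (if x = 0 then 0 else x - 1) (if x = 0 then node else sib) := by
    split_ifs with hx
    · rwa [hx] at hedge
    · rwa [if_neg hx] at hsib
  have hr : EdgeSeen E j p ((if x = 0 then 0 else x - 1) + 1) (if x = 0 then sib else node) := by
    split_ifs with hx
    · rwa [if_pos hx] at hsib
    · rwa [Nat.sub_add_cancel (Nat.pos_of_ne_zero hx)]
  have hns : (node = (if x = 0 then node else sib) ∧ sib = if x = 0 then sib else node) ∨
      (node = (if x = 0 then sib else node) ∧ sib = if x = 0 then node else sib) := by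
    split_ifs <;> simp
  clear hsib hedge
  generalize (if x = 0 then 0 else x - 1) = li at *
  generalize (if x = 0 then node else sib) = l at *
  generalize (if x = 0 then sib else node) = r at *
  have memL : ∀ n ∈ [node, p, sib], n ∈ [l, r, p, gp] := by
    rcases hns with ⟨rfl, rfl⟩ | ⟨rfl, rfl⟩ <;> simp
  have memM : ∀ n ∈ [p, r, l], n ∈ [node, p, sib] := by
    rcases hns with ⟨rfl, rfl⟩ | ⟨rfl, rfl⟩ <;> simp
  have nodeL : node ∈ [l, r, p, gp] := memL node (by simp)
  have sibL : sib ∈ [l, r, p, gp] := memL sib (by simp)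
  obtain ⟨ep, el, kp⟩ := hl.child g le_rfl
  obtain ⟨-, er, -⟩ := hr.child g le_rfl
  obtain ⟨egp, -, kgp⟩ := hedge'.child g le_rfl
  refine safeFrom_lockAll (by simp) hN.held (by simp [el, er, ep, egp]) (by simp)
    fun j₁ hj₁ g₁ _ hH₁ hnd => ?_
  rw [List.append_nil] at hH₁ hnd
  have lk : ∀ n ∈ [l, r, p, gp], (E.cfg j₁).mem.lock n = some t := fun n hn => (hH₁.lock n).2 hn
  have lt : ∀ n ∈ [l, r, p, gp], n < (E.cfg j₁).mem.next := fun n hn =>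
    g₁.ever_lt le_rfl (hH₁.ever n hn)
  have htodo := htodo.mono g₁ hj₁ le_rfl
  have hpost := hpost.mono hj₁
  have hretry : SafeFrom E t i op j₁ [] (unlockAll [l, r, p, gp]
      (fixUnderfullRetry node todo res)) :=
    safeFrom_unlockAll (by simp) hH₁ hnd fun j' hj' g' _ hN' =>
      safeFrom_fixUnderfullRetry hN' (htodo.mono g' hj' le_rfl) (hpost.mono hj')
  refine safeFrom_read_locked (by simp) (lt node nodeL) (lk node nodeL) ?_
  split_ifs with hs
  · exact safeFrom_release (by simp) hH₁ hnd htodo hpost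
  refine safeFrom_read_locked (by simp) (lt p (by simp)) (lk p (by simp)) ?_
  split_ifs with hsp
  · exact hretry
  refine safeFrom_ifMarked hH₁ g₁ (fun n hn => ?_) hretry fun hR => ?_
  · simp only [List.mem_cons, List.not_mem_nil, or_false] at hn
    rcases hn with rfl | rfl | rfl | rfl
    · exact nodeL
    · exact sibL
    all_goals simp
  refine safeFrom_ifTagged hH₁ g₁ (fun n hn => memL n (by
    simp only [List.mem_cons] at hn ⊢; tauto)) hretry fun htag => ?_
  have hR : ∀ n ∈ [l, r, p, gp], E.Rch j₁ n := by
    rcases hns with ⟨rfl, rfl⟩ | ⟨rfl, rfl⟩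
    · exact hR
    · simpa [and_left_comm] using hR
  have htag : ∀ n ∈ [l, r, p], (E.cfg j₁).mem.node n .kind ≠ .tagged := by
    rcases hns with ⟨rfl, rfl⟩ | ⟨rfl, rfl⟩
    · exact htag
    · simpa [and_left_comm] using htag
  have hkp : (E.cfg j₁).mem.node p .kind ≠ .leaf := by
    rwa [g₁.kind hj₁ le_rfl (g.ever_lt le_rfl ep)]
  have hkgp : (E.cfg j₁).mem.node gp .kind ≠ .leaf := by
    rwa [g₁.kind hj₁ le_rfl (g.ever_lt le_rfl egp)]
  obtain ⟨H, w⟩ := g₁.self.wf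
  obtain ⟨ks, cs, hi, hlen, -⟩ := w.shape p (hR p (by simp)) hkp
  have hlp := (hl.mono hj₁).ptr g₁ le_rfl (hR p (by simp)) (hR l (by simp))
  have hrp := (hr.mono hj₁).ptr g₁ le_rfl (hR p (by simp)) (hR r (by simp))
  have hgp := (hedge'.mono hj₁).ptr g₁ le_rfl (hR gp (by simp)) (hR p (by simp))
  rw [hi.ptr_eq] at hlp hrp
  obtain ⟨KA, x₀, KB, A, B, rfl, rfl, lenA, lenB, rfl⟩ := exists_around_two hlen hlp hrp
  have q : Siblings E t j₁ gp i₀ p l r KA x₀ KB A B :=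
    ⟨g₁, hH₁, hnd, hR, hkgp, hgp, hi, lenA, lenB, htag⟩
  refine safeFrom_read_locked (by simp) (lt sib sibL) (lk sib sibL) ?_
  refine safeFrom_readInternal (lt p (by simp)) (lk p (by simp)) hi hlen ?_
  refine safeFrom_read_locked (by simp) (lt node nodeL) (lk node nodeL) ?_
  have hkind : (E.cfg j₁).mem.node node .kind = .leaf ↔ (E.cfg j₁).mem.node l .kind = .leaf := by
    rcases hns with ⟨rfl, rfl⟩ | ⟨rfl, rfl⟩
    · rfl
    · exact q.kind_r.symm
  -- the routing keys and children of the new parent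
  have e1 : ∀ y, (KA ++ x₀ :: KB).set A.length y = KA ++ y :: KB := fun y => by
    simp [← lenA]
  have e2 : ∀ l' r', ((A ++ l :: r :: B).set A.length l').set (A.length + 1) r' =
      A ++ l' :: r' :: B := fun l' r' => by
    simp
  have e3 : (KA ++ x₀ :: KB).eraseIdx A.length = KA ++ KB := by
    rw [← lenA, List.eraseIdx_append_of_length_le le_rfl]
    simp
  have e4 : ∀ l', ((A ++ l :: r :: B).set A.length l').eraseIdx (A.length + 1) =
      A ++ l' :: B := fun l' => by
    rw [List.set_append_right _ _ le_rfl, List.eraseIdx_append_of_length_le (Nat.le_succ _)]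
    simp
  have e5 : (KA ++ x₀ :: KB)[A.length]? = some x₀ := by simp [← lenA]
  simp only [e1, e2, e3, e4, e5]
  -- the code after the write of the pointer
  have hfin : ∀ u todo', j₁ ≤ u → E.Good u → (∀ n, Task.fixTagged n ∈ todo' → .fixTagged n ∈ todo) →
      Held E t [l, r, p, gp] [p, r, l] u → SafeFrom E t i op u [] (markAll [node, p, sib]
        (unlockAll [l, r, p, gp] (.goto (.rebalance todo' res)))) := by
    intro u todo' hu gu ht hH
    refine safeFrom_markAll (by simp) (hH.weaken memM) memL fun j' hj' g' hH' _ => ?_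
    exact safeFrom_release (by simp) hH' hnd
      (fun n hn => htodo.mono g' (hu.trans hj') le_rfl n (ht n hn)) (hpost.mono (hu.trans hj'))
  -- a parent with two children below the sentinel is the root, and has no other children
  have hroot : gp = entry ∧ (A ++ l :: r :: B).length = 2 →
      gp = entry ∧ i₀ = 0 ∧ KA = [] ∧ KB = [] ∧ A = [] ∧ B = [] := by
    rintro ⟨rfl, h2⟩
    obtain ⟨c, hc⟩ := w.entry
    rw [hc.ptr_eq] at hgp
    have := (List.getElem?_eq_some_iff.1 hgp).1
    simp only [List.length_append, List.length_cons] at h2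
    simp only [List.length_cons, List.length_nil] at this
    refine ⟨rfl, by omega, ?_, ?_, ?_, ?_⟩ <;> rw [← List.length_eq_zero_iff] <;> omega
  by_cases hk : (E.cfg j₁).mem.node node .kind = .leaf
  · rw [if_pos hk]
    rw [hkind] at hk
    refine safeFrom_readPairs (lt l (by simp)) (lk l (by simp)) ?_
    refine safeFrom_readPairs (lt r (by simp)) (lk r (by simp)) ?_
    obtain ⟨hN₁, hN₂, hN₃, hN₄, hN₅⟩ := q.pairs hk rfl
    generalize sortPairs (pairsFrom ((E.cfg j₁).mem.node l) 0 b ++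
      pairsFrom ((E.cfg j₁).mem.node r) 0 b) = N at *
    have hsum : N.length = (E.cfg j₁).mem.node node .size + (E.cfg j₁).mem.node sib .size := by
      rcases hns with ⟨rfl, rfl⟩ | ⟨rfl, rfl⟩
      · exact hN₄
      · exact hN₄.trans (Nat.add_comm _ _)
    have hstep : ∀ {u Fr}, Keeps E t j₁ Fr u → Siblings E t u gp i₀ p l r KA x₀ KB A B ∧
        (E.cfg u).mem.node l .kind = .leaf ∧ ∀ k v, (k, v) ∈ N ↔
          SlotHas b ((E.cfg u).mem.node l) k v ∨ SlotHas b ((E.cfg u).mem.node r) k v :=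
      fun {u Fr} k => by
        obtain ⟨h1, h2⟩ := q.mono k
        refine ⟨h1, by rwa [h2 l (by simp)], ?_⟩
        rw [h2 l (by simp), h2 r (by simp)]
        exact hN₁
    by_cases hsz : 2 * a ≤ (E.cfg j₁).mem.node node .size + (E.cfg j₁).mem.node sib .size
    · rw [if_pos hsz]
      refine safeFrom_allocLeaves hN₂ (by omega) (by omega) fun y R hR skl l' skr r' => ?_
      refine safeFrom_allocInternal (by simp) fun sk new => safeFrom_write fun u k _ hw => ?_
      obtain ⟨q', hk', hN'⟩ := hstep k
      obtain ⟨hok, hH⟩ := q'.distribute_leaves hk' hN' hN₂ (by omega) hN₅ hR hw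
        (k.newNodes (by simp [mkInternal, mkLeaf])) (k.internal (by simp) List.mem_cons_self)
        (by rw [(k.fresh_spec List.mem_cons_self).2.1]; simp [mkInternal])
        (k.fresh_spec (List.mem_cons_of_mem _
          (List.mem_cons_of_mem _ List.mem_cons_self))).2.1
        (k.fresh_spec (List.mem_cons_of_mem _ List.mem_cons_self)).2.1
      exact ⟨hok, fun g' => hfin _ _ (k.le.trans (Nat.le_succ u)) g' (fun _ h => h) hH⟩
    · rw [if_neg hsz]
      have hNb : N.length ≤ b := by omega
      refine safeFrom_allocLeaf hNb hN₃ fun skl l' => ?_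
      split_ifs with hrt
      · obtain ⟨rfl, rfl, rfl, rfl, rfl, rfl⟩ := hroot hrt
        refine safeFrom_write fun u k _ hw => ?_
        obtain ⟨q', hk', hN'⟩ := hstep k
        obtain ⟨hok, hH⟩ := q'.merge_leaves_root hk' hN' hNb hw (k.newNodes (by simp [mkLeaf]))
          (k.fresh_spec List.mem_cons_self).2.1
        exact ⟨hok, fun g' => hfin _ _ (k.le.trans (Nat.le_succ u)) g' (fun _ h => h) hH⟩
      · refine safeFrom_allocInternal (by simp) fun sk new => safeFrom_write fun u k _ hw => ?_
        obtain ⟨q', hk', hN'⟩ := hstep k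
        obtain ⟨hok, hH⟩ := q'.merge_leaves hk' hN' hNb hw
          (k.newNodes (by simp [mkInternal, mkLeaf])) (k.internal (by simp) List.mem_cons_self)
          (by rw [(k.fresh_spec List.mem_cons_self).2.1]; simp [mkInternal])
          (k.fresh_spec (List.mem_cons_of_mem _ List.mem_cons_self)).2.1
        exact ⟨hok, fun g' => hfin _ _ (k.le.trans (Nat.le_succ u)) g' (by simp) hH⟩
  · rw [if_neg hk]
    rw [hkind] at hk
    obtain ⟨KL, L, hiL, lenL, -⟩ := w.shape l (hR l (by simp)) hk
    obtain ⟨KR, R, hiR, lenR, -⟩ := w.shape r (hR r (by simp)) fun h => hk (q.kind_r.2 h)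
    refine safeFrom_readInternal (lt l (by simp)) (lk l (by simp)) hiL lenL ?_
    refine safeFrom_readInternal (lt r (by simp)) (lk r (by simp)) hiR lenR ?_
    have hstep : ∀ {u Fr}, Keeps E t j₁ Fr u → Siblings E t u gp i₀ p l r KA x₀ KB A B ∧
        IsInternal ((E.cfg u).mem.node l) KL L ∧ IsInternal ((E.cfg u).mem.node r) KR R :=
      fun {u Fr} k => by
        obtain ⟨h1, h2⟩ := q.mono k
        exact ⟨h1, by rwa [h2 l (by simp)], by rwa [h2 r (by simp)]⟩
    by_cases hsz : 2 * a ≤ (E.cfg j₁).mem.node node .size + (E.cfg j₁).mem.node sib .size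
    · rw [if_pos hsz]
      refine safeFrom_allocInternals fun y R' hR' skl l' skr r' => ?_
      refine safeFrom_allocInternal (by simp) fun sk new => safeFrom_write fun u k _ hw => ?_
      obtain ⟨q', h1, h2⟩ := hstep k
      obtain ⟨hok, hH⟩ := q'.distribute_internals h1 h2 hR' hw
        (k.newNodes (by simp [mkInternal])) (k.internal (by simp) List.mem_cons_self)
        (by rw [(k.fresh_spec List.mem_cons_self).2.1]; simp [mkInternal])
        (k.internal (by simp) (List.mem_cons_of_mem _
          (List.mem_cons_of_mem _ List.mem_cons_self)))
        (k.internal (by simp) (List.mem_cons_of_mem _ List.mem_cons_self))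
        (by
          rw [(k.fresh_spec (List.mem_cons_of_mem _
            (List.mem_cons_of_mem _ List.mem_cons_self))).2.1]
          simp [mkInternal])
        (by
          rw [(k.fresh_spec (List.mem_cons_of_mem _ List.mem_cons_self)).2.1]
          simp [mkInternal])
      exact ⟨hok, fun g' => hfin _ _ (k.le.trans (Nat.le_succ u)) g' (fun _ h => h) hH⟩
    · rw [if_neg hsz]
      refine safeFrom_allocInternal (by simp) fun skl l' => ?_
      split_ifs with hrt
      · obtain ⟨rfl, rfl, rfl, rfl, rfl, rfl⟩ := hroot hrt
        refine safeFrom_write fun u k _ hw => ?_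
        obtain ⟨q', h1, h2⟩ := hstep k
        obtain ⟨hok, hH⟩ := q'.merge_internals_root h1 h2 hw (k.newNodes (by simp [mkInternal]))
          (k.internal (by simp) List.mem_cons_self)
          (by rw [(k.fresh_spec List.mem_cons_self).2.1]; simp [mkInternal])
        exact ⟨hok, fun g' => hfin _ _ (k.le.trans (Nat.le_succ u)) g' (fun _ h => h) hH⟩
      · refine safeFrom_allocInternal (by simp) fun sk new => safeFrom_write fun u k _ hw => ?_
        obtain ⟨q', h1, h2⟩ := hstep k
        obtain ⟨hok, hH⟩ := q'.merge_internals h1 h2 hw (k.newNodes (by simp [mkInternal]))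
          (k.internal (by simp) List.mem_cons_self)
          (by rw [(k.fresh_spec List.mem_cons_self).2.1]; simp [mkInternal])
          (k.internal (by simp) (List.mem_cons_of_mem _ List.mem_cons_self))
          (by
            rw [(k.fresh_spec (List.mem_cons_of_mem _ List.mem_cons_self)).2.1]
            simp [mkInternal])
        exact ⟨hok, fun g' => hfin _ _ (k.le.trans (Nat.le_succ u)) g' (by simp) hH⟩

/-! ### The pending rebalancing steps -/

lemma safeFrom_rebalance (h : LInv E t i op j (.rebalance todo res)) :
    SafeFrom E t i op j [] (rebalance todo res) := by
  obtain ⟨hN, ht, hp⟩ := h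
  have hgoto : ∀ {todo'}, (∀ x ∈ todo', x ∈ todo) →
      SafeFrom E t i op j [] (.goto (.rebalance todo' res)) := fun {todo'} hs =>
    safeFrom_goto (by simp) fun j' k => ⟨hN.frame k.le k.good k.mhold,
      fun n hn => ht.mono k.good k.le le_rfl n (hs _ hn), hp.mono k.le⟩
  match todo with
  | [] => exact safeFrom_ret fun r k _ => ⟨hN.frame k.le k.good k.mhold, .inl (hp.mono k.le)⟩
  | .fixTagged node :: todo =>
    have ht' : TodoOK E j todo := fun n hn => ht n (by simp [hn])
    have hlt := ht node (by simp)
    refine safeFrom_read (by simp) fun j₁ k₁ _ => ?_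
    refine safeFrom_read_const (by simp) _ (fun j' k => k.good.kind k.le le_rfl hlt) ?_
    split_ifs with hk
    · exact hgoto (by simp +contextual)
    · refine safeFrom_read (by simp) fun _ _ _ => safeFrom_goto_start fun j' hj' g' hc => ?_
      rw [not_or, not_not] at hk
      exact ⟨hN.frame hj' g' fun m h1 h2 q h3 h4 => (hc m h1 h2 q h3 h4).noWrite,
        hlt.trans_le (g'.next_mono hj' le_rfl), (g'.kind hj' le_rfl hlt).trans hk.2,
        ht'.mono g' hj' le_rfl, hp.mono hj'⟩
  | .fixUnderfull node :: todo =>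
    have ht' : TodoOK E j todo := fun n hn => ht n (by simp [hn])
    refine safeFrom_read (by simp) fun j₁ k₁ _ => ?_
    split_ifs with hk
    · exact hgoto (by simp +contextual)
    · exact safeFrom_fixUnderfullRetry hN ht' hp

end

end Execution

end OCC

namespace OCC

namespace Execution

variable {K V T : Type} [LinearOrder K] [DecidableEq T] {a b : ℕ} {E : Execution K V T a b}

/-! ### The invariants hold -/

/-- The thread is idle, or the code that it is about to execute is safe. -/
def ThreadOK (E : Execution K V T a b) (t : T) (j : ℕ) : Prop :=
  ((E.cfg j).thread t = none ∧ NoLocks E t j) ∨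
  ∃ i op q j₀, E.Invokes (t, i) op ∧ Waits E t i q j₀ j ∧ Safe E t i op q j₀

/-- The code at a label is safe if the assertion at the label holds. -/
lemma safe_body (ha : 2 ≤ a) (hab : 2 * a ≤ b + 1) {t : T} {i : ℕ} {op : Op K V} {j : ℕ}
    (hi : E.Invokes (t, i) op) {l : Label K V} (h : LInv E t i op j l)
    (hp : (E.cfg j).thread t = some (.goto l)) (g : E.Good (j + 1)) :
    Safe E t i op (body a b l) (j + 1) := by
  have hm : MHold E t j (j + 1) := MHold.step hp trivial
  refine SafeFrom.start ?_ g
  cases l with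
  | search c key target path =>
    have h := h.enter hp g
    refine safeFrom_searchIter g h ?_ ?_
    · rintro todo res rfl
      exact safeFrom_fixTaggedFound g h
    · rintro todo res rfl
      exact safeFrom_fixUnderfullFound ha hab h
  | searchLeaf o path =>
    have h := h.searchLeaf_mono (Nat.le_succ j) g hm fun s h1 h2 => by
      obtain rfl : s = j := by omega
      rintro ⟨c, key, target, h'⟩
      rw [hp] at h'
      simp at h'
    refine safeFrom_searchLeaf g h ?_ ?_
    · rintro j' hL gj key val rfl
      refine safeFrom_insertLocked hi gj hL fun parent s hpar hs hA hr hnk hsz => ?_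
      exact safeFrom_split (by omega) hi ((hL.2.2.2.2.2.1 parent hpar).mono hs) hA hr hnk hsz
    · rintro j' hL gj key rfl
      exact safeFrom_deleteLocked hi gj hL
  | rebalance todo res =>
    obtain ⟨h1, h2, h3⟩ := h
    exact safeFrom_rebalance ⟨h1.frame (Nat.le_succ j) g hm, h2.mono g (Nat.le_succ j) le_rfl,
      h3.mono (Nat.le_succ j)⟩

lemma InProgress.succ {o : T × ℕ} {j : ℕ} (h : E.InProgress o j)
    (hr : ∀ w, E.act j ≠ .respond o.1 w) : E.InProgress o (j + 1) :=
  ⟨h.1.trans (Nat.lt_succ_self j), fun m h1 h2 => by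
    rcases Nat.lt_succ_iff_lt_or_eq.1 h2 with h' | rfl
    · exact h.2 m h1 h'
    · exact hr⟩

/-- The step is taken by one thread, whose code is safe. -/
lemma stepOK_of_threads {j : ℕ} (g : E.Good j) (ht : ∀ t, ThreadOK E t j) : E.StepOK j := by
  by_cases hint : ∃ t, E.act j = .internal t
  · obtain ⟨t, hact⟩ := hint
    obtain ⟨q, q', hq, hps, -⟩ := step_internal hact
    rcases ht t with ⟨h, -⟩ | ⟨i, op, q₀, j₀, hi, hw, hs⟩
    · rw [h] at hq
      simp at hq
    obtain rfl := Option.some.inj ((hw.prog j hw.le le_rfl).symm.trans hq)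
    have tk : Takes E t i q₀ j₀ j := ⟨hw, hact⟩
    have hupd : (∀ n f x nx, q₀ ≠ .write n f x nx) → ∀ o op, ¬ E.UpdatePoint o j op := by
      intro hne o op hu
      obtain ⟨h1, n, f, x, nx, h2, -⟩ := hu.exists_write
      rw [hact] at h1
      rw [← Action.internal.inj h1, hq] at h2
      exact hne _ _ _ _ (Option.some.inj h2)
    generalize hm : (E.cfg (j + 1)).mem = m' at hps
    cases hps with
    | read | anyKey | goto => exact stepOK_same g hm (hupd (by simp))
    | write n f x nx => exact (hs j tk ⟨hact, ⟨_, hq⟩, hm⟩).1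
    | lock n nx free =>
      refine stepOK_nodes g (by rw [hm]) (fun n' _ => by rw [hm]) (fun n' h1 h2 => ?_)
        (fun n' => ?_) (fun n' _ h => ?_) (hupd (by simp))
      · rw [hm] at h1
        exact absurd h1 (not_lt.2 h2)
      · rw [hm]
        by_cases h : n' = n
        · subst h
          exact .inr ⟨t, hact, .inl ⟨free, by simp⟩⟩
        · exact .inl (by simp [h])
      · rw [hm] at h
        by_cases h' : n' = n
        · subst h'
          simp at h
        · exact .inl (by simpa [h'] using h)
    | unlock n nx =>
      obtain ⟨⟨h1, h2, h3⟩, -⟩ := hs j tk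
      refine stepOK_nodes g (by rw [hm]) (fun n' _ => by rw [hm]) (fun n' h1 h2 => ?_)
        (fun n' => ?_) (fun n' _ h => ?_) (hupd (by simp))
      · rw [hm] at h1
        exact absurd h1 (not_lt.2 h2)
      · rw [hm]
        by_cases h : n' = n
        · subst h
          exact .inr ⟨t, hact, .inr ⟨h1, by simp⟩⟩
        · exact .inl (by simp [h])
      · by_cases h' : n' = n
        · subst h'
          exact .inr ⟨h2, h3⟩
        · rw [hm] at h
          exact .inl (by simpa [h'] using h)
    | alloc nd nx =>
      obtain ⟨⟨h1, h2⟩, -⟩ := hs j tk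
      refine stepOK_nodes g (by rw [hm]; exact Nat.le_succ _) (fun n' hn => ?_) (fun n' h3 h4 => ?_)
        (fun n' => by rw [hm]; exact .inl rfl) (fun n' _ h => by rw [hm] at h; exact .inl h)
        (hupd (by simp))
      · rw [hm]
        simp [hn.ne]
      · rw [hm] at h3 ⊢
        obtain rfl : n' = (E.cfg j).mem.next := Nat.le_antisymm (Nat.lt_succ_iff.1 h3) h4
        simpa using ⟨h1, h2⟩
  · push Not at hint
    refine stepOK_same g (mem_eq_of_not_internal hint) fun o op hu => hint _ hu.exists_write.1

/-- Safety of the code of a thread is stable under the steps of other threads by definition, and it is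
passed on to the remaining code by the steps of the thread. -/
lemma threadOK_succ (ha : 2 ≤ a) (hab : 2 * a ≤ b + 1) {t : T} {j : ℕ} (h : ThreadOK E t j)
    (g : E.Good (j + 1)) : ThreadOK E t (j + 1) := by
  by_cases hact : E.act j = .internal t
  · obtain ⟨q, q', hq, hps, hth⟩ := step_internal hact
    rcases h with ⟨h, -⟩ | ⟨i, op, q₀, j₀, hi, hw, hs⟩
    · rw [h] at hq
      simp at hq
    obtain rfl := Option.some.inj ((hw.prog j hw.le le_rfl).symm.trans hq)
    have tk : Takes E t i q₀ j₀ j := ⟨hw, hact⟩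
    refine .inr ⟨i, op, q', j + 1, hi, ⟨le_rfl, g, fun m h1 h2 => ?_, fun m h1 h2 => by omega,
      hw.inProgress.succ (by simp [hact])⟩, ?_⟩
    · obtain rfl : m = j + 1 := by omega
      rw [hth, Function.update_self]
    · generalize hm : (E.cfg (j + 1)).mem = m' at hps
      cases hps with
      | read n f nx => exact hs j tk g
      | write n f x nx => exact (hs j tk ⟨hact, ⟨_, hq⟩, hm⟩).2 g
      | lock n nx free => exact hs j tk free hm g
      | unlock n nx => exact (hs j tk).2 hm g
      | alloc nd nx => exact (hs j tk).2 hm g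
      | anyKey nx k => exact hs j k tk g
      | goto l => exact safe_body ha hab hi (hs j hw) hq g
  · have hm : MHold E t j (j + 1) := fun m h1 h2 q h3 _ => by
      obtain rfl : m = j := by omega
      exact absurd h3 hact
    have hstep := E.step j
    generalize hc : E.cfg (j + 1) = c' at hstep
    generalize hα : E.act j = α at hstep hact
    have keep : (E.cfg (j + 1)).thread t = (E.cfg j).thread t →
        (∀ w, E.act j ≠ .respond t w) → ThreadOK E t (j + 1) := by
      intro he hr
      rcases h with ⟨h1, h2⟩ | ⟨i, op, q₀, j₀, hi, hw, hs⟩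
      · exact .inl ⟨he.trans h1, h2.frame (Nat.le_succ j) g hm⟩
      · refine .inr ⟨i, op, q₀, j₀, hi, ⟨hw.le.trans (Nat.le_succ j), g, fun m h1 h2 => ?_,
          fun m h1 h2 => ?_, hw.inProgress.succ hr⟩, hs⟩
        · rcases Nat.lt_or_eq_of_le h2 with h' | rfl
          · exact hw.prog m h1 (by omega)
          · exact he.trans (hw.prog j hw.le le_rfl)
        · rcases Nat.lt_succ_iff_lt_or_eq.1 h2 with h' | rfl
          · exact hw.quiet m h1 h'
          · rwa [hα]
    cases hstep with
    | invoke t' o idle =>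
      by_cases he : t' = t
      · subst he
        have hN : NoLocks E t' j := by
          rcases h with ⟨-, h⟩ | ⟨i, op, q₀, j₀, -, hw, -⟩
          · exact h
          · rw [hw.prog j hw.le le_rfl] at idle
            simp at idle
        have hP : E.InProgress (t', j) (j + 1) := ⟨Nat.lt_succ_self j, fun m h1 h2 => by
          dsimp only at h1
          omega⟩
        refine .inr ⟨j, o, startOp o, j + 1, hα, ⟨le_rfl, g, fun m h1 h2 => ?_,
          fun m h1 h2 => by omega, hP⟩, SafeFrom.start (safeFrom_startOp
          (hN.frame (Nat.le_succ j) g hm) fun m h1 h2 => by omega) g⟩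
        obtain rfl : m = j + 1 := by omega
        rw [hc]
        simp
      · exact keep (by rw [hc]; simp [Ne.symm he]) (by simp [hα])
    | respond t' res hret =>
      by_cases he : t' = t
      · subst he
        rcases h with ⟨h1, -⟩ | ⟨i, op, q₀, j₀, hi, hw, hs⟩
        · rw [h1] at hret
          simp at hret
        · obtain rfl := Option.some.inj ((hw.prog j hw.le le_rfl).symm.trans hret)
          refine .inl ⟨by rw [hc]; simp, (hs j hw hα).1.frame (Nat.le_succ j) g hm⟩
      · exact keep (by rw [hc]; simp [Ne.symm he]) (by simp [hα, he])
    | internal t' q q' m' h1 h2 =>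
      have he : t ≠ t' := fun he => hact (he ▸ rfl)
      exact keep (by rw [hc]; simp [he]) (by simp [hα])
    | stutter => exact keep (by rw [hc]) (by simp [hα])

lemma slotHas_nil {k : K} {v : V} {sk : K} : ¬ SlotHas b (mkLeaf sk ([] : List (K × V))) k v := by
  rintro ⟨i, -, h, -⟩
  simp [mkLeaf] at h

/-- Initially, the tree consists of the sentinel and an empty leaf. -/
lemma inv_zero : E.Inv 0 ∧ ∀ k v, ¬ E.InTree 0 k v := by
  obtain ⟨-, -, hnext, ⟨sk₀, he⟩, ⟨sk₁, hr⟩⟩ := E.init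
  have hi : IsInternal ((E.cfg 0).mem.node entry) [] [1] := by
    rw [he]
    exact isInternal_mkInternal (by simp) _ _ _
  have k0 : (E.cfg 0).mem.node entry .kind ≠ .leaf := hi.kind_ne
  have k1 : (E.cfg 0).mem.node 1 .kind = .leaf := by rw [hr]; rfl
  have hR : ∀ n, E.Rch 0 n → n = entry ∨ n = 1 := by
    intro n hn
    induction hn with
    | refl => exact .inl rfl
    | tail _ hc ih =>
      rcases ih with rfl | rfl
      · exact .inr (by simpa using (isChild_iff hi).1 hc)
      · exact absurd k1 hc.1
  have hE : ∀ n, E.Rch 0 n → (E.cfg 0).mem.node n .kind ≠ .leaf → n = entry := fun n hn hk =>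
    (hR n hn).resolve_right fun h => hk (h ▸ k1)
  have hL : ∀ n, E.Rch 0 n → (E.cfg 0).mem.node n .kind = .leaf → n = 1 := fun n hn hk =>
    (hR n hn).resolve_left fun h => k0 (h ▸ hk)
  have hle : ∀ l k v, E.Rch 0 l → (E.cfg 0).mem.node l .kind = .leaf → ¬ E.LE 0 l k v := by
    rintro l k v h1 h2 ⟨j', h3, -, -, h4⟩
    obtain rfl := hL l h1 h2
    obtain rfl : j' = 0 := by omega
    rw [hr] at h4
    exact slotHas_nil h4
  refine ⟨⟨⟨fun _ => 0, ⟨⟨1, hi⟩, fun n hn => ?_, fun n hn hk => ?_, ?_, fun n hn hc => ?_,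
    fun _ _ _ => rfl, fun n c hn hne hc => absurd (hE n hn hc.1) hne⟩⟩, fun l hl hk _ => ?_,
    fun l k v h1 h2 h3 => absurd h3 (hle l k v h1 h2),
    fun l k v _ h1 h2 h3 => absurd h3 (hle l k v h1 h2), fun n hn _ => ⟨?_, ?_⟩⟩, ?_⟩
  · rw [hnext]
    rcases hR n hn with rfl | rfl <;> decide
  · obtain rfl := hE n hn hk
    exact ⟨[], [1], hi, rfl, by simp, by simp⟩
  · intro n n' i i' c hn hn' hk hk' hp hp'
    obtain rfl := hE n hn hk
    obtain rfl := hE n' hn' hk'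
    rw [hi.ptr_eq] at hp hp'
    have h1 := (List.getElem?_eq_some_iff.1 hp).1
    have h2 := (List.getElem?_eq_some_iff.1 hp').1
    simp only [List.length_cons, List.length_nil] at h1 h2
    exact ⟨rfl, by omega⟩
  · obtain rfl := hE n hn hc.1
    simpa using (isChild_iff hi).1 hc
  · rw [hnext] at hl
    have hl1 : l = 1 := ((Nat.le_one_iff_eq_zero_or_eq_one.1 (Nat.lt_succ_iff.1 hl))).resolve_left
      fun h => k0 (by rwa [show l = entry from h] at hk)
    rw [hl1, hr]
    exact leafOK_mkLeaf (by simp) (by simp)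
  · rw [hnext] at hn
    rcases Nat.le_one_iff_eq_zero_or_eq_one.1 (Nat.lt_succ_iff.1 hn) with rfl | rfl
    · rw [he]; exact ⟨0, rfl⟩
    · rw [hr]; exact ⟨0, rfl⟩
  · rintro ⟨m, hm, hm'⟩ hn'
    obtain rfl : m = 0 := by omega
    exact absurd hm' hn'
  · rintro k v ⟨l, h1, h2, h3⟩
    exact hle l k v h1 h2 h3

/-- All configurations satisfy the invariants, and in each of them the code of all threads is safe. -/
lemma good (ha : 2 ≤ a) (hab : 2 * a ≤ b + 1) (j : ℕ) : E.Good j ∧ ∀ t, ThreadOK E t j := by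
  induction j with
  | zero =>
    refine ⟨⟨fun m hm => ?_, fun m hm => by omega, fun m hm => by omega⟩, fun t =>
      .inl ⟨E.init.idle t, fun n => by rw [E.init.unlocked]; simp⟩⟩
    obtain rfl : m = 0 := by omega
    exact inv_zero.1
  | succ j ih =>
    have g := ih.1.succ (stepOK_of_threads ih.1 ih.2)
    exact ⟨g, fun t => threadOK_succ ha hab (ih.2 t) g⟩

lemma Responds.inProgress {o : T × ℕ} {r : ℕ} {v : Option V} (h : E.Responds o r v) :
    E.InProgress o r := ⟨h.1, h.2.2⟩

lemma resOK_of_responds (ha : 2 ≤ a) (hab : 2 * a ≤ b + 1) {o : T × ℕ} {op : Op K V} {r : ℕ}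
    {v : Option V} (hi : E.Invokes o op) (h : E.Responds o r v) : ResOK E o.1 o.2 op r v := by
  have hret : (E.cfg r).thread o.1 = some (.ret v) := by
    have hs := E.step r
    rw [h.2.1] at hs
    generalize E.cfg (r + 1) = c' at hs
    cases hs
    assumption
  rcases (good (E := E) ha hab r).2 o.1 with ⟨h1, -⟩ | ⟨i, op', q, j₀, hi', hw, hs⟩
  · rw [h1] at hret
    simp at hret
  obtain rfl := Option.some.inj ((hw.prog r hw.le le_rfl).symm.trans hret)
  obtain ⟨he, rfl⟩ := inst_unique hi' hi hw.inProgress h.inProgress rfl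
  obtain rfl : i = o.2 := congrArg Prod.snd he
  exact (hs r hw h.2.1).2

lemma updatePoint_lt {o : T × ℕ} {op : Op K V} {r u : ℕ} {v : Option V} (h : E.Responds o r v)
    (hu : E.UpdatePoint o u op) : u < r := by
  by_contra hc
  have hp := hu.writes.1
  rcases Nat.lt_or_eq_of_le (not_lt.1 hc) with h' | rfl
  · exact hp.2 r h.1 h' v h.2.1
  · have := hu.exists_write.1
    rw [h.2.1] at this
    simp at this

lemma updatePoint_unique (ha : 2 ≤ a) (hab : 2 * a ≤ b + 1) {o : T × ℕ} {op : Op K V} {u u' : ℕ}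
    (hi : E.Invokes o op) (hu : E.UpdatePoint o u op) (hu' : E.UpdatePoint o u' op) : u' = u := by
  rcases lt_trichotomy u u' with h | h | h
  · exact absurd hu ((((good ha hab (u' + 1)).1.upd u' (Nat.lt_succ_self _)).1 o op hi hu').2.2 u h)
  · exact h.symm
  · exact absurd hu' ((((good ha hab (u + 1)).1.upd u (Nat.lt_succ_self _)).1 o op hi hu).2.2 u' h)

/-- What a search visits was in the tree since the start of the search. -/
lemma visited_reachable (ha : 2 ≤ a) (hab : 2 * a ≤ b + 1) {t : T} {s j : ℕ} {n : Addr}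
    (h : E.VisitsFrom t s j n) : ∃ m, s ≤ m ∧ m ≤ j ∧ Reachable (E.cfg m).mem n := by
  obtain ⟨hsj, hs, -, c, key, target, path, rfl, hp⟩ := h
  by_cases hst : path = PathInfo.start
  · subst hst
    exact ⟨j, hsj, le_rfl, reachable_entry _⟩
  rcases (good (E := E) ha hab j).2 t with ⟨h1, -⟩ | ⟨i, op, q, j₀, hi, hw, hsafe⟩
  · rw [h1] at hp
    simp at hp
  obtain rfl := Option.some.inj ((hw.prog j hw.le le_rfl).symm.trans hp)
  obtain ⟨-, ⟨m, -, h2, h3, h4⟩, -⟩ := hsafe j hw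
  refine ⟨m, not_lt.1 fun hms => ?_, h2, OnPath.reachable h3⟩
  rcases Nat.lt_or_eq_of_le hsj with h | rfl
  · exact h4 s hms h hs
  · obtain ⟨c', key', target', h'⟩ := hs
    rw [hp] at h'
    have := Prog.goto.inj (Option.some.inj h')
    cases this
    exact hst rfl

end Execution

end OCC

namespace OCC

namespace Execution

variable {K V T : Type} [LinearOrder K] [DecidableEq T] {a b : ℕ} {E : Execution K V T a b}

/-! ### Linearizability -/

/-- An operation instance with its operation and its return value. -/
abbrev Event (K V T : Type) : Type := (T × ℕ) × Op K V × Option V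

/-- The dictionary after a sequence of operations. -/
def run (D : Dict K V) (L : List (Event K V T)) : Dict K V :=
  L.foldl (fun D x => (x.2.1.apply D).1) D

lemma legal_append {D : Dict K V} {L L' : List (Event K V T)} (h : Legal D (L.map Prod.snd))
    (h' : Legal (run D L) (L'.map Prod.snd)) : Legal D ((L ++ L').map Prod.snd) := by
  induction L generalizing D with
  | nil => exact h'
  | cons x L ih => exact ⟨h.1, ih h.2 h'⟩

lemma legal_reads {D : Dict K V} {L : List (Event K V T)}
    (h : ∀ x ∈ L, x.2.1.apply D = (D, x.2.2)) : Legal D (L.map Prod.snd) ∧ run D L = D := by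
  induction L with
  | nil => exact ⟨trivial, rfl⟩
  | cons x L ih =>
    have hx := h x (by simp)
    obtain ⟨h1, h2⟩ := ih fun y hy => h y (by simp [hy])
    refine ⟨⟨by rw [hx], ?_⟩, ?_⟩
    · rw [hx]; exact h1
    · change run (x.2.1.apply D).1 L = D
      rw [hx]; exact h2

/-- The event responds, has no update point, and `j` is the point chosen for it among its
admissible ones. -/
def ReadAt (E : Execution K V T a b) (x : Event K V T) (j : ℕ) : Prop :=
  E.Invokes x.1 x.2.1 ∧ (¬ ∃ u, E.UpdatePoint x.1 u x.2.1) ∧ ∃ r, E.Responds x.1 r x.2.2 ∧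
    ∃ h : ∃ j, E.ReadPoint x.1 r j x.2.1, j = h.choose

/-- Step `j` is the update point of the event. -/
def UpdateAt (E : Execution K V T a b) (x : Event K V T) (j : ℕ) : Prop :=
  E.Invokes x.1 x.2.1 ∧ E.UpdatePoint x.1 j x.2.1 ∧ x.2.2 = (x.2.1.apply (E.dict j)).2

lemma Invokes.inj {o : T × ℕ} {op op' : Op K V} (h : E.Invokes o op) (h' : E.Invokes o op') :
    op = op' := (Action.invoke.inj (h.symm.trans h')).2

lemma Responds.inj {o : T × ℕ} {r r' : ℕ} {v v' : Option V} (h : E.Responds o r v)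
    (h' : E.Responds o r' v') : r = r' ∧ v = v' := by
  obtain rfl : r = r' := by
    rcases lt_trichotomy r r' with h1 | h1 | h1
    · exact absurd h.2.1 (h'.2.2 r h.1 h1 v)
    · exact h1
    · exact absurd h'.2.1 (h.2.2 r' h'.1 h1 v')
  exact ⟨rfl, (Action.respond.inj (h.2.1.symm.trans h'.2.1)).2⟩

lemma ReadAt.spec (ha : 2 ≤ a) (hab : 2 * a ≤ b + 1) {x : Event K V T} {j : ℕ}
    (h : ReadAt E x j) : x.1.2 < j ∧ (∀ r v, E.Responds x.1 r v → j ≤ r) ∧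
      x.2.1.apply (E.dict j) = (E.dict j, x.2.2) := by
  obtain ⟨hi, hu, r, hr, hp, rfl⟩ := h
  rcases resOK_of_responds ha hab hi hr with ⟨u, -, hu', -⟩ | ⟨-, -, h⟩
  · exact absurd ⟨u, hu'⟩ hu
  · obtain ⟨h1, h2, h3⟩ := h _ hp.choose_spec
    exact ⟨h1, fun r' v hr' => (hr.inj hr').1 ▸ h2, h3⟩

lemma UpdateAt.spec {x : Event K V T} {j : ℕ} (h : UpdateAt E x j) :
    x.1.2 < j ∧ ∀ r v, E.Responds x.1 r v → j ≤ r :=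
  ⟨h.2.1.writes.1.1, fun _ _ hr => (updatePoint_lt hr h.2.1).le⟩

/-- An operation instance is linearized only once. -/
lemma event_unique (ha : 2 ≤ a) (hab : 2 * a ≤ b + 1) {x y : Event K V T} {j j' : ℕ}
    (hx : ReadAt E x j ∨ UpdateAt E x j) (hy : ReadAt E y j' ∨ UpdateAt E y j')
    (h : x.1 = y.1) : x = y ∧ j = j' := by
  obtain ⟨o, op, v⟩ := x
  obtain ⟨o', op', v'⟩ := y
  obtain rfl : o = o' := h
  obtain rfl : op = op' :=
    (hx.elim And.left And.left : E.Invokes o op).inj (hy.elim And.left And.left)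
  rcases hx with ⟨hi, hu, r, hr, hp, rfl⟩ | ⟨hi, hu, hv⟩ <;>
    rcases hy with ⟨-, hu', r', hr', hp', rfl⟩ | ⟨-, hu', hv'⟩
  · obtain ⟨rfl, h⟩ := hr.inj hr'
    obtain rfl : v = v' := h
    exact ⟨rfl, rfl⟩
  · exact absurd ⟨_, hu'⟩ hu
  · exact absurd ⟨_, hu⟩ hu'
  · obtain rfl := updatePoint_unique ha hab hi hu hu'
    obtain rfl : v = v' := hv.trans hv'.symm
    exact ⟨rfl, rfl⟩

/-- Steps have at most one thread, so that at most one operation updates the dictionary in it. -/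
lemma updateAt_unique {x y : Event K V T} {j : ℕ} (hx : UpdateAt E x j) (hy : UpdateAt E y j) :
    x = y := by
  obtain ⟨o, op, v⟩ := x
  obtain ⟨o', op', v'⟩ := y
  obtain ⟨hi, hu, hv⟩ := hx
  obtain ⟨hi', hu', hv'⟩ := hy
  have ht : o.1 = o'.1 := Action.internal.inj (hu.exists_write.1.symm.trans hu'.exists_write.1)
  obtain ⟨rfl, h⟩ := inst_unique hi hi' hu.writes.1 hu'.writes.1 ht
  obtain rfl : op = op' := h
  obtain rfl : v = v' := hv.trans hv'.symm
  rfl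

/-- The events that are read at `j` are finitely many, as they are invoked in different steps before
`j`. -/
lemma finite_readAt (ha : 2 ≤ a) (hab : 2 * a ≤ b + 1) (j : ℕ) : {x | ReadAt E x j}.Finite := by
  refine Set.Finite.of_finite_image (f := fun x : Event K V T => x.1.2)
    ((Set.finite_lt_nat j).subset ?_) fun x hx y hy h => ?_
  · rintro _ ⟨x, hx, rfl⟩
    exact (ReadAt.spec ha hab hx).1
  · refine (event_unique ha hab (.inl hx) (.inl hy) (Prod.ext ?_ h)).1
    have h1 : E.act x.1.2 = _ := hx.1
    have h2 : E.act y.1.2 = _ := hy.1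
    rw [show x.1.2 = y.1.2 from h, h2] at h1
    exact (Action.invoke.inj h1).1.symm

/-- In the order of the points of the events, where the reads at a configuration precede the update in
the step that follows, the events form a sequential execution. -/
lemma linearizableUpTo (ha : 2 ≤ a) (hab : 2 * a ≤ b + 1) (n : ℕ) :
    ∃ L : List (Event K V T), (∀ x, x ∈ L ↔ ∃ j < n, ReadAt E x j ∨ UpdateAt E x j) ∧ L.Nodup ∧
      L.Pairwise (fun x y => ¬ ∃ r v, E.Responds y.1 r v ∧ r < x.1.2) ∧
      Legal (fun _ => none) (L.map Prod.snd) ∧ run (fun _ => none) L = E.dict n := by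
  have hrt : ∀ {x y : Event K V T} {j j' : ℕ}, ReadAt E x j ∨ UpdateAt E x j →
      ReadAt E y j' ∨ UpdateAt E y j' → j ≤ j' → ¬ ∃ r v, E.Responds y.1 r v ∧ r < x.1.2 := by
    rintro x y j j' hx hy hj ⟨r, v, hr, hlt⟩
    have h1 : x.1.2 < j := hx.elim (fun h => (h.spec ha hab).1) fun h => h.spec.1
    have h2 : j' ≤ r := hy.elim (fun h => (h.spec ha hab).2.1 r v hr) fun h => h.spec.2 r v hr
    omega
  induction n with
  | zero =>
    refine ⟨[], by simp, .nil, .nil, trivial, funext fun k => ?_⟩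
    refine (Option.eq_none_iff_forall_not_mem.2 fun v hv => ?_).symm
    exact inv_zero.2 k v (((good ha hab 0).1.self.dict_iff).1 hv)
  | succ n ih =>
    obtain ⟨L, hL, hnd, hpw, hleg, hrun⟩ := ih
    set R := (finite_readAt (E := E) ha hab n).toFinset.toList
    have hR : ∀ x, x ∈ R ↔ ReadAt E x n := fun x => by simp [R]
    obtain ⟨hR1, hR2⟩ := legal_reads (D := E.dict n) fun x hx =>
      (ReadAt.spec ha hab ((hR x).1 hx)).2.2
    obtain ⟨U, hU, hUnd, hUleg, hUrun⟩ : ∃ U : List (Event K V T), (∀ x, x ∈ U ↔ UpdateAt E x n) ∧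
        U.Nodup ∧ Legal (E.dict n) (U.map Prod.snd) ∧ run (E.dict n) U = E.dict (n + 1) := by
      have hupd := (good (E := E) ha hab (n + 1)).1.upd n (Nat.lt_succ_self n)
      by_cases h : ∃ o op, E.Invokes o op ∧ E.UpdatePoint o n op
      · obtain ⟨o, op, hi, hu⟩ := h
        have hx : UpdateAt E (o, op, (op.apply (E.dict n)).2) n := ⟨hi, hu, rfl⟩
        refine ⟨[(o, op, (op.apply (E.dict n)).2)], fun y => ?_, List.nodup_singleton _, ⟨rfl, trivial⟩,
          (hupd.1 o op hi hu).1.symm⟩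
        rw [List.mem_singleton]
        exact ⟨fun h => h ▸ hx, fun hy => updateAt_unique hy hx⟩
      · refine ⟨[], fun y => ?_, .nil, trivial, (hupd.2 h).symm⟩
        simpa using fun hy : UpdateAt E y n => h ⟨_, _, hy.1, hy.2.1⟩
    have hRU : ∀ x ∈ R, ∀ y ∈ U, ¬ ∃ r v, E.Responds y.1 r v ∧ r < x.1.2 := fun x hx y hy =>
      hrt (.inl ((hR x).1 hx)) (.inr ((hU y).1 hy)) le_rfl
    refine ⟨L ++ (R ++ U), fun x => ?_, ?_, ?_, legal_append hleg ?_, ?_⟩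
    · rw [List.mem_append, List.mem_append, hL, hR, hU]
      constructor
      · rintro (⟨j, hj, h⟩ | h)
        exacts [⟨j, hj.trans n.lt_succ_self, h⟩, ⟨n, n.lt_succ_self, h⟩]
      · rintro ⟨j, hj, h⟩
        rcases Nat.lt_succ_iff_lt_or_eq.1 hj with hj | rfl
        exacts [.inl ⟨j, hj, h⟩, .inr h]
    · have hdisj : ∀ x, ReadAt E x n → ¬ UpdateAt E x n := fun x h h' => h.2.1 ⟨n, h'.2.1⟩
      refine List.nodup_append'.2 ⟨hnd, List.nodup_append'.2 ⟨Finset.nodup_toList _, hUnd, ?_⟩, ?_⟩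
      · exact fun x h h' => hdisj x ((hR x).1 h) ((hU x).1 h')
      · intro x h h'
        obtain ⟨j, hj, h⟩ := (hL x).1 h
        rw [List.mem_append, hR, hU] at h'
        exact hj.ne (event_unique ha hab h h' rfl).2
    · refine List.pairwise_append.2 ⟨hpw, List.pairwise_append.2 ⟨?_, ?_, hRU⟩, ?_⟩
      · exact List.pairwise_of_forall_mem_list fun x hx y hy =>
          hrt (.inl ((hR x).1 hx)) (.inl ((hR y).1 hy)) le_rfl
      · exact List.pairwise_of_forall_mem_list fun x hx y hy =>
          hrt (.inr ((hU x).1 hx)) (.inr ((hU y).1 hy)) le_rfl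
      · intro x hx y hy
        obtain ⟨j, hj, h⟩ := (hL x).1 hx
        rw [List.mem_append, hR, hU] at hy
        exact hrt h hy hj.le
    · rw [hrun]
      exact legal_append hR1 (hR2.symm ▸ hUleg)
    · rw [run, List.foldl_append, List.foldl_append]
      change run (run (run _ L) R) U = _
      rw [hrun, hR2, hUrun]

theorem linearizable (ha : 2 ≤ a) (hab : 2 * a ≤ b + 1) : E.Linearizable := by
  intro n
  obtain ⟨L, hL, hnd, hpw, hleg, -⟩ := linearizableUpTo (E := E) ha hab n
  refine ⟨L, hnd.map_on fun x hx y hy h => ?_, fun x hx => ?_, fun o op r v hrn hi hr => ?_, hpw,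
    hleg⟩
  · obtain ⟨j, -, hj⟩ := (hL x).1 hx
    obtain ⟨j', -, hj'⟩ := (hL y).1 hy
    exact (event_unique ha hab hj hj' h).1
  · obtain ⟨j, hjn, hj⟩ := (hL x).1 hx
    exact ⟨lt_trans (hj.elim (fun h => (h.spec ha hab).1) fun h => h.spec.1) hjn,
      hj.elim And.left And.left⟩
  · rw [hL]
    rcases resOK_of_responds ha hab hi hr with ⟨u, h1, hu, hv⟩ | ⟨h1, h2, h3⟩
    · exact ⟨u, h1.trans hrn, .inr ⟨hi, hu, hv⟩⟩
    · exact ⟨_, (h3 _ h2.choose_spec).2.1.trans_lt hrn, .inl ⟨hi, fun ⟨u, hu⟩ =>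
        h1 u (updatePoint_lt hr hu) hu, r, hr, h2, rfl⟩⟩

end Execution

end OCC

theorem mainTheorem2 {K V T : Type} [LinearOrder K] [DecidableEq T] (a b : ℕ) (ha : 2 ≤ a)
    (hab : 2 * a ≤ b + 1) (E : OCC.Execution K V T a b) :
    E.Linearizable ∧
    (∃ D : ℕ → OCC.Dict K V,
      (∀ j k v, D j k = some v ↔ E.InTree j k v) ∧
      (∀ k, D 0 k = none) ∧
      (∀ j, (¬ ∃ o op, E.Invokes o op ∧ E.UpdatePoint o j op) → D (j + 1) = D j) ∧
      (∀ o op j, E.Invokes o op → E.UpdatePoint o j op →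
        (∀ j', E.UpdatePoint o j' op → j' = j) ∧
        D (j + 1) = (op.apply (D j)).1 ∧ D (j + 1) ≠ D j ∧
        ∀ r v, E.Responds o r v → j < r ∧ v = (op.apply (D j)).2) ∧
      (∀ o op r v, E.Invokes o op → E.Responds o r v → (¬ ∃ j, E.UpdatePoint o j op) →
        (∃ j, E.ReadPoint o r j op) ∧
        ∀ j, E.ReadPoint o r j op → o.2 < j ∧ j ≤ r ∧ op.apply (D j) = (D j, v))) ∧
    (∀ t s j n, E.VisitsFrom t s j n →
      ∃ m, s ≤ m ∧ m ≤ j ∧ OCC.Reachable (E.cfg m).mem n) := by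
  refine ⟨OCC.Execution.linearizable ha hab, ⟨E.dict, fun j k v =>
    (OCC.Execution.good ha hab j).1.self.dict_iff, fun k => ?_, fun j h => ?_,
    fun o op j hi hu => ?_, fun o op r v hi hr hn => ?_⟩,
    fun t s j n h => OCC.Execution.visited_reachable ha hab h⟩
  · refine Option.eq_none_iff_forall_not_mem.2 fun v hv => ?_
    exact OCC.Execution.inv_zero.2 k v ((OCC.Execution.good ha hab 0).1.self.dict_iff.1 hv)
  · exact ((OCC.Execution.good ha hab (j + 1)).1.upd j (Nat.lt_succ_self j)).2 h
  · obtain ⟨h1, h2, -⟩ :=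
      ((OCC.Execution.good ha hab (j + 1)).1.upd j (Nat.lt_succ_self j)).1 o op hi hu
    refine ⟨fun j' hu' => OCC.Execution.updatePoint_unique ha hab hi hu hu', h1, h2,
      fun r v hr => ?_⟩
    have hlt := OCC.Execution.updatePoint_lt hr hu
    rcases OCC.Execution.resOK_of_responds ha hab hi hr with ⟨u, -, hu', hv⟩ | ⟨h, -⟩
    · obtain rfl := OCC.Execution.updatePoint_unique ha hab hi hu hu'
      exact ⟨hlt, hv⟩
    · exact absurd hu (h j hlt)
  · rcases OCC.Execution.resOK_of_responds ha hab hi hr with ⟨u, -, hu, -⟩ | ⟨-, h2, h3⟩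
    · exact absurd ⟨u, hu⟩ hn
    · exact ⟨h2, h3⟩
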